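/- **Setting.** Let $\Omega\subset\mathbb{R}^2$ be a polygon, i.e. a bounded domain with $\Omega=\operatorname{int}\overline\Omega$ whose boundary is a finite union of line segments, let $s\in(0,1)$, $C(2,s)=\frac{2^{2s}s\,\Gamma(s+1)}{\pi\,\Gamma(1-s)}$, and let $\vec n_y$ be the inward unit normal at $y\in\partial\Omega$. The bilinear form of the integral fractional Laplacian is $$a(u,v)=\tfrac{C(2,s)}{2}\int_\Omega\int_\Omega\frac{(u(x)-u(y))(v(x)-v(y))}{|x-y|^{2+2s}}\,dy\,dx+\tfrac{C(2,s)}{2s}\int_\Omega\int_{\partial\Omega}\frac{u(x)v(x)\,\vec n_y\cdot(x-y)}{|x-y|^{2+2s}}\,dy\,dx .$$ Let $\mathcal P_h$ be a conforming triangulation of $\overline\Omega$ into closed triangles, $\mathcal P_{h,\partial}$ the set of its edges lying on $\partial\Omega$, $h_K$ the diameter of $K$ and $h=\max_K h_K$. For constants $\sigma,\tau$ assume shape regularity (each $K$ contains a closed disc of radius $r_K>0$ with $h_K\le 2\sigma r_K$) and quasi-uniformity ($h\le\tau h_K$ for all $K$). Let $X_h$ be the continuous functions on $\overline\Omega$ that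 are affine on each $K$ (extended by $0$), and $V_h=X_h$ if $s<1/2$, $V_h=\{v\in X_h: v=0\text{ on }\partial\Omega\}$ if $s\ge1/2$. **Quadrature.** For $\alpha>-1$, the $k$-point Gauss rule with weight $t^\alpha$ is the rule on $[0,1]$ with $k$ nodes that integrates $t^\alpha p(t)$ exactly for every polynomial $p$ of degree at most $2k-1$ ($k=0$ gives the value $0$). On $[0,1]^m$, "quadrature of order $k$" of $\int J(\eta)f(\eta)\,d\eta$ means the tensor product of $k$-point Gauss rules in every variable, where each power $\eta_i^{\alpha_i}$ displayed below in front of the brackets $\langle\cdot\rangle$ is the weight in the variable $\eta_i$ (the weight is $1$ if no power is displayed) and the function in the brackets is evaluated at the nodes. Vertices of the elements and edges of a pair are numbered arbitrarily, except that the $c$ common vertices come first. Put $$a_Q(u,v)=\sum_{K,\tilde K\in\mathcal P_h}\tfrac{C(2,s)}{2}\,4|K||\tilde K|\;Q_{K\times\tilde K}+\sum_{K\in\mathcal P_h,\,e\in\mathcal P_{h,\partial}}\tfrac{C(2,s)}{2s}\,2|K||e|\;Q_{K\times e},$$ where the $Q$'s are the following quadratures. *Separated pairs* (order $k_{NT}(K,\tilde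 K)$, respectively $k_{NT,\partial}(K,e)$). With $X_K(a,b)=(1-a)x_0+a(1-b)x_1+ab\,x_2$, where $x_0,x_1,x_2$ are the vertices of $K$ (Stroud's conical product rule), $Q_{K\times\tilde K}$ is the quadrature of $$\int_{[0,1]^4}\xi_0\xi_2\Big\langle\frac{(u(x)-u(y))(v(x)-v(y))}{|x-y|^{2+2s}}\Big\rangle d\xi,\qquad x=X_K(\xi_0,\xi_1),\ y=X_{\tilde K}(\xi_2,\xi_3),$$ and $Q_{K\times e}$ that of $\int_{[0,1]^3}\xi_0\big\langle u(x)v(x)\,\vec n_e\cdot(x-y)\,|x-y|^{-2-2s}\big\rangle d\xi$ with $x=X_K(\xi_0,\xi_1)$ and $y=(1-\xi_2)y_0+\xi_2y_1$, where $y_0,y_1$ are the endpoints of $e$. *Touching pairs $K\times\tilde K$* (order $k_T$). Let $x_0,x_1,\dots$ be the vertices of $K$ followed by those of $\tilde K$ not in $K$, and for a list $\psi=(\psi_k)$ put $$F(\psi)=\frac{\big(\sum_k\psi_ku(x_k)\big)\big(\sum_k\psi_kv(x_k)\big)}{\big|\sum_k\psi_kx_k\big|^{2+2s}} .$$ - $K=\tilde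 K$: twice the sum of the quadratures of $\int\eta_0^{3-2s}\eta_1^{2-2s}\eta_2^{1-2s}\langle F(\psi)\rangle$ over $\psi\in\{(-\eta_3,\eta_3-1,1),\ (-1,1-\eta_3,\eta_3),\ (\eta_3,-1,1-\eta_3)\}$. - Common edge: the sum of the quadratures of $\int\eta_0^{3-2s}\eta_1^{2-2s}\langle jF(\psi)\rangle$ with $j=1$ for $\psi=(-\eta_2,1-\eta_3,\eta_3,\eta_2-1)$ and $j=\eta_2$ for $\psi=(-\eta_2\eta_3,\eta_2-1,1,\eta_2\eta_3-\eta_2)$, $(\eta_2,\eta_2\eta_3-1,1-\eta_2,-\eta_2\eta_3)$, $(\eta_2\eta_3,1-\eta_2,\eta_2-\eta_2\eta_3,-1)$, $(\eta_2\eta_3,\eta_2-1,1-\eta_2\eta_3,-\eta_2)$. - Common vertex: the sum of the quadratures of $\int\eta_0^{3-2s}\langle\eta_2F(\psi)\rangle$ over $\psi=(\eta_2-1,1-\eta_1,\eta_1,\eta_2\eta_3-\eta_2,-\eta_2\eta_3)$ and $\psi=(1-\eta_2,\eta_2-\eta_2\eta_3,\eta_2\eta_3,\eta_1-1,-\eta_1)$.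 *Touching pairs $K\times e$* (order $k_{T,\partial}$). Let $x_0,x_1,x_2$ be the vertices of $K$, $x_3$ the vertex of $e$ not in $K$ if there is one, and $$N(\psi)=\frac{\vec n_e\cdot\sum_k\psi_kx_k}{\big|\sum_k\psi_kx_k\big|^{2+2s}},\qquad H(\phi,\psi)=\Big(\sum_{k\le2}\phi_ku(x_k)\Big)\Big(\sum_{k\le2}\phi_kv(x_k)\Big)N(\psi).$$ - $e\subset K$, $s<1/2$: the sum of the quadratures of $\int\eta_0^{-2s}\langle(1-\eta_0)H(\phi,\psi)\rangle$ over - $\phi=((1-\eta_0)(1-\eta_2),\ \eta_0+\eta_2-\eta_0\eta_1-\eta_0\eta_2,\ \eta_0\eta_1)$, $\psi=(-1,1-\eta_1,\eta_1)$; - $\phi=((1-\eta_0)(1-\eta_2),\ \eta_2-\eta_0\eta_2,\ \eta_0)$, $\psi=(-\eta_1,\eta_1-1,1)$; - $\phi=(1-\eta_2+\eta_0\eta_2-\eta_0\eta_1,\ \eta_2-\eta_0\eta_2,\ \eta_0\eta_1)$, $\psi=(1-\eta_1,-1,\eta_1)$. - $e\subset K$, $s\ge1/2$: the sum of the quadratures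 of $\int\eta_0^{2-2s}\langle(1-\eta_0)\,\bar\phi^2\,u(x_2)v(x_2)\,N(\psi)\rangle$ over the same three $\psi$ with $\bar\phi=\eta_1,\,1,\,\eta_1$ respectively. - $e\cap K$ a vertex: the sum of the quadratures of $\int\eta_0^{1-2s}\langle jH(\phi,\psi)\rangle$ over - $j=1$, $\phi=(1-\eta_0,\eta_0(1-\eta_1),\eta_0\eta_1)$, $\psi=(\eta_2-1,1-\eta_1,\eta_1,-\eta_2)$; - $j=\eta_1$, $\phi=(1-\eta_0\eta_1,\eta_0\eta_1(1-\eta_2),\eta_0\eta_1\eta_2)$, $\psi=(1-\eta_1,\eta_1-\eta_1\eta_2,\eta_1\eta_2,-1)$. (All these integrals, evaluated exactly, add up to $a(u,v)$.) **Theorem.** For all $\Omega$, $s$, $\sigma$, $\tau$ there are constants $C$ and $\rho_1,\rho_2,\rho_3,\rho_4>1$ such that for every triangulation $\mathcal P_h$ of $\Omega$ with shape-regularity constant $\sigma$ and quasi-uniformity constant $\tau$, all orders $k_T,k_{T,\partial},k_{NT}(K,\tilde K),k_{NT,\partial}(K,e)\in\{0,1,2,\dots\}$, all admissible vertex numberings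 and all $u,v\in V_h$ $$|a(u,v)-a_Q(u,v)|\le C\,(E_T+E_{NT}+E_{T,\partial}+E_{NT,\partial})\,\|u\|_{L^2(\Omega)}\|v\|_{L^2(\Omega)},$$ where $$E_T=h^{-2-2s}\rho_1^{-2k_T},\qquad E_{NT}=\max_{K\cap\tilde K=\emptyset}h^{-2}d_{K,\tilde K}^{-2s}\Big(\rho_2\frac{d_{K,\tilde K}}{h}\Big)^{-2k_{NT}(K,\tilde K)},$$ $$E_{T,\partial}=h^{-1-2s}\rho_3^{-2k_{T,\partial}},\qquad E_{NT,\partial}=\max_{K\cap e=\emptyset}h^{-1}d_{K,e}^{-2s}\Big(\rho_4\frac{d_{K,e}}{h}\Big)^{-2k_{NT,\partial}(K,e)},$$ $d_{K,\tilde K}=\operatorname{dist}(K,\tilde K)$, $d_{K,e}=\operatorname{dist}(K,e)$, and a maximum over the empty set is $0$. -/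

import Mathlib

open MeasureTheory Set

noncomputable section

namespace FracQuad

/-- The Euclidean plane. -/
abbrev Plane : Type := EuclideanSpace ℝ (Fin 2)

/-- The closed simplex (triangle or edge) spanned by a finite set of vertices. -/
def hull (K : Finset Plane) : Set Plane := convexHull ℝ (K : Set Plane)

/-- The distance `inf {|x - y| : x ∈ A, y ∈ B}` of two sets. -/
def setDist (A B : Set Plane) : ℝ := sInf (Set.image2 dist A B)

/-- The normalisation constant `C(d,s)` of the integral fractional Laplacian. -/
def fracConst (d : ℕ) (s : ℝ) : ℝ :=
  2 ^ (2 * s) * s * Real.Gamma (s + (d : ℝ) / 2) /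
    (Real.pi ^ ((d : ℝ) / 2) * Real.Gamma (1 - s))

/-! ### Domain and bilinear form -/

/-- A polygon: a bounded domain, equal to the interior of its closure (no slits), whose boundary
is a finite union of line segments. -/
structure IsPolygon (Ω : Set Plane) : Prop where
  isOpen : IsOpen Ω
  isBounded : Bornology.IsBounded Ω
  isConnected : IsConnected Ω
  interior_closure : interior (closure Ω) = Ω
  frontier_eq : ∃ S : Finset (Plane × Plane), frontier Ω = ⋃ p ∈ S, segment ℝ p.1 p.2

/-- `n` is the inward unit normal at the boundary point `y`: near `y` the domain is the open
half-disc into which `n` points. -/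
def IsInwardNormal (Ω : Set Plane) (y n : Plane) : Prop :=
  ‖n‖ = 1 ∧ ∃ r > 0, ∀ z ∈ Metric.ball y r, z ∈ Ω ↔ 0 < inner ℝ n (z - y)

open Classical in
/-- The inward unit normal at `y` (it is unique where it exists; on the boundary of a polygon it
exists except at finitely many points, where the value is `0`). -/
def inwardNormal (Ω : Set Plane) (y : Plane) : Plane :=
  if hn : ∃ n, IsInwardNormal Ω y n then hn.choose else 0

/-- The bilinear form of the integral fractional Laplacian on `Ω`, with the exterior of `Ω`
rewritten as a boundary integral (`μH[1]` is arc length). -/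
def bilin (Ω : Set Plane) (s : ℝ) (u v : Plane → ℝ) : ℝ :=
  fracConst 2 s / 2 *
      (∫ x in Ω, ∫ y in Ω, (u x - u y) * (v x - v y) / ‖x - y‖ ^ (2 + 2 * s)) +
    fracConst 2 s / (2 * s) *
      (∫ x in Ω, ∫ y in frontier Ω,
        u x * v x * inner ℝ (inwardNormal Ω y) (x - y) / ‖x - y‖ ^ (2 + 2 * s) ∂μH[1])

/-- The norm of `L²(Ω)`. -/
def normL2 (Ω : Set Plane) (u : Plane → ℝ) : ℝ := (eLpNorm u 2 (volume.restrict Ω)).toReal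

/-! ### Triangulations and finite elements -/

/-- A (conforming) triangulation of `Ω`: a finite simplicial complex covering the closure. -/
structure Triangulation (Ω : Set Plane) extends Geometry.SimplicialComplex ℝ Plane where
  finite_faces : faces.Finite
  space_eq : toSimplicialComplex.space = closure Ω

namespace Triangulation

variable {Ω : Set Plane} (T : Triangulation Ω)

open Classical in
/-- The elements `K ∈ 𝒫_h`: the triangles, given by their vertex sets. -/
def elements : Finset (Finset Plane) := T.finite_faces.toFinset.filter fun K => K.card = 3

open Classical in
/-- The induced boundary mesh `𝒫_{h,∂}`: the edges that lie on the boundary of `Ω`. -/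
def boundaryEdges : Finset (Finset Plane) :=
  T.finite_faces.toFinset.filter fun e => e.card = 2 ∧ hull e ⊆ frontier Ω

/-- The mesh size `h = max h_K`. -/
def meshSize : ℝ := ⨆ K : T.elements, Metric.diam (hull K.1)

/-- Shape regularity: every element contains a disc of diameter at least `h_K / σ`. -/
def ShapeRegular (σ : ℝ) : Prop :=
  ∀ K ∈ T.elements, ∃ (c : Plane) (r : ℝ), 0 < r ∧ Metric.closedBall c r ⊆ hull K ∧
    Metric.diam (hull K) ≤ σ * (2 * r)

/-- Global quasi-uniformity: `h ≤ τ h_K` for every element. -/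
def QuasiUniform (τ : ℝ) : Prop :=
  ∀ K ∈ T.elements, T.meshSize ≤ τ * Metric.diam (hull K)

/-- The space `X_h` of continuous piecewise linear functions, that is, the span of the nodal
hat functions (extended by zero outside the closed domain).  Continuity is automatic, since the
elements are closed and a function is single valued on common edges. -/
def p1Space : Submodule ℝ (Plane → ℝ) where
  carrier := {u | (∀ K ∈ T.elements, ∃ g : Plane →ᵃ[ℝ] ℝ, EqOn u g (hull K)) ∧
    ∀ x, x ∉ closure Ω → u x = 0}
  add_mem' := by
    rintro u v ⟨hu, hu0⟩ ⟨hv, hv0⟩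
    refine ⟨fun K hK => ?_, fun x hx => by simp [hu0 x hx, hv0 x hx]⟩
    obtain ⟨f, hf⟩ := hu K hK
    obtain ⟨g, hg⟩ := hv K hK
    exact ⟨f + g, fun x hx => by simp [hf hx, hg hx]⟩
  zero_mem' := ⟨fun _ _ => ⟨0, fun _ _ => by simp⟩, fun _ _ => rfl⟩
  smul_mem' := by
    rintro a u ⟨hu, hu0⟩
    refine ⟨fun K hK => ?_, fun x hx => by simp [hu0 x hx]⟩
    obtain ⟨f, hf⟩ := hu K hK
    exact ⟨a • f, fun x hx => by simp [hf hx]⟩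

/-- The finite element space `V_h`: all of `X_h` for `s < 1/2`, and the functions of `X_h` that
vanish on the boundary for `s ≥ 1/2`. -/
def feSpace (s : ℝ) : Submodule ℝ (Plane → ℝ) where
  carrier := {u | u ∈ T.p1Space ∧ (1 / 2 ≤ s → ∀ x ∈ frontier Ω, u x = 0)}
  add_mem' := by
    rintro u v ⟨hu, hu0⟩ ⟨hv, hv0⟩
    exact ⟨add_mem hu hv, fun h x hx => by simp [hu0 h x hx, hv0 h x hx]⟩
  zero_mem' := ⟨zero_mem _, fun _ _ _ => rfl⟩
  smul_mem' := by
    rintro a u ⟨hu, hu0⟩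
    exact ⟨Submodule.smul_mem _ a hu, fun h x hx => by simp [hu0 h x hx]⟩

end Triangulation

/-! ### Gauss rules -/

/-- Nodes and weights of a one-dimensional quadrature rule with `k` nodes. -/
structure Rule (k : ℕ) where
  node : Fin k → ℝ
  weight : Fin k → ℝ

/-- `R` is the `k`-node Gauss rule on `[0,1]` for the weight function `t ↦ t ^ α`, i.e. the rule
with `k` nodes that is exact for all polynomials of degree at most `2k - 1`. For `α = 0` it is the
Gauss-Legendre rule, otherwise a Gauss-Jacobi rule. -/
structure Rule.IsGauss {k : ℕ} (R : Rule k) (α : ℝ) : Prop where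
  node_mem : ∀ i, R.node i ∈ Icc (0 : ℝ) 1
  exactness : ∀ p : Polynomial ℝ, p.natDegree < 2 * k →
    ∑ i, R.weight i * p.eval (R.node i) = ∫ t in (0 : ℝ)..1, t ^ α * p.eval t

/-- A choice of rules for all exponents and orders, consisting of the Gauss rules
for every integrable weight `t ^ α`, `α > -1`. -/
def IsGaussFamily (G : ℝ → ∀ k : ℕ, Rule k) : Prop :=
  ∀ α : ℝ, -1 < α → ∀ k : ℕ, (G α k).IsGauss α

/-- Tensor product Gauss quadrature, with `k` nodes in every variable, for the integral
`∫_{[0,1]^m} (∏ i, η i ^ α i) * f η`. -/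
def tensorGauss (G : ℝ → ∀ k : ℕ, Rule k) (k : ℕ) {m : ℕ} (α : Fin m → ℝ)
    (f : (Fin m → ℝ) → ℝ) : ℝ :=
  ∑ j : Fin m → Fin k, (∏ i, (G (α i) k).weight (j i)) * f fun i => (G (α i) k).node (j i)

/-! ### Quadrature for pairs of elements -/

/-- The transformed integrand (without Jacobian) on a touching pair of elements spanned by the
vertices `x k`, where `ψ k` are the differences of the barycentric coordinates divided by the
lifted power of the Duffy variables. -/
def pairIntegrand (s : ℝ) {m : ℕ} (x : Fin m → Plane) (u v : Plane → ℝ) (ψ : Fin m → ℝ) : ℝ :=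
  (∑ k, ψ k * u (x k)) * (∑ k, ψ k * v (x k)) / ‖∑ k, ψ k • x k‖ ^ (2 + 2 * s)

/-- Identical elements, three sub-simplices. -/
def psiSame (η : Fin 4 → ℝ) : Fin 3 → Fin 3 → ℝ :=
  ![![-η 3, η 3 - 1, 1],
    ![-1, 1 - η 3, η 3],
    ![η 3, -1, 1 - η 3]]

/-- Elements with a common edge, five sub-simplices. -/
def psiEdge (η : Fin 4 → ℝ) : Fin 5 → Fin 4 → ℝ :=
  ![![-η 2, 1 - η 3, η 3, η 2 - 1],
    ![-(η 2 * η 3), η 2 - 1, 1, η 2 * η 3 - η 2],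
    ![η 2, η 2 * η 3 - 1, 1 - η 2, -(η 2 * η 3)],
    ![η 2 * η 3, 1 - η 2, η 2 - η 2 * η 3, -1],
    ![η 2 * η 3, η 2 - 1, 1 - η 2 * η 3, -η 2]]

/-- Elements with a common vertex, two sub-simplices. -/
def psiVertex (η : Fin 4 → ℝ) : Fin 2 → Fin 5 → ℝ :=
  ![![η 2 - 1, 1 - η 1, η 1, η 2 * η 3 - η 2, -(η 2 * η 3)],
    ![1 - η 2, η 2 - η 2 * η 3, η 2 * η 3, η 1 - 1, -η 1]]

/-- Identical elements with vertices `x 0, x 1, x 2`: Jacobian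
`2 η₀^(3-2s) η₁^(2-2s) η₂^(1-2s)` (the factor two accounts for the sub-simplices obtained by
exchanging the two variables). -/
def quadSame (G : ℝ → ∀ k : ℕ, Rule k) (s : ℝ) (k : ℕ) (x : Fin 3 → Plane)
    (u v : Plane → ℝ) : ℝ :=
  2 * ∑ l : Fin 3, tensorGauss G k ![3 - 2 * s, 2 - 2 * s, 1 - 2 * s, 0] fun η =>
    pairIntegrand s x u v (psiSame η l)

/-- Elements `x 0, x 1, x 2` and `x 0, x 1, y 2` with a common edge: Jacobian
`η₀^(3-2s) η₁^(2-2s)` on the first and `η₀^(3-2s) η₁^(2-2s) η₂` on the other sub-simplices. -/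
def quadEdge (G : ℝ → ∀ k : ℕ, Rule k) (s : ℝ) (k : ℕ) (x y : Fin 3 → Plane)
    (u v : Plane → ℝ) : ℝ :=
  ∑ l : Fin 5, tensorGauss G k ![3 - 2 * s, 2 - 2 * s, 0, 0] fun η =>
    (if l = 0 then 1 else η 2) *
      pairIntegrand s ![x 0, x 1, x 2, y 2] u v (psiEdge η l)

/-- Elements `x 0, x 1, x 2` and `x 0, y 1, y 2` with a common vertex: Jacobian
`η₀^(3-2s) η₂`. -/
def quadVertex (G : ℝ → ∀ k : ℕ, Rule k) (s : ℝ) (k : ℕ) (x y : Fin 3 → Plane)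
    (u v : Plane → ℝ) : ℝ :=
  ∑ l : Fin 2, tensorGauss G k ![3 - 2 * s, 0, 0, 0] fun η =>
    η 2 * pairIntegrand s ![x 0, x 1, x 2, y 1, y 2] u v (psiVertex η l)

/-- The map of the unit square onto the triangle `x 0, x 1, x 2` underlying the conical product
rule; its Jacobian is `2 |K| a`. -/
def conical (x : Fin 3 → Plane) (a b : ℝ) : Plane :=
  (1 - a) • x 0 + (a * (1 - b)) • x 1 + (a * b) • x 2

/-- Separated elements: the product of two Stroud conical rules. -/
def quadFar (G : ℝ → ∀ k : ℕ, Rule k) (s : ℝ) (k : ℕ) (x y : Fin 3 → Plane)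
    (u v : Plane → ℝ) : ℝ :=
  tensorGauss G k ![1, 0, 1, 0] fun ξ =>
    (u (conical x (ξ 0) (ξ 1)) - u (conical y (ξ 2) (ξ 3))) *
      (v (conical x (ξ 0) (ξ 1)) - v (conical y (ξ 2) (ξ 3))) /
      ‖conical x (ξ 0) (ξ 1) - conical y (ξ 2) (ξ 3)‖ ^ (2 + 2 * s)

/-! ### Quadrature for pairs of an element and a boundary edge -/

/-- The kernel `n · z / |z|^(2+2s)`. -/
def normalKernel (s : ℝ) (n z : Plane) : ℝ := inner ℝ n z / ‖z‖ ^ (2 + 2 * s)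

/-- The edge is an edge of the element: local shape functions. -/
def phiOn (η : Fin 3 → ℝ) : Fin 3 → Fin 3 → ℝ :=
  ![![(1 - η 0) * (1 - η 2), η 0 + η 2 - η 0 * η 1 - η 0 * η 2, η 0 * η 1],
    ![(1 - η 0) * (1 - η 2), η 2 - η 0 * η 2, η 0],
    ![1 - η 2 + η 0 * η 2 - η 0 * η 1, η 2 - η 0 * η 2, η 0 * η 1]]

/-- The edge is an edge of the element: differences of barycentric coordinates. -/
def psiOn (η : Fin 3 → ℝ) : Fin 3 → Fin 3 → ℝ :=
  ![![-1, 1 - η 1, η 1],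
    ![-η 1, η 1 - 1, 1],
    ![1 - η 1, -1, η 1]]

/-- The edge is an edge of the element: shape function of the opposite vertex divided by `η₀`. -/
def phiOnOpposite (η : Fin 3 → ℝ) : Fin 3 → ℝ := ![η 1, 1, η 1]

/-- The edge shares one vertex with the element: local shape functions. -/
def phiAt (η : Fin 3 → ℝ) : Fin 2 → Fin 3 → ℝ :=
  ![![1 - η 0, η 0 * (1 - η 1), η 0 * η 1],
    ![1 - η 0 * η 1, η 0 * η 1 * (1 - η 2), η 0 * η 1 * η 2]]

/-- The edge shares one vertex with the element: differences of barycentric coordinates. -/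
def psiAt (η : Fin 3 → ℝ) : Fin 2 → Fin 4 → ℝ :=
  ![![η 2 - 1, 1 - η 1, η 1, -η 2],
    ![1 - η 1, η 1 - η 1 * η 2, η 1 * η 2, -1]]

/-- Element `x 0, x 1, x 2` and its edge `x 0, x 1`. For `s < 1/2` the Jacobian is
`η₀^(-2s) (1 - η₀)`. For `s ≥ 1/2` only the degree of freedom at `x 2` is present, and a factor
`η₀²` of the shape functions is moved to the Jacobian. -/
def quadOn (G : ℝ → ∀ k : ℕ, Rule k) (s : ℝ) (k : ℕ) (n : Plane) (x : Fin 3 → Plane)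
    (u v : Plane → ℝ) : ℝ :=
  if s < 1 / 2 then
    ∑ l : Fin 3, tensorGauss G k ![-2 * s, 0, 0] fun η =>
      (1 - η 0) * (∑ i, phiOn η l i * u (x i)) * (∑ i, phiOn η l i * v (x i)) *
        normalKernel s n (∑ i, psiOn η l i • x i)
  else
    ∑ l : Fin 3, tensorGauss G k ![2 - 2 * s, 0, 0] fun η =>
      (1 - η 0) * (phiOnOpposite η l * u (x 2)) * (phiOnOpposite η l * v (x 2)) *
        normalKernel s n (∑ i, psiOn η l i • x i)

/-- Element `x 0, x 1, x 2` and edge `x 0, y 1` with common vertex `x 0`: Jacobian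
`η₀^(1-2s)` on the first and `η₀^(1-2s) η₁` on the second sub-simplex. -/
def quadAt (G : ℝ → ∀ k : ℕ, Rule k) (s : ℝ) (k : ℕ) (n : Plane) (x : Fin 3 → Plane)
    (y : Fin 2 → Plane) (u v : Plane → ℝ) : ℝ :=
  ∑ l : Fin 2, tensorGauss G k ![1 - 2 * s, 0, 0] fun η =>
    (if l = 0 then 1 else η 1) *
      (∑ i, phiAt η l i * u (x i)) * (∑ i, phiAt η l i * v (x i)) *
        normalKernel s n (∑ i, psiAt η l i • ![x 0, x 1, x 2, y 1] i)

/-- Separated element and edge: conical rule times Gauss-Legendre rule. -/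
def quadFarEdge (G : ℝ → ∀ k : ℕ, Rule k) (s : ℝ) (k : ℕ) (n : Plane) (x : Fin 3 → Plane)
    (y : Fin 2 → Plane) (u v : Plane → ℝ) : ℝ :=
  tensorGauss G k ![1, 0, 0] fun ξ =>
    u (conical x (ξ 0) (ξ 1)) * v (conical x (ξ 0) (ξ 1)) *
      normalKernel s n (conical x (ξ 0) (ξ 1) - ((1 - ξ 2) • y 0 + ξ 2 • y 1))

/-! ### The approximate bilinear form -/

/-- The data of a quadrature scheme on a mesh: the quadrature orders, and a local numbering of the
vertices for every pair of elements and every pair of an element and a boundary edge, in which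
the common vertices come first and in the same order. -/
structure Scheme {Ω : Set Plane} (T : Triangulation Ω) where
  /-- order for touching pairs of elements -/
  kT : ℕ
  /-- order for separated pairs of elements -/
  kNT : Finset Plane → Finset Plane → ℕ
  /-- order for touching pairs of an element and a boundary edge -/
  kTb : ℕ
  /-- order for separated pairs of an element and a boundary edge -/
  kNTb : Finset Plane → Finset Plane → ℕ
  /-- numbering of the first element of a pair of elements -/
  fst : Finset Plane → Finset Plane → Fin 3 → Plane
  /-- numbering of the second element of a pair of elements -/
  snd : Finset Plane → Finset Plane → Fin 3 → Plane
  /-- numbering of the element in a pair of an element and an edge -/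
  fstb : Finset Plane → Finset Plane → Fin 3 → Plane
  /-- numbering of the edge in a pair of an element and an edge -/
  sndb : Finset Plane → Finset Plane → Fin 2 → Plane
  range_fst : ∀ K ∈ T.elements, ∀ L ∈ T.elements, range (fst K L) = K
  range_snd : ∀ K ∈ T.elements, ∀ L ∈ T.elements, range (snd K L) = L
  range_fstb : ∀ K ∈ T.elements, ∀ e ∈ T.boundaryEdges, range (fstb K e) = K
  range_sndb : ∀ K ∈ T.elements, ∀ e ∈ T.boundaryEdges, range (sndb K e) = e
  common : ∀ K ∈ T.elements, ∀ L ∈ T.elements, ∀ i : Fin 3,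
    (i : ℕ) < ((K : Set Plane) ∩ L).ncard → fst K L i = snd K L i
  commonb : ∀ K ∈ T.elements, ∀ e ∈ T.boundaryEdges, ∀ i : Fin 2,
    (i : ℕ) < ((K : Set Plane) ∩ e).ncard → fstb K e i.castSucc = sndb K e i

namespace Scheme

variable {Ω : Set Plane} {T : Triangulation Ω} (Q : Scheme T)

/-- The area of an element. -/
def area (K : Finset Plane) : ℝ := (volume (hull K)).toReal

/-- The inward unit normal `n_e` on a boundary edge, taken at its midpoint. -/
def edgeNormal (Ω : Set Plane) (y : Fin 2 → Plane) : Plane :=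
  inwardNormal Ω (midpoint ℝ (y 0) (y 1))

/-- The approximate contribution of a pair of elements. The reference triangle has area `1/2`. -/
def aPair (G : ℝ → ∀ k : ℕ, Rule k) (s : ℝ) (K L : Finset Plane) (u v : Plane → ℝ) : ℝ :=
  fracConst 2 s / 2 * (area K / (1 / 2)) * (area L / (1 / 2)) *
    match ((K : Set Plane) ∩ L).ncard with
    | 0 => quadFar G s (Q.kNT K L) (Q.fst K L) (Q.snd K L) u v
    | 1 => quadVertex G s Q.kT (Q.fst K L) (Q.snd K L) u v
    | 2 => quadEdge G s Q.kT (Q.fst K L) (Q.snd K L) u v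
    | _ => quadSame G s Q.kT (Q.fst K L) u v

/-- The approximate contribution of an element and a boundary edge. The reference edge has
length `1`. -/
def aPairb (G : ℝ → ∀ k : ℕ, Rule k) (s : ℝ) (K e : Finset Plane) (u v : Plane → ℝ) : ℝ :=
  fracConst 2 s / (2 * s) * (area K / (1 / 2)) * Metric.diam (hull e) *
    match ((K : Set Plane) ∩ e).ncard with
    | 0 => quadFarEdge G s (Q.kNTb K e) (edgeNormal Ω (Q.sndb K e)) (Q.fstb K e) (Q.sndb K e) u v
    | 1 => quadAt G s Q.kTb (edgeNormal Ω (Q.sndb K e)) (Q.fstb K e) (Q.sndb K e) u v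
    | _ => quadOn G s Q.kTb (edgeNormal Ω (Q.sndb K e)) (Q.fstb K e) u v

/-- The approximation `a_Q` of the bilinear form. -/
def aQ (G : ℝ → ∀ k : ℕ, Rule k) (s : ℝ) (u v : Plane → ℝ) : ℝ :=
  ∑ K ∈ T.elements, ∑ L ∈ T.elements, Q.aPair G s K L u v +
    ∑ K ∈ T.elements, ∑ e ∈ T.boundaryEdges, Q.aPairb G s K e u v

/-! ### The error terms -/

/-- `E_T` -/
def errT (s ρ : ℝ) : ℝ := T.meshSize ^ (-2 - 2 * s) * ρ ^ (-2 * (Q.kT : ℤ))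

/-- `E_{T,∂}` -/
def errTb (s ρ : ℝ) : ℝ := T.meshSize ^ (-1 - 2 * s) * ρ ^ (-2 * (Q.kTb : ℤ))

/-- `E_{NT}`, the maximum over all pairs of disjoint elements (zero if there is none). -/
def errNT (s ρ : ℝ) : ℝ :=
  ⨆ p : {p : Finset Plane × Finset Plane //
      p.1 ∈ T.elements ∧ p.2 ∈ T.elements ∧ Disjoint (hull p.1) (hull p.2)},
    T.meshSize ^ (-2 : ℤ) * setDist (hull p.1.1) (hull p.1.2) ^ (-2 * s) *
      (ρ * (setDist (hull p.1.1) (hull p.1.2) / T.meshSize)) ^ (-2 * (Q.kNT p.1.1 p.1.2 : ℤ))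

/-- `E_{NT,∂}`, the maximum over all pairs of an element and a boundary edge that are disjoint
(zero if there is none). -/
def errNTb (s ρ : ℝ) : ℝ :=
  ⨆ p : {p : Finset Plane × Finset Plane //
      p.1 ∈ T.elements ∧ p.2 ∈ T.boundaryEdges ∧ Disjoint (hull p.1) (hull p.2)},
    T.meshSize ^ (-1 : ℤ) * setDist (hull p.1.1) (hull p.1.2) ^ (-2 * s) *
      (ρ * (setDist (hull p.1.1) (hull p.1.2) / T.meshSize)) ^ (-2 * (Q.kNTb p.1.1 p.1.2 : ℤ))

end Scheme

end FracQuad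

end

/-!
The quadrature error is estimated pair by pair, in reference coordinates, and summed.

*Regularised integrands.* On a touching pair the singularity is removed by Duffy transformations:
the reference domain is cut into regions that are mapped onto the cube, and there the homogeneity
of the kernel produces the powers `∏ η_i ^ α_i` of the quadrature rules
(`setLIntegral_refPair_same` and its variants, `integral_refPair_same`, `integral_refPairEdge_on`
and so on). What remains has the form `(∏ P_j) / ‖Z‖ ^ (2 + 2 s)` where the `P_j` and the vector
`Z = ∑ ψ_k x_k` are affine in each variable separately. The coefficients `ψ` sum to zero, one of
them has absolute value at least `1/2`, and their signs separate the two simplices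
(`IsDuffyWeight`); hence `‖Z‖` lies between fixed multiples of `h`
(`Controlled.norm_sum_smul_bounds`).

*Quadrature.* Gauss rules have nonnegative weights and are exact up to degree `2 k - 1`, so that
their error is at most twice the mass of the weight function times the error of best polynomial
approximation, and the errors of the factors of a tensor product add up
(`Rule.IsGauss.error_le`, `abs_integral_pi_sub_tensorGauss_le`). It is therefore enough to
approximate `q(t) / ‖a + t b‖ ^ (2 + 2 s)` by polynomials in one variable. If `‖a + t b‖` varies
in a fixed ratio, the binomial series in a quadratic polynomial does so at a geometric rate
(`exists_poly_near`). If it is at least `d` and `‖b‖ ≤ h`, the Taylor expansion at the midpoint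
gives `(ρ d / h) ^ (-2 k)` (`exists_poly_far`).

*Geometry.* The uniform bounds rest on a Lipschitz bound `C / h` for the hat functions on the whole
closed domain, not on single elements only (`exists_abs_bary_sub_le`). It follows from the bound on
each element, since nearby points of the closed domain can be joined inside it by a path of
comparable length. This is proved with the help of one fixed triangulation of the domain
(`exists_waypoint`); if no triangulation satisfies the assumptions, nothing has to be shown. Two
points of disjoint simplices differ by `1` in the value of some sum of hat functions, so that the
Lipschitz bound separates them by a multiple of `h`.

*Summation.* The form `a` is the sum of the contributions of all pairs, because different elements
overlap in null sets and the inward normal is constant on each boundary edge (`bilin_eq_sum`). The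
nodal values are bounded by `L²` norms with the inverse estimate (`apply_sq_mul_area_le`), and the
sums over pairs by the Cauchy-Schwarz inequality and the number of elements and of boundary edges.

*Separated boundary edges.* For an element and an edge at distance `d` the estimate obtained in
this way exceeds `E_{NT,∂}` by the factor `(d / h)²`. On coarse meshes this factor is bounded. On
fine meshes the error is bounded in another way: some disjoint pair of elements has distance at
most `θ h` with a fixed `θ < 1` (`Regular.exists_near_pair`), and `ρ₂ θ ≤ 1` makes
`E_{NT} ≥ h ^ (-2 - 2 s)` for all quadrature orders (`rpow_le_errNT`); this dominates the maximum
of the integrand.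
-/

namespace FracQuad

/-! ### Gauss rules -/

/-- The measure `t ^ α dt` on the unit interval. -/
noncomputable def powMeasure (α : ℝ) : Measure ℝ :=
  (volume.restrict (Ioo (0 : ℝ) 1)).withDensity fun t => ENNReal.ofReal (t ^ α)

theorem measurable_ofReal_rpow (α : ℝ) : Measurable fun t : ℝ => ENNReal.ofReal (t ^ α) := by
  fun_prop

theorem powMeasure_univ {α : ℝ} (hα : -1 < α) :
    powMeasure α univ = ENNReal.ofReal (1 / (α + 1)) := by
  have hint : IntegrableOn (fun t : ℝ => t ^ α) (Ioo 0 1) := by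
    have := (intervalIntegral.intervalIntegrable_rpow' (a := 0) (b := 1) hα).1
    exact this.mono_set Ioo_subset_Ioc_self
  rw [powMeasure, withDensity_apply _ MeasurableSet.univ, Measure.restrict_univ,
    ← ofReal_integral_eq_lintegral_ofReal hint]
  · congr 1
    rw [← integral_Ioc_eq_integral_Ioo, ← intervalIntegral.integral_of_le zero_le_one,
      integral_rpow (Or.inl hα)]
    have : α + 1 ≠ 0 := by linarith
    rw [Real.one_rpow, Real.zero_rpow this, sub_zero]
  · refine (ae_restrict_iff' measurableSet_Ioo).2 (Filter.Eventually.of_forall fun t ht => ?_)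
    exact Real.rpow_nonneg ht.1.le _

theorem isFiniteMeasure_powMeasure {α : ℝ} (hα : -1 < α) : IsFiniteMeasure (powMeasure α) :=
  ⟨by rw [powMeasure_univ hα]; exact ENNReal.ofReal_lt_top⟩

instance instSFinitePowMeasure (α : ℝ) : SFinite (powMeasure α) := by
  unfold powMeasure; infer_instance

instance instSigmaFinitePowMeasure (α : ℝ) : SigmaFinite (powMeasure α) := by
  unfold powMeasure
  exact SigmaFinite.withDensity_ofReal _

theorem ae_powMeasure_mem (α : ℝ) : ∀ᵐ t ∂(powMeasure α), t ∈ Ioo (0 : ℝ) 1 := by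
  have : ∀ᵐ t ∂(volume.restrict (Ioo (0 : ℝ) 1)), t ∈ Ioo (0 : ℝ) 1 :=
    ae_restrict_mem measurableSet_Ioo
  exact (withDensity_absolutelyContinuous _ _) this

theorem integral_powMeasure (α : ℝ) (f : ℝ → ℝ) :
    ∫ t, f t ∂(powMeasure α) = ∫ t in (0 : ℝ)..1, t ^ α * f t := by
  rw [powMeasure, integral_withDensity_eq_integral_toReal_smul (measurable_ofReal_rpow α)
    (Filter.Eventually.of_forall fun _ => ENNReal.ofReal_lt_top),
    intervalIntegral.integral_of_le zero_le_one, integral_Ioc_eq_integral_Ioo]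
  refine setIntegral_congr_fun measurableSet_Ioo fun t ht => ?_
  simp only [smul_eq_mul]
  rw [ENNReal.toReal_ofReal (Real.rpow_nonneg ht.1.le _)]

theorem lintegral_powMeasure (α : ℝ) (f : ℝ → ENNReal) :
    ∫⁻ t, f t ∂(powMeasure α) = ∫⁻ t in Ioo (0 : ℝ) 1, ENNReal.ofReal (t ^ α) * f t := by
  rw [powMeasure, lintegral_withDensity_eq_lintegral_mul_non_measurable _
    (measurable_ofReal_rpow α) (Filter.Eventually.of_forall fun _ => ENNReal.ofReal_lt_top)]
  rfl

theorem integrable_powMeasure_of_continuous {α : ℝ} (hα : -1 < α) {f : ℝ → ℝ}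
    (hf : Continuous f) : Integrable f (powMeasure α) := by
  have := isFiniteMeasure_powMeasure hα
  obtain ⟨M, hM⟩ := isCompact_Icc.exists_bound_of_continuousOn (s := Icc (0 : ℝ) 1)
    hf.continuousOn
  refine Integrable.of_bound hf.aestronglyMeasurable M ?_
  filter_upwards [ae_powMeasure_mem α] with t ht using hM t (Ioo_subset_Icc_self ht)

theorem powMeasure_compl_ne_zero {α : ℝ} {S : Set ℝ} (hS : S.Finite) :
    powMeasure α Sᶜ ≠ 0 := by
  rw [powMeasure, withDensity_apply _ hS.measurableSet.compl]
  rw [Ne, lintegral_eq_zero_iff (measurable_ofReal_rpow α)]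
  intro h
  have h2 : ∀ᵐ t ∂((volume.restrict (Ioo (0 : ℝ) 1)).restrict Sᶜ), False := by
    have h3 : ∀ᵐ t ∂((volume.restrict (Ioo (0 : ℝ) 1)).restrict Sᶜ), t ∈ Ioo (0 : ℝ) 1 :=
      ae_restrict_of_ae (ae_restrict_mem measurableSet_Ioo)
    filter_upwards [h, h3] with t ht ht'
    have : 0 < t ^ α := Real.rpow_pos_of_pos ht'.1 α
    simp only [Pi.zero_apply, ENNReal.ofReal_eq_zero] at ht
    linarith
  rw [Measure.restrict_restrict hS.measurableSet.compl] at h2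
  have h4 : volume (Sᶜ ∩ Ioo (0 : ℝ) 1) = 0 := by
    have := ae_iff.1 h2
    simpa using this
  have h5 : volume (Ioo (0 : ℝ) 1) ≤ volume (Sᶜ ∩ Ioo (0 : ℝ) 1) + volume S := by
    refine (measure_mono fun t ht => ?_).trans (measure_union_le _ _)
    by_cases h : t ∈ S
    · exact Or.inr h
    · exact Or.inl ⟨h, ht⟩
  rw [h4, hS.measure_zero] at h5
  simp at h5

/-- The test polynomial is the square of the product of `t - x_j` over the other nodes. -/
theorem Rule.IsGauss.weight_nonneg {k : ℕ} {R : Rule k} {α : ℝ} (hα : -1 < α) (hR : R.IsGauss α)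
    (i : Fin k) : 0 ≤ R.weight i := by
  classical
  set q : Polynomial ℝ :=
    ∏ j ∈ Finset.univ.erase i, (Polynomial.X - Polynomial.C (R.node j)) with hq
  have hk : 0 < k := i.pos
  have hq0 : q ≠ 0 := Finset.prod_ne_zero_iff.2 fun j _ => Polynomial.X_sub_C_ne_zero _
  have hdeg : (q ^ 2).natDegree < 2 * k := by
    have h1 : q.natDegree ≤ k - 1 := by
      refine (Polynomial.natDegree_prod_le _ _).trans ?_
      simp [Finset.card_erase_of_mem]
    have h2 := Polynomial.natDegree_pow_le (p := q) (n := 2)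
    omega
  have hex := hR.exactness (q ^ 2) hdeg
  -- the other nodes are zeros of `q`
  have hsum : ∑ l, R.weight l * (q ^ 2).eval (R.node l) =
      R.weight i * (q ^ 2).eval (R.node i) := by
    refine Finset.sum_eq_single i (fun l _ hl => ?_) (by simp)
    have : q.eval (R.node l) = 0 := by
      rw [hq, Polynomial.eval_prod,
        Finset.prod_eq_zero (i := l) (by simp [hl]) (by simp)]
    rw [Polynomial.eval_pow, this]
    simp
  rw [hsum, ← integral_powMeasure α] at hex
  -- `q ^ 2` vanishes at finitely many points only, which do not carry the whole mass
  have hpos : 0 < ∫ t, (q ^ 2).eval t ∂(powMeasure α) := by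
    rw [integral_pos_iff_support_of_nonneg]
    · refine pos_iff_ne_zero.2 fun h => ?_
      refine powMeasure_compl_ne_zero (α := α) q.roots.toFinset.finite_toSet ?_
      refine measure_mono_null (fun t ht => ?_) h
      have : q.eval t ≠ 0 := by
        intro h0
        exact ht (by simpa [hq0, Polynomial.IsRoot] using h0)
      simpa [Function.mem_support] using this
    · intro t
      simp only [Polynomial.eval_pow, Pi.zero_apply]
      positivity
    · exact integrable_powMeasure_of_continuous hα (q ^ 2).continuous
  rw [← hex, Polynomial.eval_pow] at hpos
  exact (pos_of_mul_pos_left hpos (sq_nonneg _)).le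

/-- The total mass `∫₀¹ t ^ α dt` of the weight function. -/
theorem powMeasure_real_univ {α : ℝ} (hα : -1 < α) :
    (powMeasure α).real univ = 1 / (α + 1) := by
  rw [Measure.real, powMeasure_univ hα, ENNReal.toReal_ofReal]
  have : 0 < α + 1 := by linarith
  positivity

theorem Rule.IsGauss.sum_weight_le {k : ℕ} {R : Rule k} {α : ℝ} (hα : -1 < α)
    (hR : R.IsGauss α) : ∑ i, R.weight i ≤ 1 / (α + 1) := by
  have h0 : 0 < α + 1 := by linarith
  rcases Nat.eq_zero_or_pos k with rfl | hk
  · simp only [Finset.univ_eq_empty, Finset.sum_empty]; positivity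
  · have := hR.exactness 1 (by simpa using hk)
    rw [← integral_powMeasure] at this
    simp only [Polynomial.eval_one, mul_one, integral_const, smul_eq_mul] at this
    rw [this, powMeasure_real_univ hα]

/-- A Gauss rule is, up to twice the total mass, as good as the best uniform approximation of the
integrand by polynomials of degree less than `2 k`. -/
theorem Rule.IsGauss.error_le {k : ℕ} {R : Rule k} {α : ℝ} (hα : -1 < α) (hR : R.IsGauss α)
    {f : ℝ → ℝ} (hf : Continuous f) {p : Polynomial ℝ} (hp : p.degree < (2 * k : ℕ)) {ε : ℝ}
    (hε : ∀ t ∈ Icc (0 : ℝ) 1, |f t - p.eval t| ≤ ε) :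
    |∫ t, f t ∂(powMeasure α) - ∑ i, R.weight i * f (R.node i)| ≤ 2 * (1 / (α + 1)) * ε := by
  have := isFiniteMeasure_powMeasure hα
  have hex : ∑ i, R.weight i * p.eval (R.node i) = ∫ t, p.eval t ∂(powMeasure α) := by
    rw [integral_powMeasure]
    by_cases h0 : p = 0
    · simp [h0]
    · exact hR.exactness p ((Polynomial.natDegree_lt_iff_degree_lt h0).2 hp)
  have hε0 : 0 ≤ ε := (abs_nonneg _).trans (hε 0 (by simp))
  have h1 : |∫ t, (f t - p.eval t) ∂(powMeasure α)| ≤ ε * (powMeasure α).real univ := by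
    refine norm_integral_le_of_norm_le_const (f := fun t => f t - p.eval t) ?_
    filter_upwards [ae_powMeasure_mem α] with t ht using hε t (Ioo_subset_Icc_self ht)
  have h2 : |∑ i, R.weight i * (f (R.node i) - p.eval (R.node i))| ≤ ε * (1 / (α + 1)) := by
    calc |∑ i, R.weight i * (f (R.node i) - p.eval (R.node i))|
        ≤ ∑ i, |R.weight i * (f (R.node i) - p.eval (R.node i))| :=
          Finset.abs_sum_le_sum_abs _ _
      _ ≤ ∑ i, R.weight i * ε := by
          refine Finset.sum_le_sum fun i _ => ?_
          rw [abs_mul, abs_of_nonneg (hR.weight_nonneg hα i)]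
          exact mul_le_mul_of_nonneg_left (hε _ (hR.node_mem i)) (hR.weight_nonneg hα i)
      _ = ε * ∑ i, R.weight i := by rw [← Finset.sum_mul, mul_comm]
      _ ≤ ε * (1 / (α + 1)) := mul_le_mul_of_nonneg_left (hR.sum_weight_le hα) hε0
  rw [powMeasure_real_univ hα] at h1
  have h3 : ∫ t, f t ∂(powMeasure α) - ∑ i, R.weight i * f (R.node i) =
      ∫ t, (f t - p.eval t) ∂(powMeasure α) -
        ∑ i, R.weight i * (f (R.node i) - p.eval (R.node i)) := by
    rw [integral_sub (integrable_powMeasure_of_continuous hα hf)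
      (integrable_powMeasure_of_continuous hα p.continuous), ← hex]
    simp only [mul_sub, Finset.sum_sub_distrib]
    ring
  rw [h3]
  refine (abs_sub _ _).trans ?_
  linarith

theorem integral_pi_cons {m : ℕ} (μ : Fin (m + 1) → Measure ℝ) [∀ i, SigmaFinite (μ i)]
    (f : (Fin (m + 1) → ℝ) → ℝ) :
    ∫ η, f η ∂(Measure.pi μ) =
      ∫ z : ℝ × (Fin m → ℝ), f (Fin.cons z.1 z.2)
        ∂((μ 0).prod (Measure.pi fun i => μ i.succ)) := by
  rw [← ((measurePreserving_piFinSuccAbove μ 0).symm).integral_comp']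
  simp_rw [MeasurableEquiv.piFinSuccAbove_symm_apply, Fin.insertNthEquiv,
    Equiv.coe_fn_mk, Fin.insertNth_zero', Fin.succAbove_zero]

theorem lintegral_pi_cons {m : ℕ} (μ : Fin (m + 1) → Measure ℝ) [∀ i, SigmaFinite (μ i)]
    (f : (Fin (m + 1) → ℝ) → ENNReal) (hf : Measurable f) :
    ∫⁻ η, f η ∂(Measure.pi μ) =
      ∫⁻ t, ∫⁻ η : Fin m → ℝ, f (Fin.cons t η) ∂(Measure.pi fun i => μ i.succ) ∂(μ 0) := by
  have h1 := (measurePreserving_piFinSuccAbove μ 0).symm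
  rw [← h1.lintegral_comp_emb (MeasurableEquiv.measurableEmbedding _), lintegral_prod]
  · simp_rw [MeasurableEquiv.piFinSuccAbove_symm_apply, Fin.insertNthEquiv,
      Equiv.coe_fn_mk, Fin.insertNth_zero', Fin.succAbove_zero]
  · exact (hf.comp (MeasurableEquiv.measurable _)).aemeasurable

theorem tensorGauss_cons (G : ℝ → ∀ k : ℕ, Rule k) (k : ℕ) {m : ℕ} (α : Fin (m + 1) → ℝ)
    (f : (Fin (m + 1) → ℝ) → ℝ) :
    tensorGauss G k α f = ∑ i : Fin k, (G (α 0) k).weight i *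
      tensorGauss G k (fun i => α i.succ) fun η => f (Fin.cons ((G (α 0) k).node i) η) := by
  simp only [tensorGauss, Finset.mul_sum]
  rw [← Fintype.sum_prod_type', ← (Fin.consEquiv fun _ : Fin (m + 1) => Fin k).sum_comp]
  refine Finset.sum_congr rfl fun x _ => ?_
  rw [Fin.prod_univ_succ]
  simp only [Fin.consEquiv, Equiv.coe_fn_mk, Fin.cons_zero, Fin.cons_succ]
  rw [mul_assoc]
  congr 3
  funext i
  refine Fin.cases ?_ (fun j => ?_) i <;> simp

theorem cons_mem_Icc {m : ℕ} {t : ℝ} {η : Fin m → ℝ} (ht : t ∈ Icc (0 : ℝ) 1)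
    (hη : η ∈ Icc (0 : Fin m → ℝ) 1) :
    (Fin.cons t η : Fin (m + 1) → ℝ) ∈ Icc (0 : Fin (m + 1) → ℝ) 1 := by
  constructor
  · intro i
    refine Fin.cases ?_ (fun j => ?_) i
    · simpa using ht.1
    · simpa using hη.1 j
  · intro i
    refine Fin.cases ?_ (fun j => ?_) i
    · simpa using ht.2
    · simpa using hη.2 j

theorem ae_pi_powMeasure_mem {m : ℕ} (α : Fin m → ℝ) :
    ∀ᵐ η ∂(Measure.pi fun i => powMeasure (α i)), ∀ i, η i ∈ Ioo (0 : ℝ) 1 := by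
  rw [ae_all_iff]
  intro i
  exact (Measure.quasiMeasurePreserving_eval (μ := fun i => powMeasure (α i)) i).ae
    (ae_powMeasure_mem (α i))

theorem pi_powMeasure_real_univ_le {m : ℕ} {α : Fin m → ℝ} (hα : ∀ i, -1 < α i) {W : ℝ}
    (hαW : ∀ i, 1 / (α i + 1) ≤ W) :
    (Measure.pi fun i => powMeasure (α i)).real univ ≤ W ^ m := by
  have : ∀ i, IsFiniteMeasure (powMeasure (α i)) := fun i => isFiniteMeasure_powMeasure (hα i)
  rw [Measure.real, Measure.pi_univ, ENNReal.toReal_prod]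
  refine (Finset.prod_le_prod (fun i _ => ENNReal.toReal_nonneg) fun i _ => ?_).trans
    (by rw [Finset.prod_const, Finset.card_univ, Fintype.card_fin])
  exact (powMeasure_real_univ (hα i)).trans_le (hαW i)

/-- Tensor products of Gauss rules: the one-dimensional errors add up. -/
theorem abs_integral_pi_sub_tensorGauss_le {G : ℝ → ∀ k : ℕ, Rule k} (hG : IsGaussFamily G)
    {W : ℝ} (hW1 : 1 ≤ W) (k : ℕ) : ∀ {m : ℕ} (α : Fin m → ℝ), (∀ i, -1 < α i) →
    (∀ i, 1 / (α i + 1) ≤ W) → ∀ {f : (Fin m → ℝ) → ℝ}, Continuous f →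
    (∃ M, ∀ η, |f η| ≤ M) → ∀ {ε : ℝ}, 0 ≤ ε →
    (∀ i, ∀ η ∈ Icc (0 : Fin m → ℝ) 1, ∃ p : Polynomial ℝ, p.degree < (2 * k : ℕ) ∧
      ∀ t ∈ Icc (0 : ℝ) 1, |f (Function.update η i t) - p.eval t| ≤ ε) →
    |∫ η, f η ∂(Measure.pi fun i => powMeasure (α i)) - tensorGauss G k α f| ≤
      m * (2 * W ^ m * ε) := by
  intro m
  induction m with
  | zero =>
    intro α _ _ f _ _ ε _ _
    simp only [tensorGauss, Finset.univ_eq_empty, Finset.prod_empty, one_mul]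
    rw [Fintype.sum_unique, Measure.pi_of_empty (x := 0), integral_dirac]
    rw [Subsingleton.elim (fun i : Fin 0 => _) (0 : Fin 0 → ℝ)]
    simp
  | succ m ih =>
    intro α hα hαW f hf hM ε hε0 hε
    obtain ⟨M, hM⟩ := hM
    have hfin : ∀ i, IsFiniteMeasure (powMeasure (α i)) :=
      fun i => isFiniteMeasure_powMeasure (hα i)
    set ν := Measure.pi fun i : Fin m => powMeasure (α i.succ) with hν
    set R := G (α 0) k with hR
    have hRG : R.IsGauss (α 0) := hG (α 0) (hα 0) k
    have hcons : Continuous fun z : ℝ × (Fin m → ℝ) => f (Fin.cons z.1 z.2) :=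
      hf.comp (continuous_fst.finCons (A := fun _ : Fin (m + 1) => ℝ) continuous_snd)
    have hint : Integrable (fun z : ℝ × (Fin m → ℝ) => f (Fin.cons z.1 z.2))
        ((powMeasure (α 0)).prod ν) :=
      Integrable.of_bound hcons.aestronglyMeasurable M
        (Filter.Eventually.of_forall fun z => hM _)
    have hcont1 : ∀ t : ℝ, Continuous fun η : Fin m → ℝ => f (Fin.cons t η) := fun t =>
      hcons.comp (by fun_prop : Continuous fun η : Fin m → ℝ => (t, η))
    have hint1 : ∀ t : ℝ, Integrable (fun η : Fin m → ℝ => f (Fin.cons t η)) ν := fun t =>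
      Integrable.of_bound (hcont1 t).aestronglyMeasurable M
        (Filter.Eventually.of_forall fun z => hM _)
    rw [integral_pi_cons, integral_prod_symm _ hint, tensorGauss_cons]
    have hW0 : 0 ≤ W := by linarith
    -- the error of the first variable
    have h1 : |(∫ η, ∫ t, f (Fin.cons t η) ∂(powMeasure (α 0)) ∂ν) -
        ∑ i, R.weight i * ∫ η, f (Fin.cons (R.node i) η) ∂ν| ≤ 2 * W * ε * W ^ m := by
      have h2 : ∑ i, R.weight i * ∫ η, f (Fin.cons (R.node i) η) ∂ν =
          ∫ η, ∑ i, R.weight i * f (Fin.cons (R.node i) η) ∂ν := by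
        rw [integral_finsetSum _ fun i _ => (hint1 _).const_mul _]
        refine Finset.sum_congr rfl fun i _ => ?_
        rw [integral_const_mul]
      rw [h2, ← integral_sub hint.integral_prod_right
        (integrable_finsetSum _ fun i _ => (hint1 _).const_mul _)]
      rw [← Real.norm_eq_abs]
      refine (norm_integral_le_of_norm_le_const (μ := ν) (C := 2 * W * ε) ?_).trans ?_
      · filter_upwards [ae_pi_powMeasure_mem fun i : Fin m => α i.succ] with η hη
        have hη' : η ∈ Icc (0 : Fin m → ℝ) 1 := ⟨fun i => (hη i).1.le, fun i => (hη i).2.le⟩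
        obtain ⟨p, hp, hpε⟩ := hε 0 (Fin.cons 0 η) (cons_mem_Icc (by simp) hη')
        have := hRG.error_le (hα 0) (f := fun t => f (Fin.cons t η))
          (hcons.comp (by fun_prop : Continuous fun t : ℝ => (t, η))) hp
          (ε := ε) (fun t ht => by simpa using hpε t ht)
        refine this.trans ?_
        have := hαW 0
        gcongr
      · exact mul_le_mul_of_nonneg_left
          (pi_powMeasure_real_univ_le (fun i => hα i.succ) fun i => hαW i.succ) (by positivity)
    -- the errors of the other variables
    have h3 : |∑ i, R.weight i * ∫ η, f (Fin.cons (R.node i) η) ∂ν -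
        ∑ i, R.weight i * tensorGauss G k (fun i => α i.succ)
          fun η => f (Fin.cons (R.node i) η)| ≤ W * (m * (2 * W ^ m * ε)) := by
      rw [← Finset.sum_sub_distrib]
      refine (Finset.abs_sum_le_sum_abs _ _).trans ?_
      have h4 : ∀ i, |R.weight i * ∫ η, f (Fin.cons (R.node i) η) ∂ν -
          R.weight i * tensorGauss G k (fun i => α i.succ)
            fun η => f (Fin.cons (R.node i) η)| ≤ R.weight i * (m * (2 * W ^ m * ε)) := by
        intro i
        rw [← mul_sub, abs_mul, abs_of_nonneg (hRG.weight_nonneg (hα 0) i)]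
        refine mul_le_mul_of_nonneg_left ?_ (hRG.weight_nonneg (hα 0) i)
        refine ih (fun i => α i.succ) (fun i => hα i.succ) (fun i => hαW i.succ) (hcont1 _)
          ⟨M, fun _ => hM _⟩ hε0 fun j η hη => ?_
        obtain ⟨p, hp, hpε⟩ := hε j.succ (Fin.cons (R.node i) η)
          (cons_mem_Icc (hRG.node_mem i) hη)
        refine ⟨p, hp, fun t ht => ?_⟩
        have := hpε t ht
        rwa [← Fin.cons_update] at this
      refine (Finset.sum_le_sum fun i _ => h4 i).trans ?_
      rw [← Finset.sum_mul]
      have := (hRG.sum_weight_le (hα 0)).trans (hαW 0)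
      gcongr
    refine (abs_sub_le _ _ _).trans ((add_le_add h1 h3).trans (le_of_eq ?_))
    push_cast
    ring

/-- The projection of `ℝ^m` onto the unit cube. -/
def clamp {m : ℕ} (η : Fin m → ℝ) : Fin m → ℝ := fun i => max 0 (min 1 (η i))

theorem continuous_clamp {m : ℕ} : Continuous (clamp (m := m)) := by
  unfold clamp; fun_prop

theorem clamp_mem {m : ℕ} (η : Fin m → ℝ) : clamp η ∈ Icc (0 : Fin m → ℝ) 1 :=
  ⟨fun i => by simp [clamp], fun i => by simp [clamp]⟩

theorem clamp_of_mem {m : ℕ} {η : Fin m → ℝ} (hη : η ∈ Icc (0 : Fin m → ℝ) 1) :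
    clamp η = η := by
  funext i
  have h1 : η i ≤ 1 := hη.2 i
  have h0 : 0 ≤ η i := hη.1 i
  simp [clamp, h1, h0]

theorem update_mem_Icc {m : ℕ} {η : Fin m → ℝ} (hη : η ∈ Icc (0 : Fin m → ℝ) 1) (i : Fin m)
    {t : ℝ} (ht : t ∈ Icc (0 : ℝ) 1) : Function.update η i t ∈ Icc (0 : Fin m → ℝ) 1 := by
  constructor
  · intro j
    by_cases h : j = i
    · subst h; simpa using ht.1
    · simpa [h] using hη.1 j
  · intro j
    by_cases h : j = i
    · subst h; simpa using ht.2
    · simpa [h] using hη.2 j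

theorem tensorGauss_congr {G : ℝ → ∀ k : ℕ, Rule k} (hG : IsGaussFamily G) (k : ℕ) {m : ℕ}
    {α : Fin m → ℝ} (hα : ∀ i, -1 < α i) {f g : (Fin m → ℝ) → ℝ}
    (h : ∀ η ∈ Icc (0 : Fin m → ℝ) 1, f η = g η) : tensorGauss G k α f = tensorGauss G k α g := by
  refine Finset.sum_congr rfl fun j _ => ?_
  rw [h]
  exact ⟨fun i => ((hG _ (hα i) k).node_mem _).1, fun i => ((hG _ (hα i) k).node_mem _).2⟩

theorem ae_pi_powMeasure_mem_Icc {m : ℕ} (α : Fin m → ℝ) :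
    ∀ᵐ η ∂(Measure.pi fun i => powMeasure (α i)), η ∈ Icc (0 : Fin m → ℝ) 1 := by
  filter_upwards [ae_pi_powMeasure_mem α] with η hη
  exact ⟨fun i => (hη i).1.le, fun i => (hη i).2.le⟩

/-- For an integrand that is only continuous on the cube, as quotients with a denominator that
vanishes elsewhere: compose with the projection onto the cube. -/
theorem abs_integral_pi_sub_tensorGauss_le_of_continuousOn {G : ℝ → ∀ k : ℕ, Rule k}
    (hG : IsGaussFamily G) {W : ℝ} (hW1 : 1 ≤ W) (k : ℕ) {m : ℕ} {α : Fin m → ℝ}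
    (hα : ∀ i, -1 < α i) (hαW : ∀ i, 1 / (α i + 1) ≤ W) {f : (Fin m → ℝ) → ℝ}
    (hf : ContinuousOn f (Icc 0 1)) {ε : ℝ} (hε0 : 0 ≤ ε)
    (hε : ∀ i, ∀ η ∈ Icc (0 : Fin m → ℝ) 1, ∃ p : Polynomial ℝ, p.degree < (2 * k : ℕ) ∧
      ∀ t ∈ Icc (0 : ℝ) 1, |f (Function.update η i t) - p.eval t| ≤ ε) :
    |∫ η, f η ∂(Measure.pi fun i => powMeasure (α i)) - tensorGauss G k α f| ≤
      m * (2 * W ^ m * ε) := by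
  have h1 : ∫ η, f η ∂(Measure.pi fun i => powMeasure (α i)) =
      ∫ η, f (clamp η) ∂(Measure.pi fun i => powMeasure (α i)) := by
    refine integral_congr_ae ?_
    filter_upwards [ae_pi_powMeasure_mem_Icc α] with η hη
    rw [clamp_of_mem hη]
  rw [h1, tensorGauss_congr hG k hα (g := fun η => f (clamp η))
    fun η hη => by rw [clamp_of_mem hη]]
  obtain ⟨M, hM⟩ := isCompact_Icc.exists_bound_of_continuousOn hf
  refine abs_integral_pi_sub_tensorGauss_le hG hW1 k α hα hαW
    (hf.comp_continuous continuous_clamp clamp_mem) ⟨M, fun η => hM _ (clamp_mem η)⟩ hε0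
    fun i η hη => ?_
  obtain ⟨p, hp, hpε⟩ := hε i η hη
  refine ⟨p, hp, fun t ht => ?_⟩
  rw [Function.comp_apply, clamp_of_mem (update_mem_Icc hη i ht)]
  exact hpε t ht

theorem integrable_pi_powMeasure {m : ℕ} {α : Fin m → ℝ} (hα : ∀ i, -1 < α i)
    {f : (Fin m → ℝ) → ℝ} (hf : ContinuousOn f (Icc 0 1)) :
    Integrable f (Measure.pi fun i => powMeasure (α i)) := by
  have : ∀ i, IsFiniteMeasure (powMeasure (α i)) := fun i => isFiniteMeasure_powMeasure (hα i)
  obtain ⟨M, hM⟩ := isCompact_Icc.exists_bound_of_continuousOn hf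
  have h : Integrable (fun η => f (clamp η)) (Measure.pi fun i => powMeasure (α i)) :=
    Integrable.of_bound (hf.comp_continuous continuous_clamp clamp_mem).aestronglyMeasurable M
      (Filter.Eventually.of_forall fun η => hM _ (clamp_mem η))
  refine h.congr ?_
  filter_upwards [ae_pi_powMeasure_mem_Icc α] with η hη
  rw [clamp_of_mem hη]

end FracQuad

namespace FracQuad

/-! ### Polynomial approximation of powers of a distance -/

/-- The Taylor polynomials of a function that is holomorphic in a disc converge geometrically. -/
theorem exists_taylor_error_le {f : ℂ → ℂ} {R B : ℝ} (hR : 0 < R)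
    (hf : DifferentiableOn ℂ f (Metric.closedBall 0 R)) (hB : ∀ z, ‖z‖ = R → ‖f z‖ ≤ B) :
    ∃ a : ℕ → ℂ, ∀ z : ℂ, ‖z‖ < R → ∀ N : ℕ,
      ‖f z - ∑ n ∈ Finset.range N, a n * z ^ n‖ ≤ B * (‖z‖ / R) ^ N / (1 - ‖z‖ / R) := by
  lift R to NNReal using hR.le
  have hR' : 0 < R := by exact_mod_cast hR
  have hps := hf.hasFPowerSeriesOnBall hR'
  set p := cauchyPowerSeries f 0 R with hp
  have hcoeff : ∀ n, ‖p.coeff n‖ ≤ B * ((R : ℝ)⁻¹) ^ n := by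
    intro n
    have h1 := norm_cauchyPowerSeries_le f 0 R n
    have h2 : ((2 * Real.pi)⁻¹ * ∫ θ in (0 : ℝ)..2 * Real.pi, ‖f (circleMap 0 R θ)‖) ≤ B := by
      have h3 : ∫ θ in (0 : ℝ)..2 * Real.pi, ‖f (circleMap 0 R θ)‖ ≤ B * |2 * Real.pi - 0| := by
        refine (Real.le_norm_self _).trans ?_
        refine intervalIntegral.norm_integral_le_of_norm_le_const fun θ _ => ?_
        rw [norm_norm]
        exact hB _ (by simp)
      rw [sub_zero, abs_of_pos Real.two_pi_pos] at h3
      calc _ ≤ (2 * Real.pi)⁻¹ * (B * (2 * Real.pi)) :=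
            mul_le_mul_of_nonneg_left h3 (inv_nonneg.2 Real.two_pi_pos.le)
        _ = B := by field_simp
    rw [abs_of_pos hR] at h1
    rw [← FormalMultilinearSeries.norm_apply_eq_norm_coef]
    exact h1.trans (mul_le_mul_of_nonneg_right h2 (by positivity))
  refine ⟨fun n => p.coeff n, fun z hz N => ?_⟩
  have hr0 : 0 ≤ ‖z‖ / R := by positivity
  have hr1 : ‖z‖ / R < 1 := (div_lt_one hR).2 hz
  have hsum : HasSum (fun n => p.coeff n * z ^ n) (f z) := by
    have := hps.hasSum (y := z) (by
      rw [Metric.mem_eball, edist_zero_right, enorm_eq_nnnorm]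
      exact_mod_cast hz)
    rw [zero_add] at this
    simpa [FormalMultilinearSeries.apply_eq_pow_smul_coeff, mul_comm] using this
  have htail := (hasSum_nat_add_iff' N).2 hsum
  rw [← htail.tsum_eq]
  have hgeo : HasSum (fun n => B * (‖z‖ / R) ^ N * (‖z‖ / R) ^ n)
      (B * (‖z‖ / R) ^ N * (1 - ‖z‖ / R)⁻¹) :=
    (hasSum_geometric_of_lt_one hr0 hr1).mul_left _
  rw [div_eq_mul_inv]
  refine tsum_of_norm_bounded hgeo fun n => ?_
  rw [norm_mul, norm_pow]
  calc _ ≤ B * ((R : ℝ)⁻¹) ^ (n + N) * ‖z‖ ^ (n + N) :=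
        mul_le_mul_of_nonneg_right (hcoeff _) (by positivity)
    _ = _ := by rw [div_eq_mul_inv, mul_pow, mul_pow, pow_add, pow_add]; ring

/-- At real points a real number is approximated by the real parts of the coefficients as well as
by the coefficients. -/
theorem abs_sub_sum_re_le {x : ℝ} {y t : ℝ} {a : ℕ → ℂ} {N : ℕ}
    (h : ‖(x : ℂ) - ∑ n ∈ Finset.range N, a n * (t : ℂ) ^ n‖ ≤ y) :
    |x - ∑ n ∈ Finset.range N, (a n).re * t ^ n| ≤ y := by
  have h2 : x - ∑ n ∈ Finset.range N, (a n).re * t ^ n =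
      ((x : ℂ) - ∑ n ∈ Finset.range N, a n * (t : ℂ) ^ n).re := by
    rw [Complex.sub_re, Complex.re_sum, Complex.ofReal_re]
    congr 1
    refine Finset.sum_congr rfl fun n _ => ?_
    rw [← Complex.ofReal_pow, Complex.re_mul_ofReal]
  rw [h2]
  exact (Complex.abs_re_le_norm _).trans h

theorem norm_cpow_neg_le {z : ℂ} {c l : ℝ} (hc : 0 < c) (hl : 0 ≤ l) (hz : c ≤ ‖z‖) :
    ‖z ^ ((-l : ℝ) : ℂ)‖ ≤ c ^ (-l) := by
  rw [Complex.norm_cpow_real]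
  exact Real.rpow_le_rpow_of_nonpos hc hz (by linarith)

theorem one_add_mem_slitPlane {z : ℂ} (hz : ‖z‖ < 1) : 1 + z ∈ Complex.slitPlane := by
  left
  have := (abs_le.1 (Complex.abs_re_le_norm z)).1
  simp only [Complex.add_re, Complex.one_re]
  linarith

/-- The binomial series of `(1 - w) ^ (-l)`. -/
theorem exists_binomial_error_le {l q : ℝ} (hl : 0 ≤ l) (hq0 : 0 < q) (hq1 : q < 1) :
    ∃ B r : ℝ, 0 ≤ B ∧ 0 < r ∧ r < 1 ∧ ∃ a : ℕ → ℝ, ∀ w ∈ Icc (0 : ℝ) q, ∀ N : ℕ,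
      |(1 - w) ^ (-l) - ∑ n ∈ Finset.range N, a n * w ^ n| ≤ B * r ^ N := by
  -- any radius strictly between `q` and `1` would do
  set R := (1 + q) / 2 with hR
  have hR0 : 0 < R := by positivity
  have hqR : q < R := by rw [hR]; linarith
  have hR1 : R < 1 := by rw [hR]; linarith
  have hbd : ∀ z : ℂ, ‖z‖ ≤ R → 1 - R ≤ ‖1 + -z‖ := fun z hz => by
    have := norm_sub_norm_le (1 : ℂ) z
    rw [norm_one] at this
    rw [← sub_eq_add_neg]
    linarith
  obtain ⟨a, ha⟩ := exists_taylor_error_le (f := fun z => (1 + -z) ^ ((-l : ℝ) : ℂ))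
    (B := (1 - R) ^ (-l)) hR0 (by
      intro z hz
      have hz' : ‖-z‖ < 1 := by
        rw [norm_neg]; exact lt_of_le_of_lt (by simpa using hz) hR1
      exact (((differentiableAt_id.neg).const_add 1).cpow_const
        (one_add_mem_slitPlane hz')).differentiableWithinAt)
    (fun z hz => norm_cpow_neg_le (by linarith) hl (hbd z hz.le))
  have hr1 : q / R < 1 := (div_lt_one hR0).2 hqR
  refine ⟨(1 - R) ^ (-l) / (1 - q / R), q / R, ?_, by positivity, hr1, fun n => (a n).re,
    fun w hw N => ?_⟩
  · exact div_nonneg (Real.rpow_nonneg (by linarith) _) (by linarith)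
  · have hwn : ‖(w : ℂ)‖ = w := by rw [Complex.norm_real, Real.norm_of_nonneg hw.1]
    have h1 := ha w (by rw [hwn]; linarith [hw.2]) N
    have h2 : (1 + -(w : ℂ)) ^ ((-l : ℝ) : ℂ) = (((1 - w) ^ (-l) : ℝ) : ℂ) := by
      rw [Complex.ofReal_cpow (by linarith [hw.2])]
      push_cast
      ring_nf
    rw [h2, hwn] at h1
    refine (abs_sub_sum_re_le h1).trans ?_
    have hwq : w / R ≤ q / R := by have := hw.2; gcongr
    have h0 : 0 ≤ w / R := div_nonneg hw.1 hR0.le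
    have h3 : 0 ≤ (1 - R) ^ (-l) := Real.rpow_nonneg (by linarith) _
    rw [div_mul_eq_mul_div]
    have h4 : 0 < 1 - q / R := by linarith
    gcongr

/-- The Taylor expansion at `t = 0` of `‖1 + t b‖ ^ (-2 l)`, which is the product of the
holomorphic functions `(1 + t b) ^ (-l)` and `(1 + t \bar b) ^ (-l)`. -/
theorem exists_dist_taylor_error_le {l : ℝ} (hl : 0 ≤ l) {b : ℂ} (hb : ‖b‖ ≤ 3 / 2) :
    ∃ a : ℕ → ℝ, ∀ t ∈ Icc (-(1 / 2) : ℝ) (1 / 2), ∀ N : ℕ,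
      |‖1 + (t : ℂ) * b‖ ^ (-(2 * l)) - ∑ n ∈ Finset.range N, a n * t ^ n| ≤
        16 * (1 / 5 : ℝ) ^ (-(2 * l)) * (5 / 8 * ‖b‖) ^ N := by
  have h15 : (1 : ℝ) ≤ (1 / 5 : ℝ) ^ (-(2 * l)) :=
    Real.one_le_rpow_of_pos_of_le_one_of_nonpos (by norm_num) (by norm_num) (by linarith)
  rcases eq_or_ne b 0 with rfl | hb0
  · refine ⟨fun n => if n = 0 then 1 else 0, fun t _ N => ?_⟩
    rcases N with - | N
    · simp only [mul_zero, add_zero, norm_one, Real.one_rpow, Finset.range_zero,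
        Finset.sum_empty, sub_zero, abs_one, pow_zero, mul_one]
      linarith
    · simp
  have hbpos : 0 < ‖b‖ := norm_pos_iff.2 hb0
  -- in the disc of this radius both factors have base of absolute value at least `1 / 5`, and the
  -- radius exceeds `1 / 2` since `‖b‖ ≤ 3 / 2`
  set R := 4 / 5 / ‖b‖ with hR
  have hR0 : 0 < R := by positivity
  have hRb : R * ‖b‖ = 4 / 5 := by rw [hR]; field_simp
  have hlt : ∀ {z c : ℂ}, ‖z‖ ≤ R → ‖c‖ = ‖b‖ → ‖z * c‖ ≤ 4 / 5 := fun {z c} hz hc => by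
    rw [norm_mul, hc, ← hRb]
    gcongr
  have hlow : ∀ {z c : ℂ}, ‖z‖ ≤ R → ‖c‖ = ‖b‖ → 1 / 5 ≤ ‖1 + z * c‖ := fun {z c} hz hc => by
    have h1 := norm_sub_norm_le (1 : ℂ) (-(z * c))
    have h2 := hlt hz hc
    rw [norm_one, norm_neg, sub_neg_eq_add] at h1
    linarith
  have hstar : ‖(starRingEnd ℂ) b‖ = ‖b‖ := RCLike.norm_conj b
  obtain ⟨a, ha⟩ := exists_taylor_error_le
    (f := fun z => (1 + z * b) ^ ((-l : ℝ) : ℂ) * (1 + z * (starRingEnd ℂ) b) ^ ((-l : ℝ) : ℂ))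
    (B := (1 / 5 : ℝ) ^ (-(2 * l))) hR0 (by
      intro z hz
      have hz' : ‖z‖ ≤ R := by simpa using hz
      refine (DifferentiableAt.mul ?_ ?_).differentiableWithinAt
      · exact ((differentiableAt_id.mul_const b).const_add 1).cpow_const
          (one_add_mem_slitPlane ((hlt hz' rfl).trans_lt (by norm_num)))
      · exact ((differentiableAt_id.mul_const _).const_add 1).cpow_const
          (one_add_mem_slitPlane ((hlt hz' hstar).trans_lt (by norm_num))))
    (fun z hz => by
      rw [norm_mul]
      have h1 := norm_cpow_neg_le (by norm_num) hl (hlow hz.le (c := b) rfl)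
      have h2 := norm_cpow_neg_le (by norm_num) hl (hlow hz.le hstar)
      have h3 : (1 / 5 : ℝ) ^ (-(2 * l)) = (1 / 5 : ℝ) ^ (-l) * (1 / 5 : ℝ) ^ (-l) := by
        rw [← Real.rpow_add (by norm_num)]; ring_nf
      rw [h3]
      gcongr)
  refine ⟨fun n => (a n).re, fun t ht N => ?_⟩
  have htn : ‖(t : ℂ)‖ ≤ 1 / 2 := by
    rw [Complex.norm_real]; exact abs_le.2 ⟨by linarith [ht.1], ht.2⟩
  have hdiv : ‖(t : ℂ)‖ / R ≤ 5 / 8 * ‖b‖ := by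
    rw [div_le_iff₀ hR0]
    nlinarith
  have htR : ‖(t : ℂ)‖ < R := by
    have : ‖(t : ℂ)‖ / R < 1 := by linarith
    exact (div_lt_one hR0).1 this
  have h1 := ha t htR N
  -- at a real point the two factors are conjugate, so that their product is a power of the norm
  have h2 : (1 + (t : ℂ) * b) ^ ((-l : ℝ) : ℂ) * (1 + (t : ℂ) * (starRingEnd ℂ) b) ^ ((-l : ℝ) : ℂ)
      = ((‖1 + (t : ℂ) * b‖ ^ (-(2 * l)) : ℝ) : ℂ) := by
    have hsl := one_add_mem_slitPlane ((hlt htR.le (c := b) rfl).trans_lt (by norm_num))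
    have h3 : 1 + (t : ℂ) * (starRingEnd ℂ) b = (starRingEnd ℂ) (1 + (t : ℂ) * b) := by
      simp
    have h4 : (starRingEnd ℂ) ((-l : ℝ) : ℂ) = ((-l : ℝ) : ℂ) := Complex.conj_ofReal _
    rw [h3, ← h4, Complex.conj_cpow _ _ (Complex.slitPlane_arg_ne_pi hsl), h4, h4,
      Complex.mul_conj, Complex.normSq_eq_norm_sq, Complex.norm_cpow_real, ← Real.rpow_natCast,
      ← Real.rpow_mul (norm_nonneg _)]
    congr 2
    push_cast
    ring
  rw [h2] at h1
  refine (abs_sub_sum_re_le h1).trans ?_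
  have h5 : (1 : ℝ) / 16 ≤ 1 - ‖(t : ℂ)‖ / R := by linarith
  have h6 : 0 ≤ ‖(t : ℂ)‖ / R := by positivity
  rw [div_le_iff₀ (by linarith)]
  have h7 : (‖(t : ℂ)‖ / R) ^ N ≤ (5 / 8 * ‖b‖) ^ N := by gcongr
  have h8 : 0 ≤ (5 / 8 * ‖b‖) ^ N := by positivity
  have h9 : (1 / 5 : ℝ) ^ (-(2 * l)) * (‖(t : ℂ)‖ / R) ^ N ≤
      (1 / 5 : ℝ) ^ (-(2 * l)) * (5 / 8 * ‖b‖) ^ N := by gcongr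
  have h10 : 0 ≤ (1 / 5 : ℝ) ^ (-(2 * l)) * (5 / 8 * ‖b‖) ^ N := by positivity
  nlinarith

theorem zpow_neg_two_mul (x : ℝ) (k : ℕ) : x ^ (-2 * (k : ℤ)) = (x ^ (2 * k))⁻¹ := by
  rw [neg_mul, zpow_neg]
  norm_cast

/-- The polynomial `∑ n < N, a n * w ^ n`, with factor `q`. -/
theorem degree_mul_sum_lt {q w : Polynomial ℝ} {D e N m : ℕ} (hq : q.natDegree ≤ D)
    (hw : w.natDegree ≤ e) (h : N ≠ 0 → D + e * (N - 1) < m) (a : ℕ → ℝ) :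
    (q * ∑ n ∈ Finset.range N, Polynomial.C (a n) * w ^ n).degree < (m : ℕ) := by
  rcases Nat.eq_zero_or_pos N with rfl | hN
  · simp
  · refine lt_of_le_of_lt (Polynomial.degree_le_natDegree) ?_
    have h1 : (∑ n ∈ Finset.range N, Polynomial.C (a n) * w ^ n).natDegree ≤ e * (N - 1) := by
      refine Polynomial.natDegree_sum_le_of_forall_le _ _ fun n hn => ?_
      refine (Polynomial.natDegree_C_mul_le _ _).trans ((Polynomial.natDegree_pow_le).trans ?_)
      have := Finset.mem_range.1 hn
      calc n * w.natDegree ≤ (N - 1) * e := Nat.mul_le_mul (by omega) hw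
        _ = e * (N - 1) := mul_comm _ _
    have h2 := Polynomial.natDegree_mul_le (p := q)
      (q := ∑ n ∈ Finset.range N, Polynomial.C (a n) * w ^ n)
    have h3 := h (by omega)
    exact_mod_cast (by omega : _ < m)

/-- If a line segment keeps a distance between `c` and `κ c` from the origin, then
`q(t) / ‖a + t b‖ ^ (2 + 2 s)` is approximated by polynomials at a rate that depends on `κ` only:
insert the quadratic polynomial `1 - ‖a + t b‖² / (κ c)²` into the binomial series. -/
theorem exists_poly_near (s : ℝ) (hs : 0 < s) {κ : ℝ} (hκ : 1 < κ) :
    ∃ B ρ : ℝ, 0 ≤ B ∧ 1 < ρ ∧ ∀ (a b : Plane) (c : ℝ), 0 < c →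
      (∀ t ∈ Icc (0 : ℝ) 1, c ≤ ‖a + t • b‖ ∧ ‖a + t • b‖ ≤ κ * c) →
      ∀ (q : Polynomial ℝ) (A : ℝ), q.natDegree ≤ 4 → (∀ t ∈ Icc (0 : ℝ) 1, |q.eval t| ≤ A) →
      ∀ k : ℕ, ∃ p : Polynomial ℝ, p.degree < (2 * k : ℕ) ∧ ∀ t ∈ Icc (0 : ℝ) 1,
        |q.eval t / ‖a + t • b‖ ^ (2 + 2 * s) - p.eval t| ≤
          B * A * c ^ (-(2 + 2 * s)) * ρ ^ (-2 * (k : ℤ)) := by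
  have hκ0 : 0 < κ := by linarith
  have hκ2 : 1 < κ ^ 2 := by nlinarith
  obtain ⟨B, r, hB, hr0, hr1, coef, hcoef⟩ := exists_binomial_error_le (l := 1 + s)
    (q := 1 - (κ ^ 2)⁻¹) (by linarith) (sub_pos.2 (inv_lt_one_of_one_lt₀ hκ2))
    (sub_lt_self _ (by positivity))
  have hsq0 : 0 < √r := Real.sqrt_pos.2 hr0
  have hsq1 : √r < 1 := by rw [Real.sqrt_lt' one_pos]; simpa using hr1
  refine ⟨B * (r ^ 2)⁻¹, (√r)⁻¹, by positivity, one_lt_inv_iff₀.2 ⟨hsq0, hsq1⟩,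
    fun a b c hc hab q A hq hA k => ?_⟩
  set M := (κ * c) ^ 2 with hM
  have hM0 : 0 < M := by positivity
  set w : Polynomial ℝ := 1 - Polynomial.C M⁻¹ * (Polynomial.C (‖a‖ ^ 2) +
    Polynomial.C (2 * inner ℝ a b) * Polynomial.X + Polynomial.C (‖b‖ ^ 2) * Polynomial.X ^ 2)
    with hw
  have hwdeg : w.natDegree ≤ 2 := by rw [hw]; compute_degree
  have hweval : ∀ t, w.eval t = 1 - ‖a + t • b‖ ^ 2 / M := fun t => by
    rw [hw, norm_add_sq_real, norm_smul, inner_smul_right, mul_pow, Real.norm_eq_abs, sq_abs]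
    simp only [Polynomial.eval_sub, Polynomial.eval_one, Polynomial.eval_mul, Polynomial.eval_C,
      Polynomial.eval_add, Polynomial.eval_X, Polynomial.eval_pow]
    ring
  -- the degree is at most `4 + 2 (N - 1) < 2 k`; for `k ≤ 2` the polynomial is zero
  set N := k - 2 with hN
  refine ⟨Polynomial.C (M ^ (-(1 + s))) * q *
    ∑ n ∈ Finset.range N, Polynomial.C (coef n) * w ^ n, ?_, fun t ht => ?_⟩
  · refine degree_mul_sum_lt ((Polynomial.natDegree_C_mul_le _ _).trans hq) hwdeg ?_ coef
    omega
  · obtain ⟨h1, h2⟩ := hab t ht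
    have hz : 0 < ‖a + t • b‖ := hc.trans_le h1
    have hwt : w.eval t ∈ Icc (0 : ℝ) (1 - (κ ^ 2)⁻¹) := by
      rw [hweval, hM]
      constructor
      · rw [sub_nonneg]
        exact div_le_one_of_le₀ (by gcongr) (by positivity)
      · refine sub_le_sub_left ?_ _
        rw [inv_eq_one_div, div_le_div_iff₀ (by positivity) (by positivity), one_mul, mul_pow,
          mul_comm]
        gcongr
    have hkey := hcoef _ hwt N
    have h3 : (‖a + t • b‖ ^ (2 + 2 * s))⁻¹ =
        M ^ (-(1 + s)) * (1 - w.eval t) ^ (-(1 + s)) := by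
      rw [← Real.mul_rpow hM0.le (by linarith [hwt.2, inv_pos.2 (by positivity : 0 < κ ^ 2)]),
        hweval, ← Real.rpow_neg hz.le]
      have : M * (1 - (1 - ‖a + t • b‖ ^ 2 / M)) = ‖a + t • b‖ ^ (2 : ℝ) := by
        rw [Real.rpow_two]; field_simp; ring
      rw [this, ← Real.rpow_mul hz.le]
      congr 1
      ring
    have h4 : M ^ (-(1 + s)) ≤ c ^ (-(2 + 2 * s)) := by
      have : M ^ (-(1 + s)) = (κ * c) ^ (-(2 + 2 * s)) := by
        rw [hM, ← Real.rpow_two, ← Real.rpow_mul (by positivity)]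
        congr 1; ring
      rw [this]
      refine Real.rpow_le_rpow_of_nonpos hc ?_ (by linarith)
      nlinarith
    have h5 : r ^ N ≤ (r ^ 2)⁻¹ * (√r)⁻¹ ^ (-2 * (k : ℤ)) := by
      rw [zpow_neg_two_mul, inv_pow, inv_inv, pow_mul, Real.sq_sqrt hr0.le,
        ← div_eq_inv_mul, le_div_iff₀ (by positivity), ← pow_add]
      exact pow_le_pow_of_le_one hr0.le hr1.le (by omega)
    rw [Polynomial.eval_mul, Polynomial.eval_mul, Polynomial.eval_C, Polynomial.eval_finsetSum,
      div_eq_mul_inv, h3]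
    simp only [Polynomial.eval_mul, Polynomial.eval_C, Polynomial.eval_pow]
    have h6 : q.eval t * (M ^ (-(1 + s)) * (1 - w.eval t) ^ (-(1 + s))) -
        M ^ (-(1 + s)) * q.eval t * ∑ n ∈ Finset.range N, coef n * (w.eval t) ^ n =
        q.eval t * (M ^ (-(1 + s)) * ((1 - w.eval t) ^ (-(1 + s)) -
          ∑ n ∈ Finset.range N, coef n * (w.eval t) ^ n)) := by ring
    have hMp : 0 ≤ M ^ (-(1 + s)) := Real.rpow_nonneg hM0.le _
    have hA0 : 0 ≤ A := (abs_nonneg _).trans (hA t ht)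
    have hcp : 0 ≤ c ^ (-(2 + 2 * s)) := Real.rpow_nonneg hc.le _
    rw [h6, abs_mul, abs_mul, abs_of_nonneg hMp]
    calc _ ≤ A * (c ^ (-(2 + 2 * s)) * (B * ((r ^ 2)⁻¹ * (√r)⁻¹ ^ (-2 * (k : ℤ))))) := by
          refine mul_le_mul (hA t ht) ?_ (by positivity) hA0
          refine mul_le_mul h4 (hkey.trans ?_) (abs_nonneg _) hcp
          gcongr
      _ = _ := by ring

/-- If the segment `a + t b`, of length at most `h`, keeps a distance `d` from the origin, then
the Taylor polynomials at the midpoint approximate `q(t) / ‖a + t b‖ ^ (2 + 2 s)` with an error of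
the order `(ρ d / h) ^ (-2 k)`. If `d ≤ 2 h / 3`, then this factor is at least `1` and nothing has
to be approximated. -/
theorem exists_poly_far (s : ℝ) (hs : 0 < s) (D : ℕ) :
    ∃ B : ℝ, 0 ≤ B ∧ ∀ ρ : ℝ, 1 < ρ → ρ ≤ 3 / 2 → ∀ (a b : Plane) (d h : ℝ), 0 < d → 0 < h →
      ‖b‖ ≤ h → (∀ t ∈ Icc (0 : ℝ) 1, d ≤ ‖a + t • b‖) →
      ∀ (q : Polynomial ℝ) (A : ℝ), q.natDegree ≤ D → (∀ t ∈ Icc (0 : ℝ) 1, |q.eval t| ≤ A) →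
      ∀ k : ℕ, ∃ p : Polynomial ℝ, p.degree < (2 * k : ℕ) ∧ ∀ t ∈ Icc (0 : ℝ) 1,
        |q.eval t / ‖a + t • b‖ ^ (2 + 2 * s) - p.eval t| ≤
          B * A * d ^ (-(2 + 2 * s)) * (1 + d / h) ^ D * (ρ * (d / h)) ^ (-2 * (k : ℤ)) := by
  have h15 : (1 : ℝ) ≤ (1 / 5 : ℝ) ^ (-(2 * (1 + s))) :=
    Real.one_le_rpow_of_pos_of_le_one_of_nonpos (by norm_num) (by norm_num) (by linarith)
  set B := 16 * (1 / 5 : ℝ) ^ (-(2 * (1 + s))) * (8 / 5) ^ D with hB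
  have hB1 : 1 ≤ B := by
    have : (1 : ℝ) ≤ (8 / 5) ^ D := one_le_pow₀ (by norm_num)
    rw [hB]
    nlinarith
  refine ⟨B, by linarith, fun ρ hρ1 hρ2 a b d h hd hh hb hab q A hq hA k => ?_⟩
  have hA0 : 0 ≤ A := (abs_nonneg _).trans (hA 0 (by simp))
  have hdp : 0 ≤ d ^ (-(2 + 2 * s)) := Real.rpow_nonneg hd.le _
  have hdh : 0 < d / h := by positivity
  have hpow : (1 : ℝ) ≤ (1 + d / h) ^ D := one_le_pow₀ (by linarith)
  rcases le_or_gt (d / h) (2 / 3) with hcase | hcase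
  · refine ⟨0, by rw [Polynomial.degree_zero]; exact WithBot.bot_lt_coe _, fun t ht => ?_⟩
    rw [Polynomial.eval_zero, sub_zero, div_eq_mul_inv, abs_mul,
      abs_of_nonneg (inv_nonneg.2 (Real.rpow_nonneg (norm_nonneg _) _)),
      ← Real.rpow_neg (norm_nonneg _)]
    have h1 : ‖a + t • b‖ ^ (-(2 + 2 * s)) ≤ d ^ (-(2 + 2 * s)) :=
      Real.rpow_le_rpow_of_nonpos hd (hab t ht) (by linarith)
    have h2 : 1 ≤ (ρ * (d / h)) ^ (-2 * (k : ℤ)) := by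
      rw [zpow_neg_two_mul]
      have hr : ρ * (d / h) ≤ 1 := by nlinarith
      exact (one_le_inv₀ (by positivity)).2 (pow_le_one₀ (by positivity) hr)
    calc _ ≤ A * d ^ (-(2 + 2 * s)) :=
          mul_le_mul (hA t ht) h1 (Real.rpow_nonneg (norm_nonneg _) _) hA0
      _ = 1 * A * d ^ (-(2 + 2 * s)) * 1 * 1 := by ring
      _ ≤ _ := by gcongr
  · -- in the complex plane `a + t b` is the midpoint times `1 + (t - 1 / 2) β`
    set e := Complex.orthonormalBasisOneI.repr.symm with he
    set m := a + (1 / 2 : ℝ) • b with hm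
    have hmd : d ≤ ‖m‖ := hab (1 / 2) (by norm_num)
    have hm0 : 0 < ‖m‖ := hd.trans_le hmd
    have hem : e m ≠ 0 := by
      rw [← norm_pos_iff, LinearIsometryEquiv.norm_map]; exact hm0
    set β := e b / e m with hβ
    have hβn : ‖β‖ ≤ h / d := by
      rw [hβ, norm_div, LinearIsometryEquiv.norm_map, LinearIsometryEquiv.norm_map]
      gcongr
    have hβ32 : ‖β‖ ≤ 3 / 2 := by
      refine hβn.trans ?_
      rw [lt_div_iff₀ hh] at hcase
      rw [div_le_iff₀ hd]
      linarith
    have hnorm : ∀ t : ℝ, ‖a + t • b‖ = ‖m‖ * ‖1 + ((t - 1 / 2 : ℝ) : ℂ) * β‖ := fun t => by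
      have h1 : a + t • b = m + (t - 1 / 2) • b := by rw [hm]; module
      rw [h1, ← LinearIsometryEquiv.norm_map e, ← LinearIsometryEquiv.norm_map e m, ← norm_mul]
      congr 1
      rw [map_add, map_smul, hβ, Complex.real_smul]
      field_simp
    obtain ⟨coef, hcoef⟩ := exists_dist_taylor_error_le (l := 1 + s) (by linarith) hβ32
    -- the degree is at most `D + N - 1 < 2 k`; the factor `(1 + d / h) ^ D` makes up for the loss
    -- of `D` powers
    set N := 2 * k - D with hN
    refine ⟨Polynomial.C (‖m‖ ^ (-(2 * (1 + s)))) * q *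
      ∑ n ∈ Finset.range N, Polynomial.C (coef n) * (Polynomial.X - Polynomial.C (1 / 2)) ^ n,
      ?_, fun t ht => ?_⟩
    · refine degree_mul_sum_lt ((Polynomial.natDegree_C_mul_le _ _).trans hq)
        (Polynomial.natDegree_X_sub_C_le _) ?_ coef
      omega
    · have hkey := hcoef (t - 1 / 2) ⟨by linarith [ht.1], by linarith [ht.2]⟩ N
      set y := ‖1 + ((t - 1 / 2 : ℝ) : ℂ) * β‖ with hy
      have h3 : (‖a + t • b‖ ^ (2 + 2 * s))⁻¹ =
          ‖m‖ ^ (-(2 * (1 + s))) * y ^ (-(2 * (1 + s))) := by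
        rw [hnorm, ← Real.rpow_neg (by positivity), ← Real.mul_rpow (norm_nonneg _) (norm_nonneg _)]
        congr 1
        ring
      rw [Polynomial.eval_mul, Polynomial.eval_mul, Polynomial.eval_C, Polynomial.eval_finsetSum,
        div_eq_mul_inv, h3]
      simp only [Polynomial.eval_mul, Polynomial.eval_C, Polynomial.eval_pow,
        Polynomial.eval_sub, Polynomial.eval_X]
      have h6 : q.eval t * (‖m‖ ^ (-(2 * (1 + s))) * y ^ (-(2 * (1 + s)))) -
          ‖m‖ ^ (-(2 * (1 + s))) * q.eval t * ∑ n ∈ Finset.range N, coef n * (t - 1 / 2) ^ n =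
          q.eval t * (‖m‖ ^ (-(2 * (1 + s))) * (y ^ (-(2 * (1 + s))) -
            ∑ n ∈ Finset.range N, coef n * (t - 1 / 2) ^ n)) := by ring
      have hMp : 0 ≤ ‖m‖ ^ (-(2 * (1 + s))) := Real.rpow_nonneg hm0.le _
      have h4 : ‖m‖ ^ (-(2 * (1 + s))) ≤ d ^ (-(2 + 2 * s)) := by
        rw [show -(2 * (1 + s)) = -(2 + 2 * s) by ring]
        exact Real.rpow_le_rpow_of_nonpos hd hmd (by linarith)
      set r := 8 / 5 * (d / h) with hr
      have hr1 : 1 ≤ r := by rw [hr]; linarith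
      have h7 : (5 / 8 * ‖β‖) ^ N ≤ (8 / 5) ^ D * (1 + d / h) ^ D *
          (ρ * (d / h)) ^ (-2 * (k : ℤ)) := by
        have h8 : 5 / 8 * ‖β‖ ≤ r⁻¹ := by
          rw [hr, mul_inv, inv_div, inv_div]
          gcongr
        calc (5 / 8 * ‖β‖) ^ N ≤ (r⁻¹) ^ N := by gcongr
          _ ≤ r ^ D * (r ^ (2 * k))⁻¹ := by
              rw [inv_pow, ← div_eq_mul_inv, le_div_iff₀ (by positivity), inv_mul_le_iff₀
                (by positivity), ← pow_add]
              exact pow_le_pow_right₀ hr1 (by omega)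
          _ ≤ (8 / 5 * (1 + d / h)) ^ D * (ρ * (d / h)) ^ (-2 * (k : ℤ)) := by
              rw [zpow_neg_two_mul]
              have : r ≤ 8 / 5 * (1 + d / h) := by rw [hr]; linarith
              have : ρ * (d / h) ≤ r := by rw [hr]; nlinarith
              have : 0 < ρ * (d / h) := by positivity
              gcongr
          _ = _ := by rw [mul_pow]
      rw [h6, abs_mul, abs_mul, abs_of_nonneg hMp]
      calc _ ≤ A * (d ^ (-(2 + 2 * s)) * (16 * (1 / 5 : ℝ) ^ (-(2 * (1 + s))) *
            ((8 / 5) ^ D * (1 + d / h) ^ D * (ρ * (d / h)) ^ (-2 * (k : ℤ))))) := by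
            refine mul_le_mul (hA t ht) ?_ (by positivity) hA0
            refine mul_le_mul h4 (hkey.trans ?_) (abs_nonneg _) hdp
            gcongr
        _ = _ := by rw [hB]; ring

end FracQuad

namespace FracQuad

/-! ### Tensor quadrature of quotients of multi-affine functions -/

/-- A function on `ℝ^m` that is affine in each variable separately. -/
def MultiAffine {m : ℕ} {E : Type*} [AddCommGroup E] [Module ℝ E] (f : (Fin m → ℝ) → E) : Prop :=
  ∀ (η : Fin m → ℝ) (i : Fin m) (t : ℝ), f (Function.update η i t) =
    f (Function.update η i 0) + t • (f (Function.update η i 1) - f (Function.update η i 0))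

theorem MultiAffine.mul_const {m : ℕ} {f : (Fin m → ℝ) → ℝ} (hf : MultiAffine f) (a : ℝ) :
    MultiAffine fun η => f η * a := fun η i t => by
  simp only [hf η i t, smul_eq_mul]; ring

theorem MultiAffine.smul_const {m : ℕ} {E : Type*} [AddCommGroup E] [Module ℝ E]
    {f : (Fin m → ℝ) → ℝ} (hf : MultiAffine f) (a : E) : MultiAffine fun η => f η • a :=
  fun η i t => by
    simp only [hf η i t, smul_eq_mul]; module

theorem MultiAffine.sum {m : ℕ} {E : Type*} [AddCommGroup E] [Module ℝ E] {ι : Type*}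
    {S : Finset ι} {f : ι → (Fin m → ℝ) → E} (hf : ∀ j ∈ S, MultiAffine (f j)) :
    MultiAffine fun η => ∑ j ∈ S, f j η := fun η i t => by
  rw [← Finset.sum_sub_distrib, Finset.smul_sum, ← Finset.sum_add_distrib]
  exact Finset.sum_congr rfl fun j hj => hf j hj η i t

theorem MultiAffine.inner_left {m : ℕ} {f : (Fin m → ℝ) → Plane} (hf : MultiAffine f)
    (n : Plane) : MultiAffine fun η => inner ℝ n (f η) := fun η i t => by
  simp only [hf η i t, inner_add_right, inner_smul_right, inner_sub_right, smul_eq_mul]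

theorem MultiAffine.const {m : ℕ} {E : Type*} [AddCommGroup E] [Module ℝ E] (a : E) :
    MultiAffine fun _ : Fin m → ℝ => a := fun η i t => by simp

/-- The restriction of a product of multi-affine functions to a line in a coordinate direction
is a polynomial. -/
theorem exists_poly_of_multiAffine {m D : ℕ} {P : Fin D → (Fin m → ℝ) → ℝ}
    (hP : ∀ j, MultiAffine (P j)) (η : Fin m → ℝ) (i : Fin m) :
    ∃ q : Polynomial ℝ, q.natDegree ≤ D ∧
      ∀ t, q.eval t = ∏ j, P j (Function.update η i t) := by
  refine ⟨∏ j, (Polynomial.C (P j (Function.update η i 0)) +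
    Polynomial.X * Polynomial.C (P j (Function.update η i 1) - P j (Function.update η i 0))),
    ?_, fun t => ?_⟩
  · refine (Polynomial.natDegree_prod_le _ _).trans ?_
    calc _ ≤ ∑ _j : Fin D, 1 := Finset.sum_le_sum fun j _ => by compute_degree
      _ = D := by simp
  · rw [Polynomial.eval_prod]
    refine Finset.prod_congr rfl fun j _ => ?_
    rw [hP j η i t]
    simp

theorem continuousOn_quotient {m : ℕ} {s : ℝ} {P : (Fin m → ℝ) → ℝ} {Z : (Fin m → ℝ) → Plane}
    (hP : Continuous P) (hZ : Continuous Z)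
    (h0 : ∀ η ∈ Icc (0 : Fin m → ℝ) 1, Z η ≠ 0) :
    ContinuousOn (fun η => P η / ‖Z η‖ ^ (2 + 2 * s)) (Icc 0 1) := by
  refine hP.continuousOn.div ?_ fun η hη => ?_
  · exact hZ.norm.continuousOn.rpow_const fun η hη => Or.inl (norm_ne_zero_iff.2 (h0 η hη))
  · exact (Real.rpow_pos_of_pos (norm_pos_iff.2 (h0 η hη)) _).ne'

/-- Quadrature error for an integrand whose denominator varies in a fixed ratio. -/
theorem exists_tensorGauss_error_near (s : ℝ) (hs : 0 < s) {κ : ℝ} (hκ : 1 < κ) :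
    ∃ B ρ : ℝ, 0 ≤ B ∧ 1 < ρ ∧ ∀ {G : ℝ → ∀ k : ℕ, Rule k}, IsGaussFamily G →
      ∀ {W : ℝ}, 1 ≤ W → ∀ {m : ℕ} {α : Fin m → ℝ}, (∀ i, -1 < α i) → (∀ i, 1 / (α i + 1) ≤ W) →
      ∀ {P : Fin 4 → (Fin m → ℝ) → ℝ} {Z : (Fin m → ℝ) → Plane}, (∀ j, MultiAffine (P j)) →
      (∀ j, Continuous (P j)) → MultiAffine Z → Continuous Z → ∀ {c A : ℝ}, 0 < c →
      (∀ η ∈ Icc (0 : Fin m → ℝ) 1, c ≤ ‖Z η‖ ∧ ‖Z η‖ ≤ κ * c) →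
      (∀ η ∈ Icc (0 : Fin m → ℝ) 1, |∏ j, P j η| ≤ A) → ∀ k : ℕ,
      |∫ η, (∏ j, P j η) / ‖Z η‖ ^ (2 + 2 * s) ∂(Measure.pi fun i => powMeasure (α i)) -
        tensorGauss G k α fun η => (∏ j, P j η) / ‖Z η‖ ^ (2 + 2 * s)| ≤
          m * (2 * W ^ m * (B * A * c ^ (-(2 + 2 * s)) * ρ ^ (-2 * (k : ℤ)))) := by
  obtain ⟨B, ρ, hB, hρ, h⟩ := exists_poly_near s hs hκ
  refine ⟨B, ρ, hB, hρ, fun {G} hG {W} hW {m α} hα hαW {P Z} hP hPc hZ hZc {c A} hc hZb hA k => ?_⟩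
  have hA0 : 0 ≤ A := (abs_nonneg _).trans (hA 0 (by simp))
  refine abs_integral_pi_sub_tensorGauss_le_of_continuousOn hG hW k hα hαW
    (continuousOn_quotient (continuous_finsetProd _ fun j _ => hPc j) hZc fun η hη h0 => ?_)
    (by have := Real.rpow_nonneg hc.le (-(2 + 2 * s)); positivity) fun i η hη => ?_
  · have := (hZb η hη).1
    rw [h0, norm_zero] at this
    linarith
  · obtain ⟨q, hq, hqe⟩ := exists_poly_of_multiAffine hP η i
    obtain ⟨p, hp, hpe⟩ := h (Z (Function.update η i 0))
      (Z (Function.update η i 1) - Z (Function.update η i 0)) c hc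
      (fun t ht => by rw [← hZ η i t]; exact hZb _ (update_mem_Icc hη i ht)) q A hq
      (fun t ht => by rw [hqe]; exact hA _ (update_mem_Icc hη i ht)) k
    refine ⟨p, hp, fun t ht => ?_⟩
    have := hpe t ht
    rwa [← hZ η i t, hqe] at this

/-- Quadrature error for an integrand whose denominator stays away from zero, while `Z` varies by
at most `h` in each variable. -/
theorem exists_tensorGauss_error_far (s : ℝ) (hs : 0 < s) (D : ℕ) :
    ∃ B : ℝ, 0 ≤ B ∧ ∀ {ρ : ℝ}, 1 < ρ → ρ ≤ 3 / 2 → ∀ {G : ℝ → ∀ k : ℕ, Rule k},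
      IsGaussFamily G →
      ∀ {W : ℝ}, 1 ≤ W → ∀ {m : ℕ} {α : Fin m → ℝ}, (∀ i, -1 < α i) → (∀ i, 1 / (α i + 1) ≤ W) →
      ∀ {P : Fin D → (Fin m → ℝ) → ℝ} {Z : (Fin m → ℝ) → Plane}, (∀ j, MultiAffine (P j)) →
      (∀ j, Continuous (P j)) → MultiAffine Z → Continuous Z → ∀ {d h A : ℝ}, 0 < d → 0 < h →
      (∀ η ∈ Icc (0 : Fin m → ℝ) 1, d ≤ ‖Z η‖) →
      (∀ η ∈ Icc (0 : Fin m → ℝ) 1, ∀ i,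
        ‖Z (Function.update η i 1) - Z (Function.update η i 0)‖ ≤ h) →
      (∀ η ∈ Icc (0 : Fin m → ℝ) 1, |∏ j, P j η| ≤ A) → ∀ k : ℕ,
      |∫ η, (∏ j, P j η) / ‖Z η‖ ^ (2 + 2 * s) ∂(Measure.pi fun i => powMeasure (α i)) -
        tensorGauss G k α fun η => (∏ j, P j η) / ‖Z η‖ ^ (2 + 2 * s)| ≤
          m * (2 * W ^ m * (B * A * d ^ (-(2 + 2 * s)) * (1 + d / h) ^ D *
            (ρ * (d / h)) ^ (-2 * (k : ℤ)))) := by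
  obtain ⟨B, hB, hh⟩ := exists_poly_far s hs D
  refine ⟨B, hB, fun {ρ} hρ1 hρ2 {G} hG {W} hW {m α} hα hαW {P Z} hP hPc hZ hZc {d h A} hd hh0 hZb
    hZh hA k => ?_⟩
  have hA0 : 0 ≤ A := (abs_nonneg _).trans (hA 0 (by simp))
  refine abs_integral_pi_sub_tensorGauss_le_of_continuousOn hG hW k hα hαW
    (continuousOn_quotient (continuous_finsetProd _ fun j _ => hPc j) hZc fun η hη h0 => ?_)
    (by have := Real.rpow_nonneg hd.le (-(2 + 2 * s)); positivity) fun i η hη => ?_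
  · have := hZb η hη
    rw [h0, norm_zero] at this
    linarith
  · obtain ⟨q, hq, hqe⟩ := exists_poly_of_multiAffine hP η i
    obtain ⟨p, hp, hpe⟩ := hh ρ hρ1 hρ2 (Z (Function.update η i 0))
      (Z (Function.update η i 1) - Z (Function.update η i 0)) d h hd hh0 (hZh η hη i)
      (fun t ht => by rw [← hZ η i t]; exact hZb _ (update_mem_Icc hη i ht)) q A hq
      (fun t ht => by rw [hqe]; exact hA _ (update_mem_Icc hη i ht)) k
    refine ⟨p, hp, fun t ht => ?_⟩
    have := hpe t ht
    rwa [← hZ η i t, hqe] at this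

end FracQuad

namespace FracQuad

/-! ### Duffy transformations -/

theorem setLIntegral_Ioo_zero (a : ℝ) (ha : 0 < a) (f : ℝ → ENNReal) :
    ∫⁻ x in Ioo 0 a, f x = ENNReal.ofReal a * ∫⁻ t in Ioo (0 : ℝ) 1, f (a * t) := by
  rw [← lintegral_indicator measurableSet_Ioo, ← lintegral_indicator measurableSet_Ioo]
  have h := Real.smul_map_volume_mul_left ha.ne'
  conv_lhs => rw [← h]
  rw [lintegral_smul_measure, abs_of_pos ha, smul_eq_mul]
  congr 1
  rw [show (fun t => a * t) = (MeasurableEquiv.mulLeft₀ a ha.ne') from rfl, lintegral_map_equiv]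
  refine lintegral_congr fun t => ?_
  have : (MeasurableEquiv.mulLeft₀ a ha.ne') t ∈ Ioo 0 a ↔ t ∈ Ioo (0 : ℝ) 1 := by
    simp only [MeasurableEquiv.coe_mulLeft₀, mem_Ioo, mul_pos_iff_of_pos_left ha]
    rw [mul_lt_iff_lt_one_right ha]
  by_cases ht : t ∈ Ioo (0 : ℝ) 1
  · rw [indicator_of_mem (this.2 ht), indicator_of_mem ht]; rfl
  · rw [indicator_of_notMem (fun h => ht (this.1 h)), indicator_of_notMem ht]

theorem lintegral_pi_three (μ : Fin 3 → Measure ℝ) [∀ i, SigmaFinite (μ i)]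
    {f : (Fin 3 → ℝ) → ENNReal} (hf : Measurable f) :
    ∫⁻ η, f η ∂(Measure.pi μ) = ∫⁻ a, ∫⁻ b, ∫⁻ c, f ![a, b, c] ∂(μ 2) ∂(μ 1) ∂(μ 0) := by
  rw [lintegral_pi_cons μ f hf]
  refine lintegral_congr fun a => ?_
  rw [lintegral_pi_cons _ _ (by fun_prop)]
  refine lintegral_congr fun b => ?_
  rw [lintegral_pi_cons _ _ (by fun_prop)]
  refine lintegral_congr fun c => ?_
  rw [Measure.pi_of_empty (x := ![]), lintegral_dirac]
  rfl

theorem lintegral_pi_four (μ : Fin 4 → Measure ℝ) [∀ i, SigmaFinite (μ i)]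
    {f : (Fin 4 → ℝ) → ENNReal} (hf : Measurable f) :
    ∫⁻ η, f η ∂(Measure.pi μ) =
      ∫⁻ a, ∫⁻ b, ∫⁻ c, ∫⁻ d, f ![a, b, c, d] ∂(μ 3) ∂(μ 2) ∂(μ 1) ∂(μ 0) := by
  rw [lintegral_pi_cons μ f hf]
  refine lintegral_congr fun a => ?_
  rw [lintegral_pi_three _ (by fun_prop)]
  rfl

theorem lintegral_pi_powMeasure_three (α : Fin 3 → ℝ) {f : (Fin 3 → ℝ) → ENNReal}
    (hf : Measurable f) :
    ∫⁻ η, f η ∂(Measure.pi fun i => powMeasure (α i)) =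
      ∫⁻ a in Ioo (0 : ℝ) 1, ∫⁻ b in Ioo (0 : ℝ) 1, ∫⁻ c in Ioo (0 : ℝ) 1,
        ENNReal.ofReal (a ^ α 0) * (ENNReal.ofReal (b ^ α 1) *
          (ENNReal.ofReal (c ^ α 2) * f ![a, b, c])) := by
  rw [lintegral_pi_three _ hf]
  simp only [lintegral_powMeasure, lintegral_const_mul' _ _ ENNReal.ofReal_ne_top]

theorem lintegral_pi_powMeasure_four (α : Fin 4 → ℝ) {f : (Fin 4 → ℝ) → ENNReal}
    (hf : Measurable f) :
    ∫⁻ η, f η ∂(Measure.pi fun i => powMeasure (α i)) =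
      ∫⁻ a in Ioo (0 : ℝ) 1, ∫⁻ b in Ioo (0 : ℝ) 1, ∫⁻ c in Ioo (0 : ℝ) 1, ∫⁻ d in Ioo (0 : ℝ) 1,
        ENNReal.ofReal (a ^ α 0) * (ENNReal.ofReal (b ^ α 1) *
          (ENNReal.ofReal (c ^ α 2) * (ENNReal.ofReal (d ^ α 3) * f ![a, b, c, d]))) := by
  rw [lintegral_pi_four _ hf]
  simp only [lintegral_powMeasure, lintegral_const_mul' _ _ ENNReal.ofReal_ne_top]

/-- The integral over a region given by successive constraints on the variables. -/
theorem setLIntegral_nested_three {S : Set (Fin 3 → ℝ)} (hS : MeasurableSet S) {A : Set ℝ}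
    {B : ℝ → Set ℝ} {C : ℝ → ℝ → Set ℝ} (hA : MeasurableSet A) (hB : ∀ a, MeasurableSet (B a))
    (hC : ∀ a b, MeasurableSet (C a b))
    (h : ∀ a b c, ![a, b, c] ∈ S ↔ a ∈ A ∧ b ∈ B a ∧ c ∈ C a b)
    {f : (Fin 3 → ℝ) → ENNReal} (hf : Measurable f) :
    ∫⁻ w in S, f w = ∫⁻ a in A, ∫⁻ b in B a, ∫⁻ c in C a b, f ![a, b, c] := by
  rw [← lintegral_indicator hS, volume_pi, lintegral_pi_three _ (hf.indicator hS),
    ← lintegral_indicator hA]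
  refine lintegral_congr fun a => ?_
  by_cases ha : a ∈ A
  · rw [indicator_of_mem ha, ← lintegral_indicator (hB a)]
    refine lintegral_congr fun b => ?_
    by_cases hb : b ∈ B a
    · rw [indicator_of_mem hb, ← lintegral_indicator (hC a b)]
      refine lintegral_congr fun c => ?_
      by_cases hc : c ∈ C a b
      · rw [indicator_of_mem hc, indicator_of_mem ((h a b c).2 ⟨ha, hb, hc⟩)]
      · rw [indicator_of_notMem hc, indicator_of_notMem fun h' => hc ((h a b c).1 h').2.2]
    · simp [indicator, h, hb]
  · simp [indicator, h, ha]

/-- The integral over a region given by successive constraints on the variables. -/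
theorem setLIntegral_nested_four {S : Set (Fin 4 → ℝ)} (hS : MeasurableSet S) {A : Set ℝ}
    {B : ℝ → Set ℝ} {C : ℝ → ℝ → Set ℝ} {D : ℝ → ℝ → ℝ → Set ℝ} (hA : MeasurableSet A)
    (hB : ∀ a, MeasurableSet (B a)) (hC : ∀ a b, MeasurableSet (C a b))
    (hD : ∀ a b c, MeasurableSet (D a b c))
    (h : ∀ a b c d, ![a, b, c, d] ∈ S ↔ a ∈ A ∧ b ∈ B a ∧ c ∈ C a b ∧ d ∈ D a b c)
    {f : (Fin 4 → ℝ) → ENNReal} (hf : Measurable f) :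
    ∫⁻ w in S, f w =
      ∫⁻ a in A, ∫⁻ b in B a, ∫⁻ c in C a b, ∫⁻ d in D a b c, f ![a, b, c, d] := by
  rw [← lintegral_indicator hS, volume_pi, lintegral_pi_four _ (hf.indicator hS),
    ← lintegral_indicator hA]
  refine lintegral_congr fun a => ?_
  by_cases ha : a ∈ A
  · rw [indicator_of_mem ha, ← lintegral_indicator (hB a)]
    refine lintegral_congr fun b => ?_
    by_cases hb : b ∈ B a
    · rw [indicator_of_mem hb, ← lintegral_indicator (hC a b)]
      refine lintegral_congr fun c => ?_
      by_cases hc : c ∈ C a b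
      · rw [indicator_of_mem hc, ← lintegral_indicator (hD a b c)]
        refine lintegral_congr fun d => ?_
        by_cases hd : d ∈ D a b c
        · rw [indicator_of_mem hd, indicator_of_mem ((h a b c d).2 ⟨ha, hb, hc, hd⟩)]
        · rw [indicator_of_notMem hd, indicator_of_notMem fun h' => hd ((h a b c d).1 h').2.2.2]
      · simp [indicator, h, hc]
    · simp [indicator, h, hb]
  · simp [indicator, h, ha]

/-- The simplex `0 < w₃ < w₂ < w₁ < w₀ < 1`. -/
def regionChain : Set (Fin 4 → ℝ) :=
  {w | w 0 < 1 ∧ w 1 < w 0 ∧ w 2 < w 1 ∧ w 3 < w 2 ∧ 0 < w 3}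

/-- The region `0 < w₁ < w₀ < 1`, `0 < w₂, w₃ < w₁`. -/
def regionFork : Set (Fin 4 → ℝ) :=
  {w | w 0 < 1 ∧ w 1 < w 0 ∧ w 2 < w 1 ∧ w 3 < w 1 ∧ 0 < w 2 ∧ 0 < w 3}

/-- The region `0 < w₁ < w₀ < 1`, `0 < w₃ < w₂ < w₀`. -/
def regionSplit : Set (Fin 4 → ℝ) :=
  {w | w 0 < 1 ∧ w 1 < w 0 ∧ w 2 < w 0 ∧ w 3 < w 2 ∧ 0 < w 1 ∧ 0 < w 3}

/-- The region `0 < w₁ < w₀ < 1`, `0 < w₂ < 1 - w₀`. -/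
def regionPrism : Set (Fin 3 → ℝ) :=
  {w | w 0 < 1 ∧ w 1 < w 0 ∧ w 2 < 1 - w 0 ∧ 0 < w 1 ∧ 0 < w 2}

/-- The region `0 < w₁, w₂ < w₀ < 1`. -/
def regionPyramid : Set (Fin 3 → ℝ) :=
  {w | w 0 < 1 ∧ w 1 < w 0 ∧ w 2 < w 0 ∧ 0 < w 1 ∧ 0 < w 2}

/-- The simplex `0 < w₂ < w₁ < w₀ < 1`. -/
def regionTetrahedron : Set (Fin 3 → ℝ) :=
  {w | w 0 < 1 ∧ w 1 < w 0 ∧ w 2 < w 1 ∧ 0 < w 2}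

theorem measurableSet_regionChain : MeasurableSet regionChain := by
  unfold regionChain; measurability

theorem measurableSet_regionFork : MeasurableSet regionFork := by
  unfold regionFork; measurability

theorem measurableSet_regionSplit : MeasurableSet regionSplit := by
  unfold regionSplit; measurability

theorem measurableSet_regionPrism : MeasurableSet regionPrism := by
  unfold regionPrism; measurability

theorem measurableSet_regionPyramid : MeasurableSet regionPyramid := by
  unfold regionPyramid; measurability

theorem measurableSet_regionTetrahedron : MeasurableSet regionTetrahedron := by
  unfold regionTetrahedron; measurability

/-- The coordinates `(a, ab, abc, abcd)`, with Jacobian `a³b²c`. -/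
theorem setLIntegral_regionChain {f : (Fin 4 → ℝ) → ENNReal} (hf : Measurable f) :
    ∫⁻ w in regionChain, f w =
      ∫⁻ a in Ioo (0 : ℝ) 1, ∫⁻ b in Ioo (0 : ℝ) 1, ∫⁻ c in Ioo (0 : ℝ) 1, ∫⁻ d in Ioo (0 : ℝ) 1,
        ENNReal.ofReal (a ^ 3 * b ^ 2 * c) * f ![a, a * b, a * b * c, a * b * c * d] := by
  rw [setLIntegral_nested_four measurableSet_regionChain (A := Ioo 0 1) (B := fun a => Ioo 0 a)
    (C := fun _ b => Ioo 0 b) (D := fun _ _ c => Ioo 0 c) measurableSet_Ioo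
    (fun _ => measurableSet_Ioo) (fun _ _ => measurableSet_Ioo) (fun _ _ _ => measurableSet_Ioo)
    (fun a b c d => ?_) hf]
  · refine setLIntegral_congr_fun measurableSet_Ioo fun a ha => ?_
    rw [setLIntegral_Ioo_zero a ha.1, ← lintegral_const_mul' _ _ ENNReal.ofReal_ne_top]
    refine setLIntegral_congr_fun measurableSet_Ioo fun b hb => ?_
    have hab := mul_pos ha.1 hb.1
    rw [setLIntegral_Ioo_zero _ hab, ← lintegral_const_mul' _ _ ENNReal.ofReal_ne_top,
      ← lintegral_const_mul' _ _ ENNReal.ofReal_ne_top]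
    refine setLIntegral_congr_fun measurableSet_Ioo fun c hc => ?_
    have habc := mul_pos hab hc.1
    rw [setLIntegral_Ioo_zero _ habc, ← mul_assoc, ← mul_assoc,
      ← ENNReal.ofReal_mul ha.1.le, ← ENNReal.ofReal_mul (mul_pos ha.1 hab).le,
      ← lintegral_const_mul' _ _ ENNReal.ofReal_ne_top]
    congr! 4
    ring
  · simp only [regionChain, mem_ofPred_eq, mem_Ioo, Matrix.cons_val]
    constructor
    · rintro ⟨h1, h2, h3, h4, h5⟩
      refine ⟨⟨?_, ?_⟩, ⟨?_, ?_⟩, ⟨?_, ?_⟩, ?_, ?_⟩ <;> linarith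
    · rintro ⟨⟨_, _⟩, ⟨_, _⟩, ⟨_, _⟩, _, _⟩
      refine ⟨?_, ?_, ?_, ?_, ?_⟩ <;> linarith

/-- The coordinates `(a, ab, abc, abd)`, with Jacobian `a³b²`. -/
theorem setLIntegral_regionFork {f : (Fin 4 → ℝ) → ENNReal} (hf : Measurable f) :
    ∫⁻ w in regionFork, f w =
      ∫⁻ a in Ioo (0 : ℝ) 1, ∫⁻ b in Ioo (0 : ℝ) 1, ∫⁻ c in Ioo (0 : ℝ) 1, ∫⁻ d in Ioo (0 : ℝ) 1,
        ENNReal.ofReal (a ^ 3 * b ^ 2) * f ![a, a * b, a * b * c, a * b * d] := by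
  rw [setLIntegral_nested_four measurableSet_regionFork (A := Ioo 0 1) (B := fun a => Ioo 0 a)
    (C := fun _ b => Ioo 0 b) (D := fun _ b _ => Ioo 0 b) measurableSet_Ioo
    (fun _ => measurableSet_Ioo) (fun _ _ => measurableSet_Ioo) (fun _ _ _ => measurableSet_Ioo)
    (fun a b c d => ?_) hf]
  · refine setLIntegral_congr_fun measurableSet_Ioo fun a ha => ?_
    rw [setLIntegral_Ioo_zero a ha.1, ← lintegral_const_mul' _ _ ENNReal.ofReal_ne_top]
    refine setLIntegral_congr_fun measurableSet_Ioo fun b hb => ?_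
    have hab := mul_pos ha.1 hb.1
    rw [setLIntegral_Ioo_zero _ hab, ← lintegral_const_mul' _ _ ENNReal.ofReal_ne_top,
      ← lintegral_const_mul' _ _ ENNReal.ofReal_ne_top]
    refine setLIntegral_congr_fun measurableSet_Ioo fun c hc => ?_
    rw [setLIntegral_Ioo_zero _ hab, ← mul_assoc, ← mul_assoc,
      ← ENNReal.ofReal_mul ha.1.le, ← ENNReal.ofReal_mul (mul_pos ha.1 hab).le,
      ← lintegral_const_mul' _ _ ENNReal.ofReal_ne_top]
    congr! 4
    ring
  · simp only [regionFork, mem_ofPred_eq, mem_Ioo, Matrix.cons_val]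
    constructor
    · rintro ⟨h1, h2, h3, h4, h5, h6⟩
      refine ⟨⟨?_, ?_⟩, ⟨?_, ?_⟩, ⟨?_, ?_⟩, ?_, ?_⟩ <;> linarith
    · rintro ⟨⟨_, _⟩, ⟨_, _⟩, ⟨_, _⟩, _, _⟩
      refine ⟨?_, ?_, ?_, ?_, ?_, ?_⟩ <;> linarith

/-- The coordinates `(a, ab, ac, acd)`, with Jacobian `a³c`. -/
theorem setLIntegral_regionSplit {f : (Fin 4 → ℝ) → ENNReal} (hf : Measurable f) :
    ∫⁻ w in regionSplit, f w =
      ∫⁻ a in Ioo (0 : ℝ) 1, ∫⁻ b in Ioo (0 : ℝ) 1, ∫⁻ c in Ioo (0 : ℝ) 1, ∫⁻ d in Ioo (0 : ℝ) 1,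
        ENNReal.ofReal (a ^ 3 * c) * f ![a, a * b, a * c, a * c * d] := by
  rw [setLIntegral_nested_four measurableSet_regionSplit (A := Ioo 0 1) (B := fun a => Ioo 0 a)
    (C := fun a _ => Ioo 0 a) (D := fun _ _ c => Ioo 0 c) measurableSet_Ioo
    (fun _ => measurableSet_Ioo) (fun _ _ => measurableSet_Ioo) (fun _ _ _ => measurableSet_Ioo)
    (fun a b c d => ?_) hf]
  · refine setLIntegral_congr_fun measurableSet_Ioo fun a ha => ?_
    rw [setLIntegral_Ioo_zero a ha.1, ← lintegral_const_mul' _ _ ENNReal.ofReal_ne_top]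
    refine setLIntegral_congr_fun measurableSet_Ioo fun b hb => ?_
    rw [setLIntegral_Ioo_zero _ ha.1, ← lintegral_const_mul' _ _ ENNReal.ofReal_ne_top,
      ← lintegral_const_mul' _ _ ENNReal.ofReal_ne_top]
    refine setLIntegral_congr_fun measurableSet_Ioo fun c hc => ?_
    have hac := mul_pos ha.1 hc.1
    rw [setLIntegral_Ioo_zero _ hac, ← mul_assoc, ← mul_assoc,
      ← ENNReal.ofReal_mul ha.1.le, ← ENNReal.ofReal_mul (mul_pos ha.1 ha.1).le,
      ← lintegral_const_mul' _ _ ENNReal.ofReal_ne_top]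
    congr! 4
    ring
  · simp only [regionSplit, mem_ofPred_eq, mem_Ioo, Matrix.cons_val]
    constructor
    · rintro ⟨h1, h2, h3, h4, h5, h6⟩
      refine ⟨⟨?_, ?_⟩, ⟨?_, ?_⟩, ⟨?_, ?_⟩, ?_, ?_⟩ <;> linarith
    · rintro ⟨⟨_, _⟩, ⟨_, _⟩, ⟨_, _⟩, _, _⟩
      refine ⟨?_, ?_, ?_, ?_, ?_, ?_⟩ <;> linarith

/-- The coordinates `(a, ab, (1 - a)c)`, with Jacobian `a(1 - a)`. -/
theorem setLIntegral_regionPrism {f : (Fin 3 → ℝ) → ENNReal} (hf : Measurable f) :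
    ∫⁻ w in regionPrism, f w =
      ∫⁻ a in Ioo (0 : ℝ) 1, ∫⁻ b in Ioo (0 : ℝ) 1, ∫⁻ c in Ioo (0 : ℝ) 1,
        ENNReal.ofReal (a * (1 - a)) * f ![a, a * b, (1 - a) * c] := by
  rw [setLIntegral_nested_three measurableSet_regionPrism (A := Ioo 0 1) (B := fun a => Ioo 0 a)
    (C := fun a _ => Ioo 0 (1 - a)) measurableSet_Ioo
    (fun _ => measurableSet_Ioo) (fun _ _ => measurableSet_Ioo) (fun a b c => ?_) hf]
  · refine setLIntegral_congr_fun measurableSet_Ioo fun a ha => ?_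
    rw [setLIntegral_Ioo_zero a ha.1, ← lintegral_const_mul' _ _ ENNReal.ofReal_ne_top]
    refine setLIntegral_congr_fun measurableSet_Ioo fun b hb => ?_
    have ha' := sub_pos.2 ha.2
    rw [setLIntegral_Ioo_zero _ ha', ← mul_assoc, ← ENNReal.ofReal_mul ha.1.le,
      ← lintegral_const_mul' _ _ ENNReal.ofReal_ne_top]
  · simp only [regionPrism, mem_ofPred_eq, mem_Ioo, Matrix.cons_val]
    constructor
    · rintro ⟨h1, h2, h3, h4, h5⟩
      refine ⟨⟨?_, ?_⟩, ⟨?_, ?_⟩, ?_, ?_⟩ <;> linarith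
    · rintro ⟨⟨_, _⟩, ⟨_, _⟩, _, _⟩
      refine ⟨?_, ?_, ?_, ?_, ?_⟩ <;> linarith

/-- The coordinates `(a, ab, ac)`, with Jacobian `a²`. -/
theorem setLIntegral_regionPyramid {f : (Fin 3 → ℝ) → ENNReal} (hf : Measurable f) :
    ∫⁻ w in regionPyramid, f w =
      ∫⁻ a in Ioo (0 : ℝ) 1, ∫⁻ b in Ioo (0 : ℝ) 1, ∫⁻ c in Ioo (0 : ℝ) 1,
        ENNReal.ofReal (a ^ 2) * f ![a, a * b, a * c] := by
  rw [setLIntegral_nested_three measurableSet_regionPyramid (A := Ioo 0 1) (B := fun a => Ioo 0 a)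
    (C := fun a _ => Ioo 0 a) measurableSet_Ioo
    (fun _ => measurableSet_Ioo) (fun _ _ => measurableSet_Ioo) (fun a b c => ?_) hf]
  · refine setLIntegral_congr_fun measurableSet_Ioo fun a ha => ?_
    rw [setLIntegral_Ioo_zero a ha.1, ← lintegral_const_mul' _ _ ENNReal.ofReal_ne_top]
    refine setLIntegral_congr_fun measurableSet_Ioo fun b hb => ?_
    rw [setLIntegral_Ioo_zero _ ha.1, ← mul_assoc, ← ENNReal.ofReal_mul ha.1.le,
      ← lintegral_const_mul' _ _ ENNReal.ofReal_ne_top]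
    congr! 4
    ring
  · simp only [regionPyramid, mem_ofPred_eq, mem_Ioo, Matrix.cons_val]
    constructor
    · rintro ⟨h1, h2, h3, h4, h5⟩
      refine ⟨⟨?_, ?_⟩, ⟨?_, ?_⟩, ?_, ?_⟩ <;> linarith
    · rintro ⟨⟨_, _⟩, ⟨_, _⟩, _, _⟩
      refine ⟨?_, ?_, ?_, ?_, ?_⟩ <;> linarith

/-- The coordinates `(a, ab, abc)`, with Jacobian `a²b`. -/
theorem setLIntegral_regionTetrahedron {f : (Fin 3 → ℝ) → ENNReal} (hf : Measurable f) :
    ∫⁻ w in regionTetrahedron, f w =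
      ∫⁻ a in Ioo (0 : ℝ) 1, ∫⁻ b in Ioo (0 : ℝ) 1, ∫⁻ c in Ioo (0 : ℝ) 1,
        ENNReal.ofReal (a ^ 2 * b) * f ![a, a * b, a * b * c] := by
  rw [setLIntegral_nested_three measurableSet_regionTetrahedron (A := Ioo 0 1)
    (B := fun a => Ioo 0 a) (C := fun _ b => Ioo 0 b) measurableSet_Ioo
    (fun _ => measurableSet_Ioo) (fun _ _ => measurableSet_Ioo) (fun a b c => ?_) hf]
  · refine setLIntegral_congr_fun measurableSet_Ioo fun a ha => ?_
    rw [setLIntegral_Ioo_zero a ha.1, ← lintegral_const_mul' _ _ ENNReal.ofReal_ne_top]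
    refine setLIntegral_congr_fun measurableSet_Ioo fun b hb => ?_
    have hab := mul_pos ha.1 hb.1
    rw [setLIntegral_Ioo_zero _ hab, ← mul_assoc, ← ENNReal.ofReal_mul ha.1.le,
      ← lintegral_const_mul' _ _ ENNReal.ofReal_ne_top]
    congr! 4
    ring
  · simp only [regionTetrahedron, mem_ofPred_eq, mem_Ioo, Matrix.cons_val]
    constructor
    · rintro ⟨h1, h2, h3, h4⟩
      refine ⟨⟨?_, ?_⟩, ⟨?_, ?_⟩, ?_, ?_⟩ <;> linarith
    · rintro ⟨⟨_, _⟩, ⟨_, _⟩, _, _⟩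
      refine ⟨?_, ?_, ?_, ?_⟩ <;> linarith

end FracQuad

namespace FracQuad

/-! ### Decomposition of the reference domains -/

/-- A linear change of variables `Φ`, given by a matrix `M` of determinant `±1`, that maps `S`
onto `R`. -/
theorem setLIntegral_matrix {n : ℕ} (M : Matrix (Fin n) (Fin n) ℝ) (hM : |M.det| = 1)
    {R S : Set (Fin n → ℝ)} (hR : MeasurableSet R) (hS : MeasurableSet S)
    (Φ : (Fin n → ℝ) → Fin n → ℝ) (hΦ : ∀ v, M.mulVec v = Φ v) (h : ∀ v, Φ v ∈ R ↔ v ∈ S)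
    {f : (Fin n → ℝ) → ENNReal} (hf : Measurable f) :
    ∫⁻ w in R, f w = ∫⁻ v in S, f (Φ v) := by
  have hdet : M.det ≠ 0 := by
    intro h0; rw [h0] at hM; simp at hM
  have hmap := Real.map_matrix_volume_pi_eq_smul_volume_pi hdet
  rw [abs_inv, hM, inv_one, ENNReal.ofReal_one, one_smul] at hmap
  have hfun : (⇑(Matrix.toLin' M)) = Φ := by funext v; rw [Matrix.toLin'_apply, hΦ]
  have hmeas : Measurable Φ := by
    rw [← hfun]; exact (LinearMap.continuous_of_finiteDimensional _).measurable
  rw [hfun] at hmap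
  rw [← lintegral_indicator hR, ← lintegral_indicator hS]
  conv_lhs => rw [← hmap]
  rw [lintegral_map (hf.indicator hR) hmeas]
  refine lintegral_congr fun v => ?_
  by_cases hv : v ∈ S
  · rw [indicator_of_mem hv, indicator_of_mem ((h v).2 hv)]
  · rw [indicator_of_notMem hv, indicator_of_notMem fun h' => hv ((h v).1 h')]

theorem ae_dotProduct_ne_zero {n : ℕ} {c : Fin n → ℝ} (hc : c ≠ 0) :
    ∀ᵐ w : Fin n → ℝ, c ⬝ᵥ w ≠ 0 := by
  have h := Measure.addHaar_submodule (volume : Measure (Fin n → ℝ))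
    (LinearMap.ker (dotProductBilin ℝ ℝ c)) (by
      intro htop
      rw [LinearMap.ker_eq_top] at htop
      refine hc (funext fun i => ?_)
      have := congrArg (fun g => g (Pi.single i 1)) htop
      simpa using this)
  refine measure_mono_null (fun w hw => ?_) h
  simpa using hw

/-- Splitting a region by a hyperplane. -/
theorem setLIntegral_split {n : ℕ} (c : Fin n → ℝ) (hc : c ≠ 0) (l : (Fin n → ℝ) → ℝ)
    (hl : ∀ w, c ⬝ᵥ w = l w) (S : Set (Fin n → ℝ)) (f : (Fin n → ℝ) → ENNReal) :
    ∫⁻ w in S, f w = (∫⁻ w in S ∩ {w | 0 < l w}, f w) + ∫⁻ w in S ∩ {w | l w < 0}, f w := by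
  have hlm : Measurable l := by
    have : l = fun w => c ⬝ᵥ w := funext fun w => (hl w).symm
    rw [this]; unfold dotProduct; fun_prop
  rw [← lintegral_inter_add_sdiff f S
    (measurableSet_lt measurable_const hlm : MeasurableSet {w | 0 < l w})]
  refine congrArg₂ (fun a b : ENNReal => a + b) rfl (setLIntegral_congr ?_)
  filter_upwards [ae_dotProduct_ne_zero hc] with w hw
  rw [hl] at hw
  apply propext
  constructor
  · rintro ⟨h1, h2⟩
    exact ⟨h1, lt_of_le_of_ne (not_lt.1 h2) hw⟩
  · rintro ⟨h1, h2⟩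
    exact ⟨h1, fun h3 : 0 < l w => lt_asymm h3 h2⟩

/-- Pairs of points `(w₀, w₁)`, `(w₂, w₃)` of the reference triangle `0 < q < p < 1`. -/
def refPair : Set (Fin 4 → ℝ) :=
  {w | w 0 < 1 ∧ w 1 < w 0 ∧ 0 < w 1 ∧ w 2 < 1 ∧ w 3 < w 2 ∧ 0 < w 3}

/-- Points `(w₀, w₁)` of the reference triangle and `w₂` of the reference edge. -/
def refPairEdge : Set (Fin 3 → ℝ) :=
  {w | w 0 < 1 ∧ w 1 < w 0 ∧ 0 < w 1 ∧ w 2 < 1 ∧ 0 < w 2}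

theorem measurableSet_refPair : MeasurableSet refPair := by
  unfold refPair; measurability

theorem measurableSet_refPairEdge : MeasurableSet refPairEdge := by
  unfold refPairEdge; measurability

/-- Two triangles with the common vertex `0`: the two regions are distinguished by which of the
two points has the larger first coordinate. -/
theorem setLIntegral_refPair_vertex {f : (Fin 4 → ℝ) → ENNReal} (hf : Measurable f) :
    ∫⁻ w in refPair, f w = (∫⁻ w in regionSplit, f ![w 0, w 1, w 2, w 3]) +
      (∫⁻ w in regionSplit, f ![w 2, w 3, w 0, w 1]) := by
  rw [setLIntegral_split (n := 4) ![1, 0, -1, 0] (by simp) (fun w => w 0 - w 2)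
    (fun w => by simp [dotProduct, Fin.sum_univ_four]; ring)]
  refine congrArg₂ (fun a b : ENNReal => a + b) ?_ ?_
  · refine setLIntegral_matrix !![1, 0, 0, 0; 0, 1, 0, 0; 0, 0, 1, 0; 0, 0, 0, 1]
      ?_ ?_ measurableSet_regionSplit
      (fun w => ![w 0, w 1, w 2, w 3]) (fun v => ?_) (fun v => ?_) hf
    · simp [Matrix.det_succ_row_zero, Fin.sum_univ_succ, Fin.succAbove]
    · have := measurableSet_refPair
      measurability
    · ext i; fin_cases i <;> simp [Matrix.mulVec, dotProduct, Fin.sum_univ_four]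
    · simp only [refPair, regionSplit, mem_ofPred_eq, mem_inter_iff, Matrix.cons_val]
      constructor
      · rintro ⟨⟨h0, h1, h2, h3, h4, h5⟩, k0⟩
        refine ⟨?_, ?_, ?_, ?_, ?_, ?_⟩ <;> linarith
      · rintro ⟨h0, h1, h2, h3, h4, h5⟩
        refine ⟨⟨?_, ?_, ?_, ?_, ?_, ?_⟩, ?_⟩ <;> linarith
  · refine setLIntegral_matrix !![0, 0, 1, 0; 0, 0, 0, 1; 1, 0, 0, 0; 0, 1, 0, 0]
      ?_ ?_ measurableSet_regionSplit
      (fun w => ![w 2, w 3, w 0, w 1]) (fun v => ?_) (fun v => ?_) hf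
    · simp [Matrix.det_succ_row_zero, Fin.sum_univ_succ, Fin.succAbove]
    · have := measurableSet_refPair
      measurability
    · ext i; fin_cases i <;> simp [Matrix.mulVec, dotProduct, Fin.sum_univ_four]
    · simp only [refPair, regionSplit, mem_ofPred_eq, mem_inter_iff, Matrix.cons_val]
      constructor
      · rintro ⟨⟨h0, h1, h2, h3, h4, h5⟩, k0⟩
        refine ⟨?_, ?_, ?_, ?_, ?_, ?_⟩ <;> linarith
      · rintro ⟨h0, h1, h2, h3, h4, h5⟩
        refine ⟨⟨?_, ?_, ?_, ?_, ?_, ?_⟩, ?_⟩ <;> linarith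

/-- The six sectors of the difference of two points of the same triangle are exchanged in pairs by
the symmetry, which leaves three of them. -/
theorem setLIntegral_refPair_same {f : (Fin 4 → ℝ) → ENNReal} (hf : Measurable f)
    (hsymm : ∀ w, f ![w 2, w 3, w 0, w 1] = f w) :
    ∫⁻ w in refPair, f w = 2 * ((∫⁻ w in regionChain, f ![w 0, w 1, w 0 - w 3, w 1 - w 2]) +
      ((∫⁻ w in regionChain, f ![w 0, w 1 - w 2 + w 3, w 0 - w 2, w 1 - w 2]) +
        (∫⁻ w in regionChain, f ![w 0 - w 3, w 1 - w 3, w 0, w 1 - w 2]))) := by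
  -- the exchange of the two points accounts for half of the region
  have hswap : ∫⁻ w in refPair ∩ {w | w 1 - w 3 < 0}, f w =
      ∫⁻ w in refPair ∩ {w | 0 < w 1 - w 3}, f w := by
    rw [setLIntegral_matrix !![0, 0, 1, 0; 0, 0, 0, 1; 1, 0, 0, 0; 0, 1, 0, 0] ?_ ?_ ?_
      (fun w => ![w 2, w 3, w 0, w 1]) (fun v => ?_) (fun v => ?_) hf
      (S := refPair ∩ {w | 0 < w 1 - w 3})]
    · simp only [hsymm]
    · simp [Matrix.det_succ_row_zero, Fin.sum_univ_succ, Fin.succAbove]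
    · have := measurableSet_refPair
      measurability
    · have := measurableSet_refPair
      measurability
    · ext i; fin_cases i <;> simp [Matrix.mulVec, dotProduct, Fin.sum_univ_four]
    · simp only [refPair, mem_ofPred_eq, mem_inter_iff, Matrix.cons_val]
      constructor
      · rintro ⟨⟨h0, h1, h2, h3, h4, h5⟩, k0⟩
        refine ⟨⟨?_, ?_, ?_, ?_, ?_, ?_⟩, ?_⟩ <;> linarith
      · rintro ⟨⟨h0, h1, h2, h3, h4, h5⟩, k0⟩
        refine ⟨⟨?_, ?_, ?_, ?_, ?_, ?_⟩, ?_⟩ <;> linarith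
  rw [setLIntegral_split (n := 4) ![0, 1, 0, -1] (by simp) (fun w => w 1 - w 3)
    (fun w => by simp [dotProduct, Fin.sum_univ_four]; ring)]
  rw [hswap, ← two_mul]
  congr 1
  -- the remaining half, where the second coordinate of the difference is positive, is cut by the
  -- sign of the first coordinate, and then by the order of the two
  rw [setLIntegral_split (n := 4) ![1, 0, -1, 0] (by simp) (fun w => w 0 - w 2)
    (fun w => by simp [dotProduct, Fin.sum_univ_four]; ring)]
  rw [setLIntegral_split (n := 4) (S := refPair ∩ {w | 0 < w 1 - w 3} ∩ {w | 0 < w 0 - w 2})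
    ![-1, 1, 1, -1] (by simp) (fun w => (w 1 - w 3) - (w 0 - w 2))
    (fun w => by simp [dotProduct, Fin.sum_univ_four]; ring)]
  rw [add_assoc]
  refine congrArg₂ (fun a b : ENNReal => a + b) ?_ (congrArg₂ (fun a b : ENNReal => a + b) ?_ ?_)
  · refine setLIntegral_matrix !![1, 0, 0, 0; 0, 1, 0, 0; 1, 0, 0, -1; 0, 1, -1, 0]
      ?_ ?_ measurableSet_regionChain
      (fun w => ![w 0, w 1, w 0 - w 3, w 1 - w 2]) (fun v => ?_) (fun v => ?_) hf
    · simp [Matrix.det_succ_row_zero, Fin.sum_univ_succ, Fin.succAbove]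
    · have := measurableSet_refPair
      measurability
    · ext i; fin_cases i <;> simp [Matrix.mulVec, dotProduct, Fin.sum_univ_four] <;> ring
    · simp only [refPair, regionChain, mem_ofPred_eq, mem_inter_iff, Matrix.cons_val]
      constructor
      · rintro ⟨⟨⟨⟨h0, h1, h2, h3, h4, h5⟩, k0⟩, k1⟩, k2⟩
        refine ⟨?_, ?_, ?_, ?_, ?_⟩ <;> linarith
      · rintro ⟨h0, h1, h2, h3, h4⟩
        refine ⟨⟨⟨⟨?_, ?_, ?_, ?_, ?_, ?_⟩, ?_⟩, ?_⟩, ?_⟩ <;> linarith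
  · refine setLIntegral_matrix !![1, 0, 0, 0; 0, 1, -1, 1; 1, 0, -1, 0; 0, 1, -1, 0]
      ?_ ?_ measurableSet_regionChain
      (fun w => ![w 0, w 1 - w 2 + w 3, w 0 - w 2, w 1 - w 2]) (fun v => ?_) (fun v => ?_) hf
    · simp [Matrix.det_succ_row_zero, Fin.sum_univ_succ, Fin.succAbove]
    · have := measurableSet_refPair
      measurability
    · ext i; fin_cases i <;> simp [Matrix.mulVec, dotProduct, Fin.sum_univ_four] <;> ring
    · simp only [refPair, regionChain, mem_ofPred_eq, mem_inter_iff, Matrix.cons_val]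
      constructor
      · rintro ⟨⟨⟨⟨h0, h1, h2, h3, h4, h5⟩, k0⟩, k1⟩, k2⟩
        refine ⟨?_, ?_, ?_, ?_, ?_⟩ <;> linarith
      · rintro ⟨h0, h1, h2, h3, h4⟩
        refine ⟨⟨⟨⟨?_, ?_, ?_, ?_, ?_, ?_⟩, ?_⟩, ?_⟩, ?_⟩ <;> linarith
  · refine setLIntegral_matrix !![1, 0, 0, -1; 0, 1, 0, -1; 1, 0, 0, 0; 0, 1, -1, 0]
      ?_ ?_ measurableSet_regionChain
      (fun w => ![w 0 - w 3, w 1 - w 3, w 0, w 1 - w 2]) (fun v => ?_) (fun v => ?_) hf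
    · simp [Matrix.det_succ_row_zero, Fin.sum_univ_succ, Fin.succAbove]
    · have := measurableSet_refPair
      measurability
    · ext i; fin_cases i <;> simp [Matrix.mulVec, dotProduct, Fin.sum_univ_four] <;> ring
    · simp only [refPair, regionChain, mem_ofPred_eq, mem_inter_iff, Matrix.cons_val]
      constructor
      · rintro ⟨⟨⟨h0, h1, h2, h3, h4, h5⟩, k0⟩, k1⟩
        refine ⟨?_, ?_, ?_, ?_, ?_⟩ <;> linarith
      · rintro ⟨h0, h1, h2, h3, h4⟩
        refine ⟨⟨⟨?_, ?_, ?_, ?_, ?_, ?_⟩, ?_⟩, ?_⟩ <;> linarith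

/-- Two triangles whose common edge is `q = 0`: the five regions are distinguished by the signs of
the differences of the first two barycentric coordinates and, in one of the four cases, by the order
of `w₃` and `w₂ - w₀`. -/
theorem setLIntegral_refPair_edge {f : (Fin 4 → ℝ) → ENNReal} (hf : Measurable f) :
    ∫⁻ w in refPair, f w = (∫⁻ w in regionFork, f ![w 0, w 3, w 0 - w 2, w 1 - w 2]) +
      (∫⁻ w in regionChain, f ![w 0, w 1, w 0 - w 3, w 2 - w 3]) +
      ((∫⁻ w in regionChain, f ![w 0 - w 3, w 2 - w 3, w 0, w 1]) +
      ((∫⁻ w in regionChain, f ![w 0 - w 3, w 1 - w 3, w 0, w 2]) +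
      (∫⁻ w in regionChain, f ![w 0 - w 2, w 1 - w 2, w 0, w 3]))) := by
  rw [setLIntegral_split (n := 4) ![1, 0, -1, 0] (by simp) (fun w => w 0 - w 2)
    (fun w => by simp [dotProduct, Fin.sum_univ_four]; ring)]
  rw [setLIntegral_split (n := 4) (S := refPair ∩ {w | 0 < w 0 - w 2}) ![1, -1, -1, 1]
    (by simp) (fun w => w 3 + (w 0 - w 2) - w 1)
    (fun w => by simp [dotProduct, Fin.sum_univ_four]; ring)]
  rw [setLIntegral_split (n := 4) (S := refPair ∩ {w | w 0 - w 2 < 0}) ![1, -1, -1, 1]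
    (by simp) (fun w => w 3 - (w 1 + (w 2 - w 0)))
    (fun w => by simp [dotProduct, Fin.sum_univ_four]; ring)]
  rw [setLIntegral_split (n := 4) (S := refPair ∩ {w | w 0 - w 2 < 0} ∩
    {w | w 3 - (w 1 + (w 2 - w 0)) < 0}) ![1, 0, -1, 1] (by simp) (fun w => w 3 - (w 2 - w 0))
    (fun w => by simp [dotProduct, Fin.sum_univ_four]; ring)]
  refine congrArg₂ (fun a b : ENNReal => a + b) (congrArg₂ (fun a b : ENNReal => a + b) ?_ ?_)
    (congrArg₂ (fun a b : ENNReal => a + b) ?_ (congrArg₂ (fun a b : ENNReal => a + b) ?_ ?_))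
  · refine setLIntegral_matrix !![1, 0, 0, 0; 0, 0, 0, 1; 1, 0, -1, 0; 0, 1, -1, 0]
      ?_ ?_ measurableSet_regionFork
      (fun w => ![w 0, w 3, w 0 - w 2, w 1 - w 2]) (fun v => ?_) (fun v => ?_) hf
    · simp [Matrix.det_succ_row_zero, Fin.sum_univ_succ, Fin.succAbove]
    · have := measurableSet_refPair
      measurability
    · ext i; fin_cases i <;> simp [Matrix.mulVec, dotProduct, Fin.sum_univ_four] <;> ring
    · simp only [refPair, regionFork, mem_ofPred_eq, mem_inter_iff, Matrix.cons_val]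
      constructor
      · rintro ⟨⟨⟨h0, h1, h2, h3, h4, h5⟩, k0⟩, k1⟩
        refine ⟨?_, ?_, ?_, ?_, ?_, ?_⟩ <;> linarith
      · rintro ⟨h0, h1, h2, h3, h4, h5⟩
        refine ⟨⟨⟨?_, ?_, ?_, ?_, ?_, ?_⟩, ?_⟩, ?_⟩ <;> linarith
  · refine setLIntegral_matrix !![1, 0, 0, 0; 0, 1, 0, 0; 1, 0, 0, -1; 0, 0, 1, -1]
      ?_ ?_ measurableSet_regionChain
      (fun w => ![w 0, w 1, w 0 - w 3, w 2 - w 3]) (fun v => ?_) (fun v => ?_) hf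
    · simp [Matrix.det_succ_row_zero, Fin.sum_univ_succ, Fin.succAbove]
    · have := measurableSet_refPair
      measurability
    · ext i; fin_cases i <;> simp [Matrix.mulVec, dotProduct, Fin.sum_univ_four] <;> ring
    · simp only [refPair, regionChain, mem_ofPred_eq, mem_inter_iff, Matrix.cons_val]
      constructor
      · rintro ⟨⟨⟨h0, h1, h2, h3, h4, h5⟩, k0⟩, k1⟩
        refine ⟨?_, ?_, ?_, ?_, ?_⟩ <;> linarith
      · rintro ⟨h0, h1, h2, h3, h4⟩
        refine ⟨⟨⟨?_, ?_, ?_, ?_, ?_, ?_⟩, ?_⟩, ?_⟩ <;> linarith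
  · refine setLIntegral_matrix !![1, 0, 0, -1; 0, 0, 1, -1; 1, 0, 0, 0; 0, 1, 0, 0]
      ?_ ?_ measurableSet_regionChain
      (fun w => ![w 0 - w 3, w 2 - w 3, w 0, w 1]) (fun v => ?_) (fun v => ?_) hf
    · simp [Matrix.det_succ_row_zero, Fin.sum_univ_succ, Fin.succAbove]
    · have := measurableSet_refPair
      measurability
    · ext i; fin_cases i <;> simp [Matrix.mulVec, dotProduct, Fin.sum_univ_four] <;> ring
    · simp only [refPair, regionChain, mem_ofPred_eq, mem_inter_iff, Matrix.cons_val]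
      constructor
      · rintro ⟨⟨⟨h0, h1, h2, h3, h4, h5⟩, k0⟩, k1⟩
        refine ⟨?_, ?_, ?_, ?_, ?_⟩ <;> linarith
      · rintro ⟨h0, h1, h2, h3, h4⟩
        refine ⟨⟨⟨?_, ?_, ?_, ?_, ?_, ?_⟩, ?_⟩, ?_⟩ <;> linarith
  · refine setLIntegral_matrix !![1, 0, 0, -1; 0, 1, 0, -1; 1, 0, 0, 0; 0, 0, 1, 0]
      ?_ ?_ measurableSet_regionChain
      (fun w => ![w 0 - w 3, w 1 - w 3, w 0, w 2]) (fun v => ?_) (fun v => ?_) hf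
    · simp [Matrix.det_succ_row_zero, Fin.sum_univ_succ, Fin.succAbove]
    · have := measurableSet_refPair
      measurability
    · ext i; fin_cases i <;> simp [Matrix.mulVec, dotProduct, Fin.sum_univ_four] <;> ring
    · simp only [refPair, regionChain, mem_ofPred_eq, mem_inter_iff, Matrix.cons_val]
      constructor
      · rintro ⟨⟨⟨⟨h0, h1, h2, h3, h4, h5⟩, k0⟩, k1⟩, k2⟩
        refine ⟨?_, ?_, ?_, ?_, ?_⟩ <;> linarith
      · rintro ⟨h0, h1, h2, h3, h4⟩
        refine ⟨⟨⟨⟨?_, ?_, ?_, ?_, ?_, ?_⟩, ?_⟩, ?_⟩, ?_⟩ <;> linarith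
  · refine setLIntegral_matrix !![1, 0, -1, 0; 0, 1, -1, 0; 1, 0, 0, 0; 0, 0, 0, 1]
      ?_ ?_ measurableSet_regionChain
      (fun w => ![w 0 - w 2, w 1 - w 2, w 0, w 3]) (fun v => ?_) (fun v => ?_) hf
    · simp [Matrix.det_succ_row_zero, Fin.sum_univ_succ, Fin.succAbove]
    · have := measurableSet_refPair
      measurability
    · ext i; fin_cases i <;> simp [Matrix.mulVec, dotProduct, Fin.sum_univ_four] <;> ring
    · simp only [refPair, regionChain, mem_ofPred_eq, mem_inter_iff, Matrix.cons_val]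
      constructor
      · rintro ⟨⟨⟨⟨h0, h1, h2, h3, h4, h5⟩, k0⟩, k1⟩, k2⟩
        refine ⟨?_, ?_, ?_, ?_, ?_⟩ <;> linarith
      · rintro ⟨h0, h1, h2, h3, h4⟩
        refine ⟨⟨⟨⟨?_, ?_, ?_, ?_, ?_, ?_⟩, ?_⟩, ?_⟩, ?_⟩ <;> linarith

/-- A triangle and its edge `q = 0`: the three regions are distinguished by the position of the
boundary point relative to the interval `(p - q, p)`. -/
theorem setLIntegral_refPairEdge_on {f : (Fin 3 → ℝ) → ENNReal} (hf : Measurable f) :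
    ∫⁻ w in refPairEdge, f w = (∫⁻ w in regionPrism, f ![w 0 + w 2, w 1, w 2]) +
      (∫⁻ w in regionPrism, f ![w 0 + w 2, w 0, w 0 + w 2 - w 1]) +
      (∫⁻ w in regionPrism, f ![w 1 + w 2, w 1, w 0 + w 2]) := by
  rw [setLIntegral_split (n := 3) ![1, 0, -1] (by simp) (fun w => w 0 - w 2)
    (fun w => by simp [dotProduct, Fin.sum_univ_three]; ring)]
  rw [setLIntegral_split (n := 3) (S := refPairEdge ∩ {w | 0 < w 0 - w 2}) ![1, -1, -1]
    (by simp) (fun w => w 0 - w 2 - w 1)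
    (fun w => by simp [dotProduct, Fin.sum_univ_three]; ring)]
  refine congrArg₂ (fun a b : ENNReal => a + b) (congrArg₂ (fun a b : ENNReal => a + b) ?_ ?_) ?_
  · refine setLIntegral_matrix !![1, 0, 1; 0, 1, 0; 0, 0, 1]
      ?_ ?_ measurableSet_regionPrism
      (fun w => ![w 0 + w 2, w 1, w 2]) (fun v => ?_) (fun v => ?_) hf
    · simp [Matrix.det_succ_row_zero, Fin.sum_univ_succ, Fin.succAbove]
    · have := measurableSet_refPairEdge
      measurability
    · ext i; fin_cases i <;> simp [Matrix.mulVec, dotProduct, Fin.sum_univ_three]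
    · simp only [refPairEdge, regionPrism, mem_ofPred_eq, mem_inter_iff, Matrix.cons_val]
      constructor
      · rintro ⟨⟨⟨h0, h1, h2, h3, h4⟩, k0⟩, k1⟩
        refine ⟨?_, ?_, ?_, ?_, ?_⟩ <;> linarith
      · rintro ⟨h0, h1, h2, h3, h4⟩
        refine ⟨⟨⟨?_, ?_, ?_, ?_, ?_⟩, ?_⟩, ?_⟩ <;> linarith
  · refine setLIntegral_matrix !![1, 0, 1; 1, 0, 0; 1, -1, 1]
      ?_ ?_ measurableSet_regionPrism
      (fun w => ![w 0 + w 2, w 0, w 0 + w 2 - w 1]) (fun v => ?_) (fun v => ?_) hf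
    · simp [Matrix.det_succ_row_zero, Fin.sum_univ_succ, Fin.succAbove]
    · have := measurableSet_refPairEdge
      measurability
    · ext i; fin_cases i <;> simp [Matrix.mulVec, dotProduct, Fin.sum_univ_three] <;> ring
    · simp only [refPairEdge, regionPrism, mem_ofPred_eq, mem_inter_iff, Matrix.cons_val]
      constructor
      · rintro ⟨⟨⟨h0, h1, h2, h3, h4⟩, k0⟩, k1⟩
        refine ⟨?_, ?_, ?_, ?_, ?_⟩ <;> linarith
      · rintro ⟨h0, h1, h2, h3, h4⟩
        refine ⟨⟨⟨?_, ?_, ?_, ?_, ?_⟩, ?_⟩, ?_⟩ <;> linarith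
  · refine setLIntegral_matrix !![0, 1, 1; 0, 1, 0; 1, 0, 1]
      ?_ ?_ measurableSet_regionPrism
      (fun w => ![w 1 + w 2, w 1, w 0 + w 2]) (fun v => ?_) (fun v => ?_) hf
    · simp [Matrix.det_succ_row_zero, Fin.sum_univ_succ, Fin.succAbove]
    · have := measurableSet_refPairEdge
      measurability
    · ext i; fin_cases i <;> simp [Matrix.mulVec, dotProduct, Fin.sum_univ_three]
    · simp only [refPairEdge, regionPrism, mem_ofPred_eq, mem_inter_iff, Matrix.cons_val]
      constructor
      · rintro ⟨⟨h0, h1, h2, h3, h4⟩, k0⟩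
        refine ⟨?_, ?_, ?_, ?_, ?_⟩ <;> linarith
      · rintro ⟨h0, h1, h2, h3, h4⟩
        refine ⟨⟨?_, ?_, ?_, ?_, ?_⟩, ?_⟩ <;> linarith

/-- A triangle and an edge with the common vertex `0`: the two regions are distinguished by which
of the two points has the larger first coordinate. -/
theorem setLIntegral_refPairEdge_at {f : (Fin 3 → ℝ) → ENNReal} (hf : Measurable f) :
    ∫⁻ w in refPairEdge, f w = (∫⁻ w in regionPyramid, f ![w 0, w 1, w 2]) +
      (∫⁻ w in regionTetrahedron, f ![w 1, w 2, w 0]) := by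
  rw [setLIntegral_split (n := 3) ![1, 0, -1] (by simp) (fun w => w 0 - w 2)
    (fun w => by simp [dotProduct, Fin.sum_univ_three]; ring)]
  refine congrArg₂ (fun a b : ENNReal => a + b) ?_ ?_
  · refine setLIntegral_matrix !![1, 0, 0; 0, 1, 0; 0, 0, 1]
      ?_ ?_ measurableSet_regionPyramid
      (fun w => ![w 0, w 1, w 2]) (fun v => ?_) (fun v => ?_) hf
    · simp [Matrix.det_succ_row_zero, Fin.sum_univ_succ, Fin.succAbove]
    · have := measurableSet_refPairEdge
      measurability
    · ext i; fin_cases i <;> simp [Matrix.mulVec, dotProduct, Fin.sum_univ_three]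
    · simp only [refPairEdge, regionPyramid, mem_ofPred_eq, mem_inter_iff, Matrix.cons_val]
      constructor
      · rintro ⟨⟨h0, h1, h2, h3, h4⟩, k0⟩
        refine ⟨?_, ?_, ?_, ?_, ?_⟩ <;> linarith
      · rintro ⟨h0, h1, h2, h3, h4⟩
        refine ⟨⟨?_, ?_, ?_, ?_, ?_⟩, ?_⟩ <;> linarith
  · refine setLIntegral_matrix !![0, 1, 0; 0, 0, 1; 1, 0, 0]
      ?_ ?_ measurableSet_regionTetrahedron
      (fun w => ![w 1, w 2, w 0]) (fun v => ?_) (fun v => ?_) hf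
    · simp [Matrix.det_succ_row_zero, Fin.sum_univ_succ, Fin.succAbove]
    · have := measurableSet_refPairEdge
      measurability
    · ext i; fin_cases i <;> simp [Matrix.mulVec, dotProduct, Fin.sum_univ_three]
    · simp only [refPairEdge, regionTetrahedron, mem_ofPred_eq, mem_inter_iff, Matrix.cons_val]
      constructor
      · rintro ⟨⟨h0, h1, h2, h3, h4⟩, k0⟩
        refine ⟨?_, ?_, ?_, ?_⟩ <;> linarith
      · rintro ⟨h0, h1, h2, h3⟩
        refine ⟨⟨?_, ?_, ?_, ?_, ?_⟩, ?_⟩ <;> linarith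

end FracQuad

namespace FracQuad

/-- Passing from identities of integrals of nonnegative functions to signed integrals. -/
theorem integral_eq_sum_of_lintegral {X Y ι : Type*} [MeasurableSpace X] [MeasurableSpace Y]
    [Fintype ι] {μ : Measure X} {ν : Measure Y} {F : X → ℝ} {f : ι → Y → ℝ} {c : ℝ}
    (hc : 0 ≤ c) (hF : Measurable F) (hf : ∀ l, Integrable (f l) ν)
    (h : ∀ e : ℝ, ∫⁻ x, ENNReal.ofReal (e * F x) ∂μ =
      ENNReal.ofReal c * ∑ l, ∫⁻ y, ENNReal.ofReal (e * f l y) ∂ν) :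
    Integrable F μ ∧ ∫ x, F x ∂μ = c * ∑ l, ∫ y, f l y ∂ν := by
  have hfin : ∀ e : ℝ, ∀ l, ∫⁻ y, ENNReal.ofReal (e * f l y) ∂ν ≠ ⊤ := fun e l =>
    (((hf l).const_mul e).lintegral_lt_top).ne
  have hfinF : ∀ e : ℝ, ∫⁻ x, ENNReal.ofReal (e * F x) ∂μ ≠ ⊤ := fun e => by
    rw [h e]
    exact ENNReal.mul_ne_top ENNReal.ofReal_ne_top (ENNReal.sum_ne_top.2 fun l _ => hfin e l)
  have h1 := h 1
  have h2 := h (-1)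
  have f1 := hfinF 1
  have f2 := hfinF (-1)
  have g1 := hfin 1
  have g2 := hfin (-1)
  simp only [one_mul, neg_one_mul] at h1 h2 f1 f2 g1 g2
  have hint : Integrable F μ := by
    refine ⟨hF.aestronglyMeasurable, ?_⟩
    rw [hasFiniteIntegral_iff_norm]
    have : ∀ x, ENNReal.ofReal ‖F x‖ = ENNReal.ofReal (F x) + ENNReal.ofReal (-F x) := by
      intro x
      rcases le_total 0 (F x) with h0 | h0
      · rw [Real.norm_of_nonneg h0, ENNReal.ofReal_of_nonpos (by linarith : -F x ≤ 0), add_zero]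
      · rw [Real.norm_of_nonpos h0, ENNReal.ofReal_of_nonpos h0, zero_add]
    simp only [this]
    rw [lintegral_add_left (by fun_prop)]
    exact ENNReal.add_lt_top.2 ⟨f1.lt_top, f2.lt_top⟩
  refine ⟨hint, ?_⟩
  rw [integral_eq_lintegral_pos_part_sub_lintegral_neg_part hint, h1, h2, ENNReal.toReal_mul,
    ENNReal.toReal_mul, ENNReal.toReal_ofReal hc, ENNReal.toReal_sum fun l _ => g1 l,
    ENNReal.toReal_sum fun l _ => g2 l, ← mul_sub, ← Finset.sum_sub_distrib]
  congr 1
  refine Finset.sum_congr rfl fun l _ => ?_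
  rw [integral_eq_lintegral_pos_part_sub_lintegral_neg_part (hf l)]

/-- The powers of the weight are separated from the integrand inside `ENNReal.ofReal`. The factor
`e` is a sign, which makes positive and negative parts accessible. -/
theorem ofReal_weighted_four {a b c d x y z t J F f e : ℝ} (ha : 0 < a) (hb : 0 < b) (hc : 0 < c)
    (hd : 0 < d) (hJ : 0 ≤ J)
    (h : J * F = a ^ x * (b ^ y * (c ^ z * (d ^ t * f)))) :
    ENNReal.ofReal J * ENNReal.ofReal (e * F) = ENNReal.ofReal (a ^ x) * (ENNReal.ofReal (b ^ y) *
      (ENNReal.ofReal (c ^ z) * (ENNReal.ofReal (d ^ t) * ENNReal.ofReal (e * f)))) := by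
  rw [← ENNReal.ofReal_mul (by positivity), ← ENNReal.ofReal_mul (by positivity),
    ← ENNReal.ofReal_mul (by positivity), ← ENNReal.ofReal_mul (by positivity),
    ← ENNReal.ofReal_mul (by positivity)]
  congr 1
  linear_combination e * h

theorem ofReal_weighted_three {a b c x y z J F f e : ℝ} (ha : 0 < a) (hb : 0 < b) (hc : 0 < c)
    (hJ : 0 ≤ J) (h : J * F = a ^ x * (b ^ y * (c ^ z * f))) :
    ENNReal.ofReal J * ENNReal.ofReal (e * F) = ENNReal.ofReal (a ^ x) * (ENNReal.ofReal (b ^ y) *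
      (ENNReal.ofReal (c ^ z) * ENNReal.ofReal (e * f))) := by
  rw [← ENNReal.ofReal_mul (by positivity), ← ENNReal.ofReal_mul (by positivity),
    ← ENNReal.ofReal_mul (by positivity), ← ENNReal.ofReal_mul (by positivity)]
  congr 1
  linear_combination e * h

/-- If Jacobian times integrand is weight times `f` in the coordinates of the cube, then the
integral over the region is the one over the cube with that weight. With `e = ± 1` this covers the
positive and the negative part. -/
theorem setLIntegral_regionChain_eq_pi {α : Fin 4 → ℝ} {F f : (Fin 4 → ℝ) → ℝ}
    (hF : Measurable F) (hf : Measurable f)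
    (h : ∀ a ∈ Ioo (0 : ℝ) 1, ∀ b ∈ Ioo (0 : ℝ) 1, ∀ c ∈ Ioo (0 : ℝ) 1, ∀ d ∈ Ioo (0 : ℝ) 1,
      a ^ 3 * b ^ 2 * c * F ![a, a * b, a * b * c, a * b * c * d] =
        a ^ α 0 * (b ^ α 1 * (c ^ α 2 * (d ^ α 3 * f ![a, b, c, d])))) (e : ℝ) :
    ∫⁻ w in regionChain, ENNReal.ofReal (e * F w) =
      ∫⁻ η, ENNReal.ofReal (e * f η) ∂(Measure.pi fun i => powMeasure (α i)) := by
  rw [setLIntegral_regionChain (by fun_prop), lintegral_pi_powMeasure_four α (by fun_prop)]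
  refine setLIntegral_congr_fun measurableSet_Ioo fun a ha => ?_
  refine setLIntegral_congr_fun measurableSet_Ioo fun b hb => ?_
  refine setLIntegral_congr_fun measurableSet_Ioo fun c hc => ?_
  refine setLIntegral_congr_fun measurableSet_Ioo fun d hd => ?_
  have := ha.1
  have := hb.1
  have := hc.1
  exact ofReal_weighted_four ha.1 hb.1 hc.1 hd.1 (by positivity) (h a ha b hb c hc d hd)

theorem setLIntegral_regionFork_eq_pi {α : Fin 4 → ℝ} {F f : (Fin 4 → ℝ) → ℝ}
    (hF : Measurable F) (hf : Measurable f)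
    (h : ∀ a ∈ Ioo (0 : ℝ) 1, ∀ b ∈ Ioo (0 : ℝ) 1, ∀ c ∈ Ioo (0 : ℝ) 1, ∀ d ∈ Ioo (0 : ℝ) 1,
      a ^ 3 * b ^ 2 * F ![a, a * b, a * b * c, a * b * d] =
        a ^ α 0 * (b ^ α 1 * (c ^ α 2 * (d ^ α 3 * f ![a, b, c, d])))) (e : ℝ) :
    ∫⁻ w in regionFork, ENNReal.ofReal (e * F w) =
      ∫⁻ η, ENNReal.ofReal (e * f η) ∂(Measure.pi fun i => powMeasure (α i)) := by
  rw [setLIntegral_regionFork (by fun_prop), lintegral_pi_powMeasure_four α (by fun_prop)]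
  refine setLIntegral_congr_fun measurableSet_Ioo fun a ha => ?_
  refine setLIntegral_congr_fun measurableSet_Ioo fun b hb => ?_
  refine setLIntegral_congr_fun measurableSet_Ioo fun c hc => ?_
  refine setLIntegral_congr_fun measurableSet_Ioo fun d hd => ?_
  have := ha.1
  have := hb.1
  have := hc.1
  exact ofReal_weighted_four ha.1 hb.1 hc.1 hd.1 (by positivity) (h a ha b hb c hc d hd)

theorem setLIntegral_regionSplit_eq_pi {α : Fin 4 → ℝ} {F f : (Fin 4 → ℝ) → ℝ}
    (hF : Measurable F) (hf : Measurable f)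
    (h : ∀ a ∈ Ioo (0 : ℝ) 1, ∀ b ∈ Ioo (0 : ℝ) 1, ∀ c ∈ Ioo (0 : ℝ) 1, ∀ d ∈ Ioo (0 : ℝ) 1,
      a ^ 3 * c * F ![a, a * b, a * c, a * c * d] =
        a ^ α 0 * (b ^ α 1 * (c ^ α 2 * (d ^ α 3 * f ![a, b, c, d])))) (e : ℝ) :
    ∫⁻ w in regionSplit, ENNReal.ofReal (e * F w) =
      ∫⁻ η, ENNReal.ofReal (e * f η) ∂(Measure.pi fun i => powMeasure (α i)) := by
  rw [setLIntegral_regionSplit (by fun_prop), lintegral_pi_powMeasure_four α (by fun_prop)]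
  refine setLIntegral_congr_fun measurableSet_Ioo fun a ha => ?_
  refine setLIntegral_congr_fun measurableSet_Ioo fun b hb => ?_
  refine setLIntegral_congr_fun measurableSet_Ioo fun c hc => ?_
  refine setLIntegral_congr_fun measurableSet_Ioo fun d hd => ?_
  have := ha.1
  have := hb.1
  have := hc.1
  exact ofReal_weighted_four ha.1 hb.1 hc.1 hd.1 (by positivity) (h a ha b hb c hc d hd)

theorem setLIntegral_regionPrism_eq_pi {α : Fin 3 → ℝ} {F f : (Fin 3 → ℝ) → ℝ}
    (hF : Measurable F) (hf : Measurable f)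
    (h : ∀ a ∈ Ioo (0 : ℝ) 1, ∀ b ∈ Ioo (0 : ℝ) 1, ∀ c ∈ Ioo (0 : ℝ) 1,
      a * (1 - a) * F ![a, a * b, (1 - a) * c] =
        a ^ α 0 * (b ^ α 1 * (c ^ α 2 * f ![a, b, c]))) (e : ℝ) :
    ∫⁻ w in regionPrism, ENNReal.ofReal (e * F w) =
      ∫⁻ η, ENNReal.ofReal (e * f η) ∂(Measure.pi fun i => powMeasure (α i)) := by
  rw [setLIntegral_regionPrism (by fun_prop), lintegral_pi_powMeasure_three α (by fun_prop)]
  refine setLIntegral_congr_fun measurableSet_Ioo fun a ha => ?_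
  refine setLIntegral_congr_fun measurableSet_Ioo fun b hb => ?_
  refine setLIntegral_congr_fun measurableSet_Ioo fun c hc => ?_
  have := ha.1
  have := hb.1
  have := sub_pos.2 ha.2
  exact ofReal_weighted_three ha.1 hb.1 hc.1 (by positivity) (h a ha b hb c hc)

theorem setLIntegral_regionPyramid_eq_pi {α : Fin 3 → ℝ} {F f : (Fin 3 → ℝ) → ℝ}
    (hF : Measurable F) (hf : Measurable f)
    (h : ∀ a ∈ Ioo (0 : ℝ) 1, ∀ b ∈ Ioo (0 : ℝ) 1, ∀ c ∈ Ioo (0 : ℝ) 1,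
      a ^ 2 * F ![a, a * b, a * c] =
        a ^ α 0 * (b ^ α 1 * (c ^ α 2 * f ![a, b, c]))) (e : ℝ) :
    ∫⁻ w in regionPyramid, ENNReal.ofReal (e * F w) =
      ∫⁻ η, ENNReal.ofReal (e * f η) ∂(Measure.pi fun i => powMeasure (α i)) := by
  rw [setLIntegral_regionPyramid (by fun_prop), lintegral_pi_powMeasure_three α (by fun_prop)]
  refine setLIntegral_congr_fun measurableSet_Ioo fun a ha => ?_
  refine setLIntegral_congr_fun measurableSet_Ioo fun b hb => ?_
  refine setLIntegral_congr_fun measurableSet_Ioo fun c hc => ?_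
  have := ha.1
  have := hb.1
  exact ofReal_weighted_three ha.1 hb.1 hc.1 (by positivity) (h a ha b hb c hc)

theorem setLIntegral_regionTetrahedron_eq_pi {α : Fin 3 → ℝ} {F f : (Fin 3 → ℝ) → ℝ}
    (hF : Measurable F) (hf : Measurable f)
    (h : ∀ a ∈ Ioo (0 : ℝ) 1, ∀ b ∈ Ioo (0 : ℝ) 1, ∀ c ∈ Ioo (0 : ℝ) 1,
      a ^ 2 * b * F ![a, a * b, a * b * c] =
        a ^ α 0 * (b ^ α 1 * (c ^ α 2 * f ![a, b, c]))) (e : ℝ) :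
    ∫⁻ w in regionTetrahedron, ENNReal.ofReal (e * F w) =
      ∫⁻ η, ENNReal.ofReal (e * f η) ∂(Measure.pi fun i => powMeasure (α i)) := by
  rw [setLIntegral_regionTetrahedron (by fun_prop), lintegral_pi_powMeasure_three α (by fun_prop)]
  refine setLIntegral_congr_fun measurableSet_Ioo fun a ha => ?_
  refine setLIntegral_congr_fun measurableSet_Ioo fun b hb => ?_
  refine setLIntegral_congr_fun measurableSet_Ioo fun c hc => ?_
  have := ha.1
  have := hb.1
  exact ofReal_weighted_three ha.1 hb.1 hc.1 (by positivity) (h a ha b hb c hc)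

/-! ### Exactness of the transformed integrals -/

/-- The barycentric coordinates of the point `(p, q)` of the reference triangle `0 < q < p < 1`. -/
def refBary (p q : ℝ) : Fin 3 → ℝ := ![1 - p, p - q, q]

/-- The integrand of a pair of elements in reference coordinates. -/
noncomputable def pairKernel (s : ℝ) (x y : Fin 3 → Plane) (u v : Plane → ℝ) (w : Fin 4 → ℝ) : ℝ :=
  (∑ i, refBary (w 0) (w 1) i * u (x i) - ∑ i, refBary (w 2) (w 3) i * u (y i)) *
    (∑ i, refBary (w 0) (w 1) i * v (x i) - ∑ i, refBary (w 2) (w 3) i * v (y i)) /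
    ‖∑ i, refBary (w 0) (w 1) i • x i - ∑ i, refBary (w 2) (w 3) i • y i‖ ^ (2 + 2 * s)

/-- The integrand of an element and an edge in reference coordinates. -/
noncomputable def edgeKernel (s : ℝ) (n : Plane) (x : Fin 3 → Plane) (y : Fin 2 → Plane) (u v : Plane → ℝ)
    (w : Fin 3 → ℝ) : ℝ :=
  (∑ i, refBary (w 0) (w 1) i * u (x i)) * (∑ i, refBary (w 0) (w 1) i * v (x i)) *
    normalKernel s n (∑ i, refBary (w 0) (w 1) i • x i - ((1 - w 2) • y 0 + w 2 • y 1))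

theorem measurable_pairKernel (s : ℝ) (x y : Fin 3 → Plane) (u v : Plane → ℝ) :
    Measurable (pairKernel s x y u v) := by
  unfold pairKernel
  simp only [Fin.sum_univ_three, refBary, Matrix.cons_val]
  fun_prop

theorem measurable_edgeKernel (s : ℝ) (n : Plane) (x : Fin 3 → Plane) (y : Fin 2 → Plane)
    (u v : Plane → ℝ) : Measurable (edgeKernel s n x y u v) := by
  unfold edgeKernel normalKernel
  simp only [Fin.sum_univ_three, refBary, Matrix.cons_val]
  fun_prop

/-- The transformed integrand is homogeneous of degree `-2 s`. -/
theorem pairIntegrand_smul (s : ℝ) {m : ℕ} (x : Fin m → Plane) (u v : Plane → ℝ) {ζ : ℝ}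
    (hζ : 0 < ζ) (ψ : Fin m → ℝ) :
    pairIntegrand s x u v (fun k => ζ * ψ k) = ζ ^ (-(2 * s)) * pairIntegrand s x u v ψ := by
  have h1 : ∀ f : Plane → ℝ, ∑ k, ζ * ψ k * f (x k) = ζ * ∑ k, ψ k * f (x k) := fun f => by
    simp only [Finset.mul_sum, mul_assoc]
  have h2 : ∑ k, (ζ * ψ k) • x k = ζ • ∑ k, ψ k • x k := by
    simp only [Finset.smul_sum, mul_smul]
  unfold pairIntegrand
  rw [h1, h1, h2, norm_smul, Real.norm_of_nonneg hζ.le, Real.mul_rpow hζ.le (norm_nonneg _),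
    Real.rpow_add hζ, Real.rpow_two, Real.rpow_neg hζ.le]
  have := (Real.rpow_pos_of_pos hζ (2 * s)).ne'
  by_cases h0 : ‖∑ k, ψ k • x k‖ ^ (2 + 2 * s) = 0
  · simp [h0]
  · field_simp

/-- The kernel of the boundary integral is homogeneous of degree `-1 - 2 s`. -/
theorem normalKernel_smul (s : ℝ) (n z : Plane) {ζ : ℝ} (hζ : 0 < ζ) :
    normalKernel s n (ζ • z) = ζ⁻¹ * ζ ^ (-(2 * s)) * normalKernel s n z := by
  unfold normalKernel
  rw [inner_smul_right, norm_smul, Real.norm_of_nonneg hζ.le,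
    Real.mul_rpow hζ.le (norm_nonneg _), Real.rpow_add hζ, Real.rpow_two, Real.rpow_neg hζ.le]
  have := (Real.rpow_pos_of_pos hζ (2 * s)).ne'
  by_cases h0 : ‖z‖ ^ (2 + 2 * s) = 0
  · simp [h0]
  · field_simp

theorem rpow_natCast_sub {a : ℝ} (ha : 0 < a) (n : ℕ) (s : ℝ) :
    a ^ ((n : ℝ) - 2 * s) = a ^ n * a ^ (-(2 * s)) := by
  rw [sub_eq_add_neg, Real.rpow_add ha, Real.rpow_natCast]

/-- The value of the integrand of a pair depends on the differences of the barycentric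
coordinates only. -/
theorem pairKernel_same (s : ℝ) (x : Fin 3 → Plane) (u v : Plane → ℝ) (w : Fin 4 → ℝ) :
    pairKernel s x x u v w = pairIntegrand s x u v
      fun i => refBary (w 0) (w 1) i - refBary (w 2) (w 3) i := by
  unfold pairKernel pairIntegrand
  simp only [sub_mul, sub_smul, Finset.sum_sub_distrib]

theorem pairKernel_edge (s : ℝ) (x y : Fin 3 → Plane) (h0 : x 0 = y 0) (h1 : x 1 = y 1)
    (u v : Plane → ℝ) (w : Fin 4 → ℝ) :
    pairKernel s x y u v w = pairIntegrand s ![x 0, x 1, x 2, y 2] u v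
      ![w 2 - w 0, (w 0 - w 1) - (w 2 - w 3), w 1, -w 3] := by
  unfold pairKernel pairIntegrand
  simp only [Fin.sum_univ_three, Fin.sum_univ_four, refBary, Matrix.cons_val, ← h0, ← h1]
  congr 2
  · ring
  · ring
  · congr 1
    module

theorem pairKernel_vertex (s : ℝ) (x y : Fin 3 → Plane) (h0 : x 0 = y 0)
    (u v : Plane → ℝ) (w : Fin 4 → ℝ) :
    pairKernel s x y u v w = pairIntegrand s ![x 0, x 1, x 2, y 1, y 2] u v
      ![w 2 - w 0, w 0 - w 1, w 1, -(w 2 - w 3), -w 3] := by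
  unfold pairKernel pairIntegrand
  simp only [Fin.sum_univ_three, Fin.sum_univ_five, refBary, Matrix.cons_val, ← h0]
  congr 2
  · ring
  · ring
  · congr 1
    module

end FracQuad

namespace FracQuad

/-- The Jacobian of the chain times the factor `ζ ^ (-2 s)`, `ζ = a b c`, by which the integrand
scales is the weight of the quadrature. -/
theorem weight_same {a b c d : ℝ} (ha : 0 < a) (hb : 0 < b) (hc : 0 < c) (s f : ℝ) :
    a ^ (3 - 2 * s) * (b ^ (2 - 2 * s) * (c ^ (1 - 2 * s) * (d ^ (0 : ℝ) * f))) =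
      a ^ 3 * b ^ 2 * c * ((a * b * c) ^ (-(2 * s)) * f) := by
  have h3 := rpow_natCast_sub ha 3 s
  have h2 := rpow_natCast_sub hb 2 s
  have h1 := rpow_natCast_sub hc 1 s
  push_cast at h1 h2 h3
  rw [h3, h2, h1, Real.rpow_zero, Real.mul_rpow (by positivity) hc.le, Real.mul_rpow ha.le hb.le]
  ring

theorem weight_edge {a b c d : ℝ} (ha : 0 < a) (hb : 0 < b) (s f : ℝ) :
    a ^ (3 - 2 * s) * (b ^ (2 - 2 * s) * (c ^ (0 : ℝ) * (d ^ (0 : ℝ) * f))) =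
      a ^ 3 * b ^ 2 * ((a * b) ^ (-(2 * s)) * f) := by
  have h3 := rpow_natCast_sub ha 3 s
  have h2 := rpow_natCast_sub hb 2 s
  push_cast at h2 h3
  rw [h3, h2, Real.rpow_zero, Real.rpow_zero, Real.mul_rpow ha.le hb.le]
  ring

theorem weight_vertex {a b c d : ℝ} (ha : 0 < a) (s f : ℝ) :
    a ^ (3 - 2 * s) * (b ^ (0 : ℝ) * (c ^ (0 : ℝ) * (d ^ (0 : ℝ) * f))) =
      a ^ 3 * (a ^ (-(2 * s)) * f) := by
  have h3 := rpow_natCast_sub ha 3 s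
  push_cast at h3
  rw [h3, Real.rpow_zero, Real.rpow_zero, Real.rpow_zero]
  ring

theorem continuous_psiSame (l : Fin 3) (k : Fin 3) : Continuous fun η => psiSame η l k := by
  fin_cases l <;> fin_cases k <;> simp [psiSame] <;> fun_prop

theorem continuous_psiEdge (l : Fin 5) (k : Fin 4) : Continuous fun η => psiEdge η l k := by
  fin_cases l <;> fin_cases k <;> simp [psiEdge] <;> fun_prop

theorem continuous_psiVertex (l : Fin 2) (k : Fin 5) : Continuous fun η => psiVertex η l k := by
  fin_cases l <;> fin_cases k <;> simp [psiVertex] <;> fun_prop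

theorem continuous_psiOn (l : Fin 3) (k : Fin 3) : Continuous fun η => psiOn η l k := by
  fin_cases l <;> fin_cases k <;> simp [psiOn] <;> fun_prop

theorem continuous_psiAt (l : Fin 2) (k : Fin 4) : Continuous fun η => psiAt η l k := by
  fin_cases l <;> fin_cases k <;> simp [psiAt] <;> fun_prop

theorem continuous_phiOn (l : Fin 3) (k : Fin 3) : Continuous fun η => phiOn η l k := by
  fin_cases l <;> fin_cases k <;> simp [phiOn] <;> fun_prop

theorem continuous_phiAt (l : Fin 2) (k : Fin 3) : Continuous fun η => phiAt η l k := by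
  fin_cases l <;> fin_cases k <;> simp [phiAt] <;> fun_prop

theorem continuous_phiOnOpposite (l : Fin 3) : Continuous fun η => phiOnOpposite η l := by
  fin_cases l <;> simp [phiOnOpposite] <;> fun_prop

theorem measurable_pairIntegrand (s : ℝ) {n m : ℕ} (x : Fin m → Plane) (u v : Plane → ℝ)
    {ψ : (Fin n → ℝ) → Fin m → ℝ} (hψ : ∀ k, Continuous fun η => ψ η k) :
    Measurable fun η => pairIntegrand s x u v (ψ η) := by
  have h := fun k => (hψ k).measurable
  unfold pairIntegrand
  have h1 : ∀ f : Plane → ℝ, Measurable fun η => ∑ k, ψ η k * f (x k) := fun f =>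
    Finset.measurable_sum _ fun k _ => (h k).mul_const _
  have h2 : Measurable fun η => ∑ k, ψ η k • x k :=
    Finset.measurable_sum _ fun k _ => (h k).smul_const _
  exact ((h1 u).mul (h1 v)).div (h2.norm.pow_const _)

/-- On a pair of identical elements the integral over the reference domain is the sum of the
regularised integrals that are approximated by `quadSame`. -/
theorem integral_refPair_same (s : ℝ) (x : Fin 3 → Plane) (u v : Plane → ℝ)
    (hint : ∀ l, Integrable (fun η => pairIntegrand s x u v (psiSame η l))
      (Measure.pi fun i => powMeasure ((![3 - 2 * s, 2 - 2 * s, 1 - 2 * s, 0] : Fin 4 → ℝ) i))) :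
    IntegrableOn (pairKernel s x x u v) refPair ∧ ∫ w in refPair, pairKernel s x x u v w =
      2 * ∑ l, ∫ η, pairIntegrand s x u v (psiSame η l)
        ∂(Measure.pi fun i => powMeasure ((![3 - 2 * s, 2 - 2 * s, 1 - 2 * s, 0] : Fin 4 → ℝ) i))
    := by
  have hm := measurable_pairKernel s x x u v
  have hmf := fun l => measurable_pairIntegrand s x u v (continuous_psiSame l)
  refine integral_eq_sum_of_lintegral zero_le_two hm hint fun e => ?_
  rw [setLIntegral_refPair_same (f := fun w => ENNReal.ofReal (e * pairKernel s x x u v w))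
    (by fun_prop), Fin.sum_univ_three, add_assoc]
  · congr 1
    · simp
    refine congrArg₂ (fun a b : ENNReal => a + b) ?_ (congrArg₂ (fun a b : ENNReal => a + b) ?_ ?_)
    all_goals
      refine setLIntegral_regionChain_eq_pi (F := fun w => pairKernel s x x u v _)
        (hm.comp (measurable_pi_lambda _ fun i => by fin_cases i <;> simp <;> fun_prop)) (hmf _)
        (fun a ha b hb c hc d hd => ?_) e
      have habc : 0 < a * b * c := mul_pos (mul_pos ha.1 hb.1) hc.1
      simp only [Matrix.cons_val]
      rw [weight_same ha.1 hb.1 hc.1, ← pairIntegrand_smul s x u v habc, pairKernel_same]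
      congr 2
      funext i
      fin_cases i <;> simp [refBary, psiSame] <;> ring
  · intro w
    congr 2
    rw [pairKernel_same, pairKernel_same]
    unfold pairIntegrand
    simp only [Matrix.cons_val, sub_mul, sub_smul, Finset.sum_sub_distrib]
    rw [← norm_neg]
    congr 1
    · ring
    · rw [neg_sub]

/-- On elements with a common edge the integral over the reference domain is the sum of the
regularised integrals that are approximated by `quadEdge`. -/
theorem integral_refPair_edge (s : ℝ) (x y : Fin 3 → Plane) (h0 : x 0 = y 0) (h1 : x 1 = y 1)
    (u v : Plane → ℝ)
    (hint : ∀ l, Integrable (fun η => (if l = 0 then 1 else η 2) *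
        pairIntegrand s ![x 0, x 1, x 2, y 2] u v (psiEdge η l))
      (Measure.pi fun i => powMeasure ((![3 - 2 * s, 2 - 2 * s, 0, 0] : Fin 4 → ℝ) i))) :
    IntegrableOn (pairKernel s x y u v) refPair ∧ ∫ w in refPair, pairKernel s x y u v w =
      1 * ∑ l, ∫ η, (if l = 0 then 1 else η 2) *
        pairIntegrand s ![x 0, x 1, x 2, y 2] u v (psiEdge η l)
        ∂(Measure.pi fun i => powMeasure ((![3 - 2 * s, 2 - 2 * s, 0, 0] : Fin 4 → ℝ) i))
    := by
  have hm := measurable_pairKernel s x y u v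
  have hmf := fun l => measurable_pairIntegrand s ![x 0, x 1, x 2, y 2] u v (continuous_psiEdge l)
  refine integral_eq_sum_of_lintegral zero_le_one hm hint fun e => ?_
  rw [setLIntegral_refPair_edge (f := fun w => ENNReal.ofReal (e * pairKernel s x y u v w))
    (by fun_prop), Fin.sum_univ_five, ENNReal.ofReal_one, one_mul]
  have hfork : (∫⁻ w in regionFork,
      ENNReal.ofReal (e * pairKernel s x y u v ![w 0, w 3, w 0 - w 2, w 1 - w 2])) =
      ∫⁻ η, ENNReal.ofReal (e * ((if (0 : Fin 5) = 0 then 1 else η 2) *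
        pairIntegrand s ![x 0, x 1, x 2, y 2] u v (psiEdge η 0)))
        ∂(Measure.pi fun i => powMeasure ((![3 - 2 * s, 2 - 2 * s, 0, 0] : Fin 4 → ℝ) i)) := by
    refine setLIntegral_regionFork_eq_pi (F := fun w => pairKernel s x y u v _)
        (hm.comp (measurable_pi_lambda _ fun i => by fin_cases i <;> simp <;> fun_prop))
        (by simpa using hmf 0)
        (fun a ha b hb c hc d hd => ?_) e
    have hab : 0 < a * b := mul_pos ha.1 hb.1
    simp only [Matrix.cons_val, if_true, one_mul]
    rw [weight_edge ha.1 hb.1, ← pairIntegrand_smul s _ u v hab, pairKernel_edge s x y h0 h1]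
    congr 2
    funext i
    fin_cases i <;> simp [psiEdge] <;> ring
  have hchain : ∀ (l : Fin 5) (Φ : (Fin 4 → ℝ) → Fin 4 → ℝ), l ≠ 0 → Measurable Φ →
      (∀ a b c d : ℝ, (fun w : Fin 4 → ℝ => ![w 2 - w 0, (w 0 - w 1) - (w 2 - w 3), w 1, -w 3])
        (Φ ![a, a * b, a * b * c, a * b * c * d]) =
        fun k => a * b * psiEdge ![a, b, c, d] l k) →
      (∫⁻ w in regionChain, ENNReal.ofReal (e * pairKernel s x y u v (Φ w))) =
      ∫⁻ η, ENNReal.ofReal (e * ((if l = 0 then 1 else η 2) *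
        pairIntegrand s ![x 0, x 1, x 2, y 2] u v (psiEdge η l)))
        ∂(Measure.pi fun i => powMeasure ((![3 - 2 * s, 2 - 2 * s, 0, 0] : Fin 4 → ℝ) i)) := by
    intro l Φ hl hΦ hcomp
    refine setLIntegral_regionChain_eq_pi (F := fun w => pairKernel s x y u v (Φ w))
        (hm.comp hΦ)
        (by simp only [hl, if_false]; exact (measurable_pi_apply 2).mul (hmf l))
        (fun a ha b hb c hc d hd => ?_) e
    have hab : 0 < a * b := mul_pos ha.1 hb.1
    simp only [Matrix.cons_val, hl, if_false]
    rw [weight_edge ha.1 hb.1, pairKernel_edge s x y h0 h1]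
    have := hcomp a b c d
    simp only at this
    rw [this, pairIntegrand_smul s _ u v hab]
    ring
  rw [hfork]
  have hΦm : ∀ {Φ : (Fin 4 → ℝ) → Fin 4 → ℝ}, (∀ i, Measurable fun w => Φ w i) → Measurable Φ :=
    fun h => measurable_pi_lambda _ h
  rw [hchain 1 (fun w => ![w 0, w 1, w 0 - w 3, w 2 - w 3]) (by decide) ?_ ?_,
    hchain 3 (fun w => ![w 0 - w 3, w 2 - w 3, w 0, w 1]) (by decide) ?_ ?_,
    hchain 4 (fun w => ![w 0 - w 3, w 1 - w 3, w 0, w 2]) (by decide) ?_ ?_,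
    hchain 2 (fun w => ![w 0 - w 2, w 1 - w 2, w 0, w 3]) (by decide) ?_ ?_]
  · abel
  all_goals first
    | exact hΦm fun i => by fin_cases i <;> simp <;> fun_prop
    | (intro a b c d
       funext i
       fin_cases i <;> simp [psiEdge] <;> ring)

/-- On elements with a common vertex the integral over the reference domain is the sum of the
regularised integrals that are approximated by `quadVertex`. -/
theorem integral_refPair_vertex (s : ℝ) (x y : Fin 3 → Plane) (h0 : x 0 = y 0)
    (u v : Plane → ℝ)
    (hint : ∀ l, Integrable (fun η : Fin 4 → ℝ => η 2 *
        pairIntegrand s ![x 0, x 1, x 2, y 1, y 2] u v (psiVertex η l))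
      (Measure.pi fun i => powMeasure ((![3 - 2 * s, 0, 0, 0] : Fin 4 → ℝ) i))) :
    IntegrableOn (pairKernel s x y u v) refPair ∧ ∫ w in refPair, pairKernel s x y u v w =
      1 * ∑ l, ∫ η, η 2 *
        pairIntegrand s ![x 0, x 1, x 2, y 1, y 2] u v (psiVertex η l)
        ∂(Measure.pi fun i => powMeasure ((![3 - 2 * s, 0, 0, 0] : Fin 4 → ℝ) i))
    := by
  have hm := measurable_pairKernel s x y u v
  have hmf := fun l =>
    measurable_pairIntegrand s ![x 0, x 1, x 2, y 1, y 2] u v (continuous_psiVertex l)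
  refine integral_eq_sum_of_lintegral zero_le_one hm hint fun e => ?_
  rw [setLIntegral_refPair_vertex (f := fun w => ENNReal.ofReal (e * pairKernel s x y u v w))
    (by fun_prop), Fin.sum_univ_two, ENNReal.ofReal_one, one_mul]
  refine congrArg₂ (fun a b : ENNReal => a + b) ?_ ?_
  all_goals
    refine setLIntegral_regionSplit_eq_pi (F := fun w => pairKernel s x y u v _)
        (f := fun η : Fin 4 → ℝ => η 2 * pairIntegrand s _ u v (psiVertex η _))
        (hm.comp (measurable_pi_lambda _ fun i => by fin_cases i <;> simp <;> fun_prop))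
        ((measurable_pi_apply 2).mul (hmf _))
        (fun a ha b hb c hc d hd => ?_) e
    simp only [Matrix.cons_val]
    rw [weight_vertex ha.1, pairKernel_vertex s x y h0, mul_left_comm (a ^ (-(2 * s))),
      ← pairIntegrand_smul s _ u v ha.1, mul_assoc]
    congr 3
    funext i
    fin_cases i <;> simp [psiVertex] <;> ring

/-- The pull-back of a pair of elements to the cube by the two conical maps. -/
def conicalPair (η : Fin 4 → ℝ) : Fin 4 → ℝ := ![η 0, η 0 * η 1, η 2, η 2 * η 3]

/-- The pull-back of an element and an edge to the cube by the conical map. -/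
def conicalPairEdge (η : Fin 3 → ℝ) : Fin 3 → ℝ := ![η 0, η 0 * η 1, η 2]

theorem measurable_conicalPair : Measurable conicalPair :=
  measurable_pi_lambda _ fun i => by fin_cases i <;> simp [conicalPair] <;> fun_prop

theorem measurable_conicalPairEdge : Measurable conicalPairEdge :=
  measurable_pi_lambda _ fun i => by fin_cases i <;> simp [conicalPairEdge] <;> fun_prop

/-- On separated elements the conical maps have the Jacobian `ξ₀ ξ₂`. -/
theorem integral_refPair_far (s : ℝ) (x y : Fin 3 → Plane) (u v : Plane → ℝ)
    (hint : Integrable (fun η => pairKernel s x y u v (conicalPair η))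
      (Measure.pi fun i => powMeasure ((![1, 0, 1, 0] : Fin 4 → ℝ) i))) :
    IntegrableOn (pairKernel s x y u v) refPair ∧ ∫ w in refPair, pairKernel s x y u v w =
      ∫ η, pairKernel s x y u v (conicalPair η)
        ∂(Measure.pi fun i => powMeasure ((![1, 0, 1, 0] : Fin 4 → ℝ) i)) := by
  have hm := measurable_pairKernel s x y u v
  have hmc : Measurable fun η => pairKernel s x y u v (conicalPair η) :=
    hm.comp measurable_conicalPair
  have key := integral_eq_sum_of_lintegral (ι := Unit) zero_le_one hm (fun _ => hint)
    (μ := volume.restrict refPair) fun e => ?_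
  · simpa [IntegrableOn] using key
  rw [Fintype.sum_unique, ENNReal.ofReal_one, one_mul,
    setLIntegral_nested_four measurableSet_refPair (A := Ioo 0 1) (B := fun a => Ioo 0 a)
    (C := fun _ _ => Ioo 0 1) (D := fun _ _ c => Ioo 0 c) measurableSet_Ioo
    (fun _ => measurableSet_Ioo) (fun _ _ => measurableSet_Ioo) (fun _ _ _ => measurableSet_Ioo)
    (fun a b c d => ?_) (by fun_prop), lintegral_pi_powMeasure_four _ (by fun_prop)]
  · refine setLIntegral_congr_fun measurableSet_Ioo fun a ha => ?_
    rw [setLIntegral_Ioo_zero a ha.1, ← lintegral_const_mul' _ _ ENNReal.ofReal_ne_top]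
    refine setLIntegral_congr_fun measurableSet_Ioo fun b hb => ?_
    rw [← lintegral_const_mul' _ _ ENNReal.ofReal_ne_top]
    refine setLIntegral_congr_fun measurableSet_Ioo fun c hc => ?_
    rw [setLIntegral_Ioo_zero c hc.1, ← mul_assoc, ← lintegral_const_mul' _ _
      (ENNReal.mul_ne_top ENNReal.ofReal_ne_top ENNReal.ofReal_ne_top)]
    refine setLIntegral_congr_fun measurableSet_Ioo fun d hd => ?_
    simp [conicalPair, mul_assoc]
  · simp only [refPair, mem_ofPred_eq, mem_Ioo, Matrix.cons_val]
    constructor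
    · rintro ⟨h1, h2, h3, h4, h5, h6⟩
      exact ⟨⟨h3.trans h2, h1⟩, ⟨h3, h2⟩, ⟨h6.trans h5, h4⟩, h6, h5⟩
    · rintro ⟨⟨-, h1⟩, ⟨h3, h2⟩, ⟨-, h4⟩, h6, h5⟩
      exact ⟨h1, h2, h3, h4, h5, h6⟩

/-- The Jacobian and the homogeneity factor `a⁻¹ a ^ (-2 s)` of the boundary kernel; the factor `1
- a` of the Jacobian is part of the integrand. -/
theorem weight_on {a b c : ℝ} (ha : 0 < a) (s f : ℝ) :
    a ^ (-2 * s) * (b ^ (0 : ℝ) * (c ^ (0 : ℝ) * f)) =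
      a * (a⁻¹ * a ^ (-(2 * s)) * f) := by
  rw [Real.rpow_zero, Real.rpow_zero, neg_mul]
  field_simp

/-- Functions that vanish on the edge contribute two more powers of `a`. -/
theorem weight_on_opposite {a b c : ℝ} (ha : 0 < a) (s f : ℝ) :
    a ^ (2 - 2 * s) * (b ^ (0 : ℝ) * (c ^ (0 : ℝ) * f)) =
      a ^ 3 * (a⁻¹ * a ^ (-(2 * s)) * f) := by
  have h2 := rpow_natCast_sub ha 2 s
  push_cast at h2
  rw [Real.rpow_zero, Real.rpow_zero, h2]
  field_simp

theorem weight_at {a b c : ℝ} (ha : 0 < a) (s f : ℝ) :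
    a ^ (1 - 2 * s) * (b ^ (0 : ℝ) * (c ^ (0 : ℝ) * f)) =
      a ^ 2 * (a⁻¹ * a ^ (-(2 * s)) * f) := by
  have h1 := rpow_natCast_sub ha 1 s
  push_cast at h1
  rw [Real.rpow_zero, Real.rpow_zero, h1]
  field_simp

theorem edgeKernel_on (s : ℝ) (n : Plane) (x : Fin 3 → Plane) (y : Fin 2 → Plane)
    (h0 : x 0 = y 0) (h1 : x 1 = y 1) (u v : Plane → ℝ) (w : Fin 3 → ℝ) :
    edgeKernel s n x y u v w = (∑ i, refBary (w 0) (w 1) i * u (x i)) *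
      (∑ i, refBary (w 0) (w 1) i * v (x i)) *
      normalKernel s n (∑ i, ![w 2 - w 0, w 0 - w 1 - w 2, w 1] i • x i) := by
  unfold edgeKernel
  congr 2
  simp only [Fin.sum_univ_three, refBary, Matrix.cons_val, ← h0, ← h1]
  module

theorem edgeKernel_at (s : ℝ) (n : Plane) (x : Fin 3 → Plane) (y : Fin 2 → Plane)
    (h0 : x 0 = y 0) (u v : Plane → ℝ) (w : Fin 3 → ℝ) :
    edgeKernel s n x y u v w = (∑ i, refBary (w 0) (w 1) i * u (x i)) *
      (∑ i, refBary (w 0) (w 1) i * v (x i)) *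
      normalKernel s n
        (∑ i, ![w 2 - w 0, w 0 - w 1, w 1, -w 2] i • ![x 0, x 1, x 2, y 1] i) := by
  unfold edgeKernel
  congr 2
  simp only [Fin.sum_univ_three, Fin.sum_univ_four, refBary, Matrix.cons_val, ← h0]
  module

theorem normalKernel_sum_smul (s : ℝ) (n : Plane) {m : ℕ} (x : Fin m → Plane) {ζ : ℝ}
    (hζ : 0 < ζ) (ψ : Fin m → ℝ) :
    normalKernel s n (∑ k, (ζ * ψ k) • x k) =
      ζ⁻¹ * ζ ^ (-(2 * s)) * normalKernel s n (∑ k, ψ k • x k) := by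
  rw [← normalKernel_smul s n _ hζ, Finset.smul_sum]
  simp only [mul_smul]

theorem measurable_normalKernel_sum (s : ℝ) (nn : Plane) {n m : ℕ} (x : Fin m → Plane)
    {ψ : (Fin n → ℝ) → Fin m → ℝ} (hψ : ∀ k, Continuous fun η => ψ η k) :
    Measurable fun η => normalKernel s nn (∑ k, ψ η k • x k) := by
  have h := fun k => (hψ k).measurable
  unfold normalKernel
  have h2 : Measurable fun η => ∑ k, ψ η k • x k :=
    Finset.measurable_sum _ fun k _ => (h k).smul_const _
  exact (measurable_const.inner h2).div (h2.norm.pow_const _)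

theorem measurable_shape {n m : ℕ} (x : Fin m → Plane) (u : Plane → ℝ)
    {φ : (Fin n → ℝ) → Fin m → ℝ} (hφ : ∀ k, Continuous fun η => φ η k) :
    Measurable fun η => ∑ k, φ η k * u (x k) :=
  Finset.measurable_sum _ fun k _ => (hφ k).measurable.mul_const _

/-- The three sectors of the position of a boundary point relative to a point of an adjacent
element. -/
theorem lintegral_refPairEdge_on (s : ℝ) (n : Plane) (x : Fin 3 → Plane) (y : Fin 2 → Plane)
    (u v : Plane → ℝ) {α : Fin 3 → ℝ} {f : Fin 3 → (Fin 3 → ℝ) → ℝ} (hf : ∀ l, Measurable (f l))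
    (h : ∀ l (Φ : Fin 3 → ℝ), ∀ a ∈ Ioo (0 : ℝ) 1, ∀ b ∈ Ioo (0 : ℝ) 1, ∀ c ∈ Ioo (0 : ℝ) 1,
      (fun i => ![Φ 2 - Φ 0, Φ 0 - Φ 1 - Φ 2, Φ 1] i) = (fun k => a * psiOn ![a, b, c] l k) →
      refBary (Φ 0) (Φ 1) = phiOn ![a, b, c] l →
      a * (1 - a) * edgeKernel s n x y u v Φ =
        a ^ α 0 * (b ^ α 1 * (c ^ α 2 * f l ![a, b, c]))) (e : ℝ) :
    ∫⁻ w in refPairEdge, ENNReal.ofReal (e * edgeKernel s n x y u v w) =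
      ∑ l, ∫⁻ η, ENNReal.ofReal (e * f l η) ∂(Measure.pi fun i => powMeasure (α i)) := by
  have hm := measurable_edgeKernel s n x y u v
  rw [setLIntegral_refPairEdge_on (f := fun w => ENNReal.ofReal (e * edgeKernel s n x y u v w))
    (by fun_prop), Fin.sum_univ_three]
  refine congrArg₂ (fun a b : ENNReal => a + b)
    (congrArg₂ (fun a b : ENNReal => a + b) ?_ ?_) ?_
  all_goals
    refine setLIntegral_regionPrism_eq_pi (F := fun w => edgeKernel s n x y u v _)
        (hm.comp (measurable_pi_lambda _ fun i => by fin_cases i <;> simp <;> fun_prop))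
        (hf _) (fun a ha b hb c hc => h _ _ a ha b hb c hc ?_ ?_) e
    · funext i
      fin_cases i <;> simp [psiOn] <;> ring
    · funext i
      fin_cases i <;> simp [phiOn, refBary] <;> ring

/-- On an element and one of its edges the integral is the sum of the regularised integrals that
are approximated by `quadOn` for `s < 1/2`. -/
theorem integral_refPairEdge_on (s : ℝ) (n : Plane) (x : Fin 3 → Plane) (y : Fin 2 → Plane)
    (h0 : x 0 = y 0) (h1 : x 1 = y 1) (u v : Plane → ℝ)
    (hint : ∀ l, Integrable (fun η => (1 - η 0) * (∑ i, phiOn η l i * u (x i)) *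
        (∑ i, phiOn η l i * v (x i)) * normalKernel s n (∑ i, psiOn η l i • x i))
      (Measure.pi fun i => powMeasure ((![-2 * s, 0, 0] : Fin 3 → ℝ) i))) :
    IntegrableOn (edgeKernel s n x y u v) refPairEdge ∧
      ∫ w in refPairEdge, edgeKernel s n x y u v w =
      1 * ∑ l, ∫ η, (1 - η 0) * (∑ i, phiOn η l i * u (x i)) *
        (∑ i, phiOn η l i * v (x i)) * normalKernel s n (∑ i, psiOn η l i • x i)
        ∂(Measure.pi fun i => powMeasure ((![-2 * s, 0, 0] : Fin 3 → ℝ) i)) := by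
  refine integral_eq_sum_of_lintegral zero_le_one (measurable_edgeKernel s n x y u v) hint
    fun e => ?_
  rw [ENNReal.ofReal_one, one_mul]
  refine lintegral_refPairEdge_on s n x y u v (fun l => ?_) (fun l Φ a ha b hb c hc h2 h3 => ?_) e
  · have h1 := measurable_shape x u (continuous_phiOn l)
    have h2 := measurable_shape x v (continuous_phiOn l)
    have h3 := measurable_normalKernel_sum s n x (continuous_psiOn l)
    exact (((measurable_const.sub (measurable_pi_apply 0)).mul h1).mul h2).mul h3
  · simp only [Matrix.cons_val]
    rw [weight_on ha.1, edgeKernel_on s n x y h0 h1, h3]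
    simp only [funext_iff] at h2
    simp only [h2]
    rw [normalKernel_sum_smul s n x ha.1]
    ring

/-- For functions that vanish on the edge the integral is the sum of the regularised integrals
that are approximated by `quadOn` for `1/2 ≤ s`. -/
theorem integral_refPairEdge_on_opposite (s : ℝ) (n : Plane) (x : Fin 3 → Plane)
    (y : Fin 2 → Plane) (h0 : x 0 = y 0) (h1 : x 1 = y 1) (u v : Plane → ℝ)
    (hu0 : u (x 0) = 0) (hu1 : u (x 1) = 0) (hv0 : v (x 0) = 0) (hv1 : v (x 1) = 0)
    (hint : ∀ l, Integrable (fun η => (1 - η 0) * (phiOnOpposite η l * u (x 2)) *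
        (phiOnOpposite η l * v (x 2)) * normalKernel s n (∑ i, psiOn η l i • x i))
      (Measure.pi fun i => powMeasure ((![2 - 2 * s, 0, 0] : Fin 3 → ℝ) i))) :
    IntegrableOn (edgeKernel s n x y u v) refPairEdge ∧
      ∫ w in refPairEdge, edgeKernel s n x y u v w =
      1 * ∑ l, ∫ η, (1 - η 0) * (phiOnOpposite η l * u (x 2)) *
        (phiOnOpposite η l * v (x 2)) * normalKernel s n (∑ i, psiOn η l i • x i)
        ∂(Measure.pi fun i => powMeasure ((![2 - 2 * s, 0, 0] : Fin 3 → ℝ) i)) := by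
  refine integral_eq_sum_of_lintegral zero_le_one (measurable_edgeKernel s n x y u v) hint
    fun e => ?_
  rw [ENNReal.ofReal_one, one_mul]
  refine lintegral_refPairEdge_on s n x y u v (fun l => ?_) (fun l Φ a ha b hb c hc h2 h3 => ?_) e
  · have h1 := (continuous_phiOnOpposite l).measurable
    have h3 := measurable_normalKernel_sum s n x (continuous_psiOn l)
    exact (((measurable_const.sub (measurable_pi_apply 0)).mul (h1.mul_const _)).mul
      (h1.mul_const _)).mul h3
  · simp only [Matrix.cons_val]
    rw [weight_on_opposite ha.1, edgeKernel_on s n x y h0 h1, h3]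
    simp only [funext_iff] at h2
    simp only [h2]
    rw [normalKernel_sum_smul s n x ha.1]
    have h4 : phiOn ![a, b, c] l 2 = a * phiOnOpposite ![a, b, c] l := by
      fin_cases l <;> simp [phiOn, phiOnOpposite]
    simp only [Fin.sum_univ_three (fun i => phiOn ![a, b, c] l i * _), hu0, hu1, hv0, hv1, h4]
    ring

/-- On an element and an edge with a common vertex the integral is the sum of the regularised
integrals that are approximated by `quadAt`. -/
theorem integral_refPairEdge_at (s : ℝ) (n : Plane) (x : Fin 3 → Plane) (y : Fin 2 → Plane)
    (h0 : x 0 = y 0) (u v : Plane → ℝ)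
    (hint : ∀ l, Integrable (fun η => (if l = 0 then 1 else η 1) *
        (∑ i, phiAt η l i * u (x i)) * (∑ i, phiAt η l i * v (x i)) *
        normalKernel s n (∑ i, psiAt η l i • ![x 0, x 1, x 2, y 1] i))
      (Measure.pi fun i => powMeasure ((![1 - 2 * s, 0, 0] : Fin 3 → ℝ) i))) :
    IntegrableOn (edgeKernel s n x y u v) refPairEdge ∧
      ∫ w in refPairEdge, edgeKernel s n x y u v w =
      1 * ∑ l, ∫ η, (if l = 0 then 1 else η 1) *
        (∑ i, phiAt η l i * u (x i)) * (∑ i, phiAt η l i * v (x i)) *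
        normalKernel s n (∑ i, psiAt η l i • ![x 0, x 1, x 2, y 1] i)
        ∂(Measure.pi fun i => powMeasure ((![1 - 2 * s, 0, 0] : Fin 3 → ℝ) i)) := by
  have hm := measurable_edgeKernel s n x y u v
  refine integral_eq_sum_of_lintegral zero_le_one hm hint fun e => ?_
  rw [ENNReal.ofReal_one, one_mul,
    setLIntegral_refPairEdge_at (f := fun w => ENNReal.ofReal (e * edgeKernel s n x y u v w))
    (by fun_prop), Fin.sum_univ_two]
  have hmeas : ∀ l, Measurable fun η => (∑ i, phiAt η l i * u (x i)) *
      (∑ i, phiAt η l i * v (x i)) *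
        normalKernel s n (∑ i, psiAt η l i • ![x 0, x 1, x 2, y 1] i) := fun l =>
    ((measurable_shape x u (continuous_phiAt l)).mul
      (measurable_shape x v (continuous_phiAt l))).mul
      (measurable_normalKernel_sum s n _ (continuous_psiAt l))
  refine congrArg₂ (fun a b : ENNReal => a + b) ?_ ?_
  · refine setLIntegral_regionPyramid_eq_pi (F := fun w => edgeKernel s n x y u v _)
        (hm.comp (measurable_pi_lambda _ fun i => by fin_cases i <;> simp <;> fun_prop))
        (by simpa using hmeas 0) (fun a ha b hb c hc => ?_) e
    have h2 : ∀ i, ![a * c - a, a - a * b, a * b, -(a * c)] i = a * psiAt ![a, b, c] 0 i := by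
      intro i; fin_cases i <;> simp [psiAt] <;> ring
    have h3 : refBary a (a * b) = phiAt ![a, b, c] 0 := by
      funext i; fin_cases i <;> simp [phiAt, refBary]; ring
    rw [edgeKernel_at s n x y h0]
    simp only [Matrix.cons_val, if_true]
    rw [weight_at ha.1, h3]
    simp only [h2]
    rw [normalKernel_sum_smul s n _ ha.1]
    ring
  · refine setLIntegral_regionTetrahedron_eq_pi (F := fun w => edgeKernel s n x y u v _)
        (hm.comp (measurable_pi_lambda _ fun i => by fin_cases i <;> simp <;> fun_prop))
        (by simpa [mul_assoc, Pi.mul_def] using (measurable_pi_apply 1).mul (hmeas 1))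
        (fun a ha b hb c hc => ?_) e
    have h2 : ∀ i, ![a - a * b, a * b - a * b * c, a * b * c, -a] i = a * psiAt ![a, b, c] 1 i := by
      intro i; fin_cases i <;> simp [psiAt] <;> ring
    have h3 : refBary (a * b) (a * b * c) = phiAt ![a, b, c] 1 := by
      funext i; fin_cases i <;> simp [phiAt, refBary]; ring
    rw [edgeKernel_at s n x y h0]
    simp only [Matrix.cons_val, one_ne_zero, if_false]
    rw [weight_at ha.1, h3]
    simp only [h2]
    rw [normalKernel_sum_smul s n _ ha.1]
    ring

theorem integral_refPairEdge_far (s : ℝ) (n : Plane) (x : Fin 3 → Plane) (y : Fin 2 → Plane)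
    (u v : Plane → ℝ)
    (hint : Integrable (fun η => edgeKernel s n x y u v (conicalPairEdge η))
      (Measure.pi fun i => powMeasure ((![1, 0, 0] : Fin 3 → ℝ) i))) :
    IntegrableOn (edgeKernel s n x y u v) refPairEdge ∧
      ∫ w in refPairEdge, edgeKernel s n x y u v w =
      ∫ η, edgeKernel s n x y u v (conicalPairEdge η)
        ∂(Measure.pi fun i => powMeasure ((![1, 0, 0] : Fin 3 → ℝ) i)) := by
  have hm := measurable_edgeKernel s n x y u v
  have hmc : Measurable fun η => edgeKernel s n x y u v (conicalPairEdge η) :=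
    hm.comp measurable_conicalPairEdge
  have key := integral_eq_sum_of_lintegral (ι := Unit) zero_le_one hm (fun _ => hint)
    (μ := volume.restrict refPairEdge) fun e => ?_
  · simpa [IntegrableOn] using key
  rw [Fintype.sum_unique, ENNReal.ofReal_one, one_mul,
    setLIntegral_nested_three measurableSet_refPairEdge (A := Ioo 0 1) (B := fun a => Ioo 0 a)
    (C := fun _ _ => Ioo 0 1) measurableSet_Ioo
    (fun _ => measurableSet_Ioo) (fun _ _ => measurableSet_Ioo)
    (fun a b c => ?_) (by fun_prop), lintegral_pi_powMeasure_three _ (by fun_prop)]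
  · refine setLIntegral_congr_fun measurableSet_Ioo fun a ha => ?_
    rw [setLIntegral_Ioo_zero a ha.1, ← lintegral_const_mul' _ _ ENNReal.ofReal_ne_top]
    refine setLIntegral_congr_fun measurableSet_Ioo fun b hb => ?_
    rw [← lintegral_const_mul' _ _ ENNReal.ofReal_ne_top]
    refine setLIntegral_congr_fun measurableSet_Ioo fun c hc => ?_
    simp [conicalPairEdge]
  · simp only [refPairEdge, mem_ofPred_eq, mem_Ioo, Matrix.cons_val]
    constructor
    · rintro ⟨h1, h2, h3, h4, h5⟩
      exact ⟨⟨h3.trans h2, h1⟩, ⟨h3, h2⟩, h5, h4⟩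
    · rintro ⟨⟨-, h1⟩, ⟨h3, h2⟩, h5, h4⟩
      exact ⟨h1, h2, h3, h4, h5⟩

end FracQuad

namespace FracQuad

/-! ### Barycentric coordinates on a triangulation -/

/-- `w` are the barycentric coordinates of the point `x` of the simplex with vertex set `K`,
extended by zero to all points of the plane. -/
structure IsBary (K : Finset Plane) (x : Plane) (w : Plane → ℝ) : Prop where
  nonneg : ∀ k, 0 ≤ w k
  support : ∀ k ∉ K, w k = 0
  sum_eq : ∑ k ∈ K, w k = 1
  sum_smul : ∑ k ∈ K, w k • k = x

theorem mem_hull_iff_exists_isBary {K : Finset Plane} {x : Plane} :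
    x ∈ hull K ↔ ∃ w, IsBary K x w := by
  classical
  constructor
  · intro hx
    obtain ⟨w, h0, h1, h2⟩ := Finset.mem_convexHull'.1 hx
    refine ⟨fun k => if k ∈ K then w k else 0, fun k => ?_, fun k hk => if_neg hk, ?_, ?_⟩
    · split_ifs with h
      exacts [h0 k h, le_rfl]
    · rw [← h1]; exact Finset.sum_congr rfl fun k hk => if_pos hk
    · rw [← h2]; exact Finset.sum_congr rfl fun k hk => by rw [if_pos hk]
  · rintro ⟨w, h⟩
    exact Finset.mem_convexHull'.2 ⟨w, fun k _ => h.nonneg k, h.sum_eq, h.sum_smul⟩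

theorem IsBary.mono {K L : Finset Plane} {x : Plane} {w : Plane → ℝ} (h : IsBary K x w)
    (hKL : K ⊆ L) : IsBary L x w := by
  refine ⟨h.nonneg, fun k hk => h.support k fun h' => hk (hKL h'), ?_, ?_⟩
  · rw [← h.sum_eq]
    exact (Finset.sum_subset hKL fun k _ hk => h.support k hk).symm
  · rw [← h.sum_smul]
    exact (Finset.sum_subset hKL fun k _ hk => by rw [h.support k hk, zero_smul]).symm

theorem IsBary.le_one {K : Finset Plane} {x : Plane} {w : Plane → ℝ} (h : IsBary K x w)
    (k : Plane) : w k ≤ 1 := by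
  by_cases hk : k ∈ K
  · rw [← h.sum_eq]
    exact Finset.single_le_sum (fun i _ => h.nonneg i) hk
  · rw [h.support k hk]; exact zero_le_one

theorem IsBary.of_family {ι : Type*} [Fintype ι] {z : ι → Plane} (hz : Function.Injective z)
    {φ : ι → ℝ} (h0 : ∀ i, 0 ≤ φ i) (h1 : ∑ i, φ i = 1) {K : Finset Plane}
    (hK : ∀ i, φ i ≠ 0 → z i ∈ K) : IsBary K (∑ i, φ i • z i) (Function.extend z φ 0) := by
  classical
  have hext : ∀ i, Function.extend z φ 0 (z i) = φ i := fun i => hz.extend_apply _ _ _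
  have hout : ∀ k, k ∉ Finset.univ.image z → Function.extend z φ 0 k = 0 := fun k hk => by
    rw [Function.extend_apply' _ _ _ fun ⟨i, hi⟩ => hk (Finset.mem_image.2 ⟨i, by simp, hi⟩)]
    rfl
  have hsup : ∀ k ∉ K, Function.extend z φ 0 k = 0 := fun k hk => by
    by_cases hk' : k ∈ Finset.univ.image z
    · obtain ⟨i, -, rfl⟩ := Finset.mem_image.1 hk'
      rw [hext]
      by_contra h
      exact hk (hK i h)
    · exact hout k hk'
  have hsum : ∀ {E : Type} [AddCommMonoid E] (F : Plane → E),
      (∀ k, Function.extend z φ 0 k = 0 → F k = 0) → ∑ k ∈ K, F k = ∑ i, F (z i) := by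
    intro E _ F hF
    rw [← Finset.sum_image (f := F) (fun i _ j _ h => hz h),
      Finset.sum_subset (Finset.subset_union_left (s₂ := Finset.univ.image z))
        fun k _ hk => hF k (hsup k hk)]
    exact (Finset.sum_subset Finset.subset_union_right fun k _ hk => hF k (hout k hk)).symm
  refine ⟨fun k => ?_, hsup, ?_, ?_⟩
  · by_cases hk' : k ∈ Finset.univ.image z
    · obtain ⟨i, -, rfl⟩ := Finset.mem_image.1 hk'
      rw [hext]; exact h0 i
    · rw [hout k hk']
  · rw [hsum _ fun k hk => hk, ← h1]
    simp only [hext]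
  · rw [hsum _ fun k hk => by rw [hk, zero_smul]]
    simp only [hext]

/-- A vanishing combination of the vertices of a pair of simplices is a multiple of a difference of
a point of the first and a point of the second simplex, if the signs fit. -/
theorem exists_isBary_of_sum_eq_zero {ι : Type*} [Fintype ι] {z : ι → Plane}
    (hz : Function.Injective z) {ψ : ι → ℝ} (h0 : ∑ i, ψ i = 0) {K L : Finset Plane}
    (hK : ∀ i, 0 < ψ i → z i ∈ K) (hL : ∀ i, ψ i < 0 → z i ∈ L) (hne : ψ ≠ 0) :
    ∃ S : ℝ, 0 < S ∧ ∃ x y w w', IsBary K x w ∧ IsBary L y w' ∧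
      (∀ i, ψ i = S * (w (z i) - w' (z i))) ∧ ∑ i, ψ i • z i = S • (x - y) := by
  have hsplit : ∀ i, ψ i = (ψ i)⁺ - (ψ i)⁻ := fun i => (posPart_sub_negPart _).symm
  set S := ∑ i, (ψ i)⁺ with hS
  have hS' : S = ∑ i, (ψ i)⁻ := by
    rw [hS, ← sub_eq_zero, ← Finset.sum_sub_distrib, ← h0]
    exact Finset.sum_congr rfl fun i _ => (hsplit i).symm
  have hSpos : 0 < S := by
    refine lt_of_le_of_ne (Finset.sum_nonneg fun i _ => posPart_nonneg _) fun h => hne ?_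
    funext i
    have h1 := (Finset.sum_eq_zero_iff_of_nonneg fun i _ => posPart_nonneg (ψ i)).1 h.symm i
      (Finset.mem_univ i)
    have h2 := (Finset.sum_eq_zero_iff_of_nonneg fun i _ => negPart_nonneg (ψ i)).1
      (hS'.symm.trans h.symm) i (Finset.mem_univ i)
    rw [hsplit i, h1, h2, sub_zero, Pi.zero_apply]
  refine ⟨S, hSpos, _, _, _, _, IsBary.of_family hz (φ := fun i => (ψ i)⁺ / S)
    (fun i => div_nonneg (posPart_nonneg _) hSpos.le) (by rw [← Finset.sum_div, ← hS, div_self hSpos.ne'])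
    (fun i hi => hK i (not_le.1 fun h => hi (by rw [posPart_eq_zero.2 h, zero_div]))),
    IsBary.of_family hz (φ := fun i => (ψ i)⁻ / S)
    (fun i => div_nonneg (negPart_nonneg _) hSpos.le)
    (by rw [← Finset.sum_div, ← hS', div_self hSpos.ne'])
    (fun i hi => hL i (not_le.1 fun h => hi (by rw [negPart_eq_zero.2 h, zero_div]))), ?_, ?_⟩
  · intro i
    rw [hz.extend_apply, hz.extend_apply, ← sub_div, ← hsplit i]
    field_simp
  · rw [← Finset.sum_sub_distrib, Finset.smul_sum]
    refine Finset.sum_congr rfl fun i _ => ?_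
    rw [← sub_smul, smul_smul, ← sub_div, ← hsplit i, mul_div_cancel₀ _ hSpos.ne']

namespace Triangulation

variable {Ω : Set Plane} (T : Triangulation Ω)

theorem mem_elements {K : Finset Plane} : K ∈ T.elements ↔ K ∈ T.faces ∧ K.card = 3 := by
  simp [elements]

theorem mem_boundaryEdges {e : Finset Plane} :
    e ∈ T.boundaryEdges ↔ e ∈ T.faces ∧ e.card = 2 ∧ hull e ⊆ frontier Ω := by
  simp [boundaryEdges]

theorem eq_zero_of_face {K : Finset Plane} (hK : K ∈ T.faces) {d : Plane → ℝ}
    (h0 : ∑ k ∈ K, d k = 0) (h1 : ∑ k ∈ K, d k • k = 0) : ∀ k ∈ K, d k = 0 := by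
  have h := affineIndependent_iff.1 (T.indep hK) Finset.univ (fun k => d k)
    (by rw [← h0]; exact Finset.sum_coe_sort K d)
    (by rw [← h1]; exact Finset.sum_coe_sort K fun k => d k • k)
  exact fun k hk => h ⟨k, hk⟩ (Finset.mem_univ _)

/-- Since simplices meet in common faces, the barycentric coordinates of a point do not depend on
the simplex that is used to compute them. -/
theorem isBary_unique {K L : Finset Plane} (hK : K ∈ T.faces) (hL : L ∈ T.faces) {x : Plane}
    {w w' : Plane → ℝ} (h : IsBary K x w) (h' : IsBary L x w') : w = w' := by
  classical
  have hx : x ∈ hull (K ∩ L) := by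
    unfold hull
    rw [Finset.coe_inter]
    exact T.inter_subset_convexHull hK hL
      ⟨mem_hull_iff_exists_isBary.2 ⟨w, h⟩, mem_hull_iff_exists_isBary.2 ⟨w', h'⟩⟩
  obtain ⟨w₀, h₀⟩ := mem_hull_iff_exists_isBary.1 hx
  have key : ∀ {M : Finset Plane} {w : Plane → ℝ}, M ∈ T.faces → K ∩ L ⊆ M → IsBary M x w →
      w = w₀ := by
    intro M w hM hsub hw
    have hw₀ := h₀.mono hsub
    funext k
    by_cases hk : k ∈ M
    · have := T.eq_zero_of_face hM (d := fun k => w k - w₀ k)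
        (by rw [Finset.sum_sub_distrib, hw.sum_eq, hw₀.sum_eq, sub_self])
        (by simp only [sub_smul]; rw [Finset.sum_sub_distrib, hw.sum_smul, hw₀.sum_smul, sub_self])
        k hk
      linarith
    · rw [hw.support k hk, hw₀.support k hk]
  rw [key hK Finset.inter_subset_left h, key hL Finset.inter_subset_right h']

open Classical in
/-- The barycentric coordinates of a point of the closed domain: `T.bary x k` is the value at `x`
of the nodal hat function of the vertex `k`. -/
noncomputable def bary (x : Plane) : Plane → ℝ :=
  if h : ∃ w, ∃ K ∈ T.faces, IsBary K x w then h.choose else 0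

theorem bary_eq {K : Finset Plane} (hK : K ∈ T.faces) {x : Plane} {w : Plane → ℝ}
    (h : IsBary K x w) : T.bary x = w := by
  have hex : ∃ w, ∃ K ∈ T.faces, IsBary K x w := ⟨w, K, hK, h⟩
  rw [bary, dif_pos hex]
  obtain ⟨L, hL, hL'⟩ := hex.choose_spec
  exact T.isBary_unique hL hK hL' h

theorem isBary_bary {K : Finset Plane} (hK : K ∈ T.faces) {x : Plane} (hx : x ∈ hull K) :
    IsBary K x (T.bary x) := by
  obtain ⟨w, h⟩ := mem_hull_iff_exists_isBary.1 hx
  rwa [T.bary_eq hK h]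

theorem hull_subset_closure {K : Finset Plane} (hK : K ∈ T.faces) : hull K ⊆ closure Ω := by
  rw [← T.space_eq]
  exact T.toSimplicialComplex.convexHull_subset_space hK

end Triangulation

theorem isCompact_hull (K : Finset Plane) : IsCompact (hull K) :=
  K.finite_toSet.isCompact_convexHull (𝕜 := ℝ)

theorem convex_hull (K : Finset Plane) : Convex ℝ (hull K) := convex_convexHull ℝ _

theorem volume_hull_of_card_le_two {K : Finset Plane} (hK : K.card ≤ 2) :
    volume (hull K) = 0 := by
  refine measure_mono_null (convexHull_subset_affineSpan (𝕜 := ℝ) (K : Set Plane))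
    (Measure.addHaar_affineSubspace volume _ fun h => ?_)
  rcases K.eq_empty_or_nonempty with rfl | hne
  · simp only [Finset.coe_empty, AffineSubspace.span_empty] at h
    exact AffineSubspace.bot_ne_top ℝ Plane Plane h
  · have h1 := finrank_vectorSpan_image_finset_le ℝ (id : Plane → Plane) K (n := K.card - 1)
      (by have := hne.card_pos; omega)
    have h2 : vectorSpan ℝ (K : Set Plane) = ⊤ := by
      rw [← direction_affineSpan, h, AffineSubspace.direction_top]
    rw [Finset.coe_image, image_id] at h1
    rw [h2, finrank_top, finrank_euclideanSpace_fin] at h1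
    omega

namespace Triangulation

variable {Ω : Set Plane} (T : Triangulation Ω)

theorem card_face_le {K : Finset Plane} (hK : K ∈ T.faces) : K.card ≤ 3 := by
  have h := (T.indep hK).card_le_finrank_succ
  have h2 := (vectorSpan ℝ (range ((↑) : K → Plane))).finrank_le
  rw [finrank_euclideanSpace_fin] at h2
  simp only [Fintype.card_coe] at h
  omega

/-- The triangles alone cover the closed domain. -/
theorem closure_eq_iUnion (hΩ : IsOpen Ω) : closure Ω = ⋃ K ∈ T.elements, hull K := by
  classical
  refine Subset.antisymm ?_ (iUnion₂_subset fun K hK => T.hull_subset_closure (T.mem_elements.1 hK).1)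
  have hcl : IsClosed (⋃ K ∈ T.elements, hull K) :=
    T.elements.finite_toSet.isClosed_biUnion fun K _ => (isCompact_hull K).isClosed
  refine closure_minimal ?_ hcl
  have hnull : volume (Ω \ ⋃ K ∈ T.elements, hull K) = 0 := by
    refine measure_mono_null (t := ⋃ K ∈ T.finite_faces.toFinset.filter fun K => K.card ≤ 2, hull K)
      ?_ ?_
    · rintro x ⟨hx, hx'⟩
      have h1 : x ∈ T.space := by rw [T.space_eq]; exact subset_closure hx
      obtain ⟨K, hK, hxK⟩ := Geometry.SimplicialComplex.mem_space_iff.1 h1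
      simp only [mem_iUnion, Finset.mem_filter, Finite.mem_toFinset, exists_prop, not_exists,
        not_and] at hx' ⊢
      refine ⟨K, ⟨hK, ?_⟩, hxK⟩
      have := T.card_face_le hK
      by_contra h
      exact hx' K (T.mem_elements.2 ⟨hK, by omega⟩) hxK
    · refine (measure_biUnion_null_iff (Finset.countable_toSet _)).2 fun K hK => ?_
      exact volume_hull_of_card_le_two (by simpa using (Finset.mem_filter.1 hK).2)
  have := (hΩ.sdiff hcl).eq_empty_of_measure_zero hnull
  exact sdiff_eq_empty.1 this

end Triangulation

/-- A function that is Lipschitz on each of finitely many closed convex sets is Lipschitz along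
every segment covered by them. -/
theorem abs_sub_le_of_segment_subset {ι : Type*} [Finite ι] {A : ι → Set Plane}
    (hcl : ∀ i, IsClosed (A i)) (hcv : ∀ i, Convex ℝ (A i)) {f : Plane → ℝ} {M : ℝ} (hM : 0 ≤ M)
    (hf : ∀ i, ∀ x ∈ A i, ∀ y ∈ A i, |f x - f y| ≤ M * ‖x - y‖) {x y : Plane}
    (hxy : segment ℝ x y ⊆ ⋃ i, A i) : |f y - f x| ≤ M * ‖y - x‖ := by
  set γ : ℝ → Plane := fun t => x + t • (y - x) with hγ
  have hγc : Continuous γ := by fun_prop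
  have hmem : ∀ t ∈ Icc (0 : ℝ) 1, γ t ∈ ⋃ i, A i := fun t ht => hxy (by
    rw [segment_eq_image']; exact ⟨t, ht, rfl⟩)
  have hfc : ContinuousOn f (⋃ i, A i) := by
    refine (locallyFinite_of_finite A).continuousOn_iUnion hcl fun i => ?_
    refine (LipschitzOnWith.of_dist_le_mul (K := M.toNNReal) fun a ha b hb => ?_).continuousOn
    rw [Real.dist_eq, dist_eq_norm, Real.coe_toNNReal _ hM]
    exact hf i a ha b hb
  have hγd : ∀ t t', ‖γ t' - γ t‖ = |t' - t| * ‖y - x‖ := fun t t' => by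
    rw [show γ t' - γ t = (t' - t) • (y - x) by simp only [hγ]; module, norm_smul, Real.norm_eq_abs]
  -- real induction along the segment: the estimate persists to the right of each point
  have hsub : Icc (0 : ℝ) 1 ⊆ {t | |f (γ t) - f x| ≤ M * (t * ‖y - x‖)} := by
    refine IsClosed.Icc_subset_of_forall_mem_nhdsWithin ?_ (by simp [hγ]) ?_
    · have h1 : ContinuousOn (fun t => |f (γ t) - f x|) (Icc 0 1) :=
        ((hfc.comp hγc.continuousOn hmem).sub continuousOn_const).abs
      have h2 : ContinuousOn (fun t : ℝ => M * (t * ‖y - x‖)) (Icc 0 1) := by fun_prop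
      have := isClosed_Icc.isClosed_le h1 h2
      convert this using 1
      ext t; simp [and_comm]
    · rintro t ⟨ht, ht0, ht1⟩
      -- one of the finitely many pieces meets the segment arbitrarily close to the right of `t`
      obtain ⟨i, hi⟩ : ∃ i, ∃ᶠ t' in nhdsWithin t (Ioi t), γ t' ∈ A i := by
        by_contra! hcon
        have h1 := Filter.eventually_all.2 hcon
        have h2 : ∀ᶠ t' in nhdsWithin t (Ioi t), t' ∈ Ioo t 1 := Ioo_mem_nhdsGT ht1
        obtain ⟨t', h3, h4⟩ := (h1.and h2).exists
        obtain ⟨i, hi⟩ := mem_iUnion.1 (hmem t' ⟨(ht0.trans_lt h4.1).le, h4.2.le⟩)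
        exact h3 i hi
      have htA : γ t ∈ A i := by
        refine (hcl i).closure_subset_iff.2 Subset.rfl ?_
        refine mem_closure_of_frequently_of_tendsto hi ?_
        exact (hγc.tendsto t).mono_left nhdsWithin_le_nhds
      obtain ⟨t₁, ht₁, ht₁'⟩ := (hi.and_eventually self_mem_nhdsWithin).exists
      refine Filter.mem_of_superset (Ioc_mem_nhdsGT ht₁') fun t' ht' => ?_
      have hA : γ t' ∈ A i := by
        refine (hcv i).segment_subset htA ht₁ ?_
        have hpos : 0 < t₁ - t := sub_pos.2 ht₁'
        rw [segment_eq_image']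
        refine ⟨(t' - t) / (t₁ - t), ⟨div_nonneg (by linarith [ht'.1]) hpos.le,
          (div_le_one hpos).2 (by linarith [ht'.2])⟩, ?_⟩
        simp only [hγ]
        rw [show x + t₁ • (y - x) - (x + t • (y - x)) = (t₁ - t) • (y - x) by module, smul_smul,
          div_mul_cancel₀ _ hpos.ne']
        module
      have h1 := hf i _ hA _ htA
      rw [hγd, abs_of_pos (sub_pos.2 ht'.1)] at h1
      calc |f (γ t') - f x| ≤ |f (γ t') - f (γ t)| + |f (γ t) - f x| := abs_sub_le _ _ _
        _ ≤ M * ((t' - t) * ‖y - x‖) + M * (t * ‖y - x‖) := add_le_add h1 ht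
        _ = M * (t' * ‖y - x‖) := by ring
  have := hsub (right_mem_Icc.2 zero_le_one)
  simpa [hγ] using this

end FracQuad

namespace FracQuad

namespace Triangulation

variable {Ω : Set Plane} (T : Triangulation Ω)

/-! ### Quasi-convexity of the domain and regular meshes -/

/-- By compactness, the vertices of a pair of simplices are uniformly independent with respect to
coefficients whose signs separate the simplices. -/
theorem exists_cone_bound [DecidableEq Plane] {K L : Finset Plane} (hK : K ∈ T.faces)
    (hL : L ∈ T.faces) :
    ∃ c : ℝ, 0 < c ∧ ∀ ψ : ↥(K ∪ L) → ℝ, ∑ i, ψ i = 0 →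
      (∀ i, i.1 ∉ L → 0 ≤ ψ i) → (∀ i, i.1 ∉ K → ψ i ≤ 0) →
      c * ‖ψ‖ ≤ ‖∑ i, ψ i • i.1‖ := by
  set N : Set (↥(K ∪ L) → ℝ) := {ψ | ∑ i, ψ i = 0 ∧ (∀ i, i.1 ∉ L → 0 ≤ ψ i) ∧
    ∀ i, i.1 ∉ K → ψ i ≤ 0} ∩ Metric.sphere 0 1 with hN
  have hNc : IsCompact N := by
    refine (isCompact_sphere _ _).inter_left ?_
    simp only [ofPred_and, ofPred_forall]
    refine (isClosed_eq (by fun_prop) continuous_const).inter (IsClosed.inter ?_ ?_)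
    · exact isClosed_iInter fun i => isClosed_iInter fun _ =>
        isClosed_le continuous_const (continuous_apply i)
    · exact isClosed_iInter fun i => isClosed_iInter fun _ =>
        isClosed_le (continuous_apply i) continuous_const
  have hg : Continuous fun ψ : ↥(K ∪ L) → ℝ => ‖∑ i, ψ i • i.1‖ := by fun_prop
  have hpos : ∀ ψ ∈ N, 0 < ‖∑ i, ψ i • i.1‖ := by
    rintro ψ ⟨⟨h0, h1, h2⟩, h3⟩
    refine norm_pos_iff.2 fun hz => ?_
    have hne : ψ ≠ 0 := fun h => by simp [h] at h3
    obtain ⟨S, hS, x, y, w, w', hw, hw', hψ, hsum⟩ := exists_isBary_of_sum_eq_zero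
      Subtype.val_injective h0 (K := K) (L := L)
      (fun i hi => by_contra fun h => (h2 i h).not_gt hi)
      (fun i hi => by_contra fun h => (h1 i h).not_gt hi) hne
    rw [hz, eq_comm, smul_eq_zero_iff_right hS.ne', sub_eq_zero] at hsum
    subst hsum
    rw [T.isBary_unique hK hL hw hw'] at hψ
    exact hne (funext fun i => by rw [hψ, sub_self, mul_zero]; rfl)
  have hmin : ∃ c : ℝ, 0 < c ∧ ∀ ψ ∈ N, c ≤ ‖∑ i, ψ i • i.1‖ := by
    rcases N.eq_empty_or_nonempty with h | h
    · exact ⟨1, one_pos, by simp [h]⟩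
    · obtain ⟨ψ₀, h₀, hmin⟩ := hNc.exists_isMinOn h hg.continuousOn
      exact ⟨_, hpos ψ₀ h₀, fun ψ hψ => hmin hψ⟩
  obtain ⟨c, hc, hcm⟩ := hmin
  refine ⟨c, hc, fun ψ h0 h1 h2 => ?_⟩
  rcases eq_or_ne ψ 0 with rfl | hne
  · simp
  have hn : 0 < ‖ψ‖ := norm_pos_iff.2 hne
  have hn' : 0 ≤ ‖ψ‖⁻¹ := inv_nonneg.2 hn.le
  have := hcm (‖ψ‖⁻¹ • ψ) ⟨⟨?_, fun i hi => ?_, fun i hi => ?_⟩, ?_⟩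
  · simp only [Pi.smul_apply, smul_assoc] at this
    rw [← Finset.smul_sum, norm_smul, norm_inv, norm_norm, inv_mul_eq_div, le_div_iff₀ hn] at this
    exact this
  · simp only [Pi.smul_apply, smul_eq_mul]
    rw [← Finset.mul_sum, h0, mul_zero]
  · exact mul_nonneg hn' (h1 i hi)
  · exact mul_nonpos_of_nonneg_of_nonpos hn' (h2 i hi)
  · rw [mem_sphere_zero_iff_norm, norm_smul, norm_inv, norm_norm, inv_mul_cancel₀ hn.ne']

/-- Two points of a pair of simplices of a triangulation can be joined inside the pair by a
polygonal path with at most two pieces whose length is comparable to their distance, if they are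
close to each other: the corner of the path is taken on the common face. -/
theorem exists_waypoint_of_faces {K L : Finset Plane} (hK : K ∈ T.faces) (hL : L ∈ T.faces) :
    ∃ δ C : ℝ, 0 < δ ∧ 0 < C ∧ ∀ x ∈ hull K, ∀ y ∈ hull L, ‖x - y‖ ≤ δ →
      ∃ z ∈ hull K ∩ hull L, ‖x - z‖ + ‖z - y‖ ≤ C * ‖x - y‖ := by
  classical
  obtain ⟨c, hc, hcone⟩ := T.exists_cone_bound hK hL
  obtain ⟨R, hR⟩ := (K ∪ L).finite_toSet.isBounded.exists_norm_le
  set n : ℝ := ((K ∪ L).card : ℝ) with hn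
  have hn0 : 0 ≤ n := Nat.cast_nonneg _
  set R' : ℝ := max R 1 with hR'
  have hR'1 : 1 ≤ R' := le_max_right _ _
  refine ⟨c / (2 * (n + 1)), 4 * R' * (n + 1) / c, by positivity, by positivity,
    fun x hx y hy hxy => ?_⟩
  set a := T.bary x with ha
  set b := T.bary y with hb
  have hxa := T.isBary_bary hK hx
  have hyb := T.isBary_bary hL hy
  have hxU := hxa.mono (Finset.subset_union_left (s₂ := L))
  have hyU := hyb.mono (Finset.subset_union_right (s₁ := K))
  rw [← ha] at hxa hxU
  rw [← hb] at hyb hyU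
  have hdiff : ∀ k ∈ K ∪ L, |a k - b k| ≤ ‖x - y‖ / c := by
    intro k hk
    have h1 := hcone (fun i => a i - b i)
      (by rw [Finset.sum_coe_sort (K ∪ L) fun k => a k - b k, Finset.sum_sub_distrib, hxU.sum_eq,
            hyU.sum_eq, sub_self])
      (fun i hi => by rw [hyb.support _ hi, sub_zero]; exact hxa.nonneg _)
      (fun i hi => by rw [hxa.support _ hi, zero_sub]; exact neg_nonpos.2 (hyb.nonneg _))
    rw [Finset.sum_coe_sort (K ∪ L) fun k => (a k - b k) • k] at h1
    simp only [sub_smul] at h1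
    rw [Finset.sum_sub_distrib, hxU.sum_smul, hyU.sum_smul] at h1
    rw [le_div_iff₀ hc, mul_comm]
    refine le_trans (mul_le_mul_of_nonneg_left ?_ hc.le) h1
    exact norm_le_pi_norm (fun i : ↥(K ∪ L) => a i - b i) ⟨k, hk⟩
  -- the corner of the path: its barycentric coordinates are proportional to the minimum of those
  -- of `x` and `y` and hence supported on the common vertices
  set m : Plane → ℝ := fun k => min (a k) (b k) with hm
  have hm0 : ∀ k, 0 ≤ m k := fun k => le_min (hxa.nonneg k) (hyb.nonneg k)
  set M := ∑ k ∈ K ∪ L, m k with hM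
  set e := ‖x - y‖ / c with he
  have he0 : 0 ≤ e := by positivity
  have hMlow : 1 - M ≤ n * e := by
    rw [← hxU.sum_eq, hM, ← Finset.sum_sub_distrib]
    calc ∑ k ∈ K ∪ L, (a k - m k) ≤ ∑ k ∈ K ∪ L, e := Finset.sum_le_sum fun k hk => by
          refine le_trans ?_ (hdiff k hk)
          simp only [hm]
          rcases le_total (a k) (b k) with h | h
          · rw [min_eq_left h, sub_self]; positivity
          · rw [min_eq_right h]; exact le_abs_self _
      _ = n * e := by rw [Finset.sum_const, nsmul_eq_mul]
  have hne : n * e ≤ 1 / 2 := by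
    have h1 : e ≤ 1 / (2 * (n + 1)) := by
      rw [he, div_le_iff₀ hc]
      calc _ ≤ _ := hxy
        _ = _ := by ring
    calc n * e ≤ n * (1 / (2 * (n + 1))) := by gcongr
      _ ≤ 1 / 2 := by
        rw [mul_one_div, div_le_div_iff₀ (by positivity) two_pos]; linarith
  have hMpos : 0 < M := by linarith
  have hM1 : M ≤ 1 := by
    rw [← hxU.sum_eq]; exact Finset.sum_le_sum fun k _ => min_le_left _ _
  have hz : ∀ F : Finset Plane, F ⊆ K ∪ L → (∀ k ∉ F, m k = 0) →
      IsBary F (∑ k ∈ K ∪ L, (m k / M) • k) fun k => m k / M := by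
    intro F hF hFm
    refine ⟨fun k => div_nonneg (hm0 k) hMpos.le, fun k hk => by rw [hFm k hk, zero_div], ?_, ?_⟩
    · rw [Finset.sum_subset hF fun k _ hk => by rw [hFm k hk, zero_div], ← Finset.sum_div,
        div_self hMpos.ne']
    · exact Finset.sum_subset hF fun k _ hk => by rw [hFm k hk, zero_div, zero_smul]
  have hdist : ∀ {p : Plane} {w : Plane → ℝ}, IsBary (K ∪ L) p w → (∀ k, m k ≤ w k) →
      ‖p - ∑ k ∈ K ∪ L, (m k / M) • k‖ ≤ 2 * R' * (n * e) := by
    intro p w hw hmw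
    nth_rewrite 1 [← hw.sum_smul]
    rw [← Finset.sum_sub_distrib]
    calc ‖∑ k ∈ K ∪ L, (w k • k - (m k / M) • k)‖
        ≤ ∑ k ∈ K ∪ L, ((w k - m k) + (m k / M - m k)) * R' := by
          refine norm_sum_le_of_le _ fun k hk => ?_
          rw [← sub_smul, norm_smul]
          have hkR : ‖k‖ ≤ R' := (hR k hk).trans (le_max_left _ _)
          have h1 : m k ≤ m k / M := by
            rw [le_div_iff₀ hMpos]; exact mul_le_of_le_one_right (hm0 k) hM1
          have h2 := hmw k
          refine mul_le_mul ?_ hkR (norm_nonneg _) (by linarith)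
          rw [Real.norm_eq_abs, abs_le]
          constructor <;> linarith
      _ = ((1 - M) + (1 - M)) * R' := by
          rw [← Finset.sum_mul, Finset.sum_add_distrib, Finset.sum_sub_distrib,
            Finset.sum_sub_distrib, hw.sum_eq, ← Finset.sum_div, div_self hMpos.ne']
      _ ≤ (n * e + n * e) * R' := by gcongr
      _ = 2 * R' * (n * e) := by ring
  refine ⟨∑ k ∈ K ∪ L, (m k / M) • k, ⟨?_, ?_⟩, ?_⟩
  · exact mem_hull_iff_exists_isBary.2 ⟨_, hz K Finset.subset_union_left fun k hk =>
      le_antisymm ((min_le_left _ _).trans (hxa.support k hk).le) (hm0 k)⟩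
  · exact mem_hull_iff_exists_isBary.2 ⟨_, hz L Finset.subset_union_right fun k hk =>
      le_antisymm ((min_le_right _ _).trans (hyb.support k hk).le) (hm0 k)⟩
  · have h1 := hdist hxU fun k => min_le_left _ _
    have h2 := hdist hyU fun k => min_le_right _ _
    rw [norm_sub_rev] at h2
    calc _ ≤ 2 * R' * (n * e) + 2 * R' * (n * e) := add_le_add h1 h2
      _ ≤ 2 * R' * ((n + 1) * e) + 2 * R' * ((n + 1) * e) := by gcongr <;> linarith
      _ = 4 * R' * (n + 1) / c * ‖x - y‖ := by rw [he]; ring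

/-- The closed domain is locally quasi-convex. -/
theorem exists_waypoint (T : Triangulation Ω) (hΩ : IsOpen Ω) : ∃ δ C : ℝ, 0 < δ ∧ 0 < C ∧
    ∀ x ∈ closure Ω, ∀ y ∈ closure Ω, ‖x - y‖ ≤ δ → ∃ z, segment ℝ x z ⊆ closure Ω ∧
      segment ℝ z y ⊆ closure Ω ∧ ‖x - z‖ + ‖z - y‖ ≤ C * ‖x - y‖ := by
  classical
  have h : ∀ p : ↥(T.elements ×ˢ T.elements), ∃ q : ℝ × ℝ, 0 < q.1 ∧ 0 < q.2 ∧
      ∀ x ∈ hull p.1.1, ∀ y ∈ hull p.1.2, ‖x - y‖ ≤ q.1 →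
      ∃ z ∈ hull p.1.1 ∩ hull p.1.2, ‖x - z‖ + ‖z - y‖ ≤ q.2 * ‖x - y‖ := by
    rintro ⟨⟨K, L⟩, hp⟩
    obtain ⟨hK, hL⟩ := Finset.mem_product.1 hp
    obtain ⟨δ, C, hδ, hC, h⟩ := T.exists_waypoint_of_faces (T.mem_elements.1 hK).1
      (T.mem_elements.1 hL).1
    exact ⟨(δ, C), hδ, hC, h⟩
  choose q hq1 hq2 hq using h
  obtain ⟨δ, hδ, hδq⟩ : ∃ δ > 0, ∀ p, δ ≤ (q p).1 := by
    rcases isEmpty_or_nonempty ↥(T.elements ×ˢ T.elements) with h | h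
    · exact ⟨1, one_pos, fun p => h.elim p⟩
    · obtain ⟨p, hp⟩ := Finite.exists_min fun p => (q p).1
      exact ⟨_, hq1 p, hp⟩
  obtain ⟨C, hC, hCq⟩ : ∃ C > 0, ∀ p, (q p).2 ≤ C := by
    rcases isEmpty_or_nonempty ↥(T.elements ×ˢ T.elements) with h | h
    · exact ⟨1, one_pos, fun p => h.elim p⟩
    · obtain ⟨p, hp⟩ := Finite.exists_max fun p => (q p).2
      exact ⟨_, hq2 p, hp⟩
  refine ⟨δ, C, hδ, hC, fun x hx y hy hxy => ?_⟩
  rw [T.closure_eq_iUnion hΩ] at hx hy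
  obtain ⟨K, hK, hxK⟩ := mem_iUnion₂.1 hx
  obtain ⟨L, hL, hyL⟩ := mem_iUnion₂.1 hy
  have hK' := (T.mem_elements.1 hK).1
  have hL' := (T.mem_elements.1 hL).1
  obtain ⟨z, hz, hzC⟩ := hq ⟨(K, L), Finset.mem_product.2 ⟨hK, hL⟩⟩ x hxK y hyL
    (hxy.trans (hδq _))
  exact ⟨z, ((convex_hull K).segment_subset hxK hz.1).trans (T.hull_subset_closure hK'),
    ((convex_hull L).segment_subset hz.2 hyL).trans (T.hull_subset_closure hL'),
    hzC.trans (mul_le_mul_of_nonneg_right (hCq _) (norm_nonneg _))⟩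

/-- Every triangle of the mesh contains a disc whose diameter is at least the mesh size divided
by `Λ`. -/
structure Regular (Λ : ℝ) : Prop where
  pos : 0 < T.meshSize
  diam_le : ∀ K ∈ T.elements, Metric.diam (hull K) ≤ T.meshSize
  disc : ∀ K ∈ T.elements, ∃ (c : Plane) (r : ℝ), 0 < r ∧ Metric.closedBall c r ⊆ hull K ∧
    T.meshSize ≤ Λ * (2 * r)
  nonempty : T.elements.Nonempty

theorem two_mul_le_diam {K : Finset Plane} {c : Plane} {r : ℝ} (hr : 0 < r)
    (h : Metric.closedBall c r ⊆ hull K) : 2 * r ≤ Metric.diam (hull K) := by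
  have h1 := Metric.diam_mono h (isCompact_hull K).isBounded
  rwa [Metric.diam_closedBall_eq c hr.le] at h1

theorem regular_of_shapeRegular (hΩ : IsPolygon Ω) {σ τ : ℝ} (hσ : T.ShapeRegular σ)
    (hτ : T.QuasiUniform τ) : T.Regular (σ * τ) := by
  have hne : T.elements.Nonempty := by
    obtain ⟨x, hx⟩ := hΩ.isConnected.nonempty
    have := subset_closure hx
    rw [T.closure_eq_iUnion hΩ.isOpen] at this
    obtain ⟨K, hK, -⟩ := mem_iUnion₂.1 this
    exact ⟨K, hK⟩
  have hdiam : ∀ K ∈ T.elements, Metric.diam (hull K) ≤ T.meshSize := fun K hK =>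
    le_ciSup (f := fun K : T.elements => Metric.diam (hull K.1)) (Set.finite_range _).bddAbove
      ⟨K, hK⟩
  have hpos : 0 < T.meshSize := by
    obtain ⟨K, hK⟩ := hne
    obtain ⟨c, r, hr, hball, -⟩ := hσ K hK
    have := two_mul_le_diam hr hball
    linarith [hdiam K hK]
  refine ⟨hpos, hdiam, fun K hK => ?_, hne⟩
  obtain ⟨c, r, hr, hball, hd⟩ := hσ K hK
  refine ⟨c, r, hr, hball, (hτ K hK).trans ?_⟩
  have h1 := two_mul_le_diam hr hball
  have h2 : 0 < τ := by
    by_contra! h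
    have := hτ K hK
    nlinarith
  calc τ * Metric.diam (hull K) ≤ τ * (σ * (2 * r)) := by gcongr
    _ = σ * τ * (2 * r) := by ring

variable {T} in
theorem Regular.one_le {Λ : ℝ} (h : T.Regular Λ) : 1 ≤ Λ := by
  obtain ⟨K, hK⟩ := h.nonempty
  obtain ⟨c, r, hr, hball, hd⟩ := h.disc K hK
  have h1 := (two_mul_le_diam hr hball).trans (h.diam_le K hK)
  by_contra! hcon
  nlinarith

/-- The slope of the hat functions on each element is controlled by the inscribed disc, because
their values lie in the unit interval. -/
theorem Regular.abs_bary_sub_le_of_mem {T : Triangulation Ω} {Λ : ℝ} (h : T.Regular Λ)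
    {K : Finset Plane}
    (hK : K ∈ T.elements) {x y : Plane} (hx : x ∈ hull K) (hy : y ∈ hull K) (k : Plane) :
    |T.bary x k - T.bary y k| ≤ Λ / T.meshSize * ‖x - y‖ := by
  obtain ⟨c, r, hr, hball, hd⟩ := h.disc K hK
  have hK' := (T.mem_elements.1 hK).1
  have hbx := T.isBary_bary hK' hx
  have hby := T.isBary_bary hK' hy
  have hΛ := h.one_le
  have hpos := h.pos
  rcases eq_or_ne x y with rfl | hne
  · simp
  have hn : 0 < ‖x - y‖ := norm_pos_iff.2 (sub_ne_zero.2 hne)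
  by_cases hk : k ∈ K
  swap
  · rw [hbx.support k hk, hby.support k hk, sub_self, abs_zero]; positivity
  -- compare with the diameter of the inscribed disc parallel to `x - y`
  set v := (r / ‖x - y‖) • (x - y) with hv
  have hvn : ‖v‖ = r := by
    rw [hv, norm_smul, Real.norm_of_nonneg (by positivity), div_mul_cancel₀ _ hn.ne']
  have hp : c + v ∈ hull K := hball (by simp [hvn])
  have hm : c - v ∈ hull K := hball (by simp [hvn])
  have hbp := T.isBary_bary hK' hp
  have hbm := T.isBary_bary hK' hm
  set q := ‖x - y‖ / (2 * r) with hq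
  have key := T.eq_zero_of_face hK'
    (d := fun k => T.bary x k - T.bary y k - q * (T.bary (c + v) k - T.bary (c - v) k))
    (by
      simp only [Finset.sum_sub_distrib, ← Finset.mul_sum, hbx.sum_eq, hby.sum_eq, hbp.sum_eq,
        hbm.sum_eq]
      ring)
    (by
      simp only [sub_smul, mul_smul, Finset.sum_sub_distrib, ← Finset.smul_sum, hbx.sum_smul,
        hby.sum_smul, hbp.sum_smul, hbm.sum_smul]
      rw [show c + v - (c - v) = (2 : ℝ) • v by module, hv, smul_smul, smul_smul,
        show q * 2 * (r / ‖x - y‖) = 1 by rw [hq]; field_simp, one_smul, sub_self]) k hk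
  have h1 : T.bary x k - T.bary y k = q * (T.bary (c + v) k - T.bary (c - v) k) := by linarith
  have h2 : |T.bary (c + v) k - T.bary (c - v) k| ≤ 1 := by
    rw [abs_le]
    constructor <;> linarith [hbp.nonneg k, hbp.le_one k, hbm.nonneg k, hbm.le_one k]
  have hq0 : 0 ≤ q := by positivity
  rw [h1, abs_mul, abs_of_nonneg hq0]
  calc q * _ ≤ q * 1 := by gcongr
    _ = 1 / (2 * r) * ‖x - y‖ := by rw [hq]; ring
    _ ≤ Λ / T.meshSize * ‖x - y‖ := by
      refine mul_le_mul_of_nonneg_right ?_ hn.le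
      rw [div_le_div_iff₀ (by positivity) hpos]
      linarith

theorem Regular.meshSize_le {T : Triangulation Ω} {Λ : ℝ} (h : T.Regular Λ)
    (hΩ : Bornology.IsBounded Ω) : T.meshSize ≤ Metric.diam (closure Ω) := by
  have : Nonempty T.elements := h.nonempty.to_subtype
  exact ciSup_le fun K => Metric.diam_mono (T.hull_subset_closure (T.mem_elements.1 K.2).1)
    hΩ.closure

/-- The hat functions of regular meshes are Lipschitz on the closed domain, with a constant
inversely proportional to the mesh size. -/
theorem exists_abs_bary_sub_le (hΩ : IsPolygon Ω) (T₀ : Triangulation Ω) (Λ : ℝ) :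
    ∃ C : ℝ, 0 < C ∧ ∀ T : Triangulation Ω, T.Regular Λ → ∀ x ∈ closure Ω, ∀ y ∈ closure Ω,
      ∀ k, |T.bary x k - T.bary y k| ≤ C / T.meshSize * ‖x - y‖ := by
  obtain ⟨δ, C, hδ, hC, hway⟩ := T₀.exists_waypoint hΩ.isOpen
  set D := Metric.diam (closure Ω) with hD
  have hD0 : 0 ≤ D := Metric.diam_nonneg
  refine ⟨(|Λ| + 1) * C + D / δ, by positivity, fun T hT x hx y hy k => ?_⟩
  have hpos := hT.pos
  have hΛ := hT.one_le
  rw [abs_of_pos (show 0 < Λ by linarith)]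
  have hcov : closure Ω = ⋃ K : T.elements, hull K.1 := by
    rw [T.closure_eq_iUnion hΩ.isOpen, iUnion_subtype]
  have hseg : ∀ {p q : Plane}, segment ℝ p q ⊆ closure Ω →
      |T.bary q k - T.bary p k| ≤ Λ / T.meshSize * ‖q - p‖ := fun {p q} hpq =>
    abs_sub_le_of_segment_subset (A := fun K : T.elements => hull K.1) (f := fun x => T.bary x k)
      (fun K => (isCompact_hull _).isClosed) (fun K => convex_hull _) (by positivity)
      (fun K x hx y hy => hT.abs_bary_sub_le_of_mem K.2 hx hy k) (hcov ▸ hpq)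
  rcases le_total ‖x - y‖ δ with hxy | hxy
  · -- close points: follow the polygonal path
    obtain ⟨z, hz1, hz2, hz3⟩ := hway x hx y hy hxy
    have h1 := hseg hz1
    have h2 := hseg hz2
    rw [abs_sub_comm, norm_sub_rev] at h1 h2
    calc _ ≤ |T.bary x k - T.bary z k| + |T.bary z k - T.bary y k| := abs_sub_le _ _ _
      _ ≤ Λ / T.meshSize * ‖x - z‖ + Λ / T.meshSize * ‖z - y‖ := add_le_add h1 h2
      _ = Λ / T.meshSize * (‖x - z‖ + ‖z - y‖) := by ring
      _ ≤ Λ / T.meshSize * (C * ‖x - y‖) := by gcongr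
      _ = Λ * C / T.meshSize * ‖x - y‖ := by ring
      _ ≤ _ := by gcongr; nlinarith [div_nonneg hD0 hδ.le]
  · -- distant points: the values lie in the unit interval, and `h` is at most the diameter of the
    -- domain
    rw [hcov] at hx hy
    obtain ⟨K, hxK⟩ := mem_iUnion.1 hx
    obtain ⟨L, hyL⟩ := mem_iUnion.1 hy
    have hbx := T.isBary_bary (T.mem_elements.1 K.2).1 hxK
    have hby := T.isBary_bary (T.mem_elements.1 L.2).1 hyL
    have hm := hT.meshSize_le hΩ.isBounded
    calc _ ≤ 1 := by
          rw [abs_le]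
          constructor <;> linarith [hbx.nonneg k, hbx.le_one k, hby.nonneg k, hby.le_one k]
      _ = (T.meshSize / δ) / T.meshSize * δ := by field_simp
      _ ≤ ((Λ + 1) * C + D / δ) / T.meshSize * ‖x - y‖ := by
          gcongr
          calc T.meshSize / δ ≤ D / δ := by gcongr
            _ ≤ _ := by nlinarith

/-- Uniform independence of the vertices of pairs of simplices of a mesh with Lipschitz hat
functions. -/
theorem abs_le_of_sum_eq_zero {M : ℝ} (hM : ∀ x ∈ closure Ω, ∀ y ∈ closure Ω, ∀ k,
    |T.bary x k - T.bary y k| ≤ M * ‖x - y‖) {K L : Finset Plane} (hK : K ∈ T.faces)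
    (hL : L ∈ T.faces) {m : ℕ} {z : Fin m → Plane} (hz : Function.Injective z)
    {ψ : Fin m → ℝ} (h0 : ∑ i, ψ i = 0) (hψK : ∀ i, 0 < ψ i → z i ∈ K)
    (hψL : ∀ i, ψ i < 0 → z i ∈ L) (i : Fin m) : |ψ i| ≤ M * ‖∑ i, ψ i • z i‖ := by
  rcases eq_or_ne ψ 0 with rfl | hne
  · simp
  obtain ⟨S, hS, x, y, w, w', hw, hw', hψ, hsum⟩ := exists_isBary_of_sum_eq_zero hz h0 hψK hψL hne
  have hx := T.hull_subset_closure hK (mem_hull_iff_exists_isBary.2 ⟨w, hw⟩)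
  have hy := T.hull_subset_closure hL (mem_hull_iff_exists_isBary.2 ⟨w', hw'⟩)
  have := hM x hx y hy (z i)
  rw [T.bary_eq hK hw, T.bary_eq hL hw'] at this
  rw [hψ, hsum, norm_smul, Real.norm_of_nonneg hS.le, abs_mul, abs_of_pos hS]
  calc S * _ ≤ S * (M * ‖x - y‖) := by gcongr
    _ = _ := by ring

theorem disjoint_of_disjoint_hull {K L : Finset Plane} (h : Disjoint (hull K) (hull L)) :
    Disjoint K L := Finset.disjoint_left.2 fun _ hk hk' =>
  Set.disjoint_left.1 h (subset_convexHull ℝ _ hk) (subset_convexHull ℝ _ hk')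

/-- Disjoint simplices of a mesh are well separated. -/
theorem one_le_of_disjoint {M : ℝ} (hM : ∀ x ∈ closure Ω, ∀ y ∈ closure Ω, ∀ k,
    |T.bary x k - T.bary y k| ≤ M * ‖x - y‖) {K L : Finset Plane} (hK : K ∈ T.faces)
    (hL : L ∈ T.faces) (hKL : Disjoint K L) {x y : Plane} (hx : x ∈ hull K) (hy : y ∈ hull L) :
    1 ≤ 3 * M * ‖x - y‖ := by
  have hbx := T.isBary_bary hK hx
  have hby := T.isBary_bary hL hy
  have h1 := hM x (T.hull_subset_closure hK hx) y (T.hull_subset_closure hL hy)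
  have h2 : ∑ k ∈ K, T.bary x k ≤ ∑ _ ∈ K, M * ‖x - y‖ := Finset.sum_le_sum fun k hk => by
    have := h1 k
    rw [hby.support k (Finset.disjoint_left.1 hKL hk), sub_zero] at this
    exact (le_abs_self _).trans this
  rw [hbx.sum_eq, Finset.sum_const, nsmul_eq_mul] at h2
  have h3 : (0 : ℝ) ≤ M * ‖x - y‖ := (abs_nonneg _).trans (h1 0)
  have h4 : (K.card : ℝ) ≤ 3 := by exact_mod_cast T.card_face_le hK
  calc (1 : ℝ) ≤ K.card * (M * ‖x - y‖) := h2
    _ ≤ 3 * (M * ‖x - y‖) := by gcongr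
    _ = _ := by ring

end Triangulation

end FracQuad

namespace FracQuad

/-! ### Integration over triangles and edges -/

theorem affine_apply_sum {ι : Type*} (S : Finset ι) {w : ι → ℝ} (hw : ∑ i ∈ S, w i = 1)
    (z : ι → Plane) (g : Plane →ᵃ[ℝ] ℝ) : g (∑ i ∈ S, w i • z i) = ∑ i ∈ S, w i * g (z i) := by
  have h1 := S.map_affineCombination z w hw g
  rw [S.affineCombination_eq_linear_combination _ _ hw,
    S.affineCombination_eq_linear_combination _ _ hw] at h1
  simpa using h1

theorem coord_sum (b : AffineBasis (Fin 3) ℝ Plane) {w : Fin 3 → ℝ} (hw : ∑ i, w i = 1)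
    (j : Fin 3) : b.coord j (∑ i, w i • b i) = w j := by
  rw [affine_apply_sum _ hw]
  simp [b.coord_apply]

theorem sum_refBary (p q : ℝ) : ∑ i, refBary p q i = 1 := by
  simp [Fin.sum_univ_three, refBary]

theorem sum_refBary_smul (x : Fin 3 → Plane) (p q : ℝ) :
    ∑ i, refBary p q i • x i = x 0 + (p • (x 1 - x 0) + q • (x 2 - x 1)) := by
  simp only [Fin.sum_univ_three, refBary, Matrix.cons_val]
  module

theorem sum_refBary_smul_mem_iff (b : AffineBasis (Fin 3) ℝ Plane) (p q : ℝ) :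
    ∑ i, refBary p q i • b i ∈ convexHull ℝ (range b) ↔ p ∈ Icc (0 : ℝ) 1 ∧ q ∈ Icc 0 p := by
  rw [b.convexHull_eq_nonneg_coord, mem_ofPred_eq]
  have h : ∀ j, b.coord j (∑ i, refBary p q i • b i) = refBary p q j :=
    coord_sum b (sum_refBary p q)
  simp only [h]
  rw [Fin.forall_fin_succ, Fin.forall_fin_two]
  simp only [refBary, mem_Icc, Matrix.cons_val, Fin.succ_zero_eq_one, Fin.succ_one_eq_two,
    sub_nonneg]
  constructor
  · rintro ⟨h1, h2, h3⟩
    exact ⟨⟨h3.trans h2, h1⟩, h3, h2⟩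
  · rintro ⟨⟨-, h1⟩, h3, h2⟩
    exact ⟨h1, h2, h3⟩

theorem lintegral_triangle_one :
    ∫⁻ p in Ioo (0 : ℝ) 1, ∫⁻ _ in Ioo (0 : ℝ) p, (1 : ENNReal) = ENNReal.ofReal (1 / 2) := by
  simp only [lintegral_one, Measure.restrict_apply_univ, Real.volume_Ioo, sub_zero]
  rw [← ofReal_integral_eq_lintegral_ofReal, ← integral_Ioc_eq_integral_Ioo,
    ← intervalIntegral.integral_of_le zero_le_one, integral_id]
  · norm_num
  · exact (continuous_id.integrableOn_Icc (a := (0 : ℝ)) (b := 1)).mono_set Ioo_subset_Icc_self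
  · filter_upwards [ae_restrict_mem measurableSet_Ioo] with p hp using hp.1.le

/-- Integration over a triangle in the coordinates of the reference triangle. -/
theorem setLIntegral_triangle (b : AffineBasis (Fin 3) ℝ Plane) {g : Plane → ENNReal}
    (hg : Measurable g) :
    ∫⁻ z in convexHull ℝ (range b), g z = 2 * volume (convexHull ℝ (range b)) *
      ∫⁻ p in Ioo (0 : ℝ) 1, ∫⁻ q in Ioo 0 p, g (∑ i, refBary p q i • b i) := by
  set H := convexHull ℝ (range b) with hH
  have hHm : MeasurableSet H := ((finite_range b).isCompact_convexHull (𝕜 := ℝ)).measurableSet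
  let l : ℝ × ℝ →ₗ[ℝ] Plane :=
    (LinearMap.fst ℝ ℝ ℝ).smulRight (b 1 - b 0) + (LinearMap.snd ℝ ℝ ℝ).smulRight (b 2 - b 1)
  have hl : ∀ p q, l (p, q) = p • (b 1 - b 0) + q • (b 2 - b 1) := fun p q => by simp [l]
  have hlb : ∀ p q, b 0 + l (p, q) = ∑ i, refBary p q i • b i := fun p q => by
    rw [hl, sum_refBary_smul]
  have hinj : Function.Injective l := by
    rintro ⟨p, q⟩ ⟨p', q'⟩ h
    have h2 : ∑ i, refBary p q i • b i = ∑ i, refBary p' q' i • b i := by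
      rw [← hlb, ← hlb, h]
    have h3 : ∀ j, refBary p q j = refBary p' q' j := fun j => by
      rw [← coord_sum b (sum_refBary p q) j, h2, coord_sum b (sum_refBary p' q') j]
    have h4 := h3 0
    have h5 := h3 2
    simp only [refBary, Matrix.cons_val] at h4 h5
    rw [h5, sub_right_injective h4]
  let L : (ℝ × ℝ) ≃L[ℝ] Plane :=
    (l.linearEquivOfInjective hinj (by simp)).toContinuousLinearEquiv
  have hL : ∀ z, L z = l z := fun z => rfl
  -- up to a constant, by uniqueness of Haar measure
  obtain ⟨κ, hκ⟩ : ∃ κ : ENNReal, ∀ g : Plane → ENNReal, Measurable g → ∫⁻ z in H, g z = κ *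
      ∫⁻ p in Ioo (0 : ℝ) 1, ∫⁻ q in Ioo 0 p, g (∑ i, refBary p q i • b i) := by
    have h1 := Measure.isAddLeftInvariant_eq_smul (volume : Measure Plane)
      ((volume : Measure (ℝ × ℝ)).map L)
    refine ⟨Measure.addHaarScalarFactor (volume : Measure Plane)
      ((volume : Measure (ℝ × ℝ)).map L), fun g hg => ?_⟩
    have hgi := hg.indicator hHm
    rw [← lintegral_indicator hHm, ← lintegral_add_left_eq_self _ (b 0)]
    conv_lhs => rw [h1]
    have hgi' : Measurable fun z => H.indicator g (b 0 + z) :=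
      hgi.comp (measurable_const_add (b 0))
    rw [lintegral_smul_measure, lintegral_map hgi' L.continuous.measurable]
    refine congrArg₂ (fun a b : ENNReal => a * b) rfl ?_
    have hgL : Measurable fun z => H.indicator g (b 0 + L z) := hgi'.comp L.continuous.measurable
    rw [Measure.volume_eq_prod, lintegral_prod _ hgL.aemeasurable,
      setLIntegral_congr Ioo_ae_eq_Icc, ← lintegral_indicator measurableSet_Icc]
    refine lintegral_congr fun p => ?_
    simp only [hL, hlb]
    by_cases hp : p ∈ Icc (0 : ℝ) 1
    · rw [indicator_of_mem hp, setLIntegral_congr Ioo_ae_eq_Icc,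
        ← lintegral_indicator measurableSet_Icc]
      refine lintegral_congr fun q => ?_
      by_cases hq : q ∈ Icc 0 p
      · rw [indicator_of_mem hq, indicator_of_mem ((sum_refBary_smul_mem_iff b p q).2 ⟨hp, hq⟩)]
      · rw [indicator_of_notMem hq, indicator_of_notMem fun h =>
          hq ((sum_refBary_smul_mem_iff b p q).1 h).2]
    · rw [indicator_of_notMem hp]
      refine (lintegral_congr fun q => ?_).trans lintegral_zero
      rw [indicator_of_notMem fun h => hp ((sum_refBary_smul_mem_iff b p q).1 h).1]
  -- the constant is found from `g = 1`
  have h1 := hκ (fun _ => 1) measurable_const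
  rw [lintegral_triangle_one, lintegral_one, Measure.restrict_apply_univ] at h1
  rw [hκ g hg, h1]
  congr 1
  rw [mul_left_comm, ENNReal.ofReal_div_of_pos two_pos, ENNReal.ofReal_one, ENNReal.ofReal_ofNat,
    one_div, ENNReal.mul_inv_cancel two_ne_zero ENNReal.ofNat_ne_top, mul_one]

/-- Integration over a segment with respect to arc length. -/
theorem setLIntegral_segment (y₀ y₁ : Plane) {g : Plane → ENNReal} (hg : Measurable g) :
    ∫⁻ z in segment ℝ y₀ y₁, g z ∂μH[1] =
      edist y₀ y₁ * ∫⁻ t in Ioo (0 : ℝ) 1, g ((1 - t) • y₀ + t • y₁) := by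
  have hγ : ∀ t : ℝ, AffineMap.lineMap y₀ y₁ t = (1 - t) • y₀ + t • y₁ := fun t => by
    rw [AffineMap.lineMap_apply_module]
  have hc : Continuous (AffineMap.lineMap y₀ y₁ : ℝ →ᵃ[ℝ] Plane) := by
    exact AffineMap.lineMap_continuous
  rcases eq_or_ne y₀ y₁ with rfl | hne
  · rw [segment_same, edist_self, zero_mul]
    have : NullSingletonClass (μH[1] : Measure Plane) := Measure.nullSingletonClass_hausdorff _ one_pos
    rw [Measure.restrict_singleton, measure_singleton, zero_smul, lintegral_zero_measure]
  have hinj : Function.Injective (AffineMap.lineMap y₀ y₁ : ℝ →ᵃ[ℝ] Plane) :=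
    AffineMap.lineMap_injective ℝ hne
  have hmeas : (μH[1] : Measure Plane).restrict (segment ℝ y₀ y₁) = nndist y₀ y₁ •
      (volume.restrict (Ioo (0 : ℝ) 1)).map (AffineMap.lineMap y₀ y₁ : ℝ →ᵃ[ℝ] Plane) := by
    ext A hA
    rw [Measure.smul_apply, Measure.map_apply hc.measurable hA, Measure.restrict_apply hA,
      Measure.restrict_congr_set (Ioo_ae_eq_Icc (μ := volume)),
      Measure.restrict_apply (hc.measurable hA), ← hausdorffMeasure_real,
      ← hausdorffMeasure_lineMap_image]
    congr 1
    rw [image_preimage_inter, segment_eq_image_lineMap]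
  rw [hmeas, lintegral_smul_measure, lintegral_map hg hc.measurable, edist_nndist]
  simp only [hγ]
  rfl

end FracQuad

namespace FracQuad

/-! ### Integration over pairs of elements and over pairs of an element and an edge -/

theorem measurableSet_hull (K : Finset Plane) : MeasurableSet (hull K) :=
  (isCompact_hull K).measurableSet

theorem volume_hull_lt_top (K : Finset Plane) : volume (hull K) < ⊤ :=
  (isCompact_hull K).measure_lt_top

theorem ofReal_area (K : Finset Plane) :
    ENNReal.ofReal (Scheme.area K / (1 / 2)) = 2 * volume (hull K) := by
  rw [Scheme.area, show (volume (hull K)).toReal / (1 / 2) = 2 * (volume (hull K)).toReal by ring,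
    ENNReal.ofReal_mul two_pos.le, ENNReal.ofReal_toReal (volume_hull_lt_top K).ne]
  norm_num

instance isFiniteMeasure_restrict_hull (K : Finset Plane) :
    IsFiniteMeasure (volume.restrict (hull K)) :=
  ⟨by rw [Measure.restrict_apply_univ]; exact volume_hull_lt_top K⟩

theorem measurable_affineMap (g : Plane →ᵃ[ℝ] ℝ) : Measurable g :=
  g.continuous_of_finiteDimensional.measurable

theorem mem_range_coe {n : ℕ} {x : Fin n → Plane} {K : Finset Plane} (hx : range x = K)
    (i : Fin n) : x i ∈ K := by
  rw [← Finset.mem_coe, ← hx]; exact mem_range_self i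

theorem injective_of_range_eq {n : ℕ} {x : Fin n → Plane} {K : Finset Plane} (hx : range x = K)
    (hK : K.card = n) : Function.Injective x := by
  classical
  have h1 : Finset.univ.image x = K := by
    rw [← Finset.coe_inj, Finset.coe_image, Finset.coe_univ, image_univ, hx]
  have h2 : Set.InjOn x (Finset.univ : Finset (Fin n)) :=
    Finset.card_image_iff.1 (by rw [h1, hK, Finset.card_fin])
  exact fun i j h => h2 (by simp) (by simp) h

/-- A numbering of the vertices of an element is an affine basis of the plane. -/
theorem Triangulation.exists_affineBasis {Ω : Set Plane} (T : Triangulation Ω) {K : Finset Plane}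
    (hK : K ∈ T.elements) {x : Fin 3 → Plane} (hx : range x = K) :
    ∃ b : AffineBasis (Fin 3) ℝ Plane, ⇑b = x ∧ convexHull ℝ (range b) = hull K := by
  obtain ⟨hf, hc⟩ := T.mem_elements.1 hK
  have hinj := injective_of_range_eq hx hc
  have hind : AffineIndependent ℝ x := by
    have h := (T.indep hf).comp_embedding
      ⟨fun i : Fin 3 => (⟨x i, mem_range_coe hx i⟩ : K), fun i j h => hinj (Subtype.ext_iff.1 h)⟩
    exact h
  refine ⟨⟨x, hind, ?_⟩, rfl, ?_⟩
  · rw [hind.affineSpan_eq_top_iff_card_eq_finrank_add_one]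
    simp
  · change convexHull ℝ (range x) = hull K
    rw [hx]; rfl

theorem lintegral_triangle_prod (b b' : AffineBasis (Fin 3) ℝ Plane)
    {F : Plane × Plane → ENNReal} (hF : Measurable F) :
    ∫⁻ z, F z ∂((volume.restrict (convexHull ℝ (range b))).prod
        (volume.restrict (convexHull ℝ (range b')))) =
      2 * volume (convexHull ℝ (range b)) * (2 * volume (convexHull ℝ (range b'))) *
      ∫⁻ w in refPair, F (∑ i, refBary (w 0) (w 1) i • b i, ∑ i, refBary (w 2) (w 3) i • b' i) := by
  have hb : Measurable fun w : Fin 4 → ℝ => ∑ i, refBary (w 0) (w 1) i • b i := by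
    simp only [sum_refBary_smul]; fun_prop
  have hb' : Measurable fun w : Fin 4 → ℝ => ∑ i, refBary (w 2) (w 3) i • b' i := by
    simp only [sum_refBary_smul]; fun_prop
  have htop : 2 * volume (convexHull ℝ (range b')) ≠ ⊤ := ENNReal.mul_ne_top (by simp)
    ((finite_range b').isCompact_convexHull (𝕜 := ℝ)).measure_lt_top.ne
  rw [lintegral_prod _ hF.aemeasurable, setLIntegral_triangle b hF.lintegral_prod_right',
    setLIntegral_nested_four measurableSet_refPair (A := Ioo 0 1) (B := fun a => Ioo 0 a)
      (C := fun _ _ => Ioo 0 1) (D := fun _ _ c => Ioo 0 c) measurableSet_Ioo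
      (fun _ => measurableSet_Ioo) (fun _ _ => measurableSet_Ioo) (fun _ _ _ => measurableSet_Ioo)
      (fun a b c d => ?_) ?_]
  · refine Eq.trans (congrArg _ ?_) (mul_assoc _ _ _).symm
    rw [← lintegral_const_mul' _ _ htop]
    refine lintegral_congr fun p => ?_
    rw [← lintegral_const_mul' _ _ htop]
    refine lintegral_congr fun q => ?_
    exact setLIntegral_triangle b' (g := fun z => F (∑ i, refBary p q i • b i, z))
      (hF.comp measurable_prodMk_left)
  · exact hF.comp (hb.prodMk hb')
  · simp only [refPair, mem_ofPred_eq, mem_Ioo, Matrix.cons_val]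
    constructor
    · rintro ⟨h1, h2, h3, h4, h5, h6⟩
      exact ⟨⟨h3.trans h2, h1⟩, ⟨h3, h2⟩, ⟨h6.trans h5, h4⟩, h6, h5⟩
    · rintro ⟨⟨-, h1⟩, ⟨h3, h2⟩, ⟨-, h4⟩, h6, h5⟩
      exact ⟨h1, h2, h3, h4, h5, h6⟩

theorem lintegral_triangle_segment_prod (b : AffineBasis (Fin 3) ℝ Plane) (y : Fin 2 → Plane)
    {F : Plane × Plane → ENNReal} (hF : Measurable F) :
    ∫⁻ z, F z ∂((volume.restrict (convexHull ℝ (range b))).prod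
        (μH[1].restrict (segment ℝ (y 0) (y 1)))) =
      2 * volume (convexHull ℝ (range b)) * edist (y 0) (y 1) *
      ∫⁻ w in refPairEdge, F (∑ i, refBary (w 0) (w 1) i • b i,
        (1 - w 2) • y 0 + w 2 • y 1) := by
  have hfin : IsFiniteMeasure ((μH[1] : Measure Plane).restrict (segment ℝ (y 0) (y 1))) :=
    ⟨by rw [Measure.restrict_apply_univ, hausdorffMeasure_segment]; exact edist_lt_top _ _⟩
  have hb : Measurable fun w : Fin 3 → ℝ => ∑ i, refBary (w 0) (w 1) i • b i := by
    simp only [sum_refBary_smul]; fun_prop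
  rw [lintegral_prod _ hF.aemeasurable, setLIntegral_triangle b hF.lintegral_prod_right',
    setLIntegral_nested_three measurableSet_refPairEdge (A := Ioo 0 1) (B := fun a => Ioo 0 a)
      (C := fun _ _ => Ioo 0 1) measurableSet_Ioo
      (fun _ => measurableSet_Ioo) (fun _ _ => measurableSet_Ioo)
      (fun a b c => ?_) ?_]
  · refine Eq.trans (congrArg _ ?_) (mul_assoc _ _ _).symm
    rw [← lintegral_const_mul' _ _ (edist_ne_top _ _)]
    refine lintegral_congr fun p => ?_
    rw [← lintegral_const_mul' _ _ (edist_ne_top _ _)]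
    refine lintegral_congr fun q => ?_
    exact setLIntegral_segment _ _ (g := fun z => F (∑ i, refBary p q i • b i, z))
      (hF.comp measurable_prodMk_left)
  · exact hF.comp (hb.prodMk (by fun_prop))
  · simp only [refPairEdge, mem_ofPred_eq, mem_Ioo, Matrix.cons_val]
    constructor
    · rintro ⟨h1, h2, h3, h4, h5⟩
      exact ⟨⟨h3.trans h2, h1⟩, ⟨h3, h2⟩, h5, h4⟩
    · rintro ⟨⟨-, h1⟩, ⟨h3, h2⟩, h5, h4⟩
      exact ⟨h1, h2, h3, h4, h5⟩

/-- The integrand of the double integral over the domain. -/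
noncomputable def energyDensity (s : ℝ) (u v : Plane → ℝ) (z : Plane × Plane) : ℝ :=
  (u z.1 - u z.2) * (v z.1 - v z.2) / ‖z.1 - z.2‖ ^ (2 + 2 * s)

/-- The integrand of the boundary term, on an edge with normal `n`. -/
noncomputable def edgeDensity (s : ℝ) (n : Plane) (u v : Plane → ℝ) (z : Plane × Plane) : ℝ :=
  u z.1 * v z.1 * normalKernel s n (z.1 - z.2)

namespace Triangulation

variable {Ω : Set Plane} {T : Triangulation Ω}

/-- The contribution of a pair of elements in reference coordinates. The reference triangle has
area `1/2`. -/
theorem integral_energyDensity {s : ℝ} {K L : Finset Plane} (hK : K ∈ T.elements)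
    (hL : L ∈ T.elements) {x y : Fin 3 → Plane} (hx : range x = K) (hy : range y = L)
    {u v : Plane → ℝ} (hu : u ∈ T.p1Space) (hv : v ∈ T.p1Space)
    (h : IntegrableOn (pairKernel s x y u v) refPair) :
    Integrable (energyDensity s u v)
      ((volume.restrict (hull K)).prod (volume.restrict (hull L))) ∧
    ∫ z, energyDensity s u v z ∂((volume.restrict (hull K)).prod (volume.restrict (hull L))) =
      Scheme.area K / (1 / 2) * (Scheme.area L / (1 / 2)) *
        ∫ w in refPair, pairKernel s x y u v w := by
  obtain ⟨b, hb, hbK⟩ := T.exists_affineBasis hK hx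
  obtain ⟨b', hb', hbL⟩ := T.exists_affineBasis hL hy
  obtain ⟨f, hf⟩ := hu.1 K hK
  obtain ⟨f', hf'⟩ := hu.1 L hL
  obtain ⟨g, hg⟩ := hv.1 K hK
  obtain ⟨g', hg'⟩ := hv.1 L hL
  set F : Plane × Plane → ℝ := fun z =>
    (f z.1 - f' z.2) * (g z.1 - g' z.2) / ‖z.1 - z.2‖ ^ (2 + 2 * s) with hF
  have hFm : Measurable F := by
    have h1 : Measurable fun z : Plane × Plane => f z.1 :=
      (measurable_affineMap f).comp measurable_fst
    have h2 : Measurable fun z : Plane × Plane => f' z.2 :=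
      (measurable_affineMap f').comp measurable_snd
    have h3 : Measurable fun z : Plane × Plane => g z.1 :=
      (measurable_affineMap g).comp measurable_fst
    have h4 : Measurable fun z : Plane × Plane => g' z.2 :=
      (measurable_affineMap g').comp measurable_snd
    exact ((h1.sub h2).mul (h3.sub h4)).div ((measurable_fst.sub measurable_snd).norm.pow_const _)
  have hae : energyDensity s u v
      =ᵐ[(volume.restrict (hull K)).prod (volume.restrict (hull L))] F := by
    rw [Measure.prod_restrict]
    filter_upwards [ae_restrict_mem ((measurableSet_hull K).prod (measurableSet_hull L))] with z hz
    simp only [energyDensity, hF, hf hz.1, hf' hz.2, hg hz.1, hg' hz.2]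
  have hmemK : ∀ i, x i ∈ hull K := fun i => subset_convexHull ℝ _ (mem_range_coe hx i)
  have hmemL : ∀ i, y i ∈ hull L := fun i => subset_convexHull ℝ _ (mem_range_coe hy i)
  have hFw : ∀ w : Fin 4 → ℝ, F (∑ i, refBary (w 0) (w 1) i • b i,
      ∑ i, refBary (w 2) (w 3) i • b' i) = pairKernel s x y u v w := by
    intro w
    simp only [hF, hb, hb', affine_apply_sum _ (sum_refBary _ _), pairKernel,
      ← hf (hmemK _), ← hf' (hmemL _), ← hg (hmemK _), ← hg' (hmemL _)]
  have key := integral_eq_sum_of_lintegral (ι := Unit)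
    (c := Scheme.area K / (1 / 2) * (Scheme.area L / (1 / 2)))
    (by unfold Scheme.area; positivity) hFm (fun _ => h)
    (μ := (volume.restrict (hull K)).prod (volume.restrict (hull L))) fun e => ?_
  · rw [Fintype.sum_unique] at key
    exact ⟨key.1.congr hae.symm, (integral_congr_ae hae).trans key.2⟩
  · rw [Fintype.sum_unique, ← hbK, ← hbL,
      lintegral_triangle_prod b b' (F := fun z => ENNReal.ofReal (e * F z)) (by fun_prop)]
    simp only [hFw]
    congr 1
    rw [hbK, hbL, ENNReal.ofReal_mul (by unfold Scheme.area; positivity), ofReal_area, ofReal_area]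

/-- The contribution of an element and an edge in reference coordinates. -/
theorem integral_edgeDensity {s : ℝ} {K : Finset Plane} (hK : K ∈ T.elements) (n : Plane)
    {x : Fin 3 → Plane} (hx : range x = K) {e : Finset Plane} {y : Fin 2 → Plane}
    (hy : range y = e)
    {u v : Plane → ℝ} (hu : u ∈ T.p1Space) (hv : v ∈ T.p1Space)
    (h : IntegrableOn (edgeKernel s n x y u v) refPairEdge) :
    Integrable (edgeDensity s n u v)
      ((volume.restrict (hull K)).prod (μH[1].restrict (hull e))) ∧
    ∫ z, edgeDensity s n u v z ∂((volume.restrict (hull K)).prod (μH[1].restrict (hull e))) =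
      Scheme.area K / (1 / 2) * Metric.diam (hull e) *
        ∫ w in refPairEdge, edgeKernel s n x y u v w := by
  obtain ⟨b, hb, hbK⟩ := T.exists_affineBasis hK hx
  obtain ⟨f, hf⟩ := hu.1 K hK
  obtain ⟨g, hg⟩ := hv.1 K hK
  have hey : hull e = segment ℝ (y 0) (y 1) := by
    rw [hull, ← hy, ← convexHull_pair]
    congr 1
    ext z
    simp [Fin.exists_fin_two, eq_comm]
  have hfin : IsFiniteMeasure ((μH[1] : Measure Plane).restrict (segment ℝ (y 0) (y 1))) :=
    ⟨by rw [Measure.restrict_apply_univ, hausdorffMeasure_segment]; exact edist_lt_top _ _⟩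
  have hdiam : ENNReal.ofReal (Metric.diam (hull e)) = edist (y 0) (y 1) := by
    rw [hey, ← convexHull_pair, convexHull_diam, Metric.diam_pair, edist_dist]
  rw [hey] at hdiam ⊢
  set F : Plane × Plane → ℝ := fun z => f z.1 * g z.1 * normalKernel s n (z.1 - z.2) with hF
  have hFm : Measurable F := by
    have h1 : Measurable fun z : Plane × Plane => f z.1 :=
      (measurable_affineMap f).comp measurable_fst
    have h3 : Measurable fun z : Plane × Plane => g z.1 :=
      (measurable_affineMap g).comp measurable_fst
    have h4 : Measurable fun z : Plane × Plane => z.1 - z.2 := measurable_fst.sub measurable_snd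
    exact (h1.mul h3).mul ((measurable_const.inner h4).div (h4.norm.pow_const _))
  have hae : edgeDensity s n u v
      =ᵐ[(volume.restrict (hull K)).prod (μH[1].restrict (segment ℝ (y 0) (y 1)))] F := by
    have h1 : ∀ᵐ z ∂((volume.restrict (hull K)).prod (μH[1].restrict (segment ℝ (y 0) (y 1)))),
        z.1 ∈ hull K := Measure.quasiMeasurePreserving_fst.ae
          (ae_restrict_mem (measurableSet_hull K))
    filter_upwards [h1] with z hz
    simp only [edgeDensity, hF, hf hz, hg hz]
  have hmemK : ∀ i, x i ∈ hull K := fun i => subset_convexHull ℝ _ (mem_range_coe hx i)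
  have hFw : ∀ w : Fin 3 → ℝ, F (∑ i, refBary (w 0) (w 1) i • b i,
      (1 - w 2) • y 0 + w 2 • y 1) = edgeKernel s n x y u v w := by
    intro w
    simp only [hF, hb, affine_apply_sum _ (sum_refBary _ _), edgeKernel,
      ← hf (hmemK _), ← hg (hmemK _)]
  have key := integral_eq_sum_of_lintegral (ι := Unit)
    (c := Scheme.area K / (1 / 2) * Metric.diam (segment ℝ (y 0) (y 1)))
    (mul_nonneg (by unfold Scheme.area; positivity) Metric.diam_nonneg) hFm (fun _ => h)
    (μ := (volume.restrict (hull K)).prod (μH[1].restrict (segment ℝ (y 0) (y 1)))) fun e => ?_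
  · rw [Fintype.sum_unique] at key
    exact ⟨key.1.congr hae.symm, (integral_congr_ae hae).trans key.2⟩
  · rw [Fintype.sum_unique, ← hbK,
      lintegral_triangle_segment_prod b y (F := fun z => ENNReal.ofReal (e * F z)) (by fun_prop)]
    simp only [hFw]
    congr 1
    rw [hbK, ENNReal.ofReal_mul (by unfold Scheme.area; positivity), hdiam, ofReal_area]

end Triangulation

end FracQuad

namespace FracQuad

/-! ### The boundary of the domain -/

theorem IsInwardNormal.unique {Ω : Set Plane} {y n n' : Plane} (h : IsInwardNormal Ω y n)
    (h' : IsInwardNormal Ω y n') : n = n' := by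
  obtain ⟨h1, r, hr, hr'⟩ := h
  obtain ⟨h1', ρ, hρ, hρ'⟩ := h'
  by_contra hne
  have hlt : inner ℝ n n' < 1 := by
    exact (inner_lt_one_iff_real_of_norm_eq_one h1 h1').2 hne
  have hpos : 0 < ‖n - n'‖ := norm_pos_iff.2 (sub_ne_zero.2 hne)
  set m := min r ρ with hm
  have hm0 : 0 < m := lt_min hr hρ
  -- the point `y + ε (n - n')` lies inside with respect to `n` but outside with respect to the
  -- other normal
  set ε := m / (2 * ‖n - n'‖) with hε
  have hε0 : 0 < ε := by positivity
  have hnorm : ‖ε • (n - n')‖ < m := by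
    rw [norm_smul, Real.norm_of_nonneg hε0.le, hε]
    have : m / (2 * ‖n - n'‖) * ‖n - n'‖ = m / 2 := by field_simp
    rw [this]; linarith
  have hz : ∀ R, m ≤ R → y + ε • (n - n') ∈ Metric.ball y R := fun R hR => by
    rw [mem_ball_iff_norm, add_sub_cancel_left]; exact hnorm.trans_le hR
  have e1 := hr' _ (hz r (min_le_left _ _))
  have e2 := hρ' _ (hz ρ (min_le_right _ _))
  rw [add_sub_cancel_left, inner_smul_right, inner_sub_right, real_inner_self_eq_norm_sq] at e1 e2
  rw [h1] at e1
  rw [h1', real_inner_comm] at e2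
  have h3 := e2.1 (e1.2 (mul_pos hε0 (by linarith)))
  have := pos_of_mul_pos_right h3 hε0.le
  linarith

theorem inwardNormal_eq {Ω : Set Plane} {y n : Plane} (h : IsInwardNormal Ω y n) :
    inwardNormal Ω y = n := by
  have hex : ∃ n, IsInwardNormal Ω y n := ⟨n, h⟩
  rw [inwardNormal, dif_pos hex]
  exact hex.choose_spec.unique h

theorem IsInwardNormal.notMem {Ω : Set Plane} {y n : Plane} (h : IsInwardNormal Ω y n) :
    y ∉ Ω := by
  obtain ⟨-, r, hr, hr'⟩ := h
  intro hy
  have := (hr' y (Metric.mem_ball_self hr)).1 hy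
  simp at this

section AffineBasis

variable (b : AffineBasis (Fin 3) ℝ Plane)

theorem coord_two_lineMap (t : ℝ) : b.coord 2 ((1 - t) • b 0 + t • b 1) = 0 := by
  have := coord_sum b (w := ![1 - t, t, 0]) (by simp [Fin.sum_univ_three]) 2
  simpa [Fin.sum_univ_three] using this

/-- Near an interior point of an edge, a triangle is a half-plane. -/
theorem exists_ball_mem_triangle_iff {t : ℝ} (ht : t ∈ Ioo (0 : ℝ) 1) :
    ∃ r > 0, ∀ z ∈ Metric.ball ((1 - t) • b 0 + t • b 1) r,
      z ∈ convexHull ℝ (range b) ↔ 0 ≤ b.coord 2 z := by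
  set p := (1 - t) • b 0 + t • b 1 with hp
  have h0 : b.coord 0 p = 1 - t := by
    have := coord_sum b (w := ![1 - t, t, 0]) (by simp [Fin.sum_univ_three]) 0
    simpa [Fin.sum_univ_three] using this
  have h1 : b.coord 1 p = t := by
    have := coord_sum b (w := ![1 - t, t, 0]) (by simp [Fin.sum_univ_three]) 1
    simpa [Fin.sum_univ_three] using this
  have e0 : ∀ᶠ z in nhds p, 0 < b.coord 0 z :=
    (continuous_barycentric_coord b 0).continuousAt.eventually_const_lt
      (by rw [h0]; linarith [ht.2])
  have e1 : ∀ᶠ z in nhds p, 0 < b.coord 1 z :=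
    (continuous_barycentric_coord b 1).continuousAt.eventually_const_lt
      (by rw [h1]; exact ht.1)
  obtain ⟨r, hr, hr'⟩ := Metric.eventually_nhds_iff_ball.1 (e0.and e1)
  refine ⟨r, hr, fun z hz => ?_⟩
  rw [b.convexHull_eq_nonneg_coord, mem_ofPred_eq]
  refine ⟨fun h => h 2, fun h i => ?_⟩
  obtain ⟨h0, h1⟩ := hr' z hz
  fin_cases i
  exacts [h0.le, h1.le, h]

theorem affine_eq_coord_mul (g : Plane →ᵃ[ℝ] ℝ) (h0 : g (b 0) = 0) (h1 : g (b 1) = 0)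
    (z : Plane) : g z = b.coord 2 z * g (b 2) := by
  conv_lhs => rw [← b.linear_combination_coord_eq_self z]
  rw [affine_apply_sum _ (b.sum_coord_apply_eq_one z), Fin.sum_univ_three, h0, h1]
  ring

/-- The unit normal of an edge of a triangle is the normalised gradient of the barycentric
coordinate of the opposite vertex. -/
theorem exists_unit_normal : ∃ n : Plane, ∃ c : ℝ, 0 < c ∧ ‖n‖ = 1 ∧
    ∀ z p, b.coord 2 p = 0 → inner ℝ n (z - p) = c * b.coord 2 z := by
  set ℓ : StrongDual ℝ Plane := LinearMap.toContinuousLinearMap (b.coord 2).linear with hℓ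
  set g := (InnerProductSpace.toDual ℝ Plane).symm ℓ with hg
  have hgi : ∀ v, inner ℝ g v = (b.coord 2).linear v := fun v => by
    rw [hg, InnerProductSpace.toDual_symm_apply]; rfl
  have hdiff : ∀ z p, (b.coord 2).linear (z - p) = b.coord 2 z - b.coord 2 p := fun z p =>
    (b.coord 2).linearMap_vsub z p
  have hne : g ≠ 0 := fun h => by
    have := hdiff (b 2) (b 0)
    rw [← hgi, h, inner_zero_left] at this
    simp [b.coord_apply] at this
  have hpos : 0 < ‖g‖ := norm_pos_iff.2 hne
  refine ⟨‖g‖⁻¹ • g, ‖g‖⁻¹, inv_pos.2 hpos, ?_, fun z p hp => ?_⟩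
  · rw [norm_smul, norm_inv, norm_norm, inv_mul_cancel₀ hpos.ne']
  · rw [real_inner_smul_left, hgi, hdiff, hp, sub_zero]

end AffineBasis

theorem hull_pair [DecidableEq Plane] (a b : Plane) : hull {a, b} = segment ℝ a b := by
  rw [hull, Finset.coe_pair, convexHull_pair]

theorem lineMap_mem_hull_pair [DecidableEq Plane] {a b : Plane} {t : ℝ} (ht : t ∈ Ioo (0 : ℝ) 1) :
    (1 - t) • a + t • b ∈ hull {a, b} := by
  rw [hull_pair]
  exact ⟨1 - t, t, by linarith [ht.2], ht.1.le, by ring, rfl⟩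

theorem exists_numbering {K : Finset Plane} (hK : K.card = 3) {a b : Plane} (ha : a ∈ K)
    (hb : b ∈ K) (hab : a ≠ b) : ∃ x : Fin 3 → Plane, range x = K ∧ x 0 = a ∧ x 1 = b := by
  classical
  have h1 : ((K.erase a).erase b).card = 1 := by
    rw [Finset.card_erase_of_mem (Finset.mem_erase.2 ⟨hab.symm, hb⟩), Finset.card_erase_of_mem ha,
      hK]
  obtain ⟨c, hc⟩ := Finset.card_eq_one.1 h1
  refine ⟨![a, b, c], ?_, rfl, rfl⟩
  have h2 : K = insert a (insert b {c}) := by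
    rw [← hc, Finset.insert_erase (Finset.mem_erase.2 ⟨hab.symm, hb⟩), Finset.insert_erase ha]
  rw [h2]
  ext z
  simp only [mem_range, Fin.exists_fin_succ, Matrix.cons_val_zero, Matrix.cons_val_succ,
    Finset.coe_insert, Finset.coe_singleton, mem_insert_iff, mem_singleton_iff]
  simp [eq_comm (a := z)]

namespace Triangulation

variable {Ω : Set Plane} {T : Triangulation Ω}

/-- An interior point of an edge lies only in those simplices that contain the edge. -/
theorem mem_of_lineMap_mem_hull {a b : Plane} (hab : a ≠ b) (he : {a, b} ∈ T.faces)
    {M : Finset Plane} (hM : M ∈ T.faces) {t : ℝ} (ht : t ∈ Ioo (0 : ℝ) 1)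
    (hp : (1 - t) • a + t • b ∈ hull M) : a ∈ M ∧ b ∈ M := by
  classical
  have hbary : IsBary {a, b} ((1 - t) • a + t • b)
      (fun k => if k = a then 1 - t else if k = b then t else 0) := by
    refine ⟨fun k => ?_, fun k hk => ?_, ?_, ?_⟩
    · split_ifs <;> linarith [ht.1, ht.2]
    · simp only [Finset.mem_insert, Finset.mem_singleton, not_or] at hk
      simp [hk.1, hk.2]
    · rw [Finset.sum_pair hab]; simp [hab.symm]
    · rw [Finset.sum_pair hab]; simp [hab.symm]
  have heq := T.isBary_unique he hM hbary (T.isBary_bary hM hp)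
  constructor
  · by_contra h
    have := (T.isBary_bary hM hp).support a h
    rw [← heq] at this
    simp only [if_true] at this
    linarith [ht.2]
  · by_contra h
    have := (T.isBary_bary hM hp).support b h
    rw [← heq] at this
    simp only [hab.symm, if_false, if_true] at this
    linarith [ht.1]

/-- Near an interior point of an edge the closed domain is covered by the elements that contain
the edge. -/
theorem exists_ball_mem_closure (hΩ : IsOpen Ω) {a b : Plane} (hab : a ≠ b)
    (he : {a, b} ∈ T.faces) {t : ℝ} (ht : t ∈ Ioo (0 : ℝ) 1) :
    ∃ r > 0, ∀ z ∈ Metric.ball ((1 - t) • a + t • b) r, z ∈ closure Ω →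
      ∃ K ∈ T.elements, a ∈ K ∧ b ∈ K ∧ z ∈ hull K := by
  classical
  set B := T.elements.filter fun K => ¬(a ∈ K ∧ b ∈ K) with hB
  have hcl : IsClosed (⋃ K ∈ B, hull K) :=
    B.finite_toSet.isClosed_biUnion fun K _ => (isCompact_hull K).isClosed
  have hp : (1 - t) • a + t • b ∈ (⋃ K ∈ B, hull K)ᶜ := by
    simp only [mem_compl_iff, mem_iUnion, exists_prop, not_exists, not_and]
    intro K hK hpK
    obtain ⟨h1, h2⟩ := Finset.mem_filter.1 hK
    exact h2 (mem_of_lineMap_mem_hull hab he (T.mem_elements.1 h1).1 ht hpK)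
  obtain ⟨r, hr, hr'⟩ := Metric.isOpen_iff.1 hcl.isOpen_compl _ hp
  refine ⟨r, hr, fun z hz hzΩ => ?_⟩
  rw [T.closure_eq_iUnion hΩ] at hzΩ
  obtain ⟨K, hK, hzK⟩ := mem_iUnion₂.1 hzΩ
  by_cases h : a ∈ K ∧ b ∈ K
  · exact ⟨K, hK, h.1, h.2, hzK⟩
  · exact absurd (mem_iUnion₂.2 ⟨K, Finset.mem_filter.2 ⟨hK, h⟩, hzK⟩) (hr' hz)

/-- An edge of two different elements lies inside the domain, except for its endpoints. -/
theorem lineMap_mem_of_ne (hΩ : IsPolygon Ω) {a b : Plane} (hab : a ≠ b)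
    {K L : Finset Plane} (hK : K ∈ T.elements) (hL : L ∈ T.elements) (hKL : K ≠ L)
    (haK : a ∈ K) (hbK : b ∈ K) (haL : a ∈ L) (hbL : b ∈ L) {t : ℝ} (ht : t ∈ Ioo (0 : ℝ) 1) :
    (1 - t) • a + t • b ∈ Ω := by
  classical
  obtain ⟨hKf, hKc⟩ := T.mem_elements.1 hK
  obtain ⟨hLf, hLc⟩ := T.mem_elements.1 hL
  obtain ⟨x, hx, rfl, rfl⟩ := exists_numbering hKc haK hbK hab
  obtain ⟨y, hy, hy0, hy1⟩ := exists_numbering hLc haL hbL hab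
  obtain ⟨β, hβ, hβK⟩ := T.exists_affineBasis hK hx
  obtain ⟨γ, hγ, hγL⟩ := T.exists_affineBasis hL hy
  set p := (1 - t) • x 0 + t • x 1 with hp
  obtain ⟨r, hr, hr'⟩ := exists_ball_mem_triangle_iff β ht
  obtain ⟨ρ, hρ, hρ'⟩ := exists_ball_mem_triangle_iff γ ht
  rw [hβ, ← hp] at hr'
  rw [hγ, hy0, hy1, ← hp] at hρ'
  rw [← hβ, hβK] at hr'
  rw [← hγ, hγL] at hρ'
  -- the sign of `q` tells on which side of the edge `L` lies, relative to `K`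
  set q := γ.coord 2 (β 2) with hq
  have hprop : ∀ z, γ.coord 2 z = β.coord 2 z * q := by
    refine affine_eq_coord_mul β (γ.coord 2) ?_ ?_
    · rw [hβ, ← hy0, ← hγ]; simp [γ.coord_apply]
    · rw [hβ, ← hy1, ← hγ]; simp [γ.coord_apply]
  have hq0 : q ≠ 0 := fun h => by
    have := hprop (γ 2)
    rw [h] at this
    simp [γ.coord_apply] at this
  have hβp : β.coord 2 p = 0 := by rw [hp, ← hβ]; exact coord_two_lineMap β t
  set m := min r ρ with hm
  have hm0 : 0 < m := lt_min hr hρ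
  have hsub1 := Metric.ball_subset_ball (x := p) (min_le_left r ρ)
  have hsub2 := Metric.ball_subset_ball (x := p) (min_le_right r ρ)
  rcases lt_or_gt_of_ne hq0 with h | h
  · -- opposite sides: the two half-discs fill a neighbourhood, which lies in the closed domain
    rw [← hΩ.interior_closure]
    refine mem_interior.2 ⟨Metric.ball p m, fun z hz => ?_, Metric.isOpen_ball,
      Metric.mem_ball_self hm0⟩
    rcases le_total 0 (β.coord 2 z) with h0 | h0
    · exact T.hull_subset_closure hKf ((hr' z (hsub1 hz)).2 h0)
    · refine T.hull_subset_closure hLf ((hρ' z (hsub2 hz)).2 ?_)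
      rw [hprop]
      exact mul_nonneg_of_nonpos_of_nonpos h0 h.le
  · -- same side: the two elements would have common points off the line of the common edge
    exfalso
    have hopen := isOpenMap_barycentric_coord β 2 _ (Metric.isOpen_ball (x := p) (ε := m))
    obtain ⟨ε, hε, hε'⟩ := Metric.isOpen_iff.1 hopen 0 ⟨p, Metric.mem_ball_self hm0, hβp⟩
    obtain ⟨z, hz, hzε⟩ := hε' (show ε / 2 ∈ Metric.ball 0 ε by
      rw [mem_ball_zero_iff, Real.norm_of_nonneg (by positivity)]; linarith)
    have hzK := (hr' z (hsub1 hz)).2 (by rw [hzε]; positivity)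
    have hzL := (hρ' z (hsub2 hz)).2 (by rw [hprop, hzε]; positivity)
    have hzI := T.inter_subset_convexHull hKf hLf ⟨hzK, hzL⟩
    have hsubI : ((K : Set Plane) ∩ L) ⊆ {z | β.coord 2 z = 0} := by
      rintro k ⟨hk1, hk2⟩
      rw [← hx] at hk1
      obtain ⟨i, rfl⟩ := hk1
      rw [mem_ofPred_eq, ← hβ, β.coord_apply]
      rw [if_neg]
      rintro rfl
      refine hKL (Finset.eq_of_subset_of_card_le (fun k hk => ?_) (by rw [hKc, hLc]))
      rw [← Finset.mem_coe, ← hx] at hk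
      obtain ⟨j, rfl⟩ := hk
      fin_cases j
      exacts [haL, hbL, hk2]
    have hconv : Convex ℝ {z | β.coord 2 z = 0} :=
      (convex_singleton (0 : ℝ)).affine_preimage (β.coord 2)
    have := convexHull_min hsubI hconv hzI
    rw [mem_ofPred_eq, hzε] at this
    linarith

/-- On an edge of only one element, the inward normal exists and is constant. -/
theorem exists_isInwardNormal (hΩ : IsPolygon Ω) {a b : Plane} (hab : a ≠ b)
    {K : Finset Plane} (hK : K ∈ T.elements) (haK : a ∈ K) (hbK : b ∈ K)
    (huniq : ∀ L ∈ T.elements, a ∈ L → b ∈ L → L = K) :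
    ∃ n : Plane, ∀ t ∈ Ioo (0 : ℝ) 1, IsInwardNormal Ω ((1 - t) • a + t • b) n := by
  classical
  obtain ⟨hKf, hKc⟩ := T.mem_elements.1 hK
  have he : {a, b} ∈ T.faces := T.down_closed hKf
    (by simp [Finset.insert_subset_iff, haK, hbK]) (by simp)
  obtain ⟨x, hx, rfl, rfl⟩ := exists_numbering hKc haK hbK hab
  obtain ⟨β, hβ, hβK⟩ := T.exists_affineBasis hK hx
  obtain ⟨n, c, hc, hn, hnc⟩ := exists_unit_normal β
  refine ⟨n, fun t ht => ⟨hn, ?_⟩⟩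
  set p := (1 - t) • x 0 + t • x 1 with hp
  obtain ⟨r, hr, hr'⟩ := exists_ball_mem_triangle_iff β ht
  obtain ⟨ρ, hρ, hρ'⟩ := exists_ball_mem_closure hΩ.isOpen hab he ht
  rw [hβ, ← hp] at hr'
  rw [← hβ, hβK] at hr'
  rw [← hp] at hρ'
  have hβp : β.coord 2 p = 0 := by rw [hp, ← hβ]; exact coord_two_lineMap β t
  -- near `p` the closed domain is the half-plane of `K`; the domain is its interior
  have hiff : ∀ z ∈ Metric.ball p (min r ρ), z ∈ closure Ω ↔ 0 ≤ β.coord 2 z := by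
    intro z hz
    rw [← hr' z (Metric.ball_subset_ball (min_le_left _ _) hz)]
    refine ⟨fun h => ?_, fun h => T.hull_subset_closure hKf h⟩
    obtain ⟨L, hL, h1, h2, h3⟩ := hρ' z (Metric.ball_subset_ball (min_le_right _ _) hz) h
    rwa [huniq L hL h1 h2] at h3
  refine ⟨min r ρ, lt_min hr hρ, fun z hz => ?_⟩
  rw [hnc z p hβp, mul_pos_iff_of_pos_left hc]
  constructor
  · intro hzΩ
    have hopen := isOpenMap_barycentric_coord β 2 _ (hΩ.isOpen.inter
      (Metric.isOpen_ball (x := p) (ε := min r ρ)))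
    have hsub : β.coord 2 '' (Ω ∩ Metric.ball p (min r ρ)) ⊆ Ici 0 := by
      rintro _ ⟨w, ⟨hw1, hw2⟩, rfl⟩
      exact (hiff w hw2).1 (subset_closure hw1)
    have := hopen.subset_interior_iff.2 hsub ⟨z, ⟨hzΩ, hz⟩, rfl⟩
    rwa [interior_Ici] at this
  · intro h
    rw [← hΩ.interior_closure]
    have hopen : IsOpen (Metric.ball p (min r ρ) ∩ {w | 0 < β.coord 2 w}) :=
      Metric.isOpen_ball.inter (isOpen_lt continuous_const (continuous_barycentric_coord β 2))
    exact mem_interior.2 ⟨_, fun w hw => (hiff w hw.1).2 hw.2.le, hopen, ⟨hz, h⟩⟩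

theorem exists_element_of_edge (hΩ : IsPolygon Ω) {a b : Plane} (hab : a ≠ b)
    (he : {a, b} ∈ T.faces) : ∃ K ∈ T.elements, a ∈ K ∧ b ∈ K := by
  classical
  have ht : (1 / 2 : ℝ) ∈ Ioo (0 : ℝ) 1 := by norm_num
  obtain ⟨r, hr, h⟩ := exists_ball_mem_closure (T := T) hΩ.isOpen hab he ht
  obtain ⟨K, hK, h1, h2, -⟩ := h _ (Metric.mem_ball_self hr)
    (T.hull_subset_closure he (lineMap_mem_hull_pair ht))
  exact ⟨K, hK, h1, h2⟩

end Triangulation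

end FracQuad

namespace FracQuad

/-! ### Decomposition of the bilinear form -/

theorem hausdorffMeasure_hull_of_card_le_one {e : Finset Plane} (he : e.card ≤ 1) :
    (μH[1] : Measure Plane) (hull e) = 0 := by
  have : NullSingletonClass (μH[1] : Measure Plane) := Measure.nullSingletonClass_hausdorff _ one_pos
  obtain ⟨a, ha⟩ := Finset.card_le_one_iff_subset_singleton.1 he
  refine measure_mono_null (convexHull_mono (Finset.coe_subset.2 ha)) ?_
  rw [Finset.coe_singleton, convexHull_singleton, measure_singleton]

/-- If simplices overlap in null sets, then restricting a measure to their union is restricting it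
to each of them and adding up. -/
theorem restrict_biUnion_hull {μ : Measure Plane} (S : Finset (Finset Plane))
    (h : ∀ K ∈ S, ∀ L ∈ S, K ≠ L → μ (hull K ∩ hull L) = 0) :
    μ.restrict (⋃ K ∈ S, hull K) = ∑ K ∈ S, μ.restrict (hull K) := by
  have h1 : (⋃ K ∈ S, hull K) = ⋃ K : S, hull K.1 := by rw [iUnion_subtype]
  rw [h1, Measure.restrict_iUnion_ae (s := fun K : S => hull K.1)
    (fun K L hKL => h K.1 K.2 L.1 L.2 fun h => hKL (Subtype.ext h))
    fun K => (measurableSet_hull _).nullMeasurableSet, Measure.sum_fintype]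
  exact Finset.sum_coe_sort S fun K => μ.restrict (hull K)

/-- Splitting an iterated integral with respect to sums of measures. -/
theorem integral_integral_sum_measure {X Y ι κ : Type*} [MeasurableSpace X] [MeasurableSpace Y]
    (S : Finset ι) (R : Finset κ) (μ : ι → Measure X) (ν : κ → Measure Y)
    [∀ i, IsFiniteMeasure (μ i)] [∀ j, SFinite (ν j)] {F : X × Y → ℝ}
    (h : ∀ i ∈ S, ∀ j ∈ R, Integrable F ((μ i).prod (ν j))) :
    ∫ x, ∫ y, F (x, y) ∂(∑ j ∈ R, ν j) ∂(∑ i ∈ S, μ i) =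
      ∑ i ∈ S, ∑ j ∈ R, ∫ z, F z ∂((μ i).prod (ν j)) := by
  have hae : ∀ i ∈ S, (fun x => ∫ y, F (x, y) ∂(∑ j ∈ R, ν j)) =ᵐ[μ i]
      fun x => ∑ j ∈ R, ∫ y, F (x, y) ∂(ν j) := fun i hi => by
    have h1 : ∀ᵐ x ∂(μ i), ∀ j ∈ R, Integrable (fun y => F (x, y)) (ν j) :=
      (Finset.eventually_all R).2 fun j hj => (h i hi j hj).prod_right_ae
    filter_upwards [h1] with x hx
    exact integral_finsetSum_measure hx
  have hint : ∀ i ∈ S, ∀ j ∈ R, Integrable (fun x => ∫ y, F (x, y) ∂(ν j)) (μ i) :=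
    fun i hi j hj => (h i hi j hj).integral_prod_left
  rw [integral_finsetSum_measure fun i hi =>
    (integrable_finsetSum R fun j hj => hint i hi j hj).congr (hae i hi).symm]
  refine Finset.sum_congr rfl fun i hi => ?_
  rw [integral_congr_ae (hae i hi), integral_finsetSum R fun j hj => hint i hi j hj]
  refine Finset.sum_congr rfl fun j hj => ?_
  rw [integral_prod _ (h i hi j hj)]

theorem hull_eq_segment {e : Finset Plane} {y : Fin 2 → Plane} (hy : range y = e) :
    hull e = segment ℝ (y 0) (y 1) := by
  rw [hull, ← hy, ← convexHull_pair]
  congr 1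
  ext z
  simp [Fin.exists_fin_two, eq_comm]

namespace Triangulation

variable {Ω : Set Plane} {T : Triangulation Ω}

theorem volume_frontier (hΩ : IsPolygon Ω) : volume (frontier Ω) = 0 := by
  classical
  obtain ⟨S, hS⟩ := hΩ.frontier_eq
  rw [hS]
  refine (measure_biUnion_null_iff (Finset.countable_toSet S)).2 fun p _ => ?_
  rw [← hull_pair]
  exact volume_hull_of_card_le_two Finset.card_le_two

theorem inter_hull_subset [DecidableEq Plane] {K L : Finset Plane} (hK : K ∈ T.faces)
    (hL : L ∈ T.faces) : hull K ∩ hull L ⊆ hull (K ∩ L) := by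
  unfold hull
  rw [Finset.coe_inter]
  exact T.inter_subset_convexHull hK hL

theorem card_inter_lt [DecidableEq Plane] {K L : Finset Plane} (h : K.card = L.card)
    (hne : K ≠ L) : (K ∩ L).card < K.card := by
  refine Finset.card_lt_card ⟨Finset.inter_subset_left, fun h' => hne ?_⟩
  exact Finset.eq_of_subset_of_card_le (fun k hk => (Finset.mem_inter.1 (h' hk)).2) h.ge

/-- The integral over the domain is the sum of the integrals over the elements. -/
theorem restrict_eq_sum (hΩ : IsPolygon Ω) (T : Triangulation Ω) :
    volume.restrict Ω = ∑ K ∈ T.elements, volume.restrict (hull K) := by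
  classical
  rw [← restrict_biUnion_hull, ← T.closure_eq_iUnion hΩ.isOpen]
  · refine Measure.restrict_congr_set ?_
    refine (ae_eq_set.2 ⟨?_, ?_⟩)
    · rw [sdiff_eq_empty.2 subset_closure, measure_empty]
    · rw [← hΩ.isOpen.frontier_eq]; exact volume_frontier hΩ
  · intro K hK L hL hKL
    obtain ⟨hKf, hKc⟩ := T.mem_elements.1 hK
    obtain ⟨hLf, hLc⟩ := T.mem_elements.1 hL
    refine measure_mono_null (inter_hull_subset hKf hLf) (volume_hull_of_card_le_two ?_)
    have := card_inter_lt (hKc.trans hLc.symm) hKL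
    omega

theorem notMem_of_mem_frontier (hΩ : IsPolygon Ω) {z : Plane} (hz : z ∈ frontier Ω) : z ∉ Ω := by
  rw [hΩ.isOpen.frontier_eq] at hz
  exact hz.2

/-- Every boundary point other than a vertex lies on a boundary edge. -/
theorem frontier_subset (hΩ : IsPolygon Ω) (T : Triangulation Ω) : frontier Ω ⊆
    (⋃ e ∈ T.boundaryEdges, hull e) ∪ ⋃ K ∈ T.elements, (K : Set Plane) := by
  classical
  intro z hz
  have hzc : z ∈ closure Ω := frontier_subset_closure hz
  have hzΩ := notMem_of_mem_frontier hΩ hz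
  rw [T.closure_eq_iUnion hΩ.isOpen] at hzc
  obtain ⟨K, hK, hzK⟩ := mem_iUnion₂.1 hzc
  obtain ⟨hKf, hKc⟩ := T.mem_elements.1 hK
  by_cases hv : z ∈ K
  · exact Or.inr (mem_iUnion₂.2 ⟨K, hK, hv⟩)
  refine Or.inl ?_
  have hbary := T.isBary_bary hKf hzK
  -- otherwise `z` would be an interior point of the triangle `K`
  obtain ⟨k, hk, hk0⟩ : ∃ k ∈ K, T.bary z k = 0 := by
    by_contra! hcon
    obtain ⟨a, b, hab, hK2⟩ : ∃ a b : Plane, a ≠ b ∧ a ∈ K ∧ b ∈ K := by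
      obtain ⟨a, ha, b, hb, hab⟩ := Finset.one_lt_card.1 (by omega : 1 < K.card)
      exact ⟨a, b, hab, ha, hb⟩
    obtain ⟨x, hx, -, -⟩ := exists_numbering hKc hK2.1 hK2.2 hab
    obtain ⟨β, hβ, hβK⟩ := T.exists_affineBasis hK hx
    have hxinj := injective_of_range_eq hx hKc
    have hsumK : ∀ {E : Type} [AddCommMonoid E] (F : Plane → E), ∑ k ∈ K, F k = ∑ i, F (x i) := by
      intro E _ F
      have : K = Finset.univ.image x := by
        rw [← Finset.coe_inj, Finset.coe_image, Finset.coe_univ, image_univ, hx]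
      rw [this, Finset.sum_image fun i _ j _ h => hxinj h]
    have h1 : ∑ i, T.bary z (x i) = 1 := by rw [← hsumK, hbary.sum_eq]
    have h2 : ∑ i, T.bary z (x i) • β i = z := by
      rw [hβ, ← hsumK fun k => T.bary z k • k, hbary.sum_smul]
    have hint : z ∈ interior (hull K) := by
      rw [← hβK, β.interior_convexHull, mem_ofPred_eq]
      intro i
      rw [← h2, coord_sum β h1]
      exact lt_of_le_of_ne (hbary.nonneg _) (hcon _ (mem_range_coe hx i)).symm
    apply hzΩ
    rw [← hΩ.interior_closure]
    exact interior_mono (T.hull_subset_closure hKf) hint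
  obtain ⟨a, b, hab, hKe⟩ := Finset.card_eq_two.1
    (show (K.erase k).card = 2 by rw [Finset.card_erase_of_mem hk, hKc])
  have haK : a ∈ K := Finset.mem_of_mem_erase (by rw [hKe]; simp : a ∈ K.erase k)
  have hbK : b ∈ K := Finset.mem_of_mem_erase (by rw [hKe]; simp : b ∈ K.erase k)
  have hsum : ∀ {E : Type} [AddCommMonoid E] (F : Plane → E), F k = 0 →
      ∑ k ∈ K, F k = F a + F b := by
    intro E _ F hF
    rw [← Finset.add_sum_erase K F hk, hF, zero_add, hKe, Finset.sum_pair hab]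
  have h1 : T.bary z a + T.bary z b = 1 := by rw [← hbary.sum_eq, hsum _ hk0]
  have h2 : T.bary z a • a + T.bary z b • b = z := by
    rw [← hsum (fun k => T.bary z k • k) (by rw [hk0, zero_smul]), hbary.sum_smul]
  set t := T.bary z b with ht
  have ha1 : T.bary z a = 1 - t := by linarith
  rw [ha1] at h2
  have ht0 : t ≠ 0 := fun h => hv (by
    rw [h] at h2; simp only [sub_zero, one_smul, zero_smul, add_zero] at h2; rwa [← h2])
  have ht1 : t ≠ 1 := fun h => hv (by
    rw [h] at h2; simp only [sub_self, one_smul, zero_smul, zero_add] at h2; rwa [← h2])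
  have htI : t ∈ Ioo (0 : ℝ) 1 := ⟨lt_of_le_of_ne (hbary.nonneg b) ht0.symm,
    lt_of_le_of_ne (hbary.le_one b) ht1⟩
  have he : {a, b} ∈ T.faces := T.down_closed hKf
    (by simp [Finset.insert_subset_iff, haK, hbK]) (by simp)
  -- the edge belongs to no other element, since `z` is not in the domain; hence all of it lies on
  -- the boundary
  refine mem_iUnion₂.2 ⟨{a, b}, T.mem_boundaryEdges.2 ⟨he, Finset.card_pair hab, ?_⟩, ?_⟩
  · have huniq : ∀ L ∈ T.elements, a ∈ L → b ∈ L → L = K := by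
      intro L hL haL hbL
      by_contra hne
      exact hzΩ (h2 ▸ lineMap_mem_of_ne hΩ hab hL hK hne haL hbL haK hbK htI)
    obtain ⟨n, hn⟩ := exists_isInwardNormal hΩ hab hK haK hbK huniq
    rw [hull_pair, ← closure_openSegment]
    refine closure_minimal ?_ isClosed_frontier
    rw [openSegment_eq_image]
    rintro _ ⟨θ, hθ, rfl⟩
    rw [hΩ.isOpen.frontier_eq]
    refine ⟨T.hull_subset_closure he (lineMap_mem_hull_pair hθ), (hn θ hθ).notMem⟩
  · rw [← h2]; exact lineMap_mem_hull_pair htI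

theorem boundaryEdges_subset (T : Triangulation Ω) :
    (⋃ e ∈ T.boundaryEdges, hull e) ⊆ frontier Ω :=
  iUnion₂_subset fun _ he => (T.mem_boundaryEdges.1 he).2.2

/-- The integral over the boundary with respect to arc length is the sum of the integrals over the
boundary edges. -/
theorem restrict_frontier_eq_sum (hΩ : IsPolygon Ω) (T : Triangulation Ω) :
    (μH[1] : Measure Plane).restrict (frontier Ω) =
      ∑ e ∈ T.boundaryEdges, μH[1].restrict (hull e) := by
  classical
  have : NullSingletonClass (μH[1] : Measure Plane) := Measure.nullSingletonClass_hausdorff _ one_pos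
  rw [← restrict_biUnion_hull]
  · refine Measure.restrict_congr_set (ae_eq_set.2 ⟨?_, ?_⟩)
    · have hfin : (⋃ K ∈ T.elements, (K : Set Plane)).Finite :=
        T.elements.finite_toSet.biUnion fun K _ => K.finite_toSet
      refine measure_mono_null ?_ (hfin.measure_zero _)
      rintro z ⟨hz, hz'⟩
      exact (frontier_subset hΩ T hz).resolve_left hz'
    · rw [sdiff_eq_empty.2 T.boundaryEdges_subset, measure_empty]
  · intro e he f hf hef
    obtain ⟨hef', hec, -⟩ := T.mem_boundaryEdges.1 he
    obtain ⟨hff, hfc, -⟩ := T.mem_boundaryEdges.1 hf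
    refine measure_mono_null (inter_hull_subset hef' hff) (hausdorffMeasure_hull_of_card_le_one ?_)
    have := card_inter_lt (hec.trans hfc.symm) hef
    omega

/-- The inward normal is constant on each boundary edge. -/
theorem inwardNormal_boundaryEdge (hΩ : IsPolygon Ω) {e : Finset Plane}
    (he : e ∈ T.boundaryEdges) {y : Fin 2 → Plane} (hy : range y = e) :
    ‖Scheme.edgeNormal Ω y‖ = 1 ∧ ∀ t ∈ Ioo (0 : ℝ) 1,
      inwardNormal Ω ((1 - t) • y 0 + t • y 1) = Scheme.edgeNormal Ω y := by
  classical
  obtain ⟨hef, hec, heΩ⟩ := T.mem_boundaryEdges.1 he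
  have hinj := injective_of_range_eq hy hec
  have hne : y 0 ≠ y 1 := fun h => by have := hinj h; simp at this
  have hey : e = {y 0, y 1} := by
    rw [← Finset.coe_inj, ← hy]
    ext z
    simp [Fin.exists_fin_two, eq_comm]
  rw [hey] at hef heΩ
  obtain ⟨K, hK, hK0, hK1⟩ := exists_element_of_edge hΩ hne hef
  have huniq : ∀ L ∈ T.elements, y 0 ∈ L → y 1 ∈ L → L = K := by
    intro L hL h0 h1
    by_contra h
    have ht : (1 / 2 : ℝ) ∈ Ioo (0 : ℝ) 1 := by norm_num
    exact notMem_of_mem_frontier hΩ (heΩ (lineMap_mem_hull_pair ht))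
      (lineMap_mem_of_ne hΩ hne hL hK h h0 h1 hK0 hK1 ht)
  obtain ⟨n, hn⟩ := exists_isInwardNormal hΩ hne hK hK0 hK1 huniq
  have hmid : Scheme.edgeNormal Ω y = n := by
    have h1 := hn (1 / 2) (by norm_num)
    rw [Scheme.edgeNormal]
    refine inwardNormal_eq ?_
    convert h1 using 1
    rw [midpoint_eq_smul_add]
    norm_num
  rw [hmid]
  exact ⟨(hn (1 / 2) (by norm_num)).1, fun t ht => inwardNormal_eq (hn t ht)⟩

theorem ae_inwardNormal_eq (hΩ : IsPolygon Ω) {e : Finset Plane}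
    (he : e ∈ T.boundaryEdges) {y : Fin 2 → Plane} (hy : range y = e) :
    ∀ᵐ z ∂((μH[1] : Measure Plane).restrict (hull e)),
      inwardNormal Ω z = Scheme.edgeNormal Ω y := by
  have : NullSingletonClass (μH[1] : Measure Plane) := Measure.nullSingletonClass_hausdorff _ one_pos
  have h0 : ∀ᵐ z ∂((μH[1] : Measure Plane).restrict (hull e)), z ∉ ({y 0, y 1} : Set Plane) :=
    ae_restrict_of_ae (measure_eq_zero_iff_ae_notMem.1 ((toFinite _).measure_zero _))
  filter_upwards [h0, ae_restrict_mem (measurableSet_hull e)] with z hz hze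
  rw [hull_eq_segment hy, segment_eq_image] at hze
  obtain ⟨t, ht, rfl⟩ := hze
  refine (inwardNormal_boundaryEdge hΩ he hy).2 t ⟨lt_of_le_of_ne ht.1 fun h => hz ?_,
    lt_of_le_of_ne ht.2 fun h => hz ?_⟩
  · simp [← h]
  · simp [h]

/-- The bilinear form is the sum of the contributions of all pairs of elements, and of all pairs
of an element and a boundary edge. -/
theorem bilin_eq_sum (hΩ : IsPolygon Ω) (T : Triangulation Ω) {s : ℝ} {u v : Plane → ℝ}
    {n : Finset Plane → Finset Plane → Plane}
    (hn : ∀ K ∈ T.elements, ∀ e ∈ T.boundaryEdges,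
      ∀ᵐ z ∂((μH[1] : Measure Plane).restrict (hull e)), inwardNormal Ω z = n K e)
    (h : ∀ K ∈ T.elements, ∀ L ∈ T.elements, Integrable (energyDensity s u v)
      ((volume.restrict (hull K)).prod (volume.restrict (hull L))))
    (hb : ∀ K ∈ T.elements, ∀ e ∈ T.boundaryEdges, Integrable (edgeDensity s (n K e) u v)
      ((volume.restrict (hull K)).prod (μH[1].restrict (hull e)))) :
    bilin Ω s u v =
      ∑ K ∈ T.elements, ∑ L ∈ T.elements, fracConst 2 s / 2 *
        ∫ z, energyDensity s u v z
          ∂((volume.restrict (hull K)).prod (volume.restrict (hull L))) +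
      ∑ K ∈ T.elements, ∑ e ∈ T.boundaryEdges, fracConst 2 s / (2 * s) *
        ∫ z, edgeDensity s (n K e) u v z
          ∂((volume.restrict (hull K)).prod (μH[1].restrict (hull e))) := by
  have h1 := integral_integral_sum_measure T.elements T.elements
    (fun K => volume.restrict (hull K)) (fun K => volume.restrict (hull K)) h
  rw [← restrict_eq_sum hΩ T] at h1
  set F : Plane × Plane → ℝ := fun z =>
    u z.1 * v z.1 * inner ℝ (inwardNormal Ω z.2) (z.1 - z.2) / ‖z.1 - z.2‖ ^ (2 + 2 * s) with hF
  set ν : T.boundaryEdges → Measure Plane := fun e => μH[1].restrict (hull e.1) with hν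
  have hνfin : ∀ e : T.boundaryEdges, IsFiniteMeasure (ν e) := fun e => by
    obtain ⟨-, hec, -⟩ := T.mem_boundaryEdges.1 e.2
    refine ⟨?_⟩
    rw [hν, Measure.restrict_apply_univ]
    classical
    obtain ⟨a, b, -, hab⟩ := Finset.card_eq_two.1 hec
    rw [hab, hull_pair, hausdorffMeasure_segment]
    exact edist_lt_top _ _
  have hae : ∀ K ∈ T.elements, ∀ e : T.boundaryEdges,
      edgeDensity s (n K e) u v =ᵐ[(volume.restrict (hull K)).prod (ν e)] F := by
    intro K hK e
    have h2 : ∀ᵐ z ∂((volume.restrict (hull K)).prod (ν e)), inwardNormal Ω z.2 = n K e :=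
      Measure.quasiMeasurePreserving_snd.ae (hn K hK e e.2)
    filter_upwards [h2] with z hz
    simp only [hF, hz, edgeDensity, normalKernel, mul_div_assoc]
  have h2 := integral_integral_sum_measure T.elements Finset.univ
    (fun K => volume.restrict (hull K)) ν
    fun K hK e _ => (hb K hK e e.2).congr (hae K hK e)
  have hsum : ∑ e, ν e = μH[1].restrict (frontier Ω) := by
    rw [restrict_frontier_eq_sum hΩ T]
    exact Finset.sum_coe_sort T.boundaryEdges fun e => μH[1].restrict (hull e)
  rw [hsum, ← restrict_eq_sum hΩ T] at h2
  have e1 : ∫ x in Ω, ∫ y in Ω, (u x - u y) * (v x - v y) / ‖x - y‖ ^ (2 + 2 * s) = _ := h1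
  have e2 : ∫ x in Ω, ∫ y in frontier Ω,
    u x * v x * inner ℝ (inwardNormal Ω y) (x - y) / ‖x - y‖ ^ (2 + 2 * s) ∂μH[1] = _ := h2
  rw [bilin, e1, e2]
  simp only [Finset.mul_sum]
  congr 1
  refine Finset.sum_congr rfl fun K hK => ?_
  rw [← Finset.sum_coe_sort T.boundaryEdges]
  exact Finset.sum_congr rfl fun e _ => by rw [integral_congr_ae (hae K hK e)]

end Triangulation

end FracQuad

namespace FracQuad

/-! ### Size of the elements and inverse estimate -/

/-- The `L²` norm on one element. -/
noncomputable def localNorm (K : Finset Plane) (u : Plane → ℝ) : ℝ := √(∫ x in hull K, u x ^ 2)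

theorem localNorm_nonneg (K : Finset Plane) (u : Plane → ℝ) : 0 ≤ localNorm K u := Real.sqrt_nonneg _

theorem localNorm_sq (K : Finset Plane) (u : Plane → ℝ) :
    localNorm K u ^ 2 = ∫ x in hull K, u x ^ 2 :=
  Real.sq_sqrt (integral_nonneg fun x => sq_nonneg (u x))

theorem area_nonneg (K : Finset Plane) : 0 ≤ Scheme.area K := ENNReal.toReal_nonneg

namespace Triangulation

variable {Ω : Set Plane} {T : Triangulation Ω} {Λ : ℝ}

theorem integrableOn_sq {K : Finset Plane} (hK : K ∈ T.elements) {u : Plane → ℝ}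
    (hu : u ∈ T.p1Space) : IntegrableOn (fun x => u x ^ 2) (hull K) := by
  obtain ⟨g, hg⟩ := hu.1 K hK
  refine IntegrableOn.congr_fun (f := fun x => g x ^ 2) ?_ (fun x hx => by rw [hg hx])
    (measurableSet_hull K)
  exact ((g.continuous_of_finiteDimensional.pow 2).continuousOn).integrableOn_compact
    (isCompact_hull K)

/-- The inverse estimate, for an affine function on one triangle: shrinking the triangle towards
the vertex with the largest nodal value gives a region on which that value is half attained. -/
theorem apply_sq_mul_area_le {K : Finset Plane} (hK : K ∈ T.elements) {u : Plane → ℝ}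
    (hu : u ∈ T.p1Space) {k : Plane} (hk : k ∈ K) :
    u k ^ 2 * Scheme.area K ≤ 64 * ∫ x in hull K, u x ^ 2 := by
  obtain ⟨g, hg⟩ := hu.1 K hK
  have hsub : (K : Set Plane) ⊆ hull K := subset_convexHull ℝ _
  obtain ⟨m, hm, hmax⟩ := K.exists_max_image (fun x => |u x|) ⟨k, hk⟩
  have hle : ∀ x ∈ hull K, |u x| ≤ |u m| := by
    intro x hx
    obtain ⟨w, hw⟩ := mem_hull_iff_exists_isBary.1 hx
    rw [hg hx]
    conv_lhs => rw [← hw.sum_smul, affine_apply_sum K hw.sum_eq (fun k => k)]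
    calc |∑ i ∈ K, w i * g i| ≤ ∑ i ∈ K, w i * |u m| := by
          refine (Finset.abs_sum_le_sum_abs _ _).trans (Finset.sum_le_sum fun i hi => ?_)
          rw [abs_mul, abs_of_nonneg (hw.nonneg i), ← hg (hsub hi)]
          exact mul_le_mul_of_nonneg_left (hmax i hi) (hw.nonneg i)
      _ = |u m| := by rw [← Finset.sum_mul, hw.sum_eq, one_mul]
  -- after shrinking by `1 / 4` towards `m`, the values are at least `3 / 4 - 1 / 4` times the
  -- maximum
  set S := AffineMap.homothety m (1 / 4 : ℝ) '' hull K with hS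
  have hSK : S ⊆ hull K := by
    rintro _ ⟨x, hx, rfl⟩
    rw [AffineMap.homothety_eq_lineMap]
    exact (convex_hull K).lineMap_mem (hsub hm) hx (by norm_num)
  have hSvol : volume.real S = Scheme.area K / 16 := by
    rw [Measure.real, hS, Measure.addHaar_image_homothety, finrank_euclideanSpace_fin,
      ENNReal.toReal_mul, ENNReal.toReal_ofReal (abs_nonneg _), Scheme.area]
    norm_num
    ring
  have hSm : MeasurableSet S :=
    ((isCompact_hull K).image (AffineMap.continuous_of_finiteDimensional _)).measurableSet
  have hhalf : ∀ x ∈ S, u m ^ 2 / 4 ≤ u x ^ 2 := by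
    rintro _ ⟨x, hx, rfl⟩
    have h1 : u (AffineMap.homothety m (1 / 4 : ℝ) x) = 3 / 4 * u m + 1 / 4 * u x := by
      rw [hg (hSK ⟨x, hx, rfl⟩), hg (hsub hm), hg hx, AffineMap.homothety_eq_lineMap,
        AffineMap.apply_lineMap, AffineMap.lineMap_apply_ring']
      ring
    have h2 := hle x hx
    rw [h1, show u m ^ 2 / 4 = (|u m| / 2) ^ 2 by rw [div_pow, sq_abs]; norm_num, ← sq_abs (_ + _)]
    refine pow_le_pow_left₀ (by positivity) ?_ 2
    have h3 := abs_sub_abs_le_abs_sub (3 / 4 * u m) (-(1 / 4 * u x))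
    rw [abs_neg, abs_mul, abs_mul, sub_neg_eq_add] at h3
    norm_num at h3 ⊢
    linarith
  have hint := integrableOn_sq hK hu
  have h1 : u m ^ 2 / 4 * volume.real S ≤ ∫ x in S, u x ^ 2 := by
    refine setIntegral_ge_of_const_le_real hSm ?_ hhalf (hint.mono_set hSK)
    exact ((measure_mono hSK).trans_lt (volume_hull_lt_top K)).ne
  have h2 : ∫ x in S, u x ^ 2 ≤ ∫ x in hull K, u x ^ 2 :=
    setIntegral_mono_set hint (Filter.Eventually.of_forall fun x => sq_nonneg (u x))
      hSK.eventuallyLE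
  have h3 : u k ^ 2 ≤ u m ^ 2 := sq_le_sq.2 (hmax k hk)
  have h4 := mul_le_mul_of_nonneg_right h3 (area_nonneg K)
  rw [hSvol] at h1
  linarith

theorem Regular.sq_meshSize_le_area (h : T.Regular Λ) {K : Finset Plane} (hK : K ∈ T.elements) :
    T.meshSize ^ 2 ≤ 4 * Λ ^ 2 * Scheme.area K := by
  obtain ⟨c, r, hr, hball, hd⟩ := h.disc K hK
  have h1 : volume (Metric.closedBall c r) ≤ volume (hull K) := measure_mono hball
  have h2 : r ^ 2 * Real.pi ≤ Scheme.area K := by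
    have := ENNReal.toReal_mono (volume_hull_lt_top K).ne h1
    rwa [EuclideanSpace.volume_closedBall_fin_two, ENNReal.toReal_mul, ENNReal.toReal_pow,
      ENNReal.toReal_ofReal hr.le, ENNReal.toReal_ofReal Real.pi_pos.le] at this
  have h3 : T.meshSize ^ 2 ≤ (Λ * (2 * r)) ^ 2 := pow_le_pow_left₀ h.pos.le hd 2
  have h4 : r ^ 2 ≤ Scheme.area K := by nlinarith [Real.pi_gt_three, sq_nonneg r]
  nlinarith [mul_le_mul_of_nonneg_left h4 (sq_nonneg Λ)]

theorem Regular.area_le (h : T.Regular Λ) {K : Finset Plane} (hK : K ∈ T.elements) :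
    Scheme.area K ≤ 4 * T.meshSize ^ 2 := by
  obtain ⟨c, r, hr, hball, -⟩ := h.disc K hK
  have hc : c ∈ hull K := hball (Metric.mem_closedBall_self hr.le)
  have h1 : volume (hull K) ≤ volume (Metric.closedBall c T.meshSize) :=
    measure_mono fun x hx => (Metric.dist_le_diam_of_mem (isCompact_hull K).isBounded hx hc).trans
      (h.diam_le K hK)
  rw [EuclideanSpace.volume_closedBall_fin_two] at h1
  have h2 := ENNReal.toReal_mono (by finiteness) h1
  rw [ENNReal.toReal_mul, ENNReal.toReal_pow, ENNReal.toReal_ofReal h.pos.le,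
    ENNReal.toReal_ofReal Real.pi_pos.le] at h2
  exact h2.trans (by nlinarith [Real.pi_lt_four, sq_nonneg T.meshSize])

theorem Regular.meshSize_mul_abs_le (h : T.Regular Λ) {K : Finset Plane} (hK : K ∈ T.elements)
    {u : Plane → ℝ} (hu : u ∈ T.p1Space) {k : Plane} (hk : k ∈ K) :
    T.meshSize * |u k| ≤ 16 * Λ * localNorm K u := by
  have hΛ := h.one_le
  have h1 := apply_sq_mul_area_le hK hu hk
  have h2 := mul_le_mul_of_nonneg_left (h.sq_meshSize_le_area hK) (sq_nonneg (u k))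
  rw [← localNorm_sq] at h1
  refine (pow_le_pow_iff_left₀ (mul_nonneg h.pos.le (abs_nonneg _))
    (mul_nonneg (by positivity) (localNorm_nonneg K u)) two_ne_zero).1 ?_
  rw [mul_pow, sq_abs, mul_pow, mul_pow]
  nlinarith [mul_le_mul_of_nonneg_left h1 (sq_nonneg Λ)]

theorem Regular.meshSize_le_mul_dist (h : T.Regular Λ) {K : Finset Plane} (hK : K ∈ T.elements)
    {a b : Plane} (ha : a ∈ K) (hb : b ∈ K) (hab : a ≠ b) :
    T.meshSize ≤ Λ * ‖a - b‖ := by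
  classical
  have hKf := (T.mem_elements.1 hK).1
  have hsub : (K : Set Plane) ⊆ hull K := subset_convexHull ℝ _
  have hbary : ∀ c ∈ K, T.bary c = fun k => if k = c then 1 else 0 := fun c hc =>
    T.bary_eq hKf ⟨fun k => by split_ifs <;> norm_num,
      fun k hk => if_neg (ne_of_mem_of_not_mem hc hk).symm, by simp [hc], by simp [hc]⟩
  have h1 := h.abs_bary_sub_le_of_mem hK (hsub ha) (hsub hb) a
  rw [hbary a ha, hbary b hb] at h1
  simp only [if_true, if_neg hab, sub_zero, abs_one] at h1
  rwa [div_mul_eq_mul_div, le_div_iff₀ h.pos, one_mul] at h1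

theorem Regular.diam_edge_le (h : T.Regular Λ) (hΩ : IsPolygon Ω) {e : Finset Plane}
    (he : e ∈ T.boundaryEdges) :
    Metric.diam (hull e) ≤ T.meshSize ∧ T.meshSize ≤ Λ * Metric.diam (hull e) := by
  classical
  obtain ⟨hef, hec, -⟩ := T.mem_boundaryEdges.1 he
  obtain ⟨a, b, hab, rfl⟩ := Finset.card_eq_two.1 hec
  obtain ⟨K, hK, ha, hb⟩ := exists_element_of_edge hΩ hab hef
  refine ⟨(Metric.diam_mono (convexHull_mono ?_) (isCompact_hull K).isBounded).trans
    (h.diam_le K hK), (h.meshSize_le_mul_dist hK ha hb hab).trans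
    (mul_le_mul_of_nonneg_left ?_ (zero_le_one.trans h.one_le))⟩
  · simp [insert_subset_iff, ha, hb]
  · rw [← dist_eq_norm]
    exact Metric.dist_le_diam_of_mem (isCompact_hull _).isBounded
      (subset_convexHull ℝ _ (by simp)) (subset_convexHull ℝ _ (by simp))

theorem Regular.card_elements_le (h : T.Regular Λ) (hΩ : IsPolygon Ω) :
    T.elements.card * T.meshSize ^ 2 ≤ 4 * Λ ^ 2 * volume.real Ω := by
  have h1 : volume.real Ω = ∑ K ∈ T.elements, Scheme.area K := by
    have h2 := congrArg (fun μ : Measure Plane => μ univ) (restrict_eq_sum hΩ T)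
    simp only [Measure.restrict_apply_univ, Measure.coe_finsetSum, Finset.sum_apply] at h2
    rw [Measure.real, h2, ENNReal.toReal_sum fun K _ => (volume_hull_lt_top K).ne]
    rfl
  rw [h1, Finset.mul_sum, ← nsmul_eq_mul]
  exact Finset.card_nsmul_le_sum _ _ _ fun K hK => h.sq_meshSize_le_area hK

theorem Regular.card_boundaryEdges_le (h : T.Regular Λ) (hΩ : IsPolygon Ω) :
    T.boundaryEdges.card * T.meshSize ≤ Λ * (μH[1] (frontier Ω)).toReal := by
  have h2 := congrArg (fun μ : Measure Plane => μ univ) (restrict_frontier_eq_sum hΩ T)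
  simp only [Measure.restrict_apply_univ, Measure.coe_finsetSum, Finset.sum_apply] at h2
  have h3 : ∀ e ∈ T.boundaryEdges, μH[1] (hull e) = ENNReal.ofReal (Metric.diam (hull e)) := by
    intro e he
    classical
    obtain ⟨a, b, -, rfl⟩ := Finset.card_eq_two.1 (T.mem_boundaryEdges.1 he).2.1
    rw [hull, Finset.coe_pair, convexHull_diam, convexHull_pair, hausdorffMeasure_segment,
      Metric.diam_pair, edist_dist]
  rw [h2, ENNReal.toReal_sum fun e he => by rw [h3 e he]; finiteness, Finset.mul_sum, ← nsmul_eq_mul]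
  refine Finset.card_nsmul_le_sum _ _ _ fun e he => ?_
  rw [h3 e he, ENNReal.toReal_ofReal Metric.diam_nonneg]
  exact (h.diam_edge_le hΩ he).2

theorem sum_sq_localNorm (hΩ : IsPolygon Ω) {u : Plane → ℝ} (hu : u ∈ T.p1Space) :
    ∑ K ∈ T.elements, localNorm K u ^ 2 = normL2 Ω u ^ 2 := by
  have hres := restrict_eq_sum hΩ T
  have hint : Integrable (fun x => u x ^ 2) (volume.restrict Ω) := by
    rw [hres, integrable_finsetSum_measure]
    exact fun K hK => integrableOn_sq hK hu
  have haes : AEStronglyMeasurable u (volume.restrict Ω) := by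
    rw [hres, ← Finset.sum_coe_sort, ← Measure.sum_fintype]
    refine AEStronglyMeasurable.sum_measure fun K => ?_
    obtain ⟨g, hg⟩ := hu.1 K.1 K.2
    refine (measurable_affineMap g).aestronglyMeasurable.congr ?_
    filter_upwards [ae_restrict_mem (measurableSet_hull K.1)] with x hx using (hg hx).symm
  have hmem : MemLp u 2 (volume.restrict Ω) := (memLp_two_iff_integrable_sq haes).2 hint
  have h0 : 0 ≤ ∫ x in Ω, u x ^ 2 := integral_nonneg fun x => sq_nonneg (u x)
  have h1 : normL2 Ω u ^ 2 = ∫ x in Ω, u x ^ 2 := by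
    rw [normL2, hmem.eLpNorm_eq_integral_rpow_norm two_ne_zero ENNReal.ofNat_ne_top,
      ENNReal.toReal_ofReal (by positivity)]
    simp only [ENNReal.toReal_ofNat, Real.rpow_ofNat, Real.norm_eq_abs, sq_abs]
    rw [← Real.rpow_natCast, ← Real.rpow_mul h0]
    norm_num
  rw [h1, hres, integral_finsetSum_measure fun K hK => integrableOn_sq hK hu]
  exact Finset.sum_congr rfl fun K _ => localNorm_sq K u

end Triangulation

end FracQuad

namespace FracQuad

/-! ### Disjoint elements at a distance smaller than the mesh size -/

theorem isPreconnected_ball_sdiff_finite (c : Plane) {r : ℝ} (hr : 0 < r) {P : Set Plane}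
    (hP : P.Finite) : IsPreconnected (Metric.ball c r \ P) := by
  set f := OpenPartialHomeomorph.univBall c r with hf
  have hinj : Function.Injective f := by
    have := f.injOn
    rwa [hf, OpenPartialHomeomorph.univBall_source, injOn_univ] at this
  have himg : f '' univ = Metric.ball c r := by
    rw [← OpenPartialHomeomorph.univBall_source c r, ← OpenPartialHomeomorph.univBall_target c hr]
    exact f.image_source_eq_target
  have h1 : Metric.ball c r \ P = f '' (f ⁻¹' P)ᶜ := by
    rw [← himg]
    ext z
    constructor
    · rintro ⟨⟨w, -, rfl⟩, hw⟩; exact ⟨w, hw, rfl⟩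
    · rintro ⟨w, hw, rfl⟩; exact ⟨⟨w, trivial, rfl⟩, hw⟩
  rw [h1]
  refine IsPreconnected.image ?_ _ (OpenPartialHomeomorph.continuous_univBall c r).continuousOn
  refine ((hP.preimage hinj.injOn).countable.isConnected_compl_of_one_lt_rank ?_).isPreconnected
  rw [← Module.finrank_eq_rank, finrank_euclideanSpace_fin]
  norm_num

/-- Removing finitely many points from a connected plane open set does not disconnect it. -/
theorem exists_mem_inter_notMem {Ω P U V : Set Plane} (hΩ : IsOpen Ω) (hc : IsPreconnected Ω)
    (hP : P.Finite) (hU : IsClosed U) (hV : IsClosed V) (hUV : Ω ⊆ U ∪ V)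
    (hUΩ : (Ω ∩ U).Nonempty) (hVΩ : (Ω ∩ V).Nonempty) (hUint : U ⊆ closure (interior U))
    (hVint : V ⊆ closure (interior V)) : ∃ y ∈ U ∩ V, y ∉ P := by
  obtain ⟨x, hx, hxU, hxV⟩ := isPreconnected_closed_iff.1 hc U V hU hV hUV hUΩ hVΩ
  obtain ⟨r, hr, hball⟩ := Metric.isOpen_iff.1 hΩ x hx
  have hne : ∀ W : Set Plane, W ⊆ closure (interior W) → x ∈ W →
      (Metric.ball x r \ P ∩ W).Nonempty := by
    intro W hW hxW
    obtain ⟨z, hz1, hz2⟩ := mem_closure_iff.1 (hW hxW) _ Metric.isOpen_ball (Metric.mem_ball_self hr)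
    have hinf : (Metric.ball x r ∩ interior W).Infinite :=
      infinite_of_mem_nhds z ((Metric.isOpen_ball.inter isOpen_interior).mem_nhds ⟨hz1, hz2⟩)
    obtain ⟨y, ⟨hy1, hy2⟩, hyP⟩ := (hinf.sdiff hP).nonempty
    exact ⟨y, ⟨hy1, hyP⟩, interior_subset hy2⟩
  obtain ⟨y, ⟨-, hyP⟩, hyUV⟩ := isPreconnected_closed_iff.1
    (isPreconnected_ball_sdiff_finite x hr hP) U V hU hV
    (sdiff_subset.trans (hball.trans hUV)) (hne U hUint hxU) (hne V hVint hxV)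
  exact ⟨y, hyUV, hyP⟩

namespace Triangulation

variable {Ω : Set Plane} {T : Triangulation Ω} {Λ : ℝ}

theorem Regular.hull_subset_closure_interior (h : T.Regular Λ) {K : Finset Plane}
    (hK : K ∈ T.elements) : hull K ⊆ closure (interior (hull K)) := by
  obtain ⟨c, r, hr, hball, -⟩ := h.disc K hK
  rw [(convex_hull K).closure_interior_eq_closure_of_nonempty_interior]
  · exact subset_closure
  · exact ⟨c, interior_mono hball (by
      rw [interior_closedBall _ hr.ne']; exact Metric.mem_ball_self hr)⟩

theorem Regular.inter_nonempty (h : T.Regular Λ) {K : Finset Plane}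
    (hK : K ∈ T.elements) : (Ω ∩ hull K).Nonempty := by
  obtain ⟨c, r, hr, hball, -⟩ := h.disc K hK
  have hc := hball (Metric.mem_closedBall_self hr.le)
  obtain ⟨z, hz1, hz2⟩ := mem_closure_iff.1 (T.hull_subset_closure (T.mem_elements.1 hK).1 hc) _
    Metric.isOpen_ball (Metric.mem_ball_self hr)
  exact ⟨z, hz2, hball (Metric.ball_subset_closedBall hz1)⟩

theorem disjoint_hull {K L : Finset Plane} (hK : K ∈ T.faces) (hL : L ∈ T.faces)
    (hKL : Disjoint K L) : Disjoint (hull K) (hull L) := by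
  classical
  rw [Set.disjoint_iff]
  refine (inter_hull_subset hK hL).trans ?_
  rw [Finset.disjoint_iff_inter_eq_empty.1 hKL, hull]
  simp

/-- A mesh that is fine enough contains two disjoint elements whose distance is smaller than the
mesh size by a fixed factor: the elements touching a given `K₀` and those disjoint from it meet
along an edge, and the distance from `K₀` to the midpoint of this edge is at most a median of the
adjacent triangle that touches `K₀`. -/
theorem Regular.exists_near_pair (h : T.Regular Λ) (hΩ : IsPolygon Ω)
    (hh : 4 * T.meshSize < Metric.diam (closure Ω)) :
    ∃ K ∈ T.elements, ∃ L ∈ T.elements, Disjoint (hull K) (hull L) ∧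
      ∃ x ∈ hull K, ∃ y ∈ hull L, ‖x - y‖ ≤ √(1 - 1 / (4 * Λ ^ 2)) * T.meshSize := by
  classical
  obtain ⟨K₀, hK₀⟩ := h.nonempty
  -- `U` and `V` cover the domain; the first belongs to the elements touching `K₀`
  set A := T.elements.filter fun K => ¬Disjoint K₀ K with hA
  set B := T.elements.filter fun K => Disjoint K₀ K with hB
  set U := ⋃ K ∈ A, hull K with hU
  set V := ⋃ K ∈ B, hull K with hV
  have hcl : ∀ S : Finset (Finset Plane), IsClosed (⋃ K ∈ S, hull K) := fun S =>
    S.finite_toSet.isClosed_biUnion fun K _ => (isCompact_hull K).isClosed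
  have hcover : closure Ω ⊆ U ∪ V := by
    rw [T.closure_eq_iUnion hΩ.isOpen]
    refine iUnion₂_subset fun K hK => ?_
    by_cases hd : Disjoint K₀ K
    · have hKB : K ∈ B := Finset.mem_filter.2 ⟨hK, hd⟩
      exact (subset_biUnion_of_mem (u := hull) (Finset.mem_coe.2 hKB)).trans
        subset_union_right
    · have hKA : K ∈ A := Finset.mem_filter.2 ⟨hK, hd⟩
      exact (subset_biUnion_of_mem (u := hull) (Finset.mem_coe.2 hKA)).trans
        subset_union_left
  have hsub : ∀ K : Finset Plane, (K : Set Plane) ⊆ hull K := fun K => subset_convexHull ℝ _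
  have hdist : ∀ K ∈ T.elements, ∀ x ∈ hull K, ∀ y ∈ hull K, dist x y ≤ T.meshSize :=
    fun K hK x hx y hy => (Metric.dist_le_diam_of_mem (isCompact_hull K).isBounded hx hy).trans
      (h.diam_le K hK)
  have hBne : B.Nonempty := by
    by_contra hBe
    rw [Finset.not_nonempty_iff_eq_empty] at hBe
    have hV0 : V = ∅ := by rw [hV, hBe]; simp
    rw [hV0, union_empty] at hcover
    have : Metric.diam (closure Ω) ≤ 3 * T.meshSize := by
      refine Metric.diam_le_of_forall_dist_le (by linarith [h.pos]) fun x hx y hy => ?_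
      obtain ⟨K, hK, hxK⟩ := mem_iUnion₂.1 (hcover hx)
      obtain ⟨L, hL, hyL⟩ := mem_iUnion₂.1 (hcover hy)
      obtain ⟨hK, hdK⟩ := Finset.mem_filter.1 hK
      obtain ⟨hL, hdL⟩ := Finset.mem_filter.1 hL
      obtain ⟨a, ha, haK⟩ := Finset.not_disjoint_iff.1 hdK
      obtain ⟨b, hb, hbL⟩ := Finset.not_disjoint_iff.1 hdL
      have h1 := hdist K hK x hxK a (hsub K haK)
      have h2 := hdist K₀ hK₀ a (hsub K₀ ha) b (hsub K₀ hb)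
      have h3 := hdist L hL b (hsub L hbL) y hyL
      linarith [dist_triangle4 x a b y]
    linarith [h.pos]
  have hint : ∀ S ⊆ T.elements, (⋃ K ∈ S, hull K) ⊆ closure (interior (⋃ K ∈ S, hull K)) := by
    intro S hS
    refine iUnion₂_subset fun K hK => (h.hull_subset_closure_interior (hS hK)).trans
      (closure_mono (interior_mono (subset_iUnion₂_of_subset K hK subset_rfl)))
  have hK₀A : K₀ ∈ A := Finset.mem_filter.2 ⟨hK₀, fun hd => by
    rw [disjoint_self] at hd
    have := (T.mem_elements.1 hK₀).2
    rw [hd] at this; simp at this⟩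
  have hmeet : ∀ S : Finset (Finset Plane), S ⊆ T.elements → S.Nonempty →
      (Ω ∩ ⋃ K ∈ S, hull K).Nonempty := fun S hS ⟨K, hK⟩ =>
    (h.inter_nonempty (hS hK)).mono
      (inter_subset_inter_right _ (subset_iUnion₂_of_subset K hK subset_rfl))
  -- the domain stays connected without the vertices of the mesh, so that `U` and `V` have a
  -- common point that is not a vertex
  obtain ⟨y, ⟨hyU, hyV⟩, hyP⟩ := exists_mem_inter_notMem hΩ.isOpen hΩ.isConnected.isPreconnected
    (T.elements.finite_toSet.biUnion fun K _ => K.finite_toSet) (hcl A) (hcl B)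
    (subset_closure.trans hcover) (hmeet A (Finset.filter_subset _ _) ⟨K₀, hK₀A⟩)
    (hmeet B (Finset.filter_subset _ _) hBne) (hint A (Finset.filter_subset _ _))
    (hint B (Finset.filter_subset _ _))
  obtain ⟨M, hM, hyM⟩ := mem_iUnion₂.1 hyU
  obtain ⟨L, hL, hyL⟩ := mem_iUnion₂.1 hyV
  obtain ⟨hM, hdM⟩ := Finset.mem_filter.1 hM
  obtain ⟨hL, hdL⟩ := Finset.mem_filter.1 hL
  obtain ⟨a, ha₀, haM⟩ := Finset.not_disjoint_iff.1 hdM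
  have haL : a ∉ L := Finset.disjoint_left.1 hdL ha₀
  obtain ⟨hMf, hMc⟩ := T.mem_elements.1 hM
  obtain ⟨hLf, hLc⟩ := T.mem_elements.1 hL
  -- since `y` is not a vertex, `M` and `L` share an edge
  obtain ⟨b, hb, c, hc, hbc⟩ : ∃ b ∈ M ∩ L, ∃ c ∈ M ∩ L, b ≠ c := by
    rw [← Finset.one_lt_card]
    by_contra! hle
    obtain ⟨p, hp⟩ := Finset.card_le_one_iff_subset_singleton.1 hle
    have hy := inter_hull_subset hMf hLf ⟨hyM, hyL⟩
    have hy' := convexHull_mono (𝕜 := ℝ) (Finset.coe_subset.2 hp) hy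
    rw [Finset.coe_singleton, convexHull_singleton] at hy'
    have hne : (M ∩ L).Nonempty := by
      rw [Finset.nonempty_iff_ne_empty]
      intro h0
      rw [h0, hull] at hy
      simp at hy
    obtain ⟨q, hq⟩ := hne
    have hqp := Finset.mem_singleton.1 (hp hq)
    exact hyP (mem_iUnion₂.2 ⟨M, hM, by
      rw [mem_singleton_iff.1 hy', ← hqp]; exact Finset.mem_of_mem_inter_left hq⟩)
  rw [Finset.mem_inter] at hb hc
  refine ⟨K₀, hK₀, L, hL, disjoint_hull (T.mem_elements.1 hK₀).1 hLf hdL, a, hsub _ ha₀,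
    midpoint ℝ b c, (convex_hull L).midpoint_mem (hsub _ hb.2) (hsub _ hc.2), ?_⟩
  -- the length of the median from `a`, by Apollonius; the other two sides have length at most `h`
  have h1 := EuclideanGeometry.dist_sq_add_dist_sq_eq_two_mul_dist_midpoint_sq_add_half_dist_sq a b c
  have h2 := hdist M hM a (hsub _ haM) b (hsub _ hb.1)
  have h3 := hdist M hM a (hsub _ haM) c (hsub _ hc.1)
  have h4 := h.meshSize_le_mul_dist hL hb.2 hc.2 hbc
  rw [← dist_eq_norm] at h4 ⊢
  have hΛ : 0 < Λ := zero_lt_one.trans_le h.one_le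
  have h5 : T.meshSize / Λ ≤ dist b c := by rwa [div_le_iff₀' hΛ]
  have hpos := h.pos
  rw [← Real.sqrt_sq hpos.le, ← Real.sqrt_mul']
  refine Real.le_sqrt_of_sq_le ?_
  have h6 := pow_le_pow_left₀ dist_nonneg h2 2
  have h7 := pow_le_pow_left₀ dist_nonneg h3 2
  have h8 := pow_le_pow_left₀ (by positivity) h5 2
  have h9 : (1 - 1 / (4 * Λ ^ 2)) * T.meshSize ^ 2 =
      T.meshSize ^ 2 - (T.meshSize / Λ) ^ 2 / 4 := by field_simp
  rw [h9]
  nlinarith [h1]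
  exact sq_nonneg _

end Triangulation

end FracQuad

namespace FracQuad

/-! ### Weights of the regularised integrands -/

/-- The common properties of the lists `ψ` of differences of barycentric coordinates that remain
after the singular factors have been removed: they are multi-affine with zero sum, and on the unit
cube they are bounded by one without ever being simultaneously small. -/
structure IsDuffyWeight {n m : ℕ} (ψ : (Fin n → ℝ) → Fin m → ℝ) : Prop where
  multiAffine : ∀ k, MultiAffine fun η => ψ η k
  continuous : ∀ k, Continuous fun η => ψ η k
  sum_eq_zero : ∀ η, ∑ k, ψ η k = 0
  abs_le_one : ∀ η ∈ Icc (0 : Fin n → ℝ) 1, ∀ k, |ψ η k| ≤ 1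
  exists_half_le : ∀ η ∈ Icc (0 : Fin n → ℝ) 1, ∃ k, 1 / 2 ≤ |ψ η k|

theorem exists_half_le_abs {m : ℕ} {ψ : Fin m → ℝ} {i j : Fin m} (h : 1 ≤ |ψ i| + |ψ j|) :
    ∃ k, 1 / 2 ≤ |ψ k| := by
  by_contra! hcon
  linarith [hcon i, hcon j]

theorem isDuffyWeight_psiSame (l : Fin 3) : IsDuffyWeight fun η => psiSame η l where
  multiAffine k η i t := by
    fin_cases l <;> fin_cases k <;> fin_cases i <;> simp [psiSame] <;> ring
  continuous := continuous_psiSame l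
  sum_eq_zero η := by
    fin_cases l <;> simp [psiSame, Fin.sum_univ_three] <;> ring
  abs_le_one η hη k := by
    have h3 := hη.1 3
    have h3' := hη.2 3
    simp only [Pi.zero_apply, Pi.one_apply] at h3 h3'
    rw [abs_le]
    fin_cases l <;> fin_cases k <;> simp [psiSame] <;> grind
  exists_half_le η hη := by
    fin_cases l
    · exact ⟨2, by simp [psiSame]; norm_num⟩
    · exact ⟨0, by simp [psiSame]; norm_num⟩
    · exact ⟨1, by simp [psiSame]; norm_num⟩

theorem mem_Icc_zero_one {n : ℕ} {η : Fin n → ℝ} (hη : η ∈ Icc (0 : Fin n → ℝ) 1) (i : Fin n) :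
    0 ≤ η i ∧ η i ≤ 1 := ⟨hη.1 i, hη.2 i⟩

theorem one_le_abs_add_abs_one_sub (t : ℝ) : 1 ≤ |t| + |1 - t| := by
  have := abs_add_le t (1 - t)
  simpa using this

theorem isDuffyWeight_psiEdge (l : Fin 5) : IsDuffyWeight fun η => psiEdge η l where
  multiAffine k η i t := by
    fin_cases l <;> fin_cases k <;> fin_cases i <;> simp [psiEdge] <;> ring
  continuous := continuous_psiEdge l
  sum_eq_zero η := by
    fin_cases l <;> simp [psiEdge, Fin.sum_univ_four] <;> ring
  abs_le_one η hη k := by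
    obtain ⟨h2, h2'⟩ := mem_Icc_zero_one hη 2
    obtain ⟨h3, h3'⟩ := mem_Icc_zero_one hη 3
    have h4 := mul_nonneg h2 h3
    have h5 := mul_le_of_le_one_right h2 h3'
    rw [abs_le]
    fin_cases l <;> fin_cases k <;> simp [psiEdge] <;> constructor <;> linarith
  exists_half_le η hη := by
    fin_cases l
    · exact exists_half_le_abs (i := 2) (j := 1)
        (by simpa [psiEdge] using one_le_abs_add_abs_one_sub (η 3))
    · exact ⟨2, by simp [psiEdge]; norm_num⟩
    · exact exists_half_le_abs (i := 0) (j := 2)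
        (by simpa [psiEdge] using one_le_abs_add_abs_one_sub (η 2))
    · exact ⟨3, by simp [psiEdge]; norm_num⟩
    · exact exists_half_le_abs (i := 0) (j := 2)
        (by simpa [psiEdge] using one_le_abs_add_abs_one_sub (η 2 * η 3))

theorem isDuffyWeight_psiVertex (l : Fin 2) : IsDuffyWeight fun η => psiVertex η l where
  multiAffine k η i t := by
    fin_cases l <;> fin_cases k <;> fin_cases i <;> simp [psiVertex] <;> ring
  continuous := continuous_psiVertex l
  sum_eq_zero η := by
    fin_cases l <;> simp [psiVertex, Fin.sum_univ_five]
  abs_le_one η hη k := by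
    obtain ⟨h1, h1'⟩ := mem_Icc_zero_one hη 1
    obtain ⟨h2, h2'⟩ := mem_Icc_zero_one hη 2
    obtain ⟨h3, h3'⟩ := mem_Icc_zero_one hη 3
    have h4 := mul_nonneg h2 h3
    have h5 := mul_le_of_le_one_right h2 h3'
    rw [abs_le]
    fin_cases l <;> fin_cases k <;> simp [psiVertex] <;> constructor <;> linarith
  exists_half_le η hη := by
    fin_cases l
    · exact exists_half_le_abs (i := 2) (j := 1)
        (by simpa [psiVertex] using one_le_abs_add_abs_one_sub (η 1))
    · exact exists_half_le_abs (i := 4) (j := 3)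
        (by simpa [psiVertex, abs_sub_comm] using one_le_abs_add_abs_one_sub (η 1))

theorem isDuffyWeight_psiOn (l : Fin 3) : IsDuffyWeight fun η => psiOn η l where
  multiAffine k η i t := by
    fin_cases l <;> fin_cases k <;> fin_cases i <;> simp [psiOn] <;> ring
  continuous := continuous_psiOn l
  sum_eq_zero η := by
    fin_cases l <;> simp [psiOn, Fin.sum_univ_three] <;> ring
  abs_le_one η hη k := by
    obtain ⟨h1, h1'⟩ := mem_Icc_zero_one hη 1
    rw [abs_le]
    fin_cases l <;> fin_cases k <;> simp [psiOn] <;> grind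
  exists_half_le η hη := by
    fin_cases l
    · exact ⟨0, by simp [psiOn]; norm_num⟩
    · exact ⟨2, by simp [psiOn]; norm_num⟩
    · exact ⟨1, by simp [psiOn]; norm_num⟩

theorem isDuffyWeight_psiAt (l : Fin 2) : IsDuffyWeight fun η => psiAt η l where
  multiAffine k η i t := by
    fin_cases l <;> fin_cases k <;> fin_cases i <;> simp [psiAt] <;> ring
  continuous := continuous_psiAt l
  sum_eq_zero η := by
    fin_cases l <;> simp [psiAt, Fin.sum_univ_four]
  abs_le_one η hη k := by
    obtain ⟨h1, h1'⟩ := mem_Icc_zero_one hη 1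
    obtain ⟨h2, h2'⟩ := mem_Icc_zero_one hη 2
    have h4 := mul_nonneg h1 h2
    have h5 := mul_le_of_le_one_right h1 h2'
    rw [abs_le]
    fin_cases l <;> fin_cases k <;> simp [psiAt] <;> constructor <;> linarith
  exists_half_le η hη := by
    fin_cases l
    · exact exists_half_le_abs (i := 2) (j := 1)
        (by simpa [psiAt] using one_le_abs_add_abs_one_sub (η 1))
    · exact ⟨3, by simp [psiAt]; norm_num⟩

theorem multiAffine_phiOn (l k : Fin 3) : MultiAffine fun η => phiOn η l k := fun η i t => by
  fin_cases l <;> fin_cases k <;> fin_cases i <;> simp [phiOn] <;> ring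

theorem multiAffine_phiAt (l : Fin 2) (k : Fin 3) : MultiAffine fun η => phiAt η l k :=
  fun η i t => by
    fin_cases l <;> fin_cases k <;> fin_cases i <;> simp [phiAt] <;> ring

theorem multiAffine_phiOnOpposite (l : Fin 3) : MultiAffine fun η => phiOnOpposite η l :=
  fun η i t => by
    fin_cases l <;> fin_cases i <;> simp [phiOnOpposite]

theorem MultiAffine.apply {n : ℕ} (k : Fin n) : MultiAffine fun η : Fin n → ℝ => η k :=
  fun η i t => by
    by_cases h : k = i <;> simp [h]

theorem abs_phiOn_le_one {η : Fin 3 → ℝ} (hη : η ∈ Icc (0 : Fin 3 → ℝ) 1) (l k : Fin 3) :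
    |phiOn η l k| ≤ 1 := by
  obtain ⟨h0, h0'⟩ := mem_Icc_zero_one hη 0
  obtain ⟨h1, h1'⟩ := mem_Icc_zero_one hη 1
  obtain ⟨h2, h2'⟩ := mem_Icc_zero_one hη 2
  have e1 := mul_nonneg h0 h1
  have e2 := mul_nonneg h0 h2
  have e3 := mul_le_of_le_one_right h0 h1'
  have e4 := mul_le_of_le_one_right h0 h2'
  have e5 := mul_le_of_le_one_left h2 h0'
  have e6 := mul_nonneg (sub_nonneg.2 h0') (sub_nonneg.2 h2')
  rw [abs_le]
  fin_cases l <;> fin_cases k <;> simp [phiOn] <;> constructor <;> nlinarith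

theorem abs_phiAt_le_one {η : Fin 3 → ℝ} (hη : η ∈ Icc (0 : Fin 3 → ℝ) 1) (l : Fin 2) (k : Fin 3) :
    |phiAt η l k| ≤ 1 := by
  obtain ⟨h0, h0'⟩ := mem_Icc_zero_one hη 0
  obtain ⟨h1, h1'⟩ := mem_Icc_zero_one hη 1
  obtain ⟨h2, h2'⟩ := mem_Icc_zero_one hη 2
  have e1 := mul_nonneg h0 h1
  have e3 := mul_le_of_le_one_right h0 h1'
  have e2 := mul_nonneg e1 h2
  have e4 := mul_le_of_le_one_right e1 h2'
  rw [abs_le]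
  fin_cases l <;> fin_cases k <;> simp [phiAt] <;> constructor <;> nlinarith

theorem abs_phiOnOpposite_le_one {η : Fin 3 → ℝ} (hη : η ∈ Icc (0 : Fin 3 → ℝ) 1) (l : Fin 3) :
    |phiOnOpposite η l| ≤ 1 := by
  obtain ⟨h1, h1'⟩ := mem_Icc_zero_one hη 1
  rw [abs_le]
  fin_cases l <;> simp [phiOnOpposite] <;> grind

theorem abs_sum_mul_le {m : ℕ} {φ c : Fin m → ℝ} {a : ℝ} (hφ : ∀ k, |φ k| ≤ 1)
    (hc : ∀ k, |c k| ≤ a) : |∑ k, φ k * c k| ≤ m * a := by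
  refine (Finset.abs_sum_le_sum_abs _ _).trans ?_
  calc ∑ k, |φ k * c k| ≤ ∑ _k : Fin m, a := Finset.sum_le_sum fun k _ => by
        rw [abs_mul]
        exact (mul_le_of_le_one_left (abs_nonneg _) (hφ k)).trans (hc k)
    _ = m * a := by simp

end FracQuad

namespace FracQuad

/-! ### Quadrature error on touching pairs -/

/-- A bound for `1 / (α + 1)` for all exponents `α` of the quadrature rules. -/
noncomputable def weightBound (s : ℝ) : ℝ := 1 + 1 / (2 - 2 * s) + 1 / |1 - 2 * s|

theorem one_le_weightBound {s : ℝ} (hs1 : s < 1) : 1 ≤ weightBound s := by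
  have h1 : 0 ≤ 1 / (2 - 2 * s) := by apply one_div_nonneg.2; linarith
  have h3 : 0 ≤ 1 / |1 - 2 * s| := by positivity
  unfold weightBound
  linarith

/-- The exponents that occur are either nonnegative, `1 - 2 s`, or `-2 s` if `s < 1/2`. -/
theorem inv_le_weightBound {s α : ℝ} (hs1 : s < 1)
    (h : 0 ≤ α ∨ α = 1 - 2 * s ∨ s < 1 / 2 ∧ α = -2 * s) :
    -1 < α ∧ 1 / (α + 1) ≤ weightBound s := by
  have h1 : 0 ≤ 1 / (2 - 2 * s) := by apply one_div_nonneg.2; linarith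
  have h3 : 0 ≤ 1 / |1 - 2 * s| := by positivity
  unfold weightBound
  rcases h with h | rfl | ⟨h, rfl⟩
  · refine ⟨by linarith, ?_⟩
    have : 1 / (α + 1) ≤ 1 := by rw [div_le_one] <;> linarith
    linarith
  · refine ⟨by linarith, ?_⟩
    rw [show 1 - 2 * s + 1 = 2 - 2 * s by ring]
    linarith
  · refine ⟨by linarith, ?_⟩
    rw [abs_of_pos (by linarith : 0 < 1 - 2 * s)] at *
    rw [show -2 * s + 1 = 1 - 2 * s by ring]
    linarith

namespace Triangulation

variable {Ω : Set Plane}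

/-- Regular meshes together with a Lipschitz bound for the hat functions on the closed domain. -/
structure Controlled (T : Triangulation Ω) (Λ C₀ : ℝ) : Prop extends T.Regular Λ where
  one_le_const : 1 ≤ C₀
  lipschitz : ∀ x ∈ closure Ω, ∀ y ∈ closure Ω, ∀ k,
    |T.bary x k - T.bary y k| ≤ C₀ / T.meshSize * ‖x - y‖

variable {T : Triangulation Ω} {Λ C₀ : ℝ}

/-- On touching pairs the denominator of the regularised integrand is comparable to the mesh size:
for the lower bound, the combination is a multiple of the difference of two points of the domain
at which some hat function differs accordingly. -/
theorem Controlled.norm_sum_smul_bounds (hT : T.Controlled Λ C₀) {K L : Finset Plane}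
    (hK : K ∈ T.faces) (hL : L ∈ T.faces) {n m : ℕ} {x : Fin m → Plane}
    (hx : Function.Injective x) {p : Plane} (hp : ∀ k, ‖x k - p‖ ≤ T.meshSize)
    {ψ : (Fin n → ℝ) → Fin m → ℝ} (hψ : IsDuffyWeight ψ) {η : Fin n → ℝ} (hη : η ∈ Icc 0 1)
    (hψK : ∀ i, 0 < ψ η i → x i ∈ K) (hψL : ∀ i, ψ η i < 0 → x i ∈ L) :
    T.meshSize / (2 * C₀) ≤ ‖∑ k, ψ η k • x k‖ ∧ ‖∑ k, ψ η k • x k‖ ≤ m * T.meshSize := by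
  have hpos := hT.pos
  have hC := zero_lt_one.trans_le hT.one_le_const
  constructor
  · obtain ⟨k, hk⟩ := hψ.exists_half_le η hη
    have h1 := hk.trans (T.abs_le_of_sum_eq_zero hT.lipschitz hK hL hx (hψ.sum_eq_zero η) hψK hψL k)
    rw [div_mul_eq_mul_div, le_div_iff₀ hpos] at h1
    rw [div_le_iff₀ (by positivity)]
    linarith
  · have h1 : ∑ k, ψ η k • x k = ∑ k, ψ η k • (x k - p) := by
      simp only [smul_sub, Finset.sum_sub_distrib, ← Finset.sum_smul, hψ.sum_eq_zero, zero_smul,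
        sub_zero]
    rw [h1]
    refine (norm_sum_le _ _).trans ?_
    calc ∑ k, ‖ψ η k • (x k - p)‖ ≤ ∑ _k : Fin m, T.meshSize := Finset.sum_le_sum fun k _ => by
          rw [norm_smul, Real.norm_eq_abs]
          exact (mul_le_of_le_one_left (norm_nonneg _) (hψ.abs_le_one η hη k)).trans (hp k)
      _ = m * T.meshSize := by simp

/-- Quadrature error for one regularised integrand on a touching pair. -/
theorem exists_touching_error {s : ℝ} (hs0 : 0 < s) (hs1 : s < 1) (C₀ : ℝ) :
    ∃ B ρ : ℝ, 0 ≤ B ∧ 1 < ρ ∧ ∀ {Ω : Set Plane} {T : Triangulation Ω} {Λ : ℝ},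
      T.Controlled Λ C₀ → ∀ {G : ℝ → ∀ k : ℕ, Rule k}, IsGaussFamily G → ∀ {K L : Finset Plane},
      K ∈ T.faces → L ∈ T.faces → ∀ {n m : ℕ}, n ≤ 4 → m ≤ 5 → ∀ {α : Fin n → ℝ},
      (∀ i, 0 ≤ α i ∨ α i = 1 - 2 * s ∨ s < 1 / 2 ∧ α i = -2 * s) → ∀ {x : Fin m → Plane},
      Function.Injective x → ∀ {p : Plane}, (∀ k, ‖x k - p‖ ≤ T.meshSize) →
      ∀ {ψ : (Fin n → ℝ) → Fin m → ℝ}, IsDuffyWeight ψ →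
      (∀ η ∈ Icc (0 : Fin n → ℝ) 1, ∀ i, (0 < ψ η i → x i ∈ K) ∧ (ψ η i < 0 → x i ∈ L)) →
      ∀ {P : Fin 4 → (Fin n → ℝ) → ℝ}, (∀ j, MultiAffine (P j)) → (∀ j, Continuous (P j)) →
      ∀ {A : ℝ}, (∀ η ∈ Icc (0 : Fin n → ℝ) 1, |∏ j, P j η| ≤ A) → ∀ k : ℕ,
      ∀ {f : (Fin n → ℝ) → ℝ}, (∀ η, f η = (∏ j, P j η) / ‖∑ k, ψ η k • x k‖ ^ (2 + 2 * s)) →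
      Integrable f (Measure.pi fun i => powMeasure (α i)) ∧
      |∫ η, f η ∂(Measure.pi fun i => powMeasure (α i)) - tensorGauss G k α f| ≤
        B * A * T.meshSize ^ (-(2 + 2 * s)) * ρ ^ (-2 * (k : ℤ)) := by
  -- the ratio of the bounds `5 h` and `h / (2 C₀)` for the denominator is `10 C₀`; adding `2`
  -- leaves room above `1`
  obtain ⟨B, ρ, hB, hρ, h⟩ := exists_tensorGauss_error_near s hs0 (κ := 10 * |C₀| + 2)
    (by have := abs_nonneg C₀; linarith)
  set W := weightBound s with hW
  have hW1 : 1 ≤ W := one_le_weightBound hs1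
  have hc0 : 0 ≤ (2 * |C₀|) ^ (2 + 2 * s) := by positivity
  refine ⟨4 * (2 * W ^ 4 * (B * (2 * |C₀|) ^ (2 + 2 * s))), ρ, by positivity, hρ, ?_⟩
  intro Ω T Λ hT G hG K L hK hL n m hn hm α hα x hx p hp ψ hψ hsgn P hP hPc A hA k f hf
  obtain rfl : f = fun η => (∏ j, P j η) / ‖∑ k, ψ η k • x k‖ ^ (2 + 2 * s) := funext hf
  have hpos := hT.pos
  have hC := hT.one_le_const
  have hCabs : |C₀| = C₀ := abs_of_pos (by linarith)
  have hαb := fun i => inv_le_weightBound hs1 (hα i)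
  have hZb := fun η hη => hT.norm_sum_smul_bounds hK hL hx hp hψ (η := η) hη
    (fun i => (hsgn η hη i).1) (fun i => (hsgn η hη i).2)
  have hZm : MultiAffine fun η => ∑ k, ψ η k • x k :=
    MultiAffine.sum fun k _ => (hψ.multiAffine k).smul_const (x k)
  have hZc : Continuous fun η => ∑ k, ψ η k • x k :=
    continuous_finsetSum _ fun k _ => (hψ.continuous k).smul continuous_const
  have hc : 0 < T.meshSize / (2 * C₀) := by positivity
  have hA0 : 0 ≤ A := (abs_nonneg _).trans (hA 0 (by simp))
  refine ⟨integrable_pi_powMeasure (fun i => (hαb i).1) (continuousOn_quotient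
    (continuous_finsetProd _ fun j _ => hPc j) hZc fun η hη h0 => ?_), ?_⟩
  · have := (hZb η hη).1
    rw [h0, norm_zero] at this
    linarith
  have h1 := h hG hW1 (fun i => (hαb i).1) (fun i => (hαb i).2) hP hPc hZm hZc hc
    (fun η hη => ⟨(hZb η hη).1, (hZb η hη).2.trans ?_⟩) hA k
  · refine h1.trans ?_
    have e1 : (T.meshSize / (2 * C₀)) ^ (-(2 + 2 * s)) =
        (2 * |C₀|) ^ (2 + 2 * s) * T.meshSize ^ (-(2 + 2 * s)) := by
      rw [hCabs, Real.div_rpow hpos.le (by positivity), Real.rpow_neg (by positivity : 0 ≤ 2 * C₀),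
        div_inv_eq_mul, mul_comm]
    have hr : 0 ≤ T.meshSize ^ (-(2 + 2 * s)) := by positivity
    have hρk : 0 ≤ ρ ^ (-2 * (k : ℤ)) := by have := zero_lt_one.trans hρ; positivity
    have hn' : (n : ℝ) ≤ 4 := by exact_mod_cast hn
    have hWn : W ^ n ≤ W ^ 4 := pow_le_pow_right₀ hW1 hn
    have hX : 0 ≤ B * A * (T.meshSize / (2 * C₀)) ^ (-(2 + 2 * s)) * ρ ^ (-2 * (k : ℤ)) := by
      rw [e1]; positivity
    calc _ ≤ 4 * (2 * W ^ 4 *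
          (B * A * (T.meshSize / (2 * C₀)) ^ (-(2 + 2 * s)) * ρ ^ (-2 * (k : ℤ)))) := by
          gcongr
      _ = _ := by rw [e1]; ring
  · have hm' : (m : ℝ) ≤ 5 := by exact_mod_cast hm
    rw [hCabs]
    have : (10 * C₀ + 2) * (T.meshSize / (2 * C₀)) = 5 * T.meshSize + T.meshSize / C₀ := by
      field_simp; ring
    rw [this]
    have h2 : 0 ≤ T.meshSize / C₀ := by positivity
    nlinarith

end Triangulation

/-- If the common vertices are listed first, then the others are not common. -/
theorem notMem_of_ncard_le {m : ℕ} {y : Fin m → Plane} {K L : Finset Plane}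
    (hyr : range y = L) (hy : Function.Injective y) {c : ℕ} (hc : ((K : Set Plane) ∩ L).ncard = c)
    (hcom : ∀ j : Fin m, (j : ℕ) < c → y j ∈ K) {i : Fin m} (hi : c ≤ i) : y i ∉ K := by
  classical
  intro hiK
  have hcm : c < m := hi.trans_lt i.2
  have h1 : (insert i (Finset.Iio (⟨c, hcm⟩ : Fin m))).image y ⊆ K ∩ L := by
    intro z hz
    obtain ⟨j, hj, rfl⟩ := Finset.mem_image.1 hz
    refine Finset.mem_inter.2 ⟨?_, mem_range_coe hyr j⟩
    rcases Finset.mem_insert.1 hj with rfl | hj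
    · exact hiK
    · exact hcom j (Fin.lt_def.1 (Finset.mem_Iio.1 hj))
  have h2 := Finset.card_le_card h1
  rw [Finset.card_image_of_injective _ hy, Finset.card_insert_of_notMem (by simpa [Fin.le_def] using hi),
    Fin.card_Iio, ← Set.ncard_coe_finset, Finset.coe_inter, hc] at h2
  simp at h2

theorem abs_mul_sum_sub_le {ι : Type*} [Fintype ι] {c c' E : ℝ} {I q : ι → ℝ} (hc : 0 ≤ c)
    (h : ∀ l, |I l - q l| ≤ E) (hcc : c * Fintype.card ι * E ≤ c' * E) :
    |c * ∑ l, I l - c * ∑ l, q l| ≤ c' * E := by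
  rw [← mul_sub, ← Finset.sum_sub_distrib, abs_mul, abs_of_nonneg hc]
  refine le_trans ?_ hcc
  rw [mul_assoc]
  refine mul_le_mul_of_nonneg_left ((Finset.abs_sum_le_sum_abs _ _).trans ?_) hc
  refine (Finset.sum_le_sum fun l _ => h l).trans ?_
  simp

end FracQuad

namespace FracQuad

namespace Triangulation

/-- The regularised integrand of a pair of elements, with nodal values bounded by `a` and `b`. -/
theorem exists_pairIntegrand_error {s : ℝ} (hs0 : 0 < s) (hs1 : s < 1) (C₀ : ℝ) :
    ∃ B ρ : ℝ, 0 ≤ B ∧ 1 < ρ ∧ ∀ {Ω : Set Plane} {T : Triangulation Ω} {Λ : ℝ},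
      T.Controlled Λ C₀ → ∀ {G : ℝ → ∀ k : ℕ, Rule k}, IsGaussFamily G → ∀ {K L : Finset Plane},
      K ∈ T.faces → L ∈ T.faces → ∀ {m : ℕ}, m ≤ 5 → ∀ {α : Fin 4 → ℝ},
      (∀ i, 0 ≤ α i ∨ α i = 1 - 2 * s ∨ s < 1 / 2 ∧ α i = -2 * s) → ∀ {x : Fin m → Plane},
      Function.Injective x → ∀ {p : Plane}, (∀ k, ‖x k - p‖ ≤ T.meshSize) →
      ∀ {ψ : (Fin 4 → ℝ) → Fin m → ℝ}, IsDuffyWeight ψ →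
      (∀ η ∈ Icc (0 : Fin 4 → ℝ) 1, ∀ i, (0 < ψ η i → x i ∈ K) ∧ (ψ η i < 0 → x i ∈ L)) →
      ∀ {j : (Fin 4 → ℝ) → ℝ}, MultiAffine j → Continuous j →
      (∀ η ∈ Icc (0 : Fin 4 → ℝ) 1, |j η| ≤ 1) → ∀ {u v : Plane → ℝ} {a b : ℝ}, 0 ≤ a →
      0 ≤ b → (∀ k, |u (x k)| ≤ a) → (∀ k, |v (x k)| ≤ b) → ∀ k : ℕ,
      ∀ {f : (Fin 4 → ℝ) → ℝ}, (∀ η, f η = j η * pairIntegrand s x u v (ψ η)) →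
      Integrable f (Measure.pi fun i => powMeasure (α i)) ∧
      |∫ η, f η ∂(Measure.pi fun i => powMeasure (α i)) - tensorGauss G k α f| ≤
        B * (a * b) * T.meshSize ^ (-(2 + 2 * s)) * ρ ^ (-2 * (k : ℤ)) := by
  obtain ⟨B, ρ, hB, hρ, h⟩ := exists_touching_error hs0 hs1 C₀
  refine ⟨25 * B, ρ, by positivity, hρ, ?_⟩
  intro Ω T Λ hT G hG K L hK hL m hm α hα x hx p hp ψ hψ hsgn j hj hjc hj1 u v a b ha hb hua hvb k
    f hf
  have hsm : ∀ w : Plane → ℝ, MultiAffine fun η => ∑ k, ψ η k * w (x k) := fun w =>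
    MultiAffine.sum fun k _ => (hψ.multiAffine k).mul_const _
  have hsc : ∀ w : Plane → ℝ, Continuous fun η => ∑ k, ψ η k * w (x k) := fun w =>
    continuous_finsetSum _ fun k _ => (hψ.continuous k).mul continuous_const
  have key := h hT hG hK hL (le_refl 4) hm hα hx hp hψ hsgn
    (P := ![j, fun η => ∑ k, ψ η k * u (x k), fun η => ∑ k, ψ η k * v (x k), fun _ => 1])
    (fun i => by fin_cases i; exacts [hj, hsm u, hsm v, MultiAffine.const 1])
    (fun i => by fin_cases i; exacts [hjc, hsc u, hsc v, continuous_const])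
    (A := 5 * a * (5 * b)) (fun η hη => ?_) k (f := f) (fun η => ?_)
  · exact ⟨key.1, key.2.trans_eq (by ring)⟩
  · have hm' : (m : ℝ) ≤ 5 := by exact_mod_cast hm
    have h1 := (abs_sum_mul_le (hψ.abs_le_one η hη) hua).trans
      (mul_le_mul_of_nonneg_right hm' ha)
    have h2 := (abs_sum_mul_le (hψ.abs_le_one η hη) hvb).trans
      (mul_le_mul_of_nonneg_right hm' hb)
    rw [Fin.prod_univ_four]
    simp only [Matrix.cons_val, mul_one]
    rw [abs_mul, abs_mul]
    exact mul_le_mul ((mul_le_of_le_one_left (abs_nonneg _) (hj1 η hη)).trans h1) h2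
      (abs_nonneg _) (by positivity)
  · rw [hf, pairIntegrand, Fin.prod_univ_four]
    simp only [Matrix.cons_val]
    ring

variable {Ω : Set Plane} {T : Triangulation Ω} {Λ C₀ : ℝ}

theorem Regular.norm_sub_le (hT : T.Regular Λ) {K : Finset Plane} (hK : K ∈ T.elements)
    {a b : Plane} (ha : a ∈ K) (hb : b ∈ K) : ‖a - b‖ ≤ T.meshSize := by
  rw [← dist_eq_norm]
  exact (Metric.dist_le_diam_of_mem (isCompact_hull K).isBounded (subset_convexHull ℝ _ ha)
    (subset_convexHull ℝ _ hb)).trans (hT.diam_le K hK)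

theorem Regular.abs_le_div (hT : T.Regular Λ) {K : Finset Plane} (hK : K ∈ T.elements)
    {u : Plane → ℝ} (hu : u ∈ T.p1Space) {k : Plane} (hk : k ∈ K) :
    |u k| ≤ 16 * Λ / T.meshSize * localNorm K u := by
  rw [div_mul_eq_mul_div, le_div_iff₀' hT.pos]
  exact hT.meshSize_mul_abs_le hK hu hk

theorem injective_vecCons_of_notMem {x : Fin 3 → Plane} (hx : Function.Injective x) {z : Plane}
    (hz : ∀ i, x i ≠ z) : Function.Injective ![x 0, x 1, x 2, z] := by
  have h01 := hx.ne (by decide : (0 : Fin 3) ≠ 1)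
  have h02 := hx.ne (by decide : (0 : Fin 3) ≠ 2)
  have h12 := hx.ne (by decide : (1 : Fin 3) ≠ 2)
  have h0 := hz 0
  have h1 := hz 1
  have h2 := hz 2
  intro i j hij
  fin_cases i <;> fin_cases j <;> first | rfl | (exfalso; simp at hij; grind)

theorem injective_vecCons_of_notMem_two {x : Fin 3 → Plane} (hx : Function.Injective x)
    {z w : Plane} (hz : ∀ i, x i ≠ z) (hw : ∀ i, x i ≠ w) (hzw : z ≠ w) :
    Function.Injective ![x 0, x 1, x 2, z, w] := by
  have h01 := hx.ne (by decide : (0 : Fin 3) ≠ 1)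
  have h02 := hx.ne (by decide : (0 : Fin 3) ≠ 2)
  have h12 := hx.ne (by decide : (1 : Fin 3) ≠ 2)
  have h0 := hz 0
  have h1 := hz 1
  have h2 := hz 2
  have h0 := hw 0
  have h1 := hw 1
  have h2 := hw 2
  intro i j hij
  fin_cases i <;> fin_cases j <;> first | rfl | (exfalso; simp at hij; grind)

/-- Quadrature error on a touching pair of elements, in reference coordinates. -/
theorem exists_refPair_error {s : ℝ} (hs0 : 0 < s) (hs1 : s < 1) (C₀ : ℝ) :
    ∃ B ρ : ℝ, 0 ≤ B ∧ 1 < ρ ∧ ∀ {Ω : Set Plane} {T : Triangulation Ω} {Λ : ℝ},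
      T.Controlled Λ C₀ → ∀ {G : ℝ → ∀ k : ℕ, Rule k}, IsGaussFamily G →
      ∀ {K L : Finset Plane}, K ∈ T.elements → L ∈ T.elements → ∀ {x y : Fin 3 → Plane},
      range x = K → range y = L → ∀ {c : ℕ}, ((K : Set Plane) ∩ L).ncard = c → c ≠ 0 →
      (∀ i : Fin 3, (i : ℕ) < c → x i = y i) → ∀ {u v : Plane → ℝ} {a b : ℝ}, 0 ≤ a → 0 ≤ b →
      (∀ k, |u (x k)| ≤ a ∧ |u (y k)| ≤ a) → (∀ k, |v (x k)| ≤ b ∧ |v (y k)| ≤ b) → ∀ k : ℕ,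
      IntegrableOn (pairKernel s x y u v) refPair ∧
      |(∫ w in refPair, pairKernel s x y u v w) -
        (match c with
          | 0 => quadFar G s k x y u v
          | 1 => quadVertex G s k x y u v
          | 2 => quadEdge G s k x y u v
          | _ => quadSame G s k x u v)| ≤
        B * (a * b) * T.meshSize ^ (-(2 + 2 * s)) * ρ ^ (-2 * (k : ℤ)) := by
  classical
  obtain ⟨B, ρ, hB, hρ, h⟩ := exists_pairIntegrand_error hs0 hs1 C₀
  refine ⟨6 * B, ρ, by positivity, hρ, ?_⟩
  intro Ω T Λ hT G hG K L hK hL x y hx hy c hc hc0 hcom u v a b ha hb hua hvb k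
  obtain ⟨hKf, hKc⟩ := T.mem_elements.1 hK
  obtain ⟨hLf, hLc⟩ := T.mem_elements.1 hL
  have hxi := injective_of_range_eq hx hKc
  have hyi := injective_of_range_eq hy hLc
  have hxK := mem_range_coe hx
  have hyL := mem_range_coe hy
  have h00 : x 0 = y 0 := hcom 0 (Nat.pos_of_ne_zero hc0)
  have hpx : ∀ i, ‖x i - x 0‖ ≤ T.meshSize := fun i => hT.norm_sub_le hK (hxK i) (hxK 0)
  have hpy : ∀ i, ‖y i - x 0‖ ≤ T.meshSize := fun i => by
    rw [h00]; exact hT.norm_sub_le hL (hyL i) (hyL 0)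
  have hyK : ∀ i : Fin 3, c ≤ i → ∀ l, x l ≠ y i := fun i hi l hl =>
    notMem_of_ncard_le hy hyi hc (fun j hj => hcom j hj ▸ hxK j) hi (hl ▸ hxK l)
  set E := B * (a * b) * T.meshSize ^ (-(2 + 2 * s)) * ρ ^ (-2 * (k : ℤ)) with hE
  have hE0 : 0 ≤ E := by
    have := hT.pos
    have := zero_lt_one.trans hρ
    positivity
  rw [show 6 * B * (a * b) * T.meshSize ^ (-(2 + 2 * s)) * ρ ^ (-2 * (k : ℤ)) = 6 * E by
    rw [hE]; ring]
  have hle : c ≤ 3 := by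
    rw [← hc, ← Finset.coe_inter, Set.ncard_coe_finset, ← hKc]
    exact Finset.card_le_card Finset.inter_subset_left
  obtain rfl | rfl | rfl : c = 1 ∨ c = 2 ∨ c = 3 := by omega
  · have key := fun l : Fin 2 => h hT hG hKf hLf (m := 5) le_rfl
      (α := ![3 - 2 * s, 0, 0, 0])
      (fun i => by left; fin_cases i <;> simp; linarith)
      (x := ![x 0, x 1, x 2, y 1, y 2])
      (injective_vecCons_of_notMem_two hxi (hyK 1 le_rfl) (hyK 2 (by decide))
        (hyi.ne (by decide)))
      (p := x 0) (fun i => by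
        fin_cases i
        exacts [hpx 0, hpx 1, hpx 2, hpy 1, hpy 2])
      (isDuffyWeight_psiVertex l) (fun η hη i => by
        obtain ⟨h1, h1'⟩ := mem_Icc_zero_one hη 1
        obtain ⟨h2, h2'⟩ := mem_Icc_zero_one hη 2
        obtain ⟨h3, h3'⟩ := mem_Icc_zero_one hη 3
        have h4 := mul_nonneg h2 h3
        have h5 := mul_le_of_le_one_right h2 h3'
        fin_cases i
        · exact ⟨fun _ => hxK 0, fun _ => h00 ▸ hyL 0⟩
        · exact ⟨fun _ => hxK 1, fun hn => by fin_cases l <;> simp [psiVertex] at hn <;> linarith⟩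
        · exact ⟨fun _ => hxK 2, fun hn => by fin_cases l <;> simp [psiVertex] at hn <;> linarith⟩
        · exact ⟨fun hn => by fin_cases l <;> simp [psiVertex] at hn <;> linarith, fun _ => hyL 1⟩
        · exact ⟨fun hn => by fin_cases l <;> simp [psiVertex] at hn <;> linarith, fun _ => hyL 2⟩)
      (j := fun η => η 2) (MultiAffine.apply 2) (continuous_apply 2)
      (fun η hη => abs_le.2 ⟨by linarith [hη.1 2, (mem_Icc_zero_one hη 2).1], hη.2 2⟩)
      (u := u) (v := v) ha hb
      (fun i => by fin_cases i; exacts [(hua 0).1, (hua 1).1, (hua 2).1, (hua 1).2, (hua 2).2])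
      (fun i => by fin_cases i; exacts [(hvb 0).1, (hvb 1).1, (hvb 2).1, (hvb 1).2, (hvb 2).2])
      k (fun η => rfl)
    obtain ⟨h1, h2⟩ := integral_refPair_vertex s x y h00 u v fun l => (key l).1
    refine ⟨h1, ?_⟩
    rw [h2]
    change |_ - quadVertex G s k x y u v| ≤ _
    rw [← one_mul (quadVertex G s k x y u v)]
    exact abs_mul_sum_sub_le zero_le_one (fun l => (key l).2)
      (by rw [Fintype.card_fin]; push_cast; linarith)
  · have h11 : x 1 = y 1 := hcom 1 (by decide)
    have key := fun l : Fin 5 => h hT hG hKf hLf (m := 4) (by decide)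
      (α := ![3 - 2 * s, 2 - 2 * s, 0, 0])
      (fun i => by left; fin_cases i <;> simp <;> linarith)
      (x := ![x 0, x 1, x 2, y 2])
      (injective_vecCons_of_notMem hxi (hyK 2 le_rfl))
      (p := x 0) (fun i => by
        fin_cases i
        exacts [hpx 0, hpx 1, hpx 2, hpy 2])
      (isDuffyWeight_psiEdge l) (fun η hη i => by
        obtain ⟨h2, h2'⟩ := mem_Icc_zero_one hη 2
        obtain ⟨h3, h3'⟩ := mem_Icc_zero_one hη 3
        have h4 := mul_nonneg h2 h3
        have h5 := mul_le_of_le_one_right h2 h3'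
        fin_cases i
        · exact ⟨fun _ => hxK 0, fun _ => h00 ▸ hyL 0⟩
        · exact ⟨fun _ => hxK 1, fun _ => h11 ▸ hyL 1⟩
        · exact ⟨fun _ => hxK 2, fun hn => by fin_cases l <;> simp [psiEdge] at hn <;> linarith⟩
        · exact ⟨fun hn => by fin_cases l <;> simp [psiEdge] at hn <;> linarith, fun _ => hyL 2⟩)
      (j := fun η => if l = 0 then 1 else η 2)
      (by split_ifs; exacts [MultiAffine.const 1, MultiAffine.apply 2])
      (by split_ifs; exacts [continuous_const, continuous_apply 2])
      (fun η hη => by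
        obtain ⟨h2, h2'⟩ := mem_Icc_zero_one hη 2
        split_ifs
        · simp
        · rwa [abs_of_nonneg h2])
      (u := u) (v := v) ha hb
      (fun i => by fin_cases i; exacts [(hua 0).1, (hua 1).1, (hua 2).1, (hua 2).2])
      (fun i => by fin_cases i; exacts [(hvb 0).1, (hvb 1).1, (hvb 2).1, (hvb 2).2])
      k (fun η => rfl)
    obtain ⟨h1, h2⟩ := integral_refPair_edge s x y h00 h11 u v fun l => (key l).1
    refine ⟨h1, ?_⟩
    rw [h2]
    change |_ - quadEdge G s k x y u v| ≤ _
    rw [← one_mul (quadEdge G s k x y u v)]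
    exact abs_mul_sum_sub_le zero_le_one (fun l => (key l).2)
      (by rw [Fintype.card_fin]; push_cast; linarith)
  · obtain rfl : x = y := funext fun i => hcom i i.2
    obtain rfl : K = L := Finset.coe_injective (hx.symm.trans hy)
    have key := fun l : Fin 3 => h hT hG hKf hKf (m := 3) (by decide)
      (α := ![3 - 2 * s, 2 - 2 * s, 1 - 2 * s, 0])
      (fun i => by
        fin_cases i
        · left; simp; linarith
        · left; simp; linarith
        · right; left; simp
        · left; simp)
      hxi hpx (isDuffyWeight_psiSame l) (fun η hη i => ⟨fun _ => hxK i, fun _ => hxK i⟩)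
      (j := fun η => 1) (MultiAffine.const 1) continuous_const (fun η hη => by simp)
      (u := u) (v := v) ha hb (fun i => (hua i).1) (fun i => (hvb i).1)
      k (fun η => (one_mul _).symm)
    obtain ⟨h1, h2⟩ := integral_refPair_same s x u v fun l => (key l).1
    refine ⟨h1, ?_⟩
    rw [h2]
    exact abs_mul_sum_sub_le zero_le_two (fun l => (key l).2)
      (by rw [Fintype.card_fin]; push_cast; linarith)

end Triangulation

end FracQuad

namespace FracQuad

namespace Triangulation

/-- The regularised integrand of an element and an edge. The inner product with the normal gains a
factor `h` compared with a pair of elements. -/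
theorem exists_edgeIntegrand_error {s : ℝ} (hs0 : 0 < s) (hs1 : s < 1) (C₀ : ℝ) :
    ∃ B ρ : ℝ, 0 ≤ B ∧ 1 < ρ ∧ ∀ {Ω : Set Plane} {T : Triangulation Ω} {Λ : ℝ},
      T.Controlled Λ C₀ → ∀ {G : ℝ → ∀ k : ℕ, Rule k}, IsGaussFamily G → ∀ {K L : Finset Plane},
      K ∈ T.faces → L ∈ T.faces → ∀ {m : ℕ}, m ≤ 5 → ∀ {α : Fin 3 → ℝ},
      (∀ i, 0 ≤ α i ∨ α i = 1 - 2 * s ∨ s < 1 / 2 ∧ α i = -2 * s) → ∀ {x : Fin m → Plane},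
      Function.Injective x → ∀ {p : Plane}, (∀ k, ‖x k - p‖ ≤ T.meshSize) →
      ∀ {ψ : (Fin 3 → ℝ) → Fin m → ℝ}, IsDuffyWeight ψ →
      (∀ η ∈ Icc (0 : Fin 3 → ℝ) 1, ∀ i, (0 < ψ η i → x i ∈ K) ∧ (ψ η i < 0 → x i ∈ L)) →
      ∀ {j U V : (Fin 3 → ℝ) → ℝ}, MultiAffine j → Continuous j →
      (∀ η ∈ Icc (0 : Fin 3 → ℝ) 1, |j η| ≤ 1) → MultiAffine U → Continuous U → MultiAffine V →
      Continuous V → ∀ {a b : ℝ}, 0 ≤ a → 0 ≤ b →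
      (∀ η ∈ Icc (0 : Fin 3 → ℝ) 1, |U η| ≤ 3 * a) →
      (∀ η ∈ Icc (0 : Fin 3 → ℝ) 1, |V η| ≤ 3 * b) → ∀ {ν : Plane}, ‖ν‖ = 1 → ∀ k : ℕ,
      ∀ {f : (Fin 3 → ℝ) → ℝ},
      (∀ η, f η = j η * U η * V η * normalKernel s ν (∑ k, ψ η k • x k)) →
      Integrable f (Measure.pi fun i => powMeasure (α i)) ∧
      |∫ η, f η ∂(Measure.pi fun i => powMeasure (α i)) - tensorGauss G k α f| ≤
        B * (a * b) * T.meshSize * T.meshSize ^ (-(2 + 2 * s)) * ρ ^ (-2 * (k : ℤ)) := by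
  obtain ⟨B, ρ, hB, hρ, h⟩ := exists_touching_error hs0 hs1 C₀
  refine ⟨45 * B, ρ, by positivity, hρ, ?_⟩
  intro Ω T Λ hT G hG K L hK hL m hm α hα x hx p hp ψ hψ hsgn j U V hj hjc hj1 hU hUc hV hVc
    a b ha hb hUa hVb ν hν k f hf
  have hZm : MultiAffine fun η => ∑ k, ψ η k • x k :=
    MultiAffine.sum fun k _ => (hψ.multiAffine k).smul_const (x k)
  have hZc : Continuous fun η => ∑ k, ψ η k • x k :=
    continuous_finsetSum _ fun k _ => (hψ.continuous k).smul continuous_const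
  have key := h hT hG hK hL (by decide : 3 ≤ 4) hm hα hx hp hψ hsgn
    (P := ![j, U, V, fun η => inner ℝ ν (∑ k, ψ η k • x k)])
    (fun i => by fin_cases i; exacts [hj, hU, hV, hZm.inner_left ν])
    (fun i => by fin_cases i; exacts [hjc, hUc, hVc, continuous_const.inner hZc])
    (A := 3 * a * (3 * b) * (5 * T.meshSize)) (fun η hη => ?_) k (f := f) (fun η => ?_)
  · exact ⟨key.1, key.2.trans_eq (by ring)⟩
  · have hpos := hT.pos
    have hm' : (m : ℝ) ≤ 5 := by exact_mod_cast hm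
    have hZb := (hT.norm_sum_smul_bounds hK hL hx hp hψ (η := η) hη
      (fun i => (hsgn η hη i).1) (fun i => (hsgn η hη i).2)).2.trans
      (mul_le_mul_of_nonneg_right hm' hpos.le)
    have h1 := abs_real_inner_le_norm ν (∑ k, ψ η k • x k)
    rw [hν, one_mul] at h1
    rw [Fin.prod_univ_four]
    simp only [Matrix.cons_val]
    rw [abs_mul, abs_mul, abs_mul]
    exact mul_le_mul (mul_le_mul ((mul_le_of_le_one_left (abs_nonneg _) (hj1 η hη)).trans
      (hUa η hη)) (hVb η hη) (abs_nonneg _) (by positivity)) (h1.trans hZb)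
      (abs_nonneg _) (by positivity)
  · rw [hf, normalKernel, Fin.prod_univ_four]
    simp only [Matrix.cons_val]
    ring

/-- Quadrature error on a touching pair of an element and a boundary edge, in reference
coordinates. -/
theorem exists_refPairEdge_error {s : ℝ} (hs0 : 0 < s) (hs1 : s < 1) (C₀ : ℝ) :
    ∃ B ρ : ℝ, 0 ≤ B ∧ 1 < ρ ∧ ∀ {Ω : Set Plane} {T : Triangulation Ω} {Λ : ℝ}, IsPolygon Ω →
      T.Controlled Λ C₀ → ∀ {G : ℝ → ∀ k : ℕ, Rule k}, IsGaussFamily G →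
      ∀ {K e : Finset Plane}, K ∈ T.elements → e ∈ T.boundaryEdges → ∀ {x : Fin 3 → Plane}
      {y : Fin 2 → Plane}, range x = K → range y = e → ∀ {c : ℕ},
      ((K : Set Plane) ∩ e).ncard = c → c ≠ 0 →
      (∀ i : Fin 2, (i : ℕ) < c → x i.castSucc = y i) → ∀ {u v : Plane → ℝ} {a b : ℝ}, 0 ≤ a →
      0 ≤ b → (∀ k, |u (x k)| ≤ a) → (∀ k, |v (x k)| ≤ b) →
      (1 / 2 ≤ s → ∀ z ∈ frontier Ω, u z = 0 ∧ v z = 0) → ∀ {ν : Plane}, ‖ν‖ = 1 → ∀ k : ℕ,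
      IntegrableOn (edgeKernel s ν x y u v) refPairEdge ∧
      |(∫ w in refPairEdge, edgeKernel s ν x y u v w) -
        (match c with
          | 0 => quadFarEdge G s k ν x y u v
          | 1 => quadAt G s k ν x y u v
          | _ => quadOn G s k ν x u v)| ≤
        B * (a * b) * T.meshSize * T.meshSize ^ (-(2 + 2 * s)) * ρ ^ (-2 * (k : ℤ)) := by
  classical
  obtain ⟨B, ρ, hB, hρ, h⟩ := exists_edgeIntegrand_error hs0 hs1 C₀
  refine ⟨3 * B, ρ, by positivity, hρ, ?_⟩
  intro Ω T Λ hΩ hT G hG K e hK he x y hx hy c hc hc0 hcom u v a b ha hb hua hvb hbd ν hν k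
  obtain ⟨hKf, hKc⟩ := T.mem_elements.1 hK
  obtain ⟨hef, hec, hefr⟩ := T.mem_boundaryEdges.1 he
  have hxi := injective_of_range_eq hx hKc
  have hyi := injective_of_range_eq hy hec
  have hxK := mem_range_coe hx
  have hye := mem_range_coe hy
  have h00 : x 0 = y 0 := hcom 0 (Nat.pos_of_ne_zero hc0)
  have hpx : ∀ i, ‖x i - x 0‖ ≤ T.meshSize := fun i => hT.norm_sub_le hK (hxK i) (hxK 0)
  have hpy : ‖y 1 - x 0‖ ≤ T.meshSize := by
    rw [h00, ← dist_eq_norm]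
    exact (Metric.dist_le_diam_of_mem (isCompact_hull e).isBounded
      (subset_convexHull ℝ _ (hye 1)) (subset_convexHull ℝ _ (hye 0))).trans
      (hT.diam_edge_le hΩ he).1
  have hsm : ∀ {φ : (Fin 3 → ℝ) → Fin 3 → ℝ}, (∀ i, MultiAffine fun η => φ η i) →
      ∀ w : Plane → ℝ, MultiAffine fun η => ∑ i, φ η i * w (x i) := fun hφ w =>
    MultiAffine.sum fun i _ => (hφ i).mul_const _
  have hsc : ∀ {φ : (Fin 3 → ℝ) → Fin 3 → ℝ}, (∀ i, Continuous fun η => φ η i) →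
      ∀ w : Plane → ℝ, Continuous fun η => ∑ i, φ η i * w (x i) := fun hφ w =>
    continuous_finsetSum _ fun i _ => (hφ i).mul continuous_const
  set E := B * (a * b) * T.meshSize * T.meshSize ^ (-(2 + 2 * s)) * ρ ^ (-2 * (k : ℤ)) with hE
  have hE0 : 0 ≤ E := by
    have := hT.pos
    have := zero_lt_one.trans hρ
    positivity
  rw [show 3 * B * (a * b) * T.meshSize * T.meshSize ^ (-(2 + 2 * s)) * ρ ^ (-2 * (k : ℤ)) =
    3 * E by rw [hE]; ring]
  have hle : c ≤ 2 := by
    rw [← hc, ← Finset.coe_inter, Set.ncard_coe_finset]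
    exact (Finset.card_le_card Finset.inter_subset_right).trans_eq hec
  have hj0 : MultiAffine fun η : Fin 3 → ℝ => 1 - η 0 := fun η i t => by
    fin_cases i <;> simp <;> ring
  have hj1 : ∀ η ∈ Icc (0 : Fin 3 → ℝ) 1, |1 - η 0| ≤ 1 := fun η hη => by
    obtain ⟨h0, h0'⟩ := mem_Icc_zero_one hη 0
    rw [abs_of_nonneg] <;> linarith
  obtain rfl | rfl : c = 1 ∨ c = 2 := by omega
  · have hyK : ∀ l, x l ≠ y 1 := fun l hl =>
      notMem_of_ncard_le hy hyi hc (fun j hj => hcom j hj ▸ hxK _) (i := 1) le_rfl (hl ▸ hxK l)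
    have key := fun l : Fin 2 => h hT hG hKf hef (m := 4) (by decide)
      (α := ![1 - 2 * s, 0, 0])
      (fun i => by
        fin_cases i
        · right; left; simp
        · left; simp
        · left; simp)
      (x := ![x 0, x 1, x 2, y 1])
      (injective_vecCons_of_notMem hxi hyK)
      (p := x 0) (fun i => by
        fin_cases i
        exacts [hpx 0, hpx 1, hpx 2, hpy])
      (isDuffyWeight_psiAt l) (fun η hη i => by
        obtain ⟨h1, h1'⟩ := mem_Icc_zero_one hη 1
        obtain ⟨h2, h2'⟩ := mem_Icc_zero_one hη 2
        have h4 := mul_nonneg h1 h2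
        have h5 := mul_le_of_le_one_right h1 h2'
        fin_cases i
        · exact ⟨fun _ => hxK 0, fun _ => h00 ▸ hye 0⟩
        · exact ⟨fun _ => hxK 1, fun hn => by fin_cases l <;> simp [psiAt] at hn <;> linarith⟩
        · exact ⟨fun _ => hxK 2, fun hn => by fin_cases l <;> simp [psiAt] at hn <;> linarith⟩
        · exact ⟨fun hn => by fin_cases l <;> simp [psiAt] at hn <;> linarith, fun _ => hye 1⟩)
      (j := fun η => if l = 0 then 1 else η 1)
      (by split_ifs; exacts [MultiAffine.const 1, MultiAffine.apply 1])
      (by split_ifs; exacts [continuous_const, continuous_apply 1])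
      (fun η hη => by
        obtain ⟨h1, h1'⟩ := mem_Icc_zero_one hη 1
        split_ifs
        · simp
        · rwa [abs_of_nonneg h1])
      (hsm (multiAffine_phiAt l) u) (hsc (continuous_phiAt l) u)
      (hsm (multiAffine_phiAt l) v) (hsc (continuous_phiAt l) v) ha hb
      (fun η hη => mod_cast abs_sum_mul_le (abs_phiAt_le_one hη l) hua)
      (fun η hη => mod_cast abs_sum_mul_le (abs_phiAt_le_one hη l) hvb) hν
      k (fun η => rfl)
    obtain ⟨h1, h2⟩ := integral_refPairEdge_at s ν x y h00 u v fun l => (key l).1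
    refine ⟨h1, ?_⟩
    rw [h2]
    change |_ - quadAt G s k ν x y u v| ≤ _
    rw [← one_mul (quadAt G s k ν x y u v)]
    exact abs_mul_sum_sub_le zero_le_one (fun l => (key l).2)
      (by rw [Fintype.card_fin]; push_cast; linarith)
  · have h11 : x 1 = y 1 := hcom 1 (by decide)
    have hsgn : ∀ l, ∀ η ∈ Icc (0 : Fin 3 → ℝ) 1, ∀ i,
        (0 < psiOn η l i → x i ∈ K) ∧ (psiOn η l i < 0 → x i ∈ e) := fun l η hη i => by
      obtain ⟨h1, h1'⟩ := mem_Icc_zero_one hη 1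
      refine ⟨fun _ => hxK i, ?_⟩
      fin_cases i
      · exact fun _ => h00 ▸ hye 0
      · exact fun _ => h11 ▸ hye 1
      · exact fun hn => by fin_cases l <;> simp [psiOn] at hn <;> linarith
    -- only here the two ranges of `s` are treated differently
    change _ ∧ |_ - quadOn G s k ν x u v| ≤ _
    rw [← one_mul (quadOn G s k ν x u v), quadOn]
    split_ifs with hs2
    · have key := fun l : Fin 3 => h hT hG hKf hef (m := 3) (by decide)
        (α := ![-2 * s, 0, 0])
        (fun i => by
          fin_cases i
          · right; right; simpa using hs2
          · left; simp
          · left; simp)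
        hxi hpx (isDuffyWeight_psiOn l) (hsgn l)
        (j := fun η => 1 - η 0) hj0 (by fun_prop) hj1
        (hsm (multiAffine_phiOn l) u) (hsc (continuous_phiOn l) u)
        (hsm (multiAffine_phiOn l) v) (hsc (continuous_phiOn l) v) ha hb
        (fun η hη => mod_cast abs_sum_mul_le (abs_phiOn_le_one hη l) hua)
        (fun η hη => mod_cast abs_sum_mul_le (abs_phiOn_le_one hη l) hvb) hν
        k (fun η => rfl)
      obtain ⟨h1, h2⟩ := integral_refPairEdge_on s ν x y h00 h11 u v fun l => (key l).1
      refine ⟨h1, ?_⟩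
      rw [h2]
      exact abs_mul_sum_sub_le zero_le_one (fun l => (key l).2)
        (by rw [Fintype.card_fin]; push_cast; linarith)
    · have hsb := hbd (not_lt.1 hs2)
      have hfr : ∀ i, y i ∈ frontier Ω := fun i => hefr (subset_convexHull ℝ _ (hye i))
      have hopp : ∀ {w : Plane → ℝ} {a : ℝ}, 0 ≤ a → |w (x 2)| ≤ a → ∀ l,
          ∀ η ∈ Icc (0 : Fin 3 → ℝ) 1, |phiOnOpposite η l * w (x 2)| ≤ 3 * a :=
        fun {w a} ha hw l η hη => by
          rw [abs_mul]
          have := (mul_le_of_le_one_left (abs_nonneg _) (abs_phiOnOpposite_le_one hη l)).trans hw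
          linarith
      have key := fun l : Fin 3 => h hT hG hKf hef (m := 3) (by decide)
        (α := ![2 - 2 * s, 0, 0])
        (fun i => by
          left
          fin_cases i <;> simp
          linarith)
        hxi hpx (isDuffyWeight_psiOn l) (hsgn l)
        (j := fun η => 1 - η 0) hj0 (by fun_prop) hj1
        ((multiAffine_phiOnOpposite l).mul_const (u (x 2)))
        ((continuous_phiOnOpposite l).mul continuous_const)
        ((multiAffine_phiOnOpposite l).mul_const (v (x 2)))
        ((continuous_phiOnOpposite l).mul continuous_const) ha hb
        (hopp ha (hua 2) l) (hopp hb (hvb 2) l) hν k (fun η => rfl)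
      obtain ⟨h1, h2⟩ := integral_refPairEdge_on_opposite s ν x y h00 h11 u v
        (h00 ▸ (hsb _ (hfr 0)).1) (h11 ▸ (hsb _ (hfr 1)).1) (h00 ▸ (hsb _ (hfr 0)).2)
        (h11 ▸ (hsb _ (hfr 1)).2) fun l => (key l).1
      refine ⟨h1, ?_⟩
      rw [h2]
      exact abs_mul_sum_sub_le zero_le_one (fun l => (key l).2)
        (by rw [Fintype.card_fin]; push_cast; linarith)

end Triangulation

end FracQuad

namespace FracQuad

/-! ### Quadrature error on separated pairs -/

theorem setDist_le {A B : Set Plane} {p q : Plane} (hp : p ∈ A) (hq : q ∈ B) :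
    setDist A B ≤ ‖p - q‖ := by
  rw [← dist_eq_norm]
  exact csInf_le ⟨0, by rintro _ ⟨a, -, b, -, rfl⟩; exact dist_nonneg⟩ ⟨p, hp, q, hq, rfl⟩

theorem exists_setDist_eq {A B : Set Plane} (hA : IsCompact A) (hB : IsCompact B)
    (hA' : A.Nonempty) (hB' : B.Nonempty) : ∃ p ∈ A, ∃ q ∈ B, setDist A B = ‖p - q‖ := by
  have hc : IsCompact (Set.image2 dist A B) := by
    rw [← Set.image_uncurry_prod]
    exact (hA.prod hB).image continuous_dist
  obtain ⟨p, hp, q, hq, h⟩ := hc.sInf_mem (hA'.image2 hB')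
  exact ⟨p, hp, q, hq, by rw [setDist, ← h, dist_eq_norm]⟩

theorem refBary_nonneg {a b : ℝ} (ha : a ∈ Icc (0 : ℝ) 1) (hb : b ∈ Icc (0 : ℝ) 1) (i : Fin 3) :
    0 ≤ refBary a (a * b) i := by
  have h1 := mul_nonneg ha.1 hb.1
  have h2 := mul_le_of_le_one_right ha.1 hb.2
  have h3 := ha.2
  fin_cases i <;> simp [refBary] <;> linarith

theorem abs_refBary_le_one {a b : ℝ} (ha : a ∈ Icc (0 : ℝ) 1) (hb : b ∈ Icc (0 : ℝ) 1)
    (i : Fin 3) : |refBary a (a * b) i| ≤ 1 := by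
  rw [abs_of_nonneg (refBary_nonneg ha hb i), ← sum_refBary a (a * b)]
  exact Finset.single_le_sum (fun j _ => refBary_nonneg ha hb j) (Finset.mem_univ i)

theorem conical_eq (x : Fin 3 → Plane) (a b : ℝ) :
    conical x a b = ∑ i, refBary a (a * b) i • x i := by
  simp only [conical, Fin.sum_univ_three, refBary, Matrix.cons_val]
  module

theorem sum_refBary_smul_mem_hull {K : Finset Plane} {x : Fin 3 → Plane} (hx : range x = K)
    {a b : ℝ} (ha : a ∈ Icc (0 : ℝ) 1) (hb : b ∈ Icc (0 : ℝ) 1) :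
    ∑ i, refBary a (a * b) i • x i ∈ hull K :=
  (convex_hull K).sum_mem (fun i _ => refBary_nonneg ha hb i) (sum_refBary _ _)
    fun i _ => subset_convexHull ℝ _ (mem_range_coe hx i)

theorem continuous_refBary_conical {n : ℕ} (j k : Fin n) (i : Fin 3) :
    Continuous fun η : Fin n → ℝ => refBary (η j) (η j * η k) i := by
  fin_cases i <;> simp [refBary] <;> fun_prop

theorem multiAffine_refBary_conical {n : ℕ} {j k : Fin n} (hjk : j ≠ k) (i : Fin 3) :
    MultiAffine fun η : Fin n → ℝ => refBary (η j) (η j * η k) i := fun η l t => by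
  by_cases h1 : j = l
  · subst h1
    fin_cases i <;> simp [refBary, Function.update_of_ne hjk.symm] <;> ring
  · by_cases h2 : k = l
    · subst h2
      fin_cases i <;> simp [refBary, Function.update_of_ne hjk] <;> ring
    · simp [Function.update_of_ne h1, Function.update_of_ne h2]

theorem MultiAffine.sub {n : ℕ} {E : Type*} [AddCommGroup E] [Module ℝ E]
    {f g : (Fin n → ℝ) → E} (hf : MultiAffine f) (hg : MultiAffine g) :
    MultiAffine fun η => f η - g η := fun η i t => by
  simp only [hf η i t, hg η i t]; module

theorem multiAffine_segment {n : ℕ} (k : Fin n) (y₀ y₁ : Plane) :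
    MultiAffine fun η : Fin n → ℝ => (1 - η k) • y₀ + η k • y₁ := fun η l t => by
  by_cases h : k = l
  · subst h; simp; module
  · simp [Function.update_of_ne h]

namespace Triangulation

theorem apply_conical {Ω : Set Plane} {T : Triangulation Ω} {K : Finset Plane}
    (hK : K ∈ T.elements) {u : Plane → ℝ} (hu : u ∈ T.p1Space) {x : Fin 3 → Plane}
    (hx : range x = K) {a b : ℝ} (ha : a ∈ Icc (0 : ℝ) 1) (hb : b ∈ Icc (0 : ℝ) 1) :
    u (conical x a b) = ∑ i, refBary a (a * b) i * u (x i) := by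
  obtain ⟨g, hg⟩ := hu.1 K hK
  rw [conical_eq, hg (sum_refBary_smul_mem_hull hx ha hb), affine_apply_sum _ (sum_refBary _ _)]
  exact Finset.sum_congr rfl fun i _ => by
    rw [hg (subset_convexHull ℝ _ (mem_range_coe hx i))]

theorem Controlled.meshSize_le_setDist {Ω : Set Plane} {T : Triangulation Ω} {Λ C₀ : ℝ}
    (hT : T.Controlled Λ C₀) {K L : Finset Plane} (hK : K ∈ T.faces) (hL : L ∈ T.faces)
    (hKL : Disjoint (hull K) (hull L)) :
    T.meshSize ≤ 3 * C₀ * setDist (hull K) (hull L) ∧ 0 < setDist (hull K) (hull L) := by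
  have hne : ∀ {M : Finset Plane}, M ∈ T.faces → (hull M).Nonempty := fun hM =>
    convexHull_nonempty_iff.2 (T.nonempty_of_mem_faces hM)
  obtain ⟨p, hp, q, hq, h⟩ := exists_setDist_eq (isCompact_hull K) (isCompact_hull L)
    (hne hK) (hne hL)
  have h1 := T.one_le_of_disjoint hT.lipschitz hK hL (disjoint_of_disjoint_hull hKL) hp hq
  rw [← h] at h1
  have hpos := hT.pos
  have h2 : T.meshSize ≤ 3 * C₀ * setDist (hull K) (hull L) := by
    have := mul_le_mul_of_nonneg_left h1 hpos.le
    rw [mul_one] at this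
    refine this.trans_eq ?_
    field_simp
  have hC := zero_lt_one.trans_le hT.one_le_const
  exact ⟨h2, by by_contra! hcon; nlinarith⟩

theorem one_add_div_pow_le {d h C : ℝ} (hh : 0 < h) (hd : h ≤ 3 * C * d) (hd0 : 0 < d)
    (D : ℕ) :
    (1 + d / h) ^ D ≤ (3 * C + 1) ^ D * (d / h) ^ D := by
  rw [← mul_pow]
  refine pow_le_pow_left₀ (by positivity) ?_ D
  have : 1 ≤ 3 * C * (d / h) := by rw [← mul_div_assoc, le_div_iff₀ hh]; linarith
  linarith

/-- Quadrature error on a separated pair of elements, in reference coordinates. -/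
theorem exists_refPair_far_error {s : ℝ} (hs0 : 0 < s) (hs1 : s < 1) (C₀ : ℝ) :
    ∃ B : ℝ, 0 ≤ B ∧ ∀ {ρ : ℝ}, 1 < ρ → ρ ≤ 3 / 2 →
      ∀ {Ω : Set Plane} {T : Triangulation Ω} {Λ : ℝ},
      T.Controlled Λ C₀ → ∀ {G : ℝ → ∀ k : ℕ, Rule k}, IsGaussFamily G →
      ∀ {K L : Finset Plane}, K ∈ T.elements → L ∈ T.elements → Disjoint (hull K) (hull L) →
      ∀ {x y : Fin 3 → Plane}, range x = K → range y = L →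
      ∀ {u v : Plane → ℝ}, u ∈ T.p1Space → v ∈ T.p1Space → ∀ {a b : ℝ}, 0 ≤ a → 0 ≤ b →
      (∀ k, |u (x k)| ≤ a ∧ |u (y k)| ≤ a) → (∀ k, |v (x k)| ≤ b ∧ |v (y k)| ≤ b) → ∀ k : ℕ,
      IntegrableOn (pairKernel s x y u v) refPair ∧
      |(∫ w in refPair, pairKernel s x y u v w) - quadFar G s k x y u v| ≤
        B * (a * b) * setDist (hull K) (hull L) ^ (-(2 + 2 * s)) *
          (setDist (hull K) (hull L) / T.meshSize) ^ 2 *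
          (ρ * (setDist (hull K) (hull L) / T.meshSize)) ^ (-2 * (k : ℤ)) := by
  obtain ⟨B, hB, h⟩ := exists_tensorGauss_error_far s hs0 2
  set W := weightBound s with hW
  have hW1 : 1 ≤ W := one_le_weightBound hs1
  refine ⟨4 * (2 * W ^ 4 * (B * 36 * (3 * |C₀| + 1) ^ 2)), by positivity, ?_⟩
  intro ρ hρ hρ2 Ω T Λ hT G hG K L hK hL hKL x y hx hy u v hu hv a b ha hb hua hvb k
  obtain ⟨hKf, hKc⟩ := T.mem_elements.1 hK
  obtain ⟨hLf, hLc⟩ := T.mem_elements.1 hL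
  obtain ⟨hhd, hd⟩ := hT.meshSize_le_setDist hKf hLf hKL
  set d := setDist (hull K) (hull L) with hdef
  have hpos := hT.pos
  have hC := zero_lt_one.trans_le hT.one_le_const
  have h01 : (0 : Fin 4) ≠ 1 := by decide
  have h23 : (2 : Fin 4) ≠ 3 := by decide
  have hcI : ∀ {η : Fin 4 → ℝ}, η ∈ Icc (0 : Fin 4 → ℝ) 1 → ∀ i, η i ∈ Icc (0 : ℝ) 1 :=
    fun hη i => mem_Icc_zero_one hη i
  set X : (Fin 4 → ℝ) → Plane := fun η => ∑ i, refBary (η 0) (η 0 * η 1) i • x i with hX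
  set Y : (Fin 4 → ℝ) → Plane := fun η => ∑ i, refBary (η 2) (η 2 * η 3) i • y i with hY
  have hXm : MultiAffine X :=
    MultiAffine.sum fun i _ => (multiAffine_refBary_conical h01 i).smul_const (x i)
  have hYm : MultiAffine Y :=
    MultiAffine.sum fun i _ => (multiAffine_refBary_conical h23 i).smul_const (y i)
  have hXc : Continuous X := continuous_finsetSum _ fun i _ =>
    (continuous_refBary_conical 0 1 i).smul continuous_const
  have hYc : Continuous Y := continuous_finsetSum _ fun i _ =>
    (continuous_refBary_conical 2 3 i).smul continuous_const
  have hXK : ∀ η ∈ Icc (0 : Fin 4 → ℝ) 1, X η ∈ hull K := fun η hη =>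
    sum_refBary_smul_mem_hull hx (hcI hη 0) (hcI hη 1)
  have hYL : ∀ η ∈ Icc (0 : Fin 4 → ℝ) 1, Y η ∈ hull L := fun η hη =>
    sum_refBary_smul_mem_hull hy (hcI hη 2) (hcI hη 3)
  set S : (Plane → ℝ) → (Fin 4 → ℝ) → ℝ := fun w η =>
    ∑ i, refBary (η 0) (η 0 * η 1) i * w (x i) - ∑ i, refBary (η 2) (η 2 * η 3) i * w (y i) with hS
  have hSm : ∀ w, MultiAffine (S w) := fun w => MultiAffine.sub
    (MultiAffine.sum fun i _ => (multiAffine_refBary_conical h01 i).mul_const (w (x i)))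
    (MultiAffine.sum fun i _ => (multiAffine_refBary_conical h23 i).mul_const (w (y i)))
  have hSc : ∀ w, Continuous (S w) := fun w =>
    (continuous_finsetSum _ fun i _ => (continuous_refBary_conical 0 1 i).mul continuous_const).sub
    (continuous_finsetSum _ fun i _ => (continuous_refBary_conical 2 3 i).mul continuous_const)
  have hSb : ∀ {w : Plane → ℝ} {a : ℝ}, (∀ k, |w (x k)| ≤ a ∧ |w (y k)| ≤ a) →
      ∀ η ∈ Icc (0 : Fin 4 → ℝ) 1, |S w η| ≤ 6 * a := fun {w a} hw η hη => by
    have h1 := abs_sum_mul_le (abs_refBary_le_one (hcI hη 0) (hcI hη 1)) fun k => (hw k).1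
    have h2 := abs_sum_mul_le (abs_refBary_le_one (hcI hη 2) (hcI hη 3)) fun k => (hw k).2
    have h3 := abs_sub (∑ i, refBary (η 0) (η 0 * η 1) i * w (x i))
      (∑ i, refBary (η 2) (η 2 * η 3) i * w (y i))
    push_cast at h1 h2
    exact h3.trans (by linarith)
  have hdiam : ∀ {M : Finset Plane}, M ∈ T.elements → ∀ p ∈ hull M, ∀ q ∈ hull M,
      ‖p - q‖ ≤ T.meshSize := fun hM p hp q hq => by
    rw [← dist_eq_norm]
    exact (Metric.dist_le_diam_of_mem (isCompact_hull _).isBounded hp hq).trans (hT.diam_le _ hM)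
  have hα : ∀ i : Fin 4, -1 < (![1, 0, 1, 0] : Fin 4 → ℝ) i ∧
      1 / ((![1, 0, 1, 0] : Fin 4 → ℝ) i + 1) ≤ W := fun i =>
    inv_le_weightBound hs1 (by left; fin_cases i <;> simp)
  -- each variable moves only one of the two points, and this within one element
  have hstep : ∀ η ∈ Icc (0 : Fin 4 → ℝ) 1, ∀ i,
      ‖X (Function.update η i 1) - Y (Function.update η i 1) -
        (X (Function.update η i 0) - Y (Function.update η i 0))‖ ≤ T.meshSize := by
    intro η hη i
    have m1 : Function.update η i 1 ∈ Icc (0 : Fin 4 → ℝ) 1 := update_mem_Icc hη i (by simp)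
    have m0 : Function.update η i 0 ∈ Icc (0 : Fin 4 → ℝ) 1 := update_mem_Icc hη i (by simp)
    have hor : Y (Function.update η i 1) = Y (Function.update η i 0) ∨
        X (Function.update η i 1) = X (Function.update η i 0) := by
      fin_cases i
      · left; simp [hY]
      · left; simp [hY]
      · right; simp [hX]
      · right; simp [hX]
    rcases hor with hor | hor
    · rw [hor, sub_sub_sub_cancel_right]
      exact hdiam hK _ (hXK _ m1) _ (hXK _ m0)
    · rw [hor, sub_sub_sub_cancel_left]
      exact hdiam hL _ (hYL _ m0) _ (hYL _ m1)
  have hZ0 : ∀ η ∈ Icc (0 : Fin 4 → ℝ) 1, d ≤ ‖X η - Y η‖ := fun η hη =>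
    setDist_le (hXK η hη) (hYL η hη)
  have hf : ∀ η, pairKernel s x y u v (conicalPair η) =
      (∏ j, (![S u, S v] : Fin 2 → (Fin 4 → ℝ) → ℝ) j η) / ‖X η - Y η‖ ^ (2 + 2 * s) := fun η => by
    rw [Fin.prod_univ_two]
    simp [pairKernel, conicalPair, hS, hX, hY]
  have hPm : ∀ j, MultiAffine ((![S u, S v] : Fin 2 → (Fin 4 → ℝ) → ℝ) j) := fun j => by
    fin_cases j; exacts [hSm u, hSm v]
  have hPc : ∀ j, Continuous ((![S u, S v] : Fin 2 → (Fin 4 → ℝ) → ℝ) j) := fun j => by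
    fin_cases j; exacts [hSc u, hSc v]
  have key := h hρ hρ2 hG hW1 (fun i => (hα i).1) (fun i => (hα i).2) hPm hPc (hXm.sub hYm)
    (hXc.sub hYc) hd hpos hZ0 hstep (A := 6 * a * (6 * b)) (fun η hη => by
      rw [Fin.prod_univ_two, abs_mul]
      exact mul_le_mul (hSb hua η hη) (hSb hvb η hη) (abs_nonneg _) (by positivity)) k
  simp only [← hf] at key
  obtain ⟨h1, h2⟩ := integral_refPair_far s x y u v (by
    refine integrable_pi_powMeasure (fun i => (hα i).1) ?_
    simp only [hf]
    refine continuousOn_quotient (continuous_finsetProd _ fun j _ => hPc j) (hXc.sub hYc)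
      fun η hη h0 => ?_
    have := hZ0 η hη
    rw [h0, norm_zero] at this
    linarith)
  refine ⟨h1, ?_⟩
  have hq : quadFar G s k x y u v = tensorGauss G k ![1, 0, 1, 0] fun η =>
      pairKernel s x y u v (conicalPair η) := by
    refine tensorGauss_congr hG k (fun i => (hα i).1) fun η hη => ?_
    rw [apply_conical hK hu hx (hcI hη 0) (hcI hη 1), apply_conical hK hv hx (hcI hη 0) (hcI hη 1),
      apply_conical hL hu hy (hcI hη 2) (hcI hη 3), apply_conical hL hv hy (hcI hη 2) (hcI hη 3),
      conical_eq, conical_eq]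
    simp [pairKernel, conicalPair]
  rw [h2, hq]
  refine key.trans ?_
  rw [abs_of_pos hC]
  have hp := one_add_div_pow_le hpos hhd hd 2
  have hr : 0 ≤ d ^ (-(2 + 2 * s)) := by positivity
  have hρk : 0 ≤ (ρ * (d / T.meshSize)) ^ (-2 * (k : ℤ)) := by
    have := zero_lt_one.trans hρ; positivity
  calc _ ≤ ((4 : ℕ) : ℝ) * (2 * W ^ 4 * (B * (6 * a * (6 * b)) * d ^ (-(2 + 2 * s)) *
        ((3 * C₀ + 1) ^ 2 * (d / T.meshSize) ^ 2) *
        (ρ * (d / T.meshSize)) ^ (-2 * (k : ℤ)))) := by gcongr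
    _ = _ := by push_cast; ring

end Triangulation

end FracQuad

namespace FracQuad

namespace Triangulation

/-- Quadrature error on a separated pair of an element and a boundary edge, in reference
coordinates. The integrand contains three multi-affine factors, which cost the power `(d / h) ^ 3`
in the first bound. The second bound, which does not improve with the order, holds because both
the integral and its approximation are bounded by the maximum of the integrand. -/
theorem exists_refPairEdge_far_error {s : ℝ} (hs0 : 0 < s) (hs1 : s < 1) (C₀ : ℝ) :
    ∃ B : ℝ, 0 ≤ B ∧ ∀ {ρ : ℝ}, 1 < ρ → ρ ≤ 3 / 2 →
      ∀ {Ω : Set Plane} {T : Triangulation Ω} {Λ : ℝ}, IsPolygon Ω →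
      T.Controlled Λ C₀ → ∀ {G : ℝ → ∀ k : ℕ, Rule k}, IsGaussFamily G →
      ∀ {K e : Finset Plane}, K ∈ T.elements → e ∈ T.boundaryEdges →
      Disjoint (hull K) (hull e) →
      ∀ {x : Fin 3 → Plane} {y : Fin 2 → Plane}, range x = K → range y = e →
      ∀ {u v : Plane → ℝ}, u ∈ T.p1Space → v ∈ T.p1Space → ∀ {a b : ℝ}, 0 ≤ a → 0 ≤ b →
      (∀ k, |u (x k)| ≤ a) → (∀ k, |v (x k)| ≤ b) → ∀ {ν : Plane}, ‖ν‖ = 1 → ∀ k : ℕ,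
      IntegrableOn (edgeKernel s ν x y u v) refPairEdge ∧
      |(∫ w in refPairEdge, edgeKernel s ν x y u v w) - quadFarEdge G s k ν x y u v| ≤
        B * (a * b) * (setDist (hull K) (hull e) * setDist (hull K) (hull e) ^ (-(2 + 2 * s))) *
          (setDist (hull K) (hull e) / T.meshSize) ^ 3 *
          (ρ * (setDist (hull K) (hull e) / T.meshSize)) ^ (-2 * (k : ℤ)) ∧
      |(∫ w in refPairEdge, edgeKernel s ν x y u v w) - quadFarEdge G s k ν x y u v| ≤
        B * (a * b) * T.meshSize ^ (-(1 + 2 * s)) := by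
  obtain ⟨B, hB, h⟩ := exists_tensorGauss_error_far s hs0 3
  set W := weightBound s with hW
  have hW1 : 1 ≤ W := one_le_weightBound hs1
  have hCs : 0 ≤ (3 * |C₀|) ^ (1 + 2 * s) := by positivity
  refine ⟨3 * (2 * W ^ 3 * (B * 9 * (1 + 6 * |C₀|) * (3 * |C₀| + 1) ^ 3)) +
    3 * (2 * W ^ 3 * (9 * (3 * |C₀|) ^ (1 + 2 * s))), by positivity, ?_⟩
  intro ρ hρ hρ2 Ω T Λ hΩ hT G hG K e hK he hKe x y hx hy u v hu hv a b ha hb hua hvb ν hν k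
  obtain ⟨hKf, hKc⟩ := T.mem_elements.1 hK
  obtain ⟨hef, hec, -⟩ := T.mem_boundaryEdges.1 he
  obtain ⟨hhd, hd⟩ := hT.meshSize_le_setDist hKf hef hKe
  obtain ⟨p₀, hp₀, q₀, hq₀, hpq⟩ := exists_setDist_eq (isCompact_hull K) (isCompact_hull e)
    (convexHull_nonempty_iff.2 (T.nonempty_of_mem_faces hKf))
    (convexHull_nonempty_iff.2 (T.nonempty_of_mem_faces hef))
  set d := setDist (hull K) (hull e) with hdef
  have hpos := hT.pos
  have hC := zero_lt_one.trans_le hT.one_le_const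
  have h01 : (0 : Fin 3) ≠ 1 := by decide
  have hcI : ∀ {η : Fin 3 → ℝ}, η ∈ Icc (0 : Fin 3 → ℝ) 1 → ∀ i, η i ∈ Icc (0 : ℝ) 1 :=
    fun hη i => mem_Icc_zero_one hη i
  set X : (Fin 3 → ℝ) → Plane := fun η => ∑ i, refBary (η 0) (η 0 * η 1) i • x i with hX
  set Y : (Fin 3 → ℝ) → Plane := fun η => (1 - η 2) • y 0 + η 2 • y 1 with hY
  have hXm : MultiAffine X :=
    MultiAffine.sum fun i _ => (multiAffine_refBary_conical h01 i).smul_const (x i)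
  have hYm : MultiAffine Y := multiAffine_segment 2 (y 0) (y 1)
  have hXc : Continuous X := continuous_finsetSum _ fun i _ =>
    (continuous_refBary_conical 0 1 i).smul continuous_const
  have hYc : Continuous Y := by fun_prop
  have hXK : ∀ η ∈ Icc (0 : Fin 3 → ℝ) 1, X η ∈ hull K := fun η hη =>
    sum_refBary_smul_mem_hull hx (hcI hη 0) (hcI hη 1)
  have hYL : ∀ η ∈ Icc (0 : Fin 3 → ℝ) 1, Y η ∈ hull e := fun η hη => by
    rw [hull_eq_segment hy, segment_eq_image]
    exact ⟨η 2, hcI hη 2, rfl⟩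
  set S : (Plane → ℝ) → (Fin 3 → ℝ) → ℝ := fun w η =>
    ∑ i, refBary (η 0) (η 0 * η 1) i * w (x i) with hS
  have hSm : ∀ w, MultiAffine (S w) := fun w =>
    MultiAffine.sum fun i _ => (multiAffine_refBary_conical h01 i).mul_const (w (x i))
  have hSc : ∀ w, Continuous (S w) := fun w =>
    continuous_finsetSum _ fun i _ => (continuous_refBary_conical 0 1 i).mul continuous_const
  have hSb : ∀ {w : Plane → ℝ} {a : ℝ}, (∀ k, |w (x k)| ≤ a) →
      ∀ η ∈ Icc (0 : Fin 3 → ℝ) 1, |S w η| ≤ 3 * a := fun hw η hη => mod_cast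
    abs_sum_mul_le (abs_refBary_le_one (hcI hη 0) (hcI hη 1)) hw
  have hdiamK : ∀ p ∈ hull K, ∀ q ∈ hull K, ‖p - q‖ ≤ T.meshSize := fun p hp q hq => by
    rw [← dist_eq_norm]
    exact (Metric.dist_le_diam_of_mem (isCompact_hull _).isBounded hp hq).trans (hT.diam_le _ hK)
  have hdiame : ∀ p ∈ hull e, ∀ q ∈ hull e, ‖p - q‖ ≤ T.meshSize := fun p hp q hq => by
    rw [← dist_eq_norm]
    exact (Metric.dist_le_diam_of_mem (isCompact_hull _).isBounded hp hq).trans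
      (hT.diam_edge_le hΩ he).1
  have hα : ∀ i : Fin 3, -1 < (![1, 0, 0] : Fin 3 → ℝ) i ∧
      1 / ((![1, 0, 0] : Fin 3 → ℝ) i + 1) ≤ W := fun i =>
    inv_le_weightBound hs1 (by left; fin_cases i <;> simp)
  -- each variable moves only one of the two points, within the element or the edge
  have hstep : ∀ η ∈ Icc (0 : Fin 3 → ℝ) 1, ∀ i,
      ‖X (Function.update η i 1) - Y (Function.update η i 1) -
        (X (Function.update η i 0) - Y (Function.update η i 0))‖ ≤ T.meshSize := by
    intro η hη i
    have m1 : Function.update η i 1 ∈ Icc (0 : Fin 3 → ℝ) 1 := update_mem_Icc hη i (by simp)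
    have m0 : Function.update η i 0 ∈ Icc (0 : Fin 3 → ℝ) 1 := update_mem_Icc hη i (by simp)
    have hor : Y (Function.update η i 1) = Y (Function.update η i 0) ∨
        X (Function.update η i 1) = X (Function.update η i 0) := by
      fin_cases i
      · left; simp [hY]
      · left; simp [hY]
      · right; simp [hX]
    rcases hor with hor | hor
    · rw [hor, sub_sub_sub_cancel_right]
      exact hdiamK _ (hXK _ m1) _ (hXK _ m0)
    · rw [hor, sub_sub_sub_cancel_left]
      exact hdiame _ (hYL _ m0) _ (hYL _ m1)
  have hZ0 : ∀ η ∈ Icc (0 : Fin 3 → ℝ) 1, d ≤ ‖X η - Y η‖ := fun η hη =>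
    setDist_le (hXK η hη) (hYL η hη)
  have hZ1 : ∀ η ∈ Icc (0 : Fin 3 → ℝ) 1, ‖X η - Y η‖ ≤ (1 + 6 * C₀) * d := fun η hη => by
    have h1 := hdiamK _ (hXK η hη) _ hp₀
    have h2 := hdiame _ hq₀ _ (hYL η hη)
    have h3 : ‖X η - Y η‖ ≤ ‖X η - p₀‖ + ‖p₀ - q₀‖ + ‖q₀ - Y η‖ := by
      rw [show X η - Y η = X η - p₀ + (p₀ - q₀) + (q₀ - Y η) by abel]
      exact norm_add₃_le
    linarith
  set N : (Fin 3 → ℝ) → ℝ := fun η => inner ℝ ν (X η - Y η) with hN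
  have hNb : ∀ η, |N η| ≤ ‖X η - Y η‖ := fun η => by
    have := abs_real_inner_le_norm ν (X η - Y η)
    rwa [hν, one_mul] at this
  have hf : ∀ η, edgeKernel s ν x y u v (conicalPairEdge η) =
      (∏ j, (![S u, S v, N] : Fin 3 → (Fin 3 → ℝ) → ℝ) j η) / ‖X η - Y η‖ ^ (2 + 2 * s) :=
    fun η => by
      rw [Fin.prod_univ_three]
      simp [edgeKernel, normalKernel, conicalPairEdge, hS, hX, hY, hN, mul_div_assoc]
  have hPm : ∀ j, MultiAffine ((![S u, S v, N] : Fin 3 → (Fin 3 → ℝ) → ℝ) j) := fun j => by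
    fin_cases j; exacts [hSm u, hSm v, (hXm.sub hYm).inner_left ν]
  have hPc : ∀ j, Continuous ((![S u, S v, N] : Fin 3 → (Fin 3 → ℝ) → ℝ) j) := fun j => by
    fin_cases j; exacts [hSc u, hSc v, continuous_const.inner (hXc.sub hYc)]
  have hSS : ∀ η ∈ Icc (0 : Fin 3 → ℝ) 1, |S u η * S v η| ≤ 3 * a * (3 * b) := fun η hη => by
    rw [abs_mul]
    exact mul_le_mul (hSb hua η hη) (hSb hvb η hη) (abs_nonneg _) (by positivity)
  have hcont : ContinuousOn (fun η => edgeKernel s ν x y u v (conicalPairEdge η)) (Icc 0 1) := by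
    simp only [hf]
    refine continuousOn_quotient (continuous_finsetProd _ fun j _ => hPc j) (hXc.sub hYc)
      fun η hη h0 => ?_
    have := hZ0 η hη
    rw [h0, norm_zero] at this
    linarith
  have key := h hρ hρ2 hG hW1 (fun i => (hα i).1) (fun i => (hα i).2) hPm hPc (hXm.sub hYm)
    (hXc.sub hYc) hd hpos hZ0 hstep (A := 3 * a * (3 * b) * ((1 + 6 * C₀) * d)) (fun η hη => by
      rw [Fin.prod_univ_three, abs_mul]
      exact mul_le_mul (hSS η hη) ((hNb η).trans (hZ1 η hη)) (abs_nonneg _) (by positivity)) k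
  simp only [← hf] at key
  obtain ⟨h1, h2⟩ := integral_refPairEdge_far s ν x y u v
    (integrable_pi_powMeasure (fun i => (hα i).1) hcont)
  have hq : quadFarEdge G s k ν x y u v = tensorGauss G k ![1, 0, 0] fun η =>
      edgeKernel s ν x y u v (conicalPairEdge η) := by
    refine tensorGauss_congr hG k (fun i => (hα i).1) fun η hη => ?_
    rw [apply_conical hK hu hx (hcI hη 0) (hcI hη 1), apply_conical hK hv hx (hcI hη 0) (hcI hη 1),
      conical_eq]
    simp [edgeKernel, conicalPairEdge]
  rw [h2, hq, abs_of_pos hC]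
  have hab := mul_nonneg ha hb
  have hr : 0 ≤ d ^ (-(2 + 2 * s)) := by positivity
  have hρk : 0 ≤ (ρ * (d / T.meshSize)) ^ (-2 * (k : ℤ)) := by
    have := zero_lt_one.trans hρ; positivity
  rw [abs_of_pos hC] at hCs
  refine ⟨h1, ?_, ?_⟩
  · refine key.trans ?_
    have hp := one_add_div_pow_le hpos hhd hd 3
    calc _ ≤ ((3 : ℕ) : ℝ) * (2 * W ^ 3 * (B * (3 * a * (3 * b) * ((1 + 6 * C₀) * d)) *
          d ^ (-(2 + 2 * s)) * ((3 * C₀ + 1) ^ 3 * (d / T.meshSize) ^ 3) *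
          (ρ * (d / T.meshSize)) ^ (-2 * (k : ℤ)))) := by gcongr
      _ = 3 * (2 * W ^ 3 * (B * 9 * (1 + 6 * C₀) * (3 * C₀ + 1) ^ 3)) * (a * b) *
          (d * d ^ (-(2 + 2 * s))) * (d / T.meshSize) ^ 3 *
          (ρ * (d / T.meshSize)) ^ (-2 * (k : ℤ)) := by push_cast; ring
      _ ≤ _ := by
          gcongr
          exact le_add_of_nonneg_right (by positivity)
  · have hsup : ∀ η ∈ Icc (0 : Fin 3 → ℝ) 1, |edgeKernel s ν x y u v (conicalPairEdge η)| ≤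
        9 * (a * b) * ((3 * C₀) ^ (1 + 2 * s) * T.meshSize ^ (-(1 + 2 * s))) := fun η hη => by
      have hz0 := hd.trans_le (hZ0 η hη)
      rw [hf, Fin.prod_univ_three, abs_div, abs_of_nonneg (Real.rpow_nonneg (norm_nonneg _) _),
        abs_mul]
      simp only [Matrix.cons_val]
      have e1 : ‖X η - Y η‖ / ‖X η - Y η‖ ^ (2 + 2 * s) ≤
          (3 * C₀) ^ (1 + 2 * s) * T.meshSize ^ (-(1 + 2 * s)) := by
        have e2 : ‖X η - Y η‖ / ‖X η - Y η‖ ^ (2 + 2 * s) = ‖X η - Y η‖ ^ (-(1 + 2 * s)) := by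
          rw [div_eq_mul_inv, ← Real.rpow_neg hz0.le]
          nth_rw 1 [← Real.rpow_one ‖X η - Y η‖]
          rw [← Real.rpow_add hz0]
          congr 1; ring
        have e3 : (3 * C₀) ^ (1 + 2 * s) * T.meshSize ^ (-(1 + 2 * s)) =
            (T.meshSize / (3 * C₀)) ^ (-(1 + 2 * s)) := by
          rw [Real.div_rpow hpos.le (by positivity), Real.rpow_neg (by positivity : 0 ≤ 3 * C₀),
            div_inv_eq_mul, mul_comm]
        rw [e2, e3]
        refine Real.rpow_le_rpow_of_nonpos (by positivity) ?_ (by linarith)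
        rw [div_le_iff₀' (by positivity)]
        exact hhd.trans (mul_le_mul_of_nonneg_left (hZ0 η hη) (by positivity))
      calc _ ≤ 3 * a * (3 * b) * ‖X η - Y η‖ / ‖X η - Y η‖ ^ (2 + 2 * s) := by
            have := hSS η hη
            have := hNb η
            gcongr
        _ = 9 * (a * b) * (‖X η - Y η‖ / ‖X η - Y η‖ ^ (2 + 2 * s)) := by ring
        _ ≤ _ := mul_le_mul_of_nonneg_left e1 (by positivity)
    have hr2 : 0 ≤ T.meshSize ^ (-(1 + 2 * s)) := by positivity
    refine (abs_integral_pi_sub_tensorGauss_le_of_continuousOn hG hW1 k (fun i => (hα i).1)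
      (fun i => (hα i).2) hcont
      (ε := 9 * (a * b) * ((3 * C₀) ^ (1 + 2 * s) * T.meshSize ^ (-(1 + 2 * s))))
      (by positivity) fun i η hη =>
        ⟨0, by rw [Polynomial.degree_zero]; exact WithBot.bot_lt_coe _, fun t ht => by
          rw [Polynomial.eval_zero, sub_zero]; exact hsup _ (update_mem_Icc hη i ht)⟩).trans ?_
    calc _ = 3 * (2 * W ^ 3 * (9 * (3 * C₀) ^ (1 + 2 * s))) * (a * b) *
          T.meshSize ^ (-(1 + 2 * s)) := by
          push_cast; ring
      _ ≤ _ := by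
          gcongr
          exact le_add_of_nonneg_left (by positivity)

end Triangulation

end FracQuad

namespace FracQuad

/-! ### Error of one pair in terms of the error terms -/

namespace Scheme

variable {Ω : Set Plane} {T : Triangulation Ω} (Q : Scheme T)

theorem le_errNT (s ρ : ℝ) {K L : Finset Plane} (hK : K ∈ T.elements) (hL : L ∈ T.elements)
    (h : Disjoint (hull K) (hull L)) :
    T.meshSize ^ (-2 : ℤ) * setDist (hull K) (hull L) ^ (-2 * s) *
      (ρ * (setDist (hull K) (hull L) / T.meshSize)) ^ (-2 * (Q.kNT K L : ℤ)) ≤ Q.errNT s ρ := by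
  have hfin : Finite {p : Finset Plane × Finset Plane //
      p.1 ∈ T.elements ∧ p.2 ∈ T.elements ∧ Disjoint (hull p.1) (hull p.2)} :=
    ((T.elements ×ˢ T.elements).finite_toSet.subset fun p hp =>
      Finset.mem_coe.2 (Finset.mem_product.2 ⟨hp.1, hp.2.1⟩)).to_subtype
  exact le_ciSup (f := fun p : {p : Finset Plane × Finset Plane //
      p.1 ∈ T.elements ∧ p.2 ∈ T.elements ∧ Disjoint (hull p.1) (hull p.2)} =>
    T.meshSize ^ (-2 : ℤ) * setDist (hull p.1.1) (hull p.1.2) ^ (-2 * s) *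
      (ρ * (setDist (hull p.1.1) (hull p.1.2) / T.meshSize)) ^ (-2 * (Q.kNT p.1.1 p.1.2 : ℤ)))
    (Set.finite_range _).bddAbove ⟨(K, L), hK, hL, h⟩

theorem le_errNTb (s ρ : ℝ) {K e : Finset Plane} (hK : K ∈ T.elements) (he : e ∈ T.boundaryEdges)
    (h : Disjoint (hull K) (hull e)) :
    T.meshSize ^ (-1 : ℤ) * setDist (hull K) (hull e) ^ (-2 * s) *
      (ρ * (setDist (hull K) (hull e) / T.meshSize)) ^ (-2 * (Q.kNTb K e : ℤ)) ≤ Q.errNTb s ρ := by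
  have hfin : Finite {p : Finset Plane × Finset Plane //
      p.1 ∈ T.elements ∧ p.2 ∈ T.boundaryEdges ∧ Disjoint (hull p.1) (hull p.2)} :=
    ((T.elements ×ˢ T.boundaryEdges).finite_toSet.subset fun p hp =>
      Finset.mem_coe.2 (Finset.mem_product.2 ⟨hp.1, hp.2.1⟩)).to_subtype
  exact le_ciSup (f := fun p : {p : Finset Plane × Finset Plane //
      p.1 ∈ T.elements ∧ p.2 ∈ T.boundaryEdges ∧ Disjoint (hull p.1) (hull p.2)} =>
    T.meshSize ^ (-1 : ℤ) * setDist (hull p.1.1) (hull p.1.2) ^ (-2 * s) *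
      (ρ * (setDist (hull p.1.1) (hull p.1.2) / T.meshSize)) ^ (-2 * (Q.kNTb p.1.1 p.1.2 : ℤ)))
    (Set.finite_range _).bddAbove ⟨(K, e), hK, he, h⟩

theorem setDist_nonneg (A B : Set Plane) : 0 ≤ setDist A B :=
  Real.sInf_nonneg (by rintro _ ⟨a, -, b, -, rfl⟩; exact dist_nonneg)

theorem errNT_nonneg (h : 0 < T.meshSize) (s : ℝ) {ρ : ℝ} (hρ : 1 < ρ) : 0 ≤ Q.errNT s ρ :=
  Real.iSup_nonneg fun p => by
    have := setDist_nonneg (hull p.1.1) (hull p.1.2)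
    have := zero_lt_one.trans hρ
    positivity

theorem errNTb_nonneg (h : 0 < T.meshSize) (s : ℝ) {ρ : ℝ} (hρ : 1 < ρ) : 0 ≤ Q.errNTb s ρ :=
  Real.iSup_nonneg fun p => by
    have := setDist_nonneg (hull p.1.1) (hull p.1.2)
    have := zero_lt_one.trans hρ
    positivity

end Scheme

/-- The passage from reference coordinates, by the factor `A`, to the contribution of a pair. -/
theorem abs_scaled_sub_le {γ A E I J q : ℝ} (hA : 0 ≤ A) (hJ : J = A * I) (h : |I - q| ≤ E) :
    |γ * J - γ * A * q| ≤ |γ| * A * E := by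
  rw [hJ, show γ * (A * I) - γ * A * q = γ * A * (I - q) by ring, abs_mul, abs_mul,
    abs_of_nonneg hA]
  exact mul_le_mul_of_nonneg_left h (by positivity)

theorem ncard_eq_zero_iff {K L : Finset Plane} : ((K : Set Plane) ∩ L).ncard = 0 ↔ Disjoint K L := by
  rw [Set.ncard_eq_zero (K.finite_toSet.inter_of_left _), ← Set.disjoint_iff_inter_eq_empty,
    Finset.disjoint_coe]

namespace Triangulation

/-- The error of one pair of elements. -/
theorem exists_pair_error {s : ℝ} (hs0 : 0 < s) (hs1 : s < 1) (Λ C₀ : ℝ) :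
    ∃ D ρ₁ : ℝ, 0 ≤ D ∧ 1 < ρ₁ ∧ ∀ {ρ₂ : ℝ}, 1 < ρ₂ → ρ₂ ≤ 3 / 2 →
      ∀ {Ω : Set Plane} {T : Triangulation Ω}, T.Controlled Λ C₀ →
      ∀ {G : ℝ → ∀ k : ℕ, Rule k}, IsGaussFamily G → ∀ (Q : Scheme T) {u v : Plane → ℝ},
      u ∈ T.p1Space → v ∈ T.p1Space → ∀ {K L : Finset Plane}, K ∈ T.elements → L ∈ T.elements →
      Integrable (energyDensity s u v)
        ((volume.restrict (hull K)).prod (volume.restrict (hull L))) ∧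
      |fracConst 2 s / 2 * (∫ z, energyDensity s u v z
        ∂((volume.restrict (hull K)).prod (volume.restrict (hull L)))) - Q.aPair G s K L u v| ≤
        D * (T.meshSize ^ 2 * (Q.errT s ρ₁ + Q.errNT s ρ₂)) *
          ((localNorm K u + localNorm L u) * (localNorm K v + localNorm L v)) := by
  obtain ⟨B, ρ₁, hB, hρ₁, hnear⟩ := exists_refPair_error hs0 hs1 C₀
  obtain ⟨B', hB', hfar⟩ := exists_refPair_far_error hs0 hs1 C₀
  set γ := fracConst 2 s / 2 with hγ
  refine ⟨|γ| * 64 * (16 * Λ) ^ 2 * (B + B'), ρ₁, by positivity, hρ₁, ?_⟩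
  intro ρ₂ hρ₂ hρ₂' Ω T hT G hG Q u v hu hv K L hK hL
  have hpos := hT.pos
  have hΛ := zero_lt_one.trans_le hT.one_le
  obtain ⟨hKf, -⟩ := T.mem_elements.1 hK
  obtain ⟨hLf, -⟩ := T.mem_elements.1 hL
  have hx := Q.range_fst K hK L hL
  have hy := Q.range_snd K hK L hL
  set h := T.meshSize with hh
  have hN := localNorm_nonneg
  have hbound : ∀ {w : Plane → ℝ}, w ∈ T.p1Space → ∀ i, |w (Q.fst K L i)| ≤
      16 * Λ / h * (localNorm K w + localNorm L w) ∧ |w (Q.snd K L i)| ≤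
      16 * Λ / h * (localNorm K w + localNorm L w) := fun {w} hw i => by
    refine ⟨(hT.abs_le_div hK hw (mem_range_coe hx i)).trans ?_,
      (hT.abs_le_div hL hw (mem_range_coe hy i)).trans ?_⟩
    · exact mul_le_mul_of_nonneg_left (le_add_of_nonneg_right (hN L w)) (by positivity)
    · exact mul_le_mul_of_nonneg_left (le_add_of_nonneg_left (hN K w)) (by positivity)
  set nu := localNorm K u + localNorm L u with hnu
  set nv := localNorm K v + localNorm L v with hnv
  have hnu0 : 0 ≤ nu := add_nonneg (hN K u) (hN L u)
  have hnv0 : 0 ≤ nv := add_nonneg (hN K v) (hN L v)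
  have ha : 0 ≤ 16 * Λ / h * nu := by positivity
  have hb : 0 ≤ 16 * Λ / h * nv := by positivity
  have hAK := area_nonneg K
  have hAL := area_nonneg L
  set A := Scheme.area K / (1 / 2) * (Scheme.area L / (1 / 2)) with hA
  have hA0 : 0 ≤ A := by positivity
  have hA1 : A ≤ 64 * h ^ 4 := by
    rw [hA, show 64 * h ^ 4 = 4 * h ^ 2 / (1 / 2) * (4 * h ^ 2 / (1 / 2)) by ring]
    have := hT.area_le hK
    have := hT.area_le hL
    gcongr
  have hT0 : 0 ≤ Q.errT s ρ₁ := by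
    have := zero_lt_one.trans hρ₁
    unfold Scheme.errT; positivity
  have hNT0 : 0 ≤ Q.errNT s ρ₂ := Q.errNT_nonneg hpos s hρ₂
  -- the common scaling argument: `X` bounds the error relative to the nodal values
  have scale : ∀ {q X : ℝ} {β : ℝ}, 0 ≤ β → β ≤ B + B' → 0 ≤ X →
      X ≤ Q.errT s ρ₁ + Q.errNT s ρ₂ →
      Q.aPair G s K L u v = γ * A * q →
      IntegrableOn (pairKernel s (Q.fst K L) (Q.snd K L) u v) refPair →
      |(∫ w in refPair, pairKernel s (Q.fst K L) (Q.snd K L) u v w) - q| ≤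
        β * (16 * Λ / h * nu * (16 * Λ / h * nv)) * X →
      Integrable (energyDensity s u v)
        ((volume.restrict (hull K)).prod (volume.restrict (hull L))) ∧
      |γ * (∫ z, energyDensity s u v z
        ∂((volume.restrict (hull K)).prod (volume.restrict (hull L)))) - Q.aPair G s K L u v| ≤
        |γ| * 64 * (16 * Λ) ^ 2 * (B + B') * (h ^ 2 * (Q.errT s ρ₁ + Q.errNT s ρ₂)) *
          (nu * nv) := by
    intro q X β hβ0 hβ hX0 hX hq hint herr
    obtain ⟨h1, h2⟩ := integral_energyDensity hK hL hx hy hu hv hint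
    refine ⟨h1, ?_⟩
    rw [hq]
    refine (abs_scaled_sub_le hA0 h2 herr).trans ?_
    calc |γ| * A * (β * (16 * Λ / h * nu * (16 * Λ / h * nv)) * X)
        ≤ |γ| * (64 * h ^ 4) * ((B + B') * (16 * Λ / h * nu * (16 * Λ / h * nv)) *
          (Q.errT s ρ₁ + Q.errNT s ρ₂)) := by gcongr
      _ = _ := by field_simp
  by_cases hd : Disjoint (hull K) (hull L)
  · obtain ⟨h1, h2⟩ := hfar hρ₂ hρ₂' hT hG hK hL hd hx hy hu hv ha hb (hbound hu) (hbound hv)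
      (Q.kNT K L)
    obtain ⟨-, hd0⟩ := hT.meshSize_le_setDist hKf hLf hd
    have hnc := ncard_eq_zero_iff.2 (disjoint_of_disjoint_hull hd)
    set d := setDist (hull K) (hull L) with hdd
    have hle := Q.le_errNT s ρ₂ hK hL hd
    have e1 : d ^ (-(2 + 2 * s)) * (d / h) ^ 2 = h ^ (-2 : ℤ) * d ^ (-2 * s) := by
      rw [show -(2 + 2 * s) = -2 * s - (2 : ℕ) by push_cast; ring,
        Real.rpow_sub_natCast hd0.ne', zpow_neg, zpow_ofNat]
      field_simp
    refine scale hB' (le_add_of_nonneg_left hB) ?_ (hle.trans (le_add_of_nonneg_left hT0)) ?_ h1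
      (h2.trans_eq ?_)
    · have := zero_lt_one.trans hρ₂
      positivity
    · rw [Scheme.aPair, hnc, hA, ← mul_assoc]
      rfl
    · rw [← hdd, ← e1]; ring
  · have hnc : ((K : Set Plane) ∩ L).ncard ≠ 0 := fun h0 =>
      hd (disjoint_hull hKf hLf (ncard_eq_zero_iff.1 h0))
    obtain ⟨h1, h2⟩ := hnear hT hG hK hL hx hy rfl hnc (Q.common K hK L hL) ha hb
      (hbound hu) (hbound hv) Q.kT
    refine scale hB (le_add_of_nonneg_right hB') hT0 (le_add_of_nonneg_right hNT0) ?_ h1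
      (h2.trans_eq ?_)
    · rw [Scheme.aPair, hA, ← mul_assoc]
      congr 1
      -- the number of common vertices selects the quadrature rule
      clear h2
      generalize ((K : Set Plane) ∩ L).ncard = c at hnc
      rcases c with _ | _ | _ | c
      exacts [absurd rfl hnc, rfl, rfl, rfl]
    · rw [Scheme.errT, show -(2 + 2 * s) = -2 - 2 * s by ring]; ring

/-- On fine meshes the error term of the separated pairs of elements is at least `h ^ (-2 - 2s)`,
whatever the quadrature orders, because of a pair of elements that is too close. -/
theorem rpow_le_errNT {Ω : Set Plane} {T : Triangulation Ω} {Λ C₀ s ρ : ℝ} (hs0 : 0 < s)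
    (hΩ : IsPolygon Ω) (hT : T.Controlled Λ C₀)
    (hh : 4 * T.meshSize < Metric.diam (closure Ω)) (hρ : 1 < ρ)
    (hρθ : ρ * √(1 - 1 / (4 * Λ ^ 2)) ≤ 1) (Q : Scheme T) :
    T.meshSize ^ (-2 - 2 * s) ≤ Q.errNT s ρ := by
  obtain ⟨K, hK, L, hL, hd, x, hx, y, hy, hxy⟩ := hT.exists_near_pair hΩ hh
  obtain ⟨-, hd0⟩ := hT.meshSize_le_setDist (T.mem_elements.1 hK).1 (T.mem_elements.1 hL).1 hd
  have hle := Q.le_errNT s ρ hK hL hd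
  refine le_trans ?_ hle
  have hdx : setDist (hull K) (hull L) ≤ √(1 - 1 / (4 * Λ ^ 2)) * T.meshSize :=
    (setDist_le hx hy).trans hxy
  set d := setDist (hull K) (hull L) with hdd
  set θ := √(1 - 1 / (4 * Λ ^ 2)) with hθ
  have hpos := hT.pos
  have hρ0 := zero_lt_one.trans hρ
  have hθ1 : θ ≤ 1 := by
    have : 0 ≤ θ := Real.sqrt_nonneg _
    nlinarith
  have h1 : 1 ≤ (ρ * (d / T.meshSize)) ^ (-2 * (Q.kNT K L : ℤ)) := by
    refine one_le_zpow_of_nonpos₀ (by positivity) ?_ (by omega)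
    calc ρ * (d / T.meshSize) ≤ ρ * θ := by
          gcongr
          rwa [div_le_iff₀ hpos]
      _ ≤ 1 := hρθ
  have h2 : T.meshSize ^ (-2 * s) ≤ d ^ (-2 * s) := by
    refine Real.rpow_le_rpow_of_nonpos hd0 ?_ (by linarith)
    exact hdx.trans (mul_le_of_le_one_left hpos.le hθ1)
  have h3 : T.meshSize ^ (-2 - 2 * s) = T.meshSize ^ (-2 : ℤ) * T.meshSize ^ (-2 * s) := by
    rw [← Real.rpow_intCast, ← Real.rpow_add hpos]
    congr 1; push_cast; ring
  rw [h3]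
  calc _ ≤ T.meshSize ^ (-2 : ℤ) * d ^ (-2 * s) * 1 := by rw [mul_one]; gcongr
    _ ≤ _ := by gcongr

end Triangulation

end FracQuad

namespace FracQuad

theorem abs_sum_sum_sub_le {ι κ : Type*} {S : Finset ι} {R : Finset κ} {f g b : ι → κ → ℝ}
    (h : ∀ i ∈ S, ∀ j ∈ R, |f i j - g i j| ≤ b i j) :
    |∑ i ∈ S, ∑ j ∈ R, f i j - ∑ i ∈ S, ∑ j ∈ R, g i j| ≤ ∑ i ∈ S, ∑ j ∈ R, b i j := by
  simp only [← Finset.sum_sub_distrib]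
  exact (Finset.abs_sum_le_sum_abs _ _).trans (Finset.sum_le_sum fun i hi =>
    (Finset.abs_sum_le_sum_abs _ _).trans (Finset.sum_le_sum fun j hj => h i hi j hj))

namespace Triangulation

set_option maxHeartbeats 800000 in
/-- The error of one pair of an element and a boundary edge. On separated pairs at distance `d`
the error estimate exceeds the error term by the factor `(d / h) ^ 2`, which is bounded on coarse
meshes; on fine meshes the error is bounded by the error term of the separated pairs of elements.
-/
theorem exists_edge_error {Ω : Set Plane} (hΩ : IsPolygon Ω) {s : ℝ} (hs0 : 0 < s) (hs1 : s < 1)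
    (Λ C₀ : ℝ) :
    ∃ D ρ₃ : ℝ, 0 ≤ D ∧ 1 < ρ₃ ∧ ∀ {ρ₂ ρ₄ : ℝ}, 1 < ρ₂ → ρ₂ * √(1 - 1 / (4 * Λ ^ 2)) ≤ 1 →
      1 < ρ₄ → ρ₄ ≤ 3 / 2 →
      ∀ {T : Triangulation Ω}, T.Controlled Λ C₀ →
      ∀ {G : ℝ → ∀ k : ℕ, Rule k}, IsGaussFamily G → ∀ (Q : Scheme T) {u v : Plane → ℝ},
      u ∈ T.feSpace s → v ∈ T.feSpace s →
      ∀ {K e : Finset Plane}, K ∈ T.elements → e ∈ T.boundaryEdges →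
      Integrable (edgeDensity s (Scheme.edgeNormal Ω (Q.sndb K e)) u v)
        ((volume.restrict (hull K)).prod (μH[1].restrict (hull e))) ∧
      |fracConst 2 s / (2 * s) * (∫ z, edgeDensity s (Scheme.edgeNormal Ω (Q.sndb K e)) u v z
        ∂((volume.restrict (hull K)).prod (μH[1].restrict (hull e)))) - Q.aPairb G s K e u v| ≤
        D * (T.meshSize * (Q.errNT s ρ₂ + Q.errTb s ρ₃ + Q.errNTb s ρ₄)) *
          (localNorm K u * localNorm K v) := by
  obtain ⟨B, ρ₃, hB, hρ₃, hnear⟩ := exists_refPairEdge_error hs0 hs1 C₀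
  obtain ⟨B', hB', hfar⟩ := exists_refPairEdge_far_error hs0 hs1 C₀
  set γ := fracConst 2 s / (2 * s) with hγ
  set Dm := Metric.diam (closure Ω) with hDm
  have hDm0 : 0 ≤ Dm := Metric.diam_nonneg
  refine ⟨|γ| * 8 * (16 * Λ) ^ 2 * (B + B' * (16 + Dm)), ρ₃, by positivity, hρ₃, ?_⟩
  intro ρ₂ ρ₄ hρ₂ hρ₂' hρ₄ hρ₄' T hT G hG Q u v hu hv K e hK he
  have hpos := hT.pos
  have hΛ := zero_lt_one.trans_le hT.one_le
  obtain ⟨hKf, -⟩ := T.mem_elements.1 hK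
  obtain ⟨hef, -, heΩ⟩ := T.mem_boundaryEdges.1 he
  have hx := Q.range_fstb K hK e he
  have hy := Q.range_sndb K hK e he
  have hν := (inwardNormal_boundaryEdge hΩ he hy).1
  have hmesh : T.meshSize ≤ Dm := hT.meshSize_le hΩ.isBounded
  set ν := Scheme.edgeNormal Ω (Q.sndb K e) with hνe
  set h := T.meshSize with hh
  have hbound : ∀ {w : Plane → ℝ}, w ∈ T.p1Space → ∀ i, |w (Q.fstb K e i)| ≤
      16 * Λ / h * localNorm K w := fun {w} hw i =>
    hT.abs_le_div hK hw (mem_range_coe hx i)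
  have hnu0 := localNorm_nonneg K u
  have hnv0 := localNorm_nonneg K v
  set nu := localNorm K u with hnu
  set nv := localNorm K v with hnv
  have ha : 0 ≤ 16 * Λ / h * nu := by positivity
  have hb : 0 ≤ 16 * Λ / h * nv := by positivity
  have hAK := area_nonneg K
  set A := Scheme.area K / (1 / 2) * Metric.diam (hull e) with hA
  have hA0 : 0 ≤ A := mul_nonneg (by positivity) Metric.diam_nonneg
  have hA1 : A ≤ 8 * h ^ 3 := by
    rw [hA, show 8 * h ^ 3 = 4 * h ^ 2 / (1 / 2) * h by ring]
    have := hT.area_le hK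
    have := (hT.diam_edge_le hΩ he).1
    gcongr
  have hT0 : 0 ≤ Q.errTb s ρ₃ := by
    have := zero_lt_one.trans hρ₃
    unfold Scheme.errTb; positivity
  have hNT0 : 0 ≤ Q.errNT s ρ₂ := Q.errNT_nonneg hpos s hρ₂
  have hNTb0 : 0 ≤ Q.errNTb s ρ₄ := Q.errNTb_nonneg hpos s hρ₄
  set E := Q.errNT s ρ₂ + Q.errTb s ρ₃ + Q.errNTb s ρ₄ with hE
  have hE0 : 0 ≤ E := by positivity
  -- the common scaling argument: `X` bounds the error relative to the nodal values
  have scale : ∀ {q X : ℝ} {β : ℝ}, 0 ≤ β → β ≤ B + B' * (16 + Dm) → X ≤ β * E →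
      Q.aPairb G s K e u v = γ * A * q →
      IntegrableOn (edgeKernel s ν (Q.fstb K e) (Q.sndb K e) u v) refPairEdge →
      |(∫ w in refPairEdge, edgeKernel s ν (Q.fstb K e) (Q.sndb K e) u v w) - q| ≤
        16 * Λ / h * nu * (16 * Λ / h * nv) * X →
      Integrable (edgeDensity s ν u v)
        ((volume.restrict (hull K)).prod (μH[1].restrict (hull e))) ∧
      |γ * (∫ z, edgeDensity s ν u v z
        ∂((volume.restrict (hull K)).prod (μH[1].restrict (hull e)))) - Q.aPairb G s K e u v| ≤
        |γ| * 8 * (16 * Λ) ^ 2 * (B + B' * (16 + Dm)) * (h * E) * (nu * nv) := by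
    intro q X β hβ0 hβ hX hq hint herr
    obtain ⟨h1, h2⟩ := integral_edgeDensity hK ν hx hy hu.1 hv.1 hint
    refine ⟨h1, ?_⟩
    rw [hq]
    refine (abs_scaled_sub_le hA0 h2 herr).trans ?_
    calc |γ| * A * (16 * Λ / h * nu * (16 * Λ / h * nv) * X)
        ≤ |γ| * A * (16 * Λ / h * nu * (16 * Λ / h * nv) * ((B + B' * (16 + Dm)) * E)) := by
          have := hX.trans (mul_le_mul_of_nonneg_right hβ hE0)
          gcongr
      _ ≤ |γ| * (8 * h ^ 3) *
          (16 * Λ / h * nu * (16 * Λ / h * nv) * ((B + B' * (16 + Dm)) * E)) := by gcongr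
      _ = _ := by field_simp
  by_cases hd : Disjoint (hull K) (hull e)
  · obtain ⟨h1, h2, h3⟩ := hfar hρ₄ hρ₄' hΩ hT hG hK he hd hx hy hu.1 hv.1 ha hb (hbound hu.1)
      (hbound hv.1) hν (Q.kNTb K e)
    obtain ⟨hhd, hd0⟩ := hT.meshSize_le_setDist hKf hef hd
    have hnc := ncard_eq_zero_iff.2 (disjoint_of_disjoint_hull hd)
    have hle := Q.le_errNTb s ρ₄ hK he hd
    have hq : Q.aPairb G s K e u v = γ * A *
        quadFarEdge G s (Q.kNTb K e) ν (Q.fstb K e) (Q.sndb K e) u v := by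
      rw [Scheme.aPairb, hnc, hA, ← mul_assoc]
      rfl
    by_cases hfine : 4 * h < Dm
    · -- on fine meshes the bound that does not depend on the order is dominated by `E_{NT}`
      have hNT := rpow_le_errNT hs0 hΩ hT hfine hρ₂ hρ₂' Q
      refine scale (X := B' * h ^ (-(1 + 2 * s))) (β := B' * Dm) (by positivity) ?_ ?_ hq h1
        (h3.trans_eq (by ring))
      · exact (mul_le_mul_of_nonneg_left (le_add_of_nonneg_left (by norm_num)) hB').trans
          (le_add_of_nonneg_left hB)
      · have e1 : h ^ (-(1 + 2 * s)) = h * h ^ (-2 - 2 * s) := by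
          nth_rw 2 [← Real.rpow_one h]
          rw [← Real.rpow_add hpos]
          congr 1; ring
        have e2 : h ^ (-2 - 2 * s) ≤ E := hNT.trans (by rw [hE]; linarith)
        rw [e1, mul_assoc]
        gcongr
    · -- on coarse meshes the surplus power of `d / h` is bounded
      have hdD : setDist (hull K) (hull e) ≤ 4 * h := by
        obtain ⟨p, hp⟩ : (hull K).Nonempty := convexHull_nonempty_iff.2 (T.nonempty_of_mem_faces hKf)
        obtain ⟨q, hq⟩ : (hull e).Nonempty := convexHull_nonempty_iff.2 (T.nonempty_of_mem_faces hef)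
        refine (setDist_le hp hq).trans (le_trans ?_ (not_lt.1 hfine))
        rw [← dist_eq_norm]
        refine Metric.dist_le_diam_of_mem hΩ.isBounded.closure ?_ (frontier_subset_closure (heΩ hq))
        rw [← T.space_eq]
        exact T.convexHull_subset_space hKf hp
      set d := setDist (hull K) (hull e) with hdd
      have hdh : d / h ≤ 4 := by rwa [div_le_iff₀ hpos]
      refine scale (X := B' * (d / h) ^ 2 * (h ^ (-1 : ℤ) * d ^ (-2 * s) *
          (ρ₄ * (d / h)) ^ (-2 * (Q.kNTb K e : ℤ)))) (β := B' * 16) (by positivity) ?_ ?_ hq h1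
        (h2.trans_eq ?_)
      · exact (mul_le_mul_of_nonneg_left (le_add_of_nonneg_right hDm0) hB').trans
          (le_add_of_nonneg_left hB)
      · have e2 : (d / h) ^ 2 ≤ 16 := by
          rw [show (16 : ℝ) = 4 ^ 2 by norm_num]; gcongr
        have e3 := hle.trans (show Q.errNTb s ρ₄ ≤ E by rw [hE]; linarith)
        have := zero_lt_one.trans hρ₄
        gcongr
      · have e1 : d * d ^ (-(2 + 2 * s)) * (d / h) ^ 3 =
            (d / h) ^ 2 * (h ^ (-1 : ℤ) * d ^ (-2 * s)) := by
          rw [show -(2 + 2 * s) = -2 * s - (2 : ℕ) by push_cast; ring,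
            Real.rpow_sub_natCast hd0.ne', zpow_neg, zpow_one]
          field_simp
        calc _ = B' * (16 * Λ / h * nu * (16 * Λ / h * nv)) *
            (d * d ^ (-(2 + 2 * s)) * (d / h) ^ 3) *
            (ρ₄ * (d / h)) ^ (-2 * (Q.kNTb K e : ℤ)) := by ring
          _ = _ := by rw [e1]; ring
  · have hnc : ((K : Set Plane) ∩ e).ncard ≠ 0 := fun h0 =>
      hd (disjoint_hull hKf hef (ncard_eq_zero_iff.1 h0))
    obtain ⟨h1, h2⟩ := hnear hΩ hT hG hK he hx hy rfl hnc (Q.commonb K hK e he) ha hb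
      (hbound hu.1) (hbound hv.1) (fun hs z hz => ⟨hu.2 hs z hz, hv.2 hs z hz⟩) hν Q.kTb
    refine scale (X := B * Q.errTb s ρ₃) (β := B) hB (le_add_of_nonneg_right (by positivity)) ?_ ?_
      h1 (h2.trans_eq ?_)
    · exact mul_le_mul_of_nonneg_left (by rw [hE]; linarith) hB
    · rw [Scheme.aPairb, hA, ← mul_assoc]
      congr 1
      -- the number of common vertices selects the quadrature rule
      clear h2
      generalize ((K : Set Plane) ∩ e).ncard = c at hnc
      rcases c with _ | _ | c
      exacts [absurd rfl hnc, rfl, rfl]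
    · have e1 : h ^ (-1 - 2 * s) = h * h ^ (-(2 + 2 * s)) := by
        nth_rw 2 [← Real.rpow_one h]
        rw [← Real.rpow_add hpos]
        congr 1; ring
      rw [Scheme.errTb, ← hh, e1]; ring

/-! ### Summation over the mesh -/

theorem sum_localNorm_mul_le {Ω : Set Plane} {T : Triangulation Ω} (hΩ : IsPolygon Ω)
    {u v : Plane → ℝ} (hu : u ∈ T.p1Space) (hv : v ∈ T.p1Space) :
    ∑ K ∈ T.elements, localNorm K u * localNorm K v ≤ normL2 Ω u * normL2 Ω v := by
  refine (Real.sum_mul_le_sqrt_mul_sqrt _ _ _).trans_eq ?_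
  have hN : ∀ w, 0 ≤ normL2 Ω w := fun w => ENNReal.toReal_nonneg
  rw [sum_sq_localNorm hΩ hu, sum_sq_localNorm hΩ hv, Real.sqrt_sq (hN u), Real.sqrt_sq (hN v)]

/-- Each element occurs in `2 * card` ordered pairs. -/
theorem sum_localNorm_add_sq_le {Ω : Set Plane} {T : Triangulation Ω} (hΩ : IsPolygon Ω)
    {u : Plane → ℝ} (hu : u ∈ T.p1Space) :
    ∑ p ∈ T.elements ×ˢ T.elements, (localNorm p.1 u + localNorm p.2 u) ^ 2 ≤
      4 * T.elements.card * normL2 Ω u ^ 2 := by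
  calc _ ≤ ∑ p ∈ T.elements ×ˢ T.elements, 2 * (localNorm p.1 u ^ 2 + localNorm p.2 u ^ 2) :=
        Finset.sum_le_sum fun p _ => add_sq_le
    _ = _ := by
        rw [Finset.sum_product]
        simp only [← Finset.mul_sum, Finset.sum_add_distrib, Finset.sum_const, nsmul_eq_mul,
          sum_sq_localNorm hΩ hu]
        ring

theorem sum_localNorm_add_mul_le {Ω : Set Plane} {T : Triangulation Ω} (hΩ : IsPolygon Ω)
    {u v : Plane → ℝ} (hu : u ∈ T.p1Space) (hv : v ∈ T.p1Space) :
    ∑ K ∈ T.elements, ∑ L ∈ T.elements,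
        (localNorm K u + localNorm L u) * (localNorm K v + localNorm L v) ≤
      4 * T.elements.card * (normL2 Ω u * normL2 Ω v) := by
  have hN : ∀ w, 0 ≤ normL2 Ω w := fun w => ENNReal.toReal_nonneg
  have h2 : ∀ w, √(4 * T.elements.card * normL2 Ω w ^ 2) =
      √(4 * T.elements.card) * normL2 Ω w := fun w => by
    rw [Real.sqrt_mul (by positivity), Real.sqrt_sq (hN w)]
  rw [← Finset.sum_product']
  calc _ ≤ _ := Real.sum_mul_le_sqrt_mul_sqrt _ _ _
    _ ≤ √(4 * T.elements.card * normL2 Ω u ^ 2) * √(4 * T.elements.card * normL2 Ω v ^ 2) := by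
        gcongr
        exacts [sum_localNorm_add_sq_le hΩ hu, sum_localNorm_add_sq_le hΩ hv]
    _ = √(4 * T.elements.card) ^ 2 * (normL2 Ω u * normL2 Ω v) := by rw [h2, h2]; ring
    _ = _ := by rw [Real.sq_sqrt (by positivity)]

end Triangulation

end FracQuad

theorem mainTheorem1 (Ω : Set FracQuad.Plane) (hΩ : FracQuad.IsPolygon Ω)
    (s : ℝ) (hs0 : 0 < s) (hs1 : s < 1) (σ τ : ℝ) :
    ∃ C ρ₁ ρ₂ ρ₃ ρ₄ : ℝ, 1 < ρ₁ ∧ 1 < ρ₂ ∧ 1 < ρ₃ ∧ 1 < ρ₄ ∧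
      ∀ T : FracQuad.Triangulation Ω, T.ShapeRegular σ → T.QuasiUniform τ →
      ∀ G : ℝ → ∀ k : ℕ, FracQuad.Rule k, FracQuad.IsGaussFamily G →
      ∀ Q : FracQuad.Scheme T,
      ∀ u ∈ T.feSpace s, ∀ v ∈ T.feSpace s,
        |FracQuad.bilin Ω s u v - Q.aQ G s u v| ≤
          C * (Q.errT s ρ₁ + Q.errNT s ρ₂ + Q.errTb s ρ₃ + Q.errNTb s ρ₄) *
            FracQuad.normL2 Ω u * FracQuad.normL2 Ω v := by
  -- the constants are built from one admissible triangulation; without one nothing is claimed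
  by_cases hex : ∃ T₀ : FracQuad.Triangulation Ω, T₀.ShapeRegular σ ∧ T₀.QuasiUniform τ
  swap
  · exact ⟨0, 2, 2, 2, 2, by norm_num, by norm_num, by norm_num, by norm_num,
      fun T hσ hτ => absurd ⟨T, hσ, hτ⟩ hex⟩
  obtain ⟨T₀, hσ₀, hτ₀⟩ := hex
  have hΛ := (FracQuad.Triangulation.regular_of_shapeRegular _ hΩ hσ₀ hτ₀).one_le
  set Λ := σ * τ with hΛe
  obtain ⟨C₁, -, hbary⟩ := FracQuad.Triangulation.exists_abs_bary_sub_le hΩ T₀ Λ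
  set C₀ := max C₁ 1 with hC₀
  obtain ⟨D, ρ₁, hD, hρ₁, hpair⟩ := FracQuad.Triangulation.exists_pair_error hs0 hs1 Λ C₀
  obtain ⟨D', ρ₃, hD', hρ₃, hedge⟩ := FracQuad.Triangulation.exists_edge_error hΩ hs0 hs1 Λ C₀
  set θ := √(1 - 1 / (4 * Λ ^ 2)) with hθ
  -- `θ < 1` bounds the relative distance of the closest separated pair, whence the choice of `ρ₂`
  have hθ0 : 0 < θ := by
    refine Real.sqrt_pos.2 (sub_pos.2 ?_)
    rw [div_lt_one (by positivity)]
    nlinarith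
  have hθ1 : θ < 1 := by
    refine (Real.sqrt_lt' one_pos).2 ?_
    rw [one_pow]
    exact sub_lt_self _ (by positivity)
  set ρ₂ := min (3 / 2) (1 / θ) with hρ₂e
  have hρ₂ : 1 < ρ₂ := lt_min (by norm_num) ((one_lt_div hθ0).2 hθ1)
  have hρ₂θ : ρ₂ * θ ≤ 1 := (le_div_iff₀ hθ0).1 (min_le_right _ _)
  set V := 4 * Λ ^ 2 * volume.real Ω with hV
  set P := Λ * ((Measure.hausdorffMeasure 1 : Measure FracQuad.Plane) (frontier Ω)).toReal with hP
  refine ⟨4 * (D * V) + D' * P, ρ₁, ρ₂, ρ₃, 3 / 2, hρ₁, hρ₂, hρ₃, by norm_num, ?_⟩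
  intro T hσ hτ G hG Q u hu v hv
  have hreg := FracQuad.Triangulation.regular_of_shapeRegular _ hΩ hσ hτ
  have hpos := hreg.pos
  have hT : T.Controlled Λ C₀ := ⟨hreg, le_max_right _ _, fun x hx y hy k =>
    (hbary T hreg x hx y hy k).trans (by gcongr; exact le_max_left _ _)⟩
  have hp := fun {K L} (hK : K ∈ T.elements) (hL : L ∈ T.elements) =>
    hpair hρ₂ (min_le_left _ _) hT hG Q hu.1 hv.1 hK hL
  have he := fun {K e} (hK : K ∈ T.elements) (he : e ∈ T.boundaryEdges) =>
    hedge hρ₂ hρ₂θ (by norm_num : (1 : ℝ) < 3 / 2) le_rfl hT hG Q hu hv hK he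
  have hbil := FracQuad.Triangulation.bilin_eq_sum hΩ T (s := s) (u := u) (v := v)
    (n := fun K e => FracQuad.Scheme.edgeNormal Ω (Q.sndb K e))
    (fun K hK e he => FracQuad.Triangulation.ae_inwardNormal_eq hΩ he (Q.range_sndb K hK e he))
    (fun K hK L hL => (hp hK hL).1) (fun K hK e h => (he hK h).1)
  have hT0 : 0 ≤ Q.errT s ρ₁ := by
    have := zero_lt_one.trans hρ₁
    unfold FracQuad.Scheme.errT; positivity
  have hTb0 : 0 ≤ Q.errTb s ρ₃ := by
    have := zero_lt_one.trans hρ₃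
    unfold FracQuad.Scheme.errTb; positivity
  have hNT0 : 0 ≤ Q.errNT s ρ₂ := Q.errNT_nonneg hpos s hρ₂
  have hNTb0 : 0 ≤ Q.errNTb s (3 / 2) := Q.errNTb_nonneg hpos s (by norm_num)
  have hN : 0 ≤ FracQuad.normL2 Ω u * FracQuad.normL2 Ω v :=
    mul_nonneg ENNReal.toReal_nonneg ENNReal.toReal_nonneg
  set N := FracQuad.normL2 Ω u * FracQuad.normL2 Ω v with hNe
  set E := Q.errT s ρ₁ + Q.errNT s ρ₂ + Q.errTb s ρ₃ + Q.errNTb s (3 / 2) with hE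
  have hE0 : 0 ≤ E := by positivity
  have hcard := hreg.card_elements_le hΩ
  have hcardb := hreg.card_boundaryEdges_le hΩ
  rw [hbil, FracQuad.Scheme.aQ, add_sub_add_comm]
  refine (abs_add_le _ _).trans ((add_le_add
    (FracQuad.abs_sum_sum_sub_le fun K hK L hL => (hp hK hL).2)
    (FracQuad.abs_sum_sum_sub_le fun K hK e h => (he hK h).2)).trans ?_)
  have hn := FracQuad.localNorm_nonneg
  have hS1 : ∑ K ∈ T.elements, ∑ L ∈ T.elements,
      D * (T.meshSize ^ 2 * (Q.errT s ρ₁ + Q.errNT s ρ₂)) *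
        ((FracQuad.localNorm K u + FracQuad.localNorm L u) *
          (FracQuad.localNorm K v + FracQuad.localNorm L v)) ≤ 4 * D * V * (E * N) := by
    simp only [← Finset.mul_sum]
    calc _ ≤ D * (T.meshSize ^ 2 * E) * (4 * T.elements.card * N) := by
          gcongr
          · exact Finset.sum_nonneg fun K _ => Finset.sum_nonneg fun L _ =>
              mul_nonneg (add_nonneg (hn K u) (hn L u)) (add_nonneg (hn K v) (hn L v))
          · rw [hE]; linarith
          · exact FracQuad.Triangulation.sum_localNorm_add_mul_le hΩ hu.1 hv.1
      _ = 4 * D * (T.elements.card * T.meshSize ^ 2) * (E * N) := by ring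
      _ ≤ 4 * D * V * (E * N) := by gcongr
  have hS2 : ∑ K ∈ T.elements, ∑ e ∈ T.boundaryEdges,
      D' * (T.meshSize * (Q.errNT s ρ₂ + Q.errTb s ρ₃ + Q.errNTb s (3 / 2))) *
        (FracQuad.localNorm K u * FracQuad.localNorm K v) ≤ D' * P * (E * N) := by
    simp only [Finset.sum_const, nsmul_eq_mul, ← Finset.mul_sum]
    calc _ ≤ T.boundaryEdges.card * (D' * (T.meshSize * E) * N) := by
          gcongr
          · exact Finset.sum_nonneg fun K _ => mul_nonneg (hn K u) (hn K v)
          · rw [hE]; linarith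
          · exact FracQuad.Triangulation.sum_localNorm_mul_le hΩ hu.1 hv.1
      _ = D' * (T.boundaryEdges.card * T.meshSize) * (E * N) := by ring
      _ ≤ D' * P * (E * N) := by gcongr
  calc _ ≤ 4 * D * V * (E * N) + D' * P * (E * N) := add_le_add hS1 hS2
    _ = _ := by rw [hNe]; ring
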